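/- Let $G$ be a compact (Hausdorff) group. **Representations.** $\mathrm{Cu}(G)$ denotes the set of unitary equivalence classes of strongly continuous unitary representations of $G$ on separable complex Hilbert spaces, with $[\mu]+[\nu]=[\mu\oplus\nu]$, $[\mu]\cdot[\nu]=[\mu\otimes\nu]$, and $[\mu]\le[\nu]$ if $\mu$ is unitarily equivalent to a subrepresentation of $\nu$. **The equivariant Cuntz semigroup.** Let $A$ be a $C^*$-algebra with a continuous action $\alpha$ of $G$ (a homomorphism $\alpha\colon G\to\mathrm{Aut}(A)$ such that $g\mapsto\alpha_g(a)$ is continuous for every $a$). For separable unitary representations $(H_\mu,\mu)$, $(H_\nu,\nu)$ of $G$ let $G$ act on $K(H_\mu,H_\nu)\otimes A$ by $g\cdot(k\otimes a)=\nu_gk\mu_g^*\otimes\alpha_g(a)$, where $K(H_\mu,H_\nu)$ is the space of compact operators $H_\mu\to H_\nu$ and $\otimes$ is the completed spatial tensor product, and write $(\cdot)^G$ for fixed points. For positive $a\in(K(H_\mu)\otimes A)^G$ and $b\in(K(H_\nu)\otimes A)^G$ write $a\precsim_G b$ if there are $d_n\in(K(H_\nu,H_\mu)\otimes A)^G$ with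 $\|d_nbd_n^*-a\|\to0$. Then $\mathrm{Cu}^G(A,\alpha)$ is the set of classes $[a]$ of positive elements of all the algebras $(K(H_\mu)\otimes A)^G$ modulo the relation $a\precsim_Gb\precsim_Ga$, with $[a]\le[b]$ if $a\precsim_Gb$, with $[a]+[b]=[a\oplus b]$, and with $[\nu]\cdot[a]=[s_\nu\otimes a]$, where $s_\nu$ is any $G$-invariant strictly positive element of $K(H_\nu)$ (that is, $s_\nu\ge 0$ and $\tau(s_\nu)>0$ for every nonzero positive linear functional $\tau$ on $K(H_\nu)$). An equivariant $*$-homomorphism $\psi\colon A\to B$ induces $\mathrm{Cu}^G(\psi)([a])=[(\mathrm{id}\otimes\psi)(a)]$. **The category $\mathbf{Cu}^G$.** In an ordered set write $x\ll y$ if for every increasing sequence $(t_n)$ that has a supremum with $y\le\sup t_n$ there is $k$ with $x\le t_k$. An ordered abelian semigroup $S$ with zero (that is, a partially ordered commutative monoid in which addition is order preserving) is an object of $\mathbf{Cu}$ if (O1) increasing sequences have suprema; (O2) every $x\in S$ is the supremum of a sequence $(s_n)$ with $s_n\ll s_{n+1}$; (O3) $\sup s_n+\sup t_n=\sup(s_n+t_n)$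 for increasing sequences; (O4) $s_i\ll t_i$ ($i=1,2$) implies $s_1+s_2\ll t_1+t_2$. Morphisms of $\mathbf{Cu}$ are the order preserving additive maps that preserve $0$, suprema of increasing sequences, and $\ll$. An object of $\mathbf{Cu}^G$ is a partially ordered $\mathrm{Cu}(G)$-semimodule $S$ (commutative monoid with an action satisfying $(r+s)x=rx+sx$, $r(x+y)=rx+ry$, $(rs)x=r(sx)$, $1x=x$, $0x=0$, $r0=0$) that is an object of $\mathbf{Cu}$ and satisfies: $x\le y$, $r\le s$ imply $rx\le sy$; $x\ll y$, $r\ll s$ imply $rx\ll sy$; $\sup(r_nx_n)=(\sup r_n)(\sup x_n)$ for increasing sequences $(r_n)$ in $\mathrm{Cu}(G)$ having a supremum and $(x_n)$ in $S$. Morphisms of $\mathbf{Cu}^G$ are the $\mathrm{Cu}(G)$-linear morphisms of $\mathbf{Cu}$. **Proposition.** Let $(A_n,\iota_n)_{n\in\mathbb N}$ be a direct system of $C^*$-algebras with $*$-homomorphisms $\iota_n\colon A_n\to A_{n+1}$, let $\alpha^{(n)}$ be continuous actions of $G$ on $A_n$ with $\alpha^{(n+1)}_g\circ\iota_n=\iota_n\circ\alpha^{(n)}_g$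 for all $n$ and $g$, and let $(A,\alpha)=\varinjlim(A_n,\alpha^{(n)})$ be the inductive limit $C^*$-algebra with the limit action and canonical equivariant maps $\iota_{\infty,n}\colon A_n\to A$. Then: 1. The action of $\mathrm{Cu}(G)$ on $\mathrm{Cu}^G(B,\beta)$ is well defined for every $G$-$C^*$-algebra $(B,\beta)$: $G$-invariant strictly positive elements $s_\nu$ exist and $[\nu]\cdot[a]=[s_\nu\otimes a]$ for all choices of $\nu$, $s_\nu$, $a$. The semigroups $\mathrm{Cu}^G(A_n,\alpha^{(n)})$ and $\mathrm{Cu}^G(A,\alpha)$ are objects of $\mathbf{Cu}^G$, and $\mathrm{Cu}^G(\iota_n)$ and $\mathrm{Cu}^G(\iota_{\infty,n})$ are morphisms of $\mathbf{Cu}^G$ with $\mathrm{Cu}^G(\iota_{\infty,n+1})\circ\mathrm{Cu}^G(\iota_n)=\mathrm{Cu}^G(\iota_{\infty,n})$. 2. The system $(\mathrm{Cu}^G(A_n,\alpha^{(n)}),\mathrm{Cu}^G(\iota_n))_n$ has an inductive limit in $\mathbf{Cu}^G$ (an object with compatible morphisms from the members of the system, satisfying the universal property). 3. For every such inductive limit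 $(S,(\psi_n)_n)$ there is exactly one $\mathbf{Cu}^G$-morphism $\varphi\colon S\to\mathrm{Cu}^G(A,\alpha)$ with $\varphi\circ\psi_n=\mathrm{Cu}^G(\iota_{\infty,n})$ for all $n$, and $\varphi$ is an isomorphism of $\mathbf{Cu}^G$. That is, $\varinjlim\mathrm{Cu}^G(A_n,\alpha^{(n)})\cong\mathrm{Cu}^G(\varinjlim A_n,\varinjlim\alpha^{(n)})$ naturally. -/

import Mathlib

open scoped TensorProduct ComplexOrder InnerProductSpace
open Filter Topology

universe u v w

noncomputable section

namespace EquivCuntz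

/-! ### Compact operators and tensor products of Hilbert spaces -/

section Hilbert

variable {E F E₁ E₂ E₃ F₁ F₂ F₃ : Type*}
  [NormedAddCommGroup E] [InnerProductSpace ℂ E] [NormedAddCommGroup F] [InnerProductSpace ℂ F]
  [NormedAddCommGroup E₁] [InnerProductSpace ℂ E₁] [NormedAddCommGroup E₂] [InnerProductSpace ℂ E₂]
  [NormedAddCommGroup E₃] [InnerProductSpace ℂ E₃] [NormedAddCommGroup F₁] [InnerProductSpace ℂ F₁]
  [NormedAddCommGroup F₂] [InnerProductSpace ℂ F₂] [NormedAddCommGroup F₃] [InnerProductSpace ℂ F₃]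

/-- The Hilbert space tensor product: the completion of the algebraic tensor product with respect
to `⟪e ⊗ f, e' ⊗ f'⟫ = ⟪e, e'⟫ ⟪f, f'⟫`. -/
def HTensor (E F : Type*) [NormedAddCommGroup E] [InnerProductSpace ℂ E]
    [NormedAddCommGroup F] [InnerProductSpace ℂ F] : Type _ :=
  UniformSpace.Completion (E ⊗[ℂ] F)

instance : NormedAddCommGroup (HTensor E F) :=
  inferInstanceAs (NormedAddCommGroup (UniformSpace.Completion (E ⊗[ℂ] F)))

instance : InnerProductSpace ℂ (HTensor E F) :=
  inferInstanceAs (InnerProductSpace ℂ (UniformSpace.Completion (E ⊗[ℂ] F)))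

instance : CompleteSpace (HTensor E F) :=
  inferInstanceAs (CompleteSpace (UniformSpace.Completion (E ⊗[ℂ] F)))

/-- The inclusion of the algebraic tensor product. -/
def HTensor.of : E ⊗[ℂ] F →ₗᵢ[ℂ] HTensor E F :=
  UniformSpace.Completion.toComplₗᵢ

lemma HTensor.denseRange : DenseRange (HTensor.of (E := E) (F := F)) :=
  UniformSpace.Completion.denseRange_coe

lemma HTensor.induction {p : HTensor E F → Prop} (x : HTensor E F) (hp : IsClosed {x | p x})
    (ih : ∀ x, p (HTensor.of x)) : p x :=
  HTensor.denseRange.induction (by rintro _ ⟨x, rfl⟩; exact ih x) hp x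

/-- The tensor product `S ⊗ T` of two bounded operators. -/
def hmap (S : E₁ →L[ℂ] E₂) (T : F₁ →L[ℂ] F₂) : HTensor E₁ F₁ →L[ℂ] HTensor E₂ F₂ :=
  LinearMap.extendOfNorm (HTensor.of.toLinearMap ∘ₗ (TensorProduct.mapL S T).toLinearMap)
    HTensor.of.toLinearMap

lemma hmap_bound (S : E₁ →L[ℂ] E₂) (T : F₁ →L[ℂ] F₂) (x : E₁ ⊗[ℂ] F₁) :
    ‖(HTensor.of.toLinearMap ∘ₗ (TensorProduct.mapL S T).toLinearMap) x‖
      ≤ ‖S‖ * ‖T‖ * ‖HTensor.of.toLinearMap x‖ := by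
  have h : ‖TensorProduct.mapL S T x‖ ≤ ‖S‖ * ‖T‖ * ‖x‖ :=
    (ContinuousLinearMap.le_opNorm _ _).trans
      (mul_le_mul_of_nonneg_right (TensorProduct.norm_mapL_le S T) (norm_nonneg _))
  simpa using h

lemma hmap_coe (S : E₁ →L[ℂ] E₂) (T : F₁ →L[ℂ] F₂) (x : E₁ ⊗[ℂ] F₁) :
    hmap S T (HTensor.of x) = HTensor.of (TensorProduct.mapL S T x) :=
  LinearMap.extendOfNorm_eq HTensor.denseRange ⟨_, hmap_bound S T⟩ x

lemma HTensor.clm_ext {Z : Type*} [NormedAddCommGroup Z] [NormedSpace ℂ Z]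
    {S T : HTensor E F →L[ℂ] Z} (h : ∀ x : E ⊗[ℂ] F, S (HTensor.of x) = T (HTensor.of x)) :
    S = T := by
  ext x
  exact HTensor.induction x (isClosed_eq S.continuous T.continuous) h

lemma hmap_comp (S : E₂ →L[ℂ] E₃) (S' : E₁ →L[ℂ] E₂) (T : F₂ →L[ℂ] F₃) (T' : F₁ →L[ℂ] F₂) :
    hmap (S ∘L S') (T ∘L T') = hmap S T ∘L hmap S' T' :=
  HTensor.clm_ext fun x => by simp only [ContinuousLinearMap.comp_apply, hmap_coe, TensorProduct.mapL_comp]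

lemma hmap_add_left (S S' : E₁ →L[ℂ] E₂) (T : F₁ →L[ℂ] F₂) :
    hmap (S + S') T = hmap S T + hmap S' T :=
  HTensor.clm_ext fun x => by
    simp only [add_apply, hmap_coe, TensorProduct.mapL_add_left,
      map_add]

lemma hmap_add_right (S : E₁ →L[ℂ] E₂) (T T' : F₁ →L[ℂ] F₂) :
    hmap S (T + T') = hmap S T + hmap S T' :=
  HTensor.clm_ext fun x => by
    simp only [add_apply, hmap_coe, TensorProduct.mapL_add_right,
      map_add]

lemma hmap_smul_left (c : ℂ) (S : E₁ →L[ℂ] E₂) (T : F₁ →L[ℂ] F₂) :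
    hmap (c • S) T = c • hmap S T :=
  HTensor.clm_ext fun x => by
    simp only [smul_apply, hmap_coe, TensorProduct.mapL_smul_left,
      map_smul]

lemma hmap_smul_right (c : ℂ) (S : E₁ →L[ℂ] E₂) (T : F₁ →L[ℂ] F₂) :
    hmap S (c • T) = c • hmap S T :=
  HTensor.clm_ext fun x => by
    simp only [smul_apply, hmap_coe, TensorProduct.mapL_smul_right,
      map_smul]

lemma hmap_id : hmap (.id ℂ E) (.id ℂ F) = .id ℂ (HTensor E F) :=
  HTensor.clm_ext fun x => by
    simp only [hmap_coe, TensorProduct.mapL_id_id, ContinuousLinearMap.id_apply]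

lemma norm_hmap_le (S : E₁ →L[ℂ] E₂) (T : F₁ →L[ℂ] F₂) : ‖hmap S T‖ ≤ ‖S‖ * ‖T‖ :=
  LinearMap.opNorm_extendOfNorm_le HTensor.denseRange (by positivity) (hmap_bound S T)

lemma adjoint_hmap [CompleteSpace E₁] [CompleteSpace E₂] [CompleteSpace F₁] [CompleteSpace F₂]
    (S : E₁ →L[ℂ] E₂) (T : F₁ →L[ℂ] F₂) :
    (hmap S T).adjoint = hmap S.adjoint T.adjoint := by
  symm
  rw [ContinuousLinearMap.eq_adjoint_iff]
  intro x y
  induction x using HTensor.induction with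
  | hp =>
    exact isClosed_eq ((hmap _ _).continuous.inner continuous_const)
      (continuous_id.inner continuous_const)
  | ih x =>
  induction y using HTensor.induction with
  | hp =>
    exact isClosed_eq (continuous_const.inner continuous_id)
      (continuous_const.inner (hmap _ _).continuous)
  | ih y =>
    rw [hmap_coe, hmap_coe, LinearIsometry.inner_map_map, LinearIsometry.inner_map_map]
    induction x using TensorProduct.induction_on with
    | zero => simp
    | add x x' hx hx' => rw [map_add, inner_add_left, inner_add_left, hx, hx']
    | tmul e f =>
      induction y using TensorProduct.induction_on with
      | zero => simp
      | add y y' hy hy' => rw [map_add, inner_add_right, inner_add_right, hy, hy']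
      | tmul e' f' =>
        simp [TensorProduct.inner_tmul,
          ContinuousLinearMap.adjoint_inner_left]

lemma isCompactOperator_of_range_le {V : Submodule ℂ F} [FiniteDimensional ℂ V] (T : E →L[ℂ] F)
    (h : ∀ x, T x ∈ V) : IsCompactOperator T := by
  have h1 : IsCompactOperator (_root_.id : V → V) :=
    (isCompactOperator_id_iff_finiteDimensional (𝕜 := ℂ)).2 inferInstance
  have h2 := (h1.comp_clm (T.codRestrict V h)).clm_comp V.subtypeL
  exact h2

/-- A compact operator into a Hilbert space is a norm limit of its finite rank compressions. -/
lemma exists_finite_approx {T : E →L[ℂ] F} (hT : IsCompactOperator T) {ε : ℝ} (hε : 0 < ε) :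
    ∃ (V : Submodule ℂ F) (_ : FiniteDimensional ℂ V), ‖T - V.starProjection ∘L T‖ ≤ ε := by
  have hc := hT.isCompact_closure_image_closedBall 1
  obtain ⟨t, ht, hcov⟩ := Metric.totallyBounded_iff.1 hc.totallyBounded ε hε
  have hfin : FiniteDimensional ℂ (Submodule.span ℂ t) := FiniteDimensional.span_of_finite ℂ ht
  refine ⟨Submodule.span ℂ t, hfin, ?_⟩
  refine ContinuousLinearMap.opNorm_le_of_unit_norm hε.le fun x hx => ?_
  have hx' : T x ∈ closure (T '' Metric.closedBall 0 1) :=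
    subset_closure ⟨x, by simp [hx], rfl⟩
  obtain ⟨y, hy, hxy⟩ := Set.mem_iUnion₂.1 (hcov hx')
  have hyV : y ∈ Submodule.span ℂ t := Submodule.subset_span hy
  have := Submodule.starProjection_minimal (U := Submodule.span ℂ t) (T x)
  rw [sub_apply, ContinuousLinearMap.comp_apply, this]
  have hbdd : BddBelow (Set.range fun w : Submodule.span ℂ t => ‖T x - w‖) :=
    ⟨0, by rintro _ ⟨w, rfl⟩; positivity⟩
  refine (ciInf_le hbdd ⟨y, hyV⟩).trans ?_
  rw [← dist_eq_norm]
  exact hxy.le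

lemma isCompactOperator_of_approx {X Y : Type*} [NormedAddCommGroup X] [NormedSpace ℂ X]
    [NormedAddCommGroup Y] [NormedSpace ℂ Y] [CompleteSpace Y] (T : X →L[ℂ] Y)
    (h : ∀ ε > 0, ∃ S : X →L[ℂ] Y, IsCompactOperator S ∧ ‖T - S‖ < ε) : IsCompactOperator T := by
  refine isClosed_setOfPred_isCompactOperator.closure_subset ?_
  rw [Metric.mem_closure_iff]
  intro ε hε
  obtain ⟨S, hS, hd⟩ := h ε hε
  exact ⟨S, hS, by rwa [dist_eq_norm]⟩

lemma isCompactOperator_adjoint [CompleteSpace E] [CompleteSpace F] {T : E →L[ℂ] F}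
    (hT : IsCompactOperator T) : IsCompactOperator T.adjoint := by
  refine isCompactOperator_of_approx _ fun ε hε => ?_
  obtain ⟨V, hV, h⟩ := exists_finite_approx hT (half_pos hε)
  refine ⟨T.adjoint ∘L V.starProjection, ?_, ?_⟩
  · exact (isCompactOperator_of_range_le (V := V) V.starProjection (by simp)).clm_comp T.adjoint
  · have : T.adjoint - T.adjoint ∘L V.starProjection = (T - V.starProjection ∘L T).adjoint := by
      rw [map_sub, ContinuousLinearMap.adjoint_comp]
      congr 2
      exact (isSelfAdjoint_starProjection V).adjoint_eq.symm
    rw [this, LinearIsometryEquiv.norm_map]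
    linarith

lemma isCompactOperator_hmap [CompleteSpace E₁] [CompleteSpace F₁] {S : E₁ →L[ℂ] E₂} {T : F₁ →L[ℂ] F₂}
    (hS : IsCompactOperator S) (hT : IsCompactOperator T) : IsCompactOperator (hmap S T) := by
  refine isCompactOperator_of_approx _ fun ε hε => ?_
  have hpos : 0 < ‖S‖ + ‖T‖ + 1 := by positivity
  obtain ⟨V, hV, h⟩ := exists_finite_approx hS (show 0 < ε / 2 / (‖S‖ + ‖T‖ + 1) by positivity)
  obtain ⟨W, hW, h'⟩ := exists_finite_approx hT (show 0 < ε / 2 / (‖S‖ + ‖T‖ + 1) by positivity)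
  refine ⟨hmap (V.starProjection ∘L S) (W.starProjection ∘L T), ?_, ?_⟩
  · rw [hmap_comp]
    suffices hc : IsCompactOperator (hmap V.starProjection W.starProjection : _ →L[ℂ] HTensor E₂ F₂)
      from hc.comp_clm (hmap S T)
    let X : Submodule ℂ (E₂ ⊗[ℂ] F₂) := LinearMap.range (TensorProduct.map V.subtype W.subtype)
    let Y : Submodule ℂ (HTensor E₂ F₂) :=
      X.map (HTensor.of (E := E₂) (F := F₂)).toLinearMap
    have : FiniteDimensional ℂ X := inferInstance
    have hY : FiniteDimensional ℂ Y := inferInstance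
    refine isCompactOperator_of_range_le (V := Y) _ fun x => ?_
    refine HTensor.induction x
      ((Submodule.closed_of_finiteDimensional Y).preimage (hmap _ _).continuous) fun x => ?_
    · rw [hmap_coe]
      refine ⟨_, ?_, rfl⟩
      induction x using TensorProduct.induction_on with
      | zero => simp
      | add x y hx hy => rw [map_add]; exact X.add_mem hx hy
      | tmul a b => 
        exact ⟨(V.orthogonalProjectionOnto a) ⊗ₜ (W.orthogonalProjectionOnto b), rfl⟩
  · have e : hmap S T - hmap (V.starProjection ∘L S) (W.starProjection ∘L T)
        = hmap (S - V.starProjection ∘L S) T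
          + hmap (V.starProjection ∘L S) (T - W.starProjection ∘L T) := by
      have e1 := hmap_add_left (S - V.starProjection ∘L S) (V.starProjection ∘L S) T
      have e2 := hmap_add_right (V.starProjection ∘L S) (T - W.starProjection ∘L T)
        (W.starProjection ∘L T)
      rw [sub_add_cancel] at e1 e2
      rw [e1, e2]; abel
    have b1 := norm_hmap_le (S - V.starProjection ∘L S) T
    have b2 := norm_hmap_le (V.starProjection ∘L S) (T - W.starProjection ∘L T)
    have b3 : ‖V.starProjection ∘L S‖ ≤ ‖S‖ :=
      (ContinuousLinearMap.opNorm_comp_le _ _).trans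
        (mul_le_of_le_one_left (norm_nonneg _) V.starProjection_norm_le)
    rw [e]
    set δ := ε / 2 / (‖S‖ + ‖T‖ + 1)
    have hδ : δ * (‖S‖ + ‖T‖ + 1) = ε / 2 := by simp only [δ]; field_simp
    have hδ0 : 0 < δ := by positivity
    calc _ ≤ δ * ‖T‖ + ‖S‖ * δ := by
          refine (norm_add_le _ _).trans (add_le_add (b1.trans ?_) (b2.trans ?_)) <;> gcongr
      _ < ε := by nlinarith

/-- The Banach space `K(E, F)` of compact operators. -/
abbrev Cpt (E F : Type*) [NormedAddCommGroup E] [InnerProductSpace ℂ E]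
    [NormedAddCommGroup F] [InnerProductSpace ℂ F] : Submodule ℂ (E →L[ℂ] F) :=
  compactOperator (RingHom.id ℂ) E F

/-- `k ↦ v k w` as a map of spaces of compact operators. -/
def Cpt.sandwich (v : E₂ →L[ℂ] F₂) (w : F₁ →L[ℂ] E₁) : Cpt E₁ E₂ →ₗ[ℂ] Cpt F₁ F₂ where
  toFun k := ⟨v ∘L k.1 ∘L w, (IsCompactOperator.comp_clm k.2 w).clm_comp v⟩
  map_add' k l := by ext; simp
  map_smul' c k := by ext; simp

/-- Composition of compact operators. -/
def Cpt.comp : Cpt E₂ E₃ →ₗ[ℂ] Cpt E₁ E₂ →ₗ[ℂ] Cpt E₁ E₃ :=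
  LinearMap.mk₂ ℂ (fun k l => ⟨k.1 ∘L l.1, IsCompactOperator.comp_clm k.2 l.1⟩)
    (fun _ _ _ => by ext; simp) (fun _ _ _ => by ext; simp) (fun _ _ _ => by ext; simp)
    (fun _ _ _ => by ext; simp)

/-- The adjoint of a compact operator. -/
def Cpt.adj [CompleteSpace E] [CompleteSpace F] : Cpt E F →ₗ⋆[ℂ] Cpt F E where
  toFun k := ⟨k.1.adjoint, isCompactOperator_adjoint k.2⟩
  map_add' k l := by ext1; exact map_add _ _ _
  map_smul' c k := by ext1; exact map_smulₛₗ _ _ _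

/-- The tensor product of compact operators. -/
def Cpt.tensor [CompleteSpace E₁] [CompleteSpace F₁] :
    Cpt E₁ E₂ →ₗ[ℂ] Cpt F₁ F₂ →ₗ[ℂ] Cpt (HTensor E₁ F₁) (HTensor E₂ F₂) :=
  LinearMap.mk₂ ℂ (fun k l => ⟨hmap k.1 l.1, isCompactOperator_hmap k.2 l.2⟩)
    (fun _ _ _ => Subtype.ext (hmap_add_left _ _ _))
    (fun _ _ _ => Subtype.ext (hmap_smul_left _ _ _))
    (fun _ _ _ => Subtype.ext (hmap_add_right _ _ _))
    (fun _ _ _ => Subtype.ext (hmap_smul_right _ _ _))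

end Hilbert

/-! ### The tensor product `K(H₁, H₂) ⊗ A` -/

/-- A `*`-representation of the `C*`-algebra `A` on a Hilbert space. -/
structure StarRep (A : Type v) [NonUnitalCStarAlgebra A] where
  L : Type v
  [normed : NormedAddCommGroup L]
  [inner : InnerProductSpace ℂ L]
  [complete : CompleteSpace L]
  π : A →⋆ₙₐ[ℂ] (L →L[ℂ] L)

attribute [instance] StarRep.normed StarRep.inner StarRep.complete

/-- The zero representation. -/
instance (A : Type v) [NonUnitalCStarAlgebra A] : Nonempty (StarRep A) :=
  ⟨{ L := EuclideanSpace ℂ PEmpty.{v+1}, π := 0 }⟩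

/-- Restriction of a representation along a `*`-homomorphism. -/
def StarRep.comap {A B : Type v} [NonUnitalCStarAlgebra A] [NonUnitalCStarAlgebra B]
    (ρ : StarRep B) (ψ : A →⋆ₙₐ[ℂ] B) : StarRep A where
  L := ρ.L
  π := ρ.π.comp ψ

lemma StarRep.norm_le {A : Type v} [NonUnitalCStarAlgebra A] (ρ : StarRep A) (a : A) :
    ‖ρ.π a‖ ≤ ‖a‖ := NonUnitalStarAlgHom.norm_apply_le ρ.π a

section KT

set_option linter.unusedSectionVars false

variable (E E₁ E₂ E₃ E₄ : Type) (A B : Type v)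
  [NormedAddCommGroup E] [InnerProductSpace ℂ E] [CompleteSpace E]
  [NormedAddCommGroup E₁] [InnerProductSpace ℂ E₁] [CompleteSpace E₁]
  [NormedAddCommGroup E₂] [InnerProductSpace ℂ E₂] [CompleteSpace E₂]
  [NormedAddCommGroup E₃] [InnerProductSpace ℂ E₃] [CompleteSpace E₃]
  [NormedAddCommGroup E₄] [InnerProductSpace ℂ E₄] [CompleteSpace E₄]
  [NonUnitalCStarAlgebra A] [NonUnitalCStarAlgebra B]

/-- The algebraic tensor product `K(E₁, E₂) ⊙ A`. -/
def AlgKT : Type v := Cpt E₁ E₂ ⊗[ℂ] A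

instance : AddCommGroup (AlgKT E₁ E₂ A) := inferInstanceAs (AddCommGroup (Cpt E₁ E₂ ⊗[ℂ] A))
instance : Module ℂ (AlgKT E₁ E₂ A) := inferInstanceAs (Module ℂ (Cpt E₁ E₂ ⊗[ℂ] A))

variable {E E₁ E₂ E₃ E₄ A B}

/-- The elementary tensor `k ⊗ a`. -/
def AlgKT.tmul (k : Cpt E₁ E₂) (a : A) : AlgKT E₁ E₂ A := k ⊗ₜ[ℂ] a

lemma AlgKT.induction {p : AlgKT E₁ E₂ A → Prop} (t : AlgKT E₁ E₂ A) (zero : p 0)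
    (tmul : ∀ k a, p (AlgKT.tmul k a)) (add : ∀ x y, p x → p y → p (x + y)) : p t :=
  TensorProduct.induction_on t zero tmul add

/-- The operator `(id ⊗ π)(t)` from `E₁ ⊗ L` to `E₂ ⊗ L`. -/
def amplOf {L : Type v} [NormedAddCommGroup L] [InnerProductSpace ℂ L] [CompleteSpace L]
    (π : A →⋆ₙₐ[ℂ] (L →L[ℂ] L)) : AlgKT E₁ E₂ A →ₗ[ℂ] (HTensor E₁ L →L[ℂ] HTensor E₂ L) :=
  TensorProduct.lift (LinearMap.mk₂ ℂ (fun (k : Cpt E₁ E₂) (a : A) => hmap k.1 (π a))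
    (fun _ _ _ => hmap_add_left _ _ _) (fun _ _ _ => hmap_smul_left _ _ _)
    (fun k a b => by rw [map_add, hmap_add_right])
    (fun c k a => by rw [map_smul, hmap_smul_right]))

/-- The operator `(id ⊗ π)(t)` for a bundled representation. -/
def StarRep.ampl (ρ : StarRep A) :
    AlgKT E₁ E₂ A →ₗ[ℂ] (HTensor E₁ ρ.L →L[ℂ] HTensor E₂ ρ.L) :=
  amplOf ρ.π

lemma StarRep.ampl_tmul (ρ : StarRep A) (k : Cpt E₁ E₂) (a : A) :
    ρ.ampl (AlgKT.tmul k a) = hmap k.1 (ρ.π a) := rfl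

/-- The spatial `C*`-norm on `K(E₁, E₂) ⊙ A`: the supremum of the operator norms of
`(id ⊗ π)(t) : E₁ ⊗ L → E₂ ⊗ L` over all `*`-representations `π` of `A` on Hilbert spaces `L`. -/
instance : Norm (AlgKT E₁ E₂ A) := ⟨fun t => ⨆ ρ : StarRep A, ‖ρ.ampl t‖⟩

lemma AlgKT.norm_def (t : AlgKT E₁ E₂ A) : ‖t‖ = ⨆ ρ : StarRep A, ‖ρ.ampl t‖ := rfl

lemma AlgKT.bddAbove (t : AlgKT E₁ E₂ A) :
    BddAbove (Set.range fun ρ : StarRep A => ‖ρ.ampl t‖) := by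
  induction t using AlgKT.induction with
  | zero => exact ⟨0, by rintro _ ⟨ρ, rfl⟩; simp⟩
  | tmul k a =>
    refine ⟨‖k.1‖ * ‖a‖, ?_⟩
    rintro _ ⟨ρ, rfl⟩
    exact (norm_hmap_le _ _).trans (mul_le_mul_of_nonneg_left (ρ.norm_le a) (norm_nonneg _))
  | add x y hx hy =>
    obtain ⟨C, hC⟩ := hx
    obtain ⟨D, hD⟩ := hy
    refine ⟨C + D, ?_⟩
    rintro _ ⟨ρ, rfl⟩
    simp only [map_add]
    exact (norm_add_le _ _).trans (add_le_add (hC ⟨ρ, rfl⟩) (hD ⟨ρ, rfl⟩))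

lemma AlgKT.le_norm (ρ : StarRep A) (t : AlgKT E₁ E₂ A) : ‖ρ.ampl t‖ ≤ ‖t‖ :=
  le_ciSup (AlgKT.bddAbove t) ρ

lemma AlgKT.norm_le {t : AlgKT E₁ E₂ A} {C : ℝ} (h : ∀ ρ : StarRep A, ‖ρ.ampl t‖ ≤ C) :
    ‖t‖ ≤ C := ciSup_le h

lemma AlgKT.norm_nonneg' (t : AlgKT E₁ E₂ A) : 0 ≤ ‖t‖ :=
  (norm_nonneg _).trans (AlgKT.le_norm (Classical.arbitrary (StarRep A)) t)

instance : SeminormedAddCommGroup (AlgKT E₁ E₂ A) :=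
  AddGroupSeminorm.toSeminormedAddCommGroup
    { toFun := fun t => ‖t‖
      map_zero' := le_antisymm (AlgKT.norm_le fun ρ => by simp) (AlgKT.norm_nonneg' _)
      add_le' := fun x y => AlgKT.norm_le fun ρ => by
        rw [map_add]
        exact (norm_add_le _ _).trans (add_le_add (AlgKT.le_norm ρ x) (AlgKT.le_norm ρ y))
      neg' := fun x => by simp only [AlgKT.norm_def, map_neg, norm_neg] }

instance : NormedSpace ℂ (AlgKT E₁ E₂ A) where
  norm_smul_le c x := AlgKT.norm_le fun ρ => by
    rw [map_smul, norm_smul]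
    exact mul_le_mul_of_nonneg_left (AlgKT.le_norm ρ x) (norm_nonneg c)

variable (E₁ E₂ A) in
/-- The Banach space `K(E₁, E₂) ⊗ A`: the completion of the algebraic tensor product. For
`E₁ = E₂ = E` this is the `C*`-algebra `K(E) ⊗ A`, see the instance below. -/
def KT : Type v := UniformSpace.Completion (AlgKT E₁ E₂ A)

instance : NormedAddCommGroup (KT E₁ E₂ A) :=
  inferInstanceAs (NormedAddCommGroup (UniformSpace.Completion (AlgKT E₁ E₂ A)))

instance : NormedSpace ℂ (KT E₁ E₂ A) :=
  inferInstanceAs (NormedSpace ℂ (UniformSpace.Completion (AlgKT E₁ E₂ A)))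

instance : CompleteSpace (KT E₁ E₂ A) :=
  inferInstanceAs (CompleteSpace (UniformSpace.Completion (AlgKT E₁ E₂ A)))

/-- The canonical map from the algebraic tensor product. -/
def KT.of : AlgKT E₁ E₂ A →ₗᵢ[ℂ] KT E₁ E₂ A := UniformSpace.Completion.toComplₗᵢ

lemma KT.denseRange : DenseRange (KT.of (E₁ := E₁) (E₂ := E₂) (A := A)) :=
  UniformSpace.Completion.denseRange_coe

lemma KT.induction {p : KT E₁ E₂ A → Prop} (x : KT E₁ E₂ A) (hp : IsClosed {x | p x})
    (ih : ∀ t, p (KT.of t)) : p x :=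
  KT.denseRange.induction (by rintro _ ⟨x, rfl⟩; exact ih x) hp x

lemma KT.funext {Z : Type*} [TopologicalSpace Z] [T2Space Z] {f g : KT E₁ E₂ A → Z}
    (hf : Continuous f) (hg : Continuous g) (h : ∀ t, f (KT.of t) = g (KT.of t))
    (x : KT E₁ E₂ A) : f x = g x :=
  KT.induction x (isClosed_eq hf hg) h

/-- The elementary tensor `k ⊗ a` in `K(E₁, E₂) ⊗ A`. -/
def KT.tmul (k : Cpt E₁ E₂) (a : A) : KT E₁ E₂ A := KT.of (AlgKT.tmul k a)

/-! #### Composition -/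

/-- Composition `(k ⊗ a)(l ⊗ b) = kl ⊗ ab` on algebraic tensor products. -/
def AlgKT.comp : AlgKT E₂ E₃ A →ₗ[ℂ] AlgKT E₁ E₂ A →ₗ[ℂ] AlgKT E₁ E₃ A :=
  TensorProduct.map₂ Cpt.comp (LinearMap.mul ℂ A)

lemma AlgKT.comp_tmul (k : Cpt E₂ E₃) (l : Cpt E₁ E₂) (a b : A) :
    AlgKT.comp (AlgKT.tmul k a) (AlgKT.tmul l b) = AlgKT.tmul (Cpt.comp k l) (a * b) :=
  rfl

lemma StarRep.ampl_comp (ρ : StarRep A) (x : AlgKT E₂ E₃ A) (y : AlgKT E₁ E₂ A) :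
    ρ.ampl (AlgKT.comp x y) = ρ.ampl x ∘L ρ.ampl y := by
  induction x using AlgKT.induction with
  | zero => simp
  | add x x' hx hx' => simp only [map_add, LinearMap.add_apply, hx, hx', ContinuousLinearMap.add_comp]
  | tmul k a =>
    induction y using AlgKT.induction with
    | zero => simp
    | add x x' hx hx' => simp only [map_add, hx, hx', ContinuousLinearMap.comp_add]
    | tmul l b =>
      rw [AlgKT.comp_tmul, StarRep.ampl_tmul, StarRep.ampl_tmul, StarRep.ampl_tmul, ← hmap_comp,
        map_mul]
      rfl

lemma AlgKT.norm_comp_le (x : AlgKT E₂ E₃ A) (y : AlgKT E₁ E₂ A) :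
    ‖AlgKT.comp x y‖ ≤ ‖x‖ * ‖y‖ := AlgKT.norm_le fun ρ => by
  rw [StarRep.ampl_comp]
  exact (ContinuousLinearMap.opNorm_comp_le _ _).trans
    (mul_le_mul (AlgKT.le_norm ρ x) (AlgKT.le_norm ρ y) (norm_nonneg _) (norm_nonneg _))

lemma AlgKT.of_comp_bound (x : AlgKT E₂ E₃ A) (y : AlgKT E₁ E₂ A) :
    ‖(KT.of.toLinearMap ∘ₗ AlgKT.comp x) y‖ ≤ ‖x‖ * ‖KT.of.toLinearMap y‖ := by
  have h := AlgKT.norm_comp_le x y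
  simpa using h

/-- Left composition by an algebraic tensor. -/
def AlgKT.compLeft : AlgKT E₂ E₃ A →ₗ[ℂ] (KT E₁ E₂ A →L[ℂ] KT E₁ E₃ A) where
  toFun x := LinearMap.extendOfNorm (KT.of.toLinearMap ∘ₗ AlgKT.comp x) KT.of.toLinearMap
  map_add' x y := LinearMap.extendOfNorm_unique KT.denseRange _ (AlgKT.of_comp_bound (x + y)) _ (by
    ext t
    have h1 := LinearMap.extendOfNorm_eq KT.denseRange ⟨_, AlgKT.of_comp_bound (E₁ := E₁) x⟩ t
    have h2 := LinearMap.extendOfNorm_eq KT.denseRange ⟨_, AlgKT.of_comp_bound (E₁ := E₁) y⟩ t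
    simp only [LinearMap.comp_apply, ContinuousLinearMap.coe_coe, add_apply, map_add] at h1 h2 ⊢
    rw [h1, h2, LinearMap.add_apply, map_add])
  map_smul' c x := LinearMap.extendOfNorm_unique KT.denseRange _ (AlgKT.of_comp_bound (c • x)) _ (by
    ext t
    have h1 := LinearMap.extendOfNorm_eq KT.denseRange ⟨_, AlgKT.of_comp_bound (E₁ := E₁) x⟩ t
    simp only [LinearMap.comp_apply, ContinuousLinearMap.coe_coe, smul_apply, map_smul,
      RingHom.id_apply] at h1 ⊢
    rw [h1, LinearMap.smul_apply, map_smul])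

lemma AlgKT.norm_compLeft_le (x : AlgKT E₂ E₃ A) :
    ‖AlgKT.compLeft (E₁ := E₁) x‖ ≤ 1 * ‖KT.of.toLinearMap x‖ := by
  have h := LinearMap.opNorm_extendOfNorm_le KT.denseRange (norm_nonneg x)
    (AlgKT.of_comp_bound (E₁ := E₁) x)
  rw [one_mul]
  exact h.trans_eq (KT.of.norm_map x).symm

/-- The composition `K(E₂, E₃) ⊗ A × K(E₁, E₂) ⊗ A → K(E₁, E₃) ⊗ A`, `(x, y) ↦ x y`. -/
def KT.comp : KT E₂ E₃ A →L[ℂ] KT E₁ E₂ A →L[ℂ] KT E₁ E₃ A :=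
  LinearMap.extendOfNorm AlgKT.compLeft KT.of.toLinearMap

lemma KT.comp_of (x : AlgKT E₂ E₃ A) (y : AlgKT E₁ E₂ A) :
    KT.comp (KT.of x) (KT.of y) = KT.of (AlgKT.comp x y) := by
  have h1 : KT.comp (KT.of x) = AlgKT.compLeft (E₁ := E₁) x :=
    LinearMap.extendOfNorm_eq KT.denseRange ⟨_, AlgKT.norm_compLeft_le⟩ x
  rw [h1]
  exact LinearMap.extendOfNorm_eq KT.denseRange ⟨_, AlgKT.of_comp_bound (E₁ := E₁) x⟩ y

lemma KT.norm_comp_le (x : KT E₂ E₃ A) (y : KT E₁ E₂ A) : ‖KT.comp x y‖ ≤ ‖x‖ * ‖y‖ := by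
  induction x using KT.induction with
  | hp => exact isClosed_le (by fun_prop) (by fun_prop)
  | ih x =>
  induction y using KT.induction with
  | hp => exact isClosed_le (by fun_prop) (by fun_prop)
  | ih y =>
  rw [KT.comp_of]
  simpa using AlgKT.norm_comp_le x y

/-! #### Adjoints -/

/-- The involution `k ⊗ a ↦ k* ⊗ a*` on algebraic tensor products. -/
def AlgKT.adj : AlgKT E₁ E₂ A →ₗ⋆[ℂ] AlgKT E₂ E₁ A :=
  TensorProduct.map (Cpt.adj : Cpt E₁ E₂ →ₗ⋆[ℂ] Cpt E₂ E₁)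
    ({ toFun := star, map_add' := star_add, map_smul' := star_smul } : A →ₗ⋆[ℂ] A)

lemma AlgKT.adj_tmul (k : Cpt E₁ E₂) (a : A) :
    AlgKT.adj (AlgKT.tmul k a) = AlgKT.tmul (Cpt.adj k) (star a) := rfl

lemma StarRep.ampl_adj (ρ : StarRep A) (x : AlgKT E₁ E₂ A) :
    ρ.ampl (AlgKT.adj x) = (ρ.ampl x).adjoint := by
  induction x using AlgKT.induction with
  | zero => simp
  | add x x' hx hx' => simp only [map_add, hx, hx']
  | tmul k a =>
    rw [AlgKT.adj_tmul, StarRep.ampl_tmul, StarRep.ampl_tmul, adjoint_hmap, map_star]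
    rfl

lemma AlgKT.norm_adj (x : AlgKT E₁ E₂ A) : ‖AlgKT.adj x‖ = ‖x‖ := by
  simp only [AlgKT.norm_def, StarRep.ampl_adj, LinearIsometryEquiv.norm_map]

/-- The involution `K(E₁, E₂) ⊗ A → K(E₂, E₁) ⊗ A`, `x ↦ x*`. -/
def KT.adj : KT E₁ E₂ A →L⋆[ℂ] KT E₂ E₁ A :=
  LinearMap.extendOfNorm (KT.of.toLinearMap.comp AlgKT.adj) KT.of.toLinearMap

lemma KT.adj_of (x : AlgKT E₁ E₂ A) : KT.adj (KT.of x) = KT.of (AlgKT.adj x) :=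
  LinearMap.extendOfNorm_eq KT.denseRange
    ⟨1, fun t => by simpa using (AlgKT.norm_adj t).le⟩ x

lemma AlgKT.adj_adj (x : AlgKT E₁ E₂ A) : AlgKT.adj (AlgKT.adj x) = x := by
  induction x using AlgKT.induction with
  | zero => simp
  | add x x' hx hx' => simp only [map_add, hx, hx']
  | tmul k a =>
    rw [AlgKT.adj_tmul, AlgKT.adj_tmul, star_star]
    congr 1
    exact Subtype.ext (ContinuousLinearMap.adjoint_adjoint _)

lemma AlgKT.adj_comp (x : AlgKT E₂ E₃ A) (y : AlgKT E₁ E₂ A) :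
    AlgKT.adj (AlgKT.comp x y) = AlgKT.comp (AlgKT.adj y) (AlgKT.adj x) := by
  induction x using AlgKT.induction with
  | zero => simp
  | add x x' hx hx' => simp only [map_add, LinearMap.add_apply, hx, hx']
  | tmul k a =>
    induction y using AlgKT.induction with
    | zero => simp
    | add x x' hx hx' => simp only [map_add, LinearMap.add_apply, hx, hx']
    | tmul l b =>
      simp only [AlgKT.adj_tmul, AlgKT.comp_tmul, star_mul]
      congr 1
      exact Subtype.ext (ContinuousLinearMap.adjoint_comp _ _)

lemma AlgKT.comp_assoc (x : AlgKT E₃ E₄ A) (y : AlgKT E₂ E₃ A) (z : AlgKT E₁ E₂ A) :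
    AlgKT.comp (AlgKT.comp x y) z = AlgKT.comp x (AlgKT.comp y z) := by
  induction x using AlgKT.induction with
  | zero => simp
  | add x x' hx hx' => simp only [map_add, LinearMap.add_apply, hx, hx']
  | tmul k a =>
    induction y using AlgKT.induction with
    | zero => simp
    | add x x' hx hx' => simp only [map_add, LinearMap.add_apply, hx, hx']
    | tmul l b =>
      induction z using AlgKT.induction with
      | zero => simp
      | add x x' hx hx' => simp only [map_add, hx, hx']
      | tmul m c => simp only [AlgKT.comp_tmul, mul_assoc]; rfl

lemma AlgKT.norm_star_comp (x : AlgKT E₁ E₂ A) : ‖x‖ * ‖x‖ ≤ ‖AlgKT.comp (AlgKT.adj x) x‖ := by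
  have h : ‖x‖ ≤ √‖AlgKT.comp (AlgKT.adj x) x‖ := AlgKT.norm_le fun ρ => by
    refine Real.le_sqrt_of_sq_le ?_
    refine le_trans (le_of_eq ?_) (AlgKT.le_norm ρ _)
    rw [StarRep.ampl_comp, StarRep.ampl_adj, sq]
    exact (ContinuousLinearMap.norm_adjoint_comp_self _).symm
  calc ‖x‖ * ‖x‖ ≤ √‖AlgKT.comp (AlgKT.adj x) x‖ * √‖AlgKT.comp (AlgKT.adj x) x‖ := by gcongr
    _ = _ := Real.mul_self_sqrt (norm_nonneg _)

lemma KT.comp_assoc (x : KT E₃ E₄ A) (y : KT E₂ E₃ A) (z : KT E₁ E₂ A) :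
    KT.comp (KT.comp x y) z = KT.comp x (KT.comp y z) := by
  induction x using KT.induction with
  | hp => exact isClosed_eq (by fun_prop) (by fun_prop)
  | ih x =>
  induction y using KT.induction with
  | hp => exact isClosed_eq (by fun_prop) (by fun_prop)
  | ih y =>
  induction z using KT.induction with
  | hp => exact isClosed_eq (by fun_prop) (by fun_prop)
  | ih z =>
  simp only [KT.comp_of, AlgKT.comp_assoc]

lemma KT.adj_adj (x : KT E₁ E₂ A) : KT.adj (KT.adj x) = x := by
  induction x using KT.induction with
  | hp => exact isClosed_eq (by fun_prop) (by fun_prop)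
  | ih x =>
  simp only [KT.adj_of, AlgKT.adj_adj]

lemma KT.adj_comp (x : KT E₂ E₃ A) (y : KT E₁ E₂ A) :
    KT.adj (KT.comp x y) = KT.comp (KT.adj y) (KT.adj x) := by
  induction x using KT.induction with
  | hp => exact isClosed_eq (by fun_prop) (by fun_prop)
  | ih x =>
  induction y using KT.induction with
  | hp => exact isClosed_eq (by fun_prop) (by fun_prop)
  | ih y =>
  simp only [KT.comp_of, KT.adj_of, AlgKT.adj_comp]

lemma KT.norm_star_comp (x : KT E₁ E₂ A) : ‖x‖ * ‖x‖ ≤ ‖KT.comp (KT.adj x) x‖ := by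
  induction x using KT.induction with
  | hp => exact isClosed_le (by fun_prop) (by fun_prop)
  | ih x =>
  simpa only [KT.comp_of, KT.adj_of, LinearIsometry.norm_map] using AlgKT.norm_star_comp x

/-- The `C*`-algebra `K(E) ⊗ A`. -/
instance : NonUnitalCStarAlgebra (KT E E A) where
  __ := (inferInstance : NormedAddCommGroup (KT E E A))
  __ := (inferInstance : NormedSpace ℂ (KT E E A))
  mul x y := KT.comp x y
  left_distrib x y z := map_add (KT.comp x) y z
  right_distrib x y z := by
    change KT.comp (x + y) z = KT.comp x z + KT.comp y z
    rw [map_add, add_apply]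
  zero_mul x := by
    change KT.comp 0 x = 0
    rw [map_zero, zero_apply]
  mul_zero x := map_zero (KT.comp x)
  mul_assoc x y z := KT.comp_assoc x y z
  norm_mul_le x y := KT.norm_comp_le x y
  star x := KT.adj x
  star_involutive x := KT.adj_adj x
  star_mul x y := KT.adj_comp x y
  star_add x y := map_add KT.adj x y
  norm_mul_self_le x := KT.norm_star_comp x
  complete := CompleteSpace.complete
  smul_assoc c x y := by
    change KT.comp (c • x) y = c • KT.comp x y
    rw [map_smul, smul_apply]
  smul_comm c x y := ((KT.comp x).map_smul c y).symm
  star_smul c x := KT.adj.map_smulₛₗ c x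

lemma KT.mul_def (x y : KT E E A) : x * y = KT.comp x y := rfl
lemma KT.star_def (x : KT E E A) : star x = KT.adj x := rfl

end KT

section Maps

set_option linter.unusedSectionVars false

variable {E₁ E₂ E₃ F₁ F₂ F₃ : Type} {A B C : Type v}
  [NormedAddCommGroup E₁] [InnerProductSpace ℂ E₁] [CompleteSpace E₁]
  [NormedAddCommGroup E₂] [InnerProductSpace ℂ E₂] [CompleteSpace E₂]
  [NormedAddCommGroup E₃] [InnerProductSpace ℂ E₃] [CompleteSpace E₃]
  [NormedAddCommGroup F₁] [InnerProductSpace ℂ F₁] [CompleteSpace F₁]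
  [NormedAddCommGroup F₂] [InnerProductSpace ℂ F₂] [CompleteSpace F₂]
  [NormedAddCommGroup F₃] [InnerProductSpace ℂ F₃] [CompleteSpace F₃]
  [NonUnitalCStarAlgebra A] [NonUnitalCStarAlgebra B] [NonUnitalCStarAlgebra C]

/-! #### The maps `k ⊗ a ↦ (v k w) ⊗ ψ(a)` -/

/-- The map `k ⊗ a ↦ (v k w) ⊗ ψ(a)` on algebraic tensor products. -/
def AlgKT.sandwich (v : E₂ →L[ℂ] F₂) (w : F₁ →L[ℂ] E₁) (ψ : A →⋆ₙₐ[ℂ] B) :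
    AlgKT E₁ E₂ A →ₗ[ℂ] AlgKT F₁ F₂ B :=
  TensorProduct.map (Cpt.sandwich v w) ({ toFun := ψ, map_add' := map_add ψ, map_smul' := map_smul ψ } : A →ₗ[ℂ] B)

lemma AlgKT.sandwich_tmul (v : E₂ →L[ℂ] F₂) (w : F₁ →L[ℂ] E₁) (ψ : A →⋆ₙₐ[ℂ] B)
    (k : Cpt E₁ E₂) (a : A) :
    AlgKT.sandwich v w ψ (AlgKT.tmul k a) = AlgKT.tmul (Cpt.sandwich v w k) (ψ a) := rfl

lemma amplOf_sandwich {L : Type v} [NormedAddCommGroup L] [InnerProductSpace ℂ L]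
    [CompleteSpace L] (π : B →⋆ₙₐ[ℂ] (L →L[ℂ] L)) (v : E₂ →L[ℂ] F₂) (w : F₁ →L[ℂ] E₁)
    (ψ : A →⋆ₙₐ[ℂ] B) (t : AlgKT E₁ E₂ A) :
    amplOf π (AlgKT.sandwich v w ψ t)
      = hmap v (.id ℂ L) ∘L amplOf (π.comp ψ) t ∘L hmap w (.id ℂ L) := by
  induction t using AlgKT.induction with
  | zero => simp
  | add x x' hx hx' =>
    rw [map_add, map_add, map_add, hx, hx', ContinuousLinearMap.add_comp,
      ContinuousLinearMap.comp_add]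
  | tmul k a =>
    change hmap (v ∘L k.1 ∘L w) (π (ψ a)) =
      hmap v (.id ℂ L) ∘L hmap k.1 (π (ψ a)) ∘L hmap w (.id ℂ L)
    rw [← hmap_comp, ← hmap_comp]
    rfl

lemma AlgKT.norm_sandwich_le (v : E₂ →L[ℂ] F₂) (w : F₁ →L[ℂ] E₁) (ψ : A →⋆ₙₐ[ℂ] B)
    (t : AlgKT E₁ E₂ A) : ‖AlgKT.sandwich v w ψ t‖ ≤ ‖v‖ * ‖w‖ * ‖t‖ := AlgKT.norm_le fun ρ => by
  have hid : ‖ContinuousLinearMap.id ℂ ρ.L‖ ≤ 1 := ContinuousLinearMap.norm_id_le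
  have hv : ‖hmap v (.id ℂ ρ.L)‖ ≤ ‖v‖ :=
    (norm_hmap_le _ _).trans (mul_le_of_le_one_right (norm_nonneg _) hid)
  have hw : ‖hmap w (.id ℂ ρ.L)‖ ≤ ‖w‖ :=
    (norm_hmap_le _ _).trans (mul_le_of_le_one_right (norm_nonneg _) hid)
  have ht : ‖amplOf (ρ.π.comp ψ) t‖ ≤ ‖t‖ := AlgKT.le_norm (ρ.comap ψ) t
  rw [StarRep.ampl, amplOf_sandwich]
  refine (ContinuousLinearMap.opNorm_comp_le _ _).trans ?_
  refine (mul_le_mul hv (ContinuousLinearMap.opNorm_comp_le _ _) (norm_nonneg _)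
    (norm_nonneg _)).trans ?_
  rw [mul_assoc, mul_comm ‖w‖]
  exact mul_le_mul_of_nonneg_left (mul_le_mul ht hw (norm_nonneg _) (norm_nonneg _)) (norm_nonneg _)

/-- The map `K(E₁, E₂) ⊗ A → K(F₁, F₂) ⊗ B` with `k ⊗ a ↦ (v k w) ⊗ ψ(a)`. -/
def KT.sandwich (v : E₂ →L[ℂ] F₂) (w : F₁ →L[ℂ] E₁) (ψ : A →⋆ₙₐ[ℂ] B) :
    KT E₁ E₂ A →L[ℂ] KT F₁ F₂ B :=
  LinearMap.extendOfNorm (KT.of.toLinearMap ∘ₗ AlgKT.sandwich v w ψ) KT.of.toLinearMap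

lemma KT.sandwich_of (v : E₂ →L[ℂ] F₂) (w : F₁ →L[ℂ] E₁) (ψ : A →⋆ₙₐ[ℂ] B) (t : AlgKT E₁ E₂ A) :
    KT.sandwich v w ψ (KT.of t) = KT.of (AlgKT.sandwich v w ψ t) :=
  LinearMap.extendOfNorm_eq KT.denseRange
    ⟨‖v‖ * ‖w‖, fun t => by simpa using AlgKT.norm_sandwich_le v w ψ t⟩ t

lemma KT.sandwich_adj (v : E₂ →L[ℂ] F₂) (w : F₁ →L[ℂ] E₁) (ψ : A →⋆ₙₐ[ℂ] B) (x : KT E₁ E₂ A) :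
    KT.adj (KT.sandwich v w ψ x) = KT.sandwich w.adjoint v.adjoint ψ (KT.adj x) := by
  induction x using KT.induction with
  | hp => exact isClosed_eq (by fun_prop) (by fun_prop)
  | ih t =>
    simp only [KT.sandwich_of, KT.adj_of]
    congr 1
    induction t using AlgKT.induction with
    | zero => simp
    | add x x' hx hx' => simp only [map_add, hx, hx']
    | tmul k a =>
      simp only [AlgKT.sandwich_tmul, AlgKT.adj_tmul, map_star]
      congr 1
      refine Subtype.ext ?_
      change (v ∘L k.1 ∘L w).adjoint = w.adjoint ∘L k.1.adjoint ∘L v.adjoint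
      rw [ContinuousLinearMap.adjoint_comp, ContinuousLinearMap.adjoint_comp]
      rfl

/-- `(v x w)(v' y w') = v (x (w v') y) w'`. -/
lemma KT.comp_sandwich {G₁ G₂ : Type} [NormedAddCommGroup G₁] [InnerProductSpace ℂ G₁]
    [CompleteSpace G₁] [NormedAddCommGroup G₂] [InnerProductSpace ℂ G₂] [CompleteSpace G₂]
    (v : E₂ →L[ℂ] F₂) (w : G₂ →L[ℂ] E₁) (v' : E₃ →L[ℂ] G₂) (w' : F₁ →L[ℂ] G₁)
    (ψ : A →⋆ₙₐ[ℂ] B) (x : KT E₁ E₂ A) (y : KT G₁ E₃ A) :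
    KT.comp (KT.sandwich v w ψ x) (KT.sandwich v' w' ψ y)
      = KT.sandwich v w' ψ
          (KT.comp x (KT.sandwich (w ∘L v') (.id ℂ G₁) (NonUnitalStarAlgHom.id ℂ A) y)) := by
  induction x using KT.induction with
  | hp => exact isClosed_eq (by fun_prop) (by fun_prop)
  | ih s =>
  induction y using KT.induction with
  | hp => exact isClosed_eq (by fun_prop) (by fun_prop)
  | ih t =>
    simp only [KT.sandwich_of, KT.comp_of]
    congr 1
    induction s using AlgKT.induction with
    | zero => simp
    | add x x' hx hx' => simp only [map_add, LinearMap.add_apply, hx, hx']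
    | tmul k a =>
      induction t using AlgKT.induction with
      | zero => simp
      | add x x' hx hx' => simp only [map_add, hx, hx']
      | tmul l b =>
        simp only [AlgKT.sandwich_tmul, AlgKT.comp_tmul, map_mul]
        rfl

lemma KT.sandwich_sandwich {G₁ G₂ : Type} [NormedAddCommGroup G₁] [InnerProductSpace ℂ G₁]
    [CompleteSpace G₁] [NormedAddCommGroup G₂] [InnerProductSpace ℂ G₂] [CompleteSpace G₂]
    (v : F₂ →L[ℂ] G₂) (w : G₁ →L[ℂ] F₁) (v' : E₂ →L[ℂ] F₂) (w' : F₁ →L[ℂ] E₁)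
    (ψ : B →⋆ₙₐ[ℂ] C) (ψ' : A →⋆ₙₐ[ℂ] B) (x : KT E₁ E₂ A) :
    KT.sandwich v w ψ (KT.sandwich v' w' ψ' x)
      = KT.sandwich (v ∘L v') (w' ∘L w) (ψ.comp ψ') x := by
  induction x using KT.induction with
  | hp => exact isClosed_eq (by fun_prop) (by fun_prop)
  | ih t =>
    simp only [KT.sandwich_of]
    congr 1
    induction t using AlgKT.induction with
    | zero => simp
    | add x x' hx hx' => simp only [map_add, hx, hx']
    | tmul k a => rfl

lemma KT.sandwich_id (x : KT E₁ E₂ A) :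
    KT.sandwich (.id ℂ E₂) (.id ℂ E₁) (NonUnitalStarAlgHom.id ℂ A) x = x := by
  induction x using KT.induction with
  | hp => exact isClosed_eq (by fun_prop) (by fun_prop)
  | ih t =>
    rw [KT.sandwich_of]
    congr 1
    induction t using AlgKT.induction with
    | zero => simp
    | add x x' hx hx' => simp only [map_add, hx, hx']
    | tmul k a => rfl

lemma KT.sandwich_zero_left (w : F₁ →L[ℂ] E₁) (ψ : A →⋆ₙₐ[ℂ] B) (x : KT E₁ E₂ A) :
    KT.sandwich (0 : E₂ →L[ℂ] F₂) w ψ x = 0 := by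
  induction x using KT.induction with
  | hp => exact isClosed_eq (by fun_prop) (by fun_prop)
  | ih t =>
    rw [KT.sandwich_of, ← map_zero KT.of]
    congr 1
    induction t using AlgKT.induction with
    | zero => simp
    | add x x' hx hx' => simp only [map_add, hx, hx', add_zero]
    | tmul k a =>
      rw [AlgKT.sandwich_tmul]
      have : Cpt.sandwich (0 : E₂ →L[ℂ] F₂) w k = 0 := Subtype.ext (ContinuousLinearMap.zero_comp _)
      rw [this]
      exact TensorProduct.zero_tmul _ _

/-! #### The maps `k ⊗ a ↦ (s ⊗ k) ⊗ a` -/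

/-- The map `k ⊗ a ↦ (s ⊗ k) ⊗ a` on algebraic tensor products. -/
def AlgKT.tensorLeft (s : Cpt F₁ F₂) :
    AlgKT E₁ E₂ A →ₗ[ℂ] AlgKT (HTensor F₁ E₁) (HTensor F₂ E₂) A :=
  TensorProduct.map (Cpt.tensor s) LinearMap.id

lemma AlgKT.tensorLeft_tmul (s : Cpt F₁ F₂) (k : Cpt E₁ E₂) (a : A) :
    AlgKT.tensorLeft s (AlgKT.tmul k a) = AlgKT.tmul (Cpt.tensor s k) a := rfl

section
variable {L : Type v} [NormedAddCommGroup L] [InnerProductSpace ℂ L] [CompleteSpace L]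

/-- The isometry `(F ⊙ E) ⊙ L → (F ⊗ E) ⊗ L`. -/
def isomA (F E : Type) (L : Type v) [NormedAddCommGroup F] [InnerProductSpace ℂ F]
    [NormedAddCommGroup E] [InnerProductSpace ℂ E] [NormedAddCommGroup L] [InnerProductSpace ℂ L] :
    (F ⊗[ℂ] E) ⊗[ℂ] L →ₗᵢ[ℂ] HTensor (HTensor F E) L :=
  HTensor.of.comp (TensorProduct.mapIsometry HTensor.of LinearIsometry.id)

/-- The isometry `(F ⊙ E) ⊙ L → F ⊗ (E ⊗ L)`. -/
def isomB (F E : Type) (L : Type v) [NormedAddCommGroup F] [InnerProductSpace ℂ F]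
    [NormedAddCommGroup E] [InnerProductSpace ℂ E] [NormedAddCommGroup L] [InnerProductSpace ℂ L] :
    (F ⊗[ℂ] E) ⊗[ℂ] L →ₗᵢ[ℂ] HTensor F (HTensor E L) :=
  (HTensor.of.comp (TensorProduct.mapIsometry LinearIsometry.id HTensor.of)).comp
    (TensorProduct.assocIsometry ℂ F E L).toLinearIsometry

lemma isomA_denseRange (F E : Type) (L : Type v) [NormedAddCommGroup F] [InnerProductSpace ℂ F]
    [NormedAddCommGroup E] [InnerProductSpace ℂ E] [NormedAddCommGroup L] [InnerProductSpace ℂ L] :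
    DenseRange (isomA F E L) := by
  let R := (LinearMap.range (isomA F E L).toLinearMap).topologicalClosure
  have hR : IsClosed (R : Set (HTensor (HTensor F E) L)) := Submodule.isClosed_topologicalClosure _
  intro x
  change x ∈ R
  refine HTensor.induction x hR fun y => ?_
  induction y using TensorProduct.induction_on with
  | zero => rw [map_zero]; exact R.zero_mem
  | add y y' h h' => rw [map_add]; exact R.add_mem h h'
  | tmul z l =>
    have hc : Continuous fun z : HTensor F E => (HTensor.of (z ⊗ₜ[ℂ] l) : HTensor (HTensor F E) L) := by
      refine HTensor.of.continuous.comp ?_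
      exact ((TensorProduct.mkL ℂ (HTensor F E) L).flip l).continuous
    refine HTensor.induction z (hR.preimage hc) fun z => ?_
    exact Submodule.le_topologicalClosure _ ⟨z ⊗ₜ l, rfl⟩

end

lemma isomA_zero (F E : Type) (L : Type v) [NormedAddCommGroup F] [InnerProductSpace ℂ F]
    [NormedAddCommGroup E] [InnerProductSpace ℂ E] [NormedAddCommGroup L] [InnerProductSpace ℂ L] :
    isomA F E L 0 = 0 := (isomA F E L).map_zero

lemma isomB_zero (F E : Type) (L : Type v) [NormedAddCommGroup F] [InnerProductSpace ℂ F]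
    [NormedAddCommGroup E] [InnerProductSpace ℂ E] [NormedAddCommGroup L] [InnerProductSpace ℂ L] :
    isomB F E L 0 = 0 := (isomB F E L).map_zero

lemma StarRep.tensorLeft_aux (ρ : StarRep A) (s : Cpt F₁ F₂) (t : AlgKT E₁ E₂ A)
    (z : (F₁ ⊗[ℂ] E₁) ⊗[ℂ] ρ.L) : ∃ z' : (F₂ ⊗[ℂ] E₂) ⊗[ℂ] ρ.L,
      ρ.ampl (AlgKT.tensorLeft s t) (isomA F₁ E₁ ρ.L z) = isomA F₂ E₂ ρ.L z' ∧
      hmap s.1 (ρ.ampl t) (isomB F₁ E₁ ρ.L z) = isomB F₂ E₂ ρ.L z' := by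
  induction t using AlgKT.induction with
  | zero =>
    refine ⟨0, by simp [isomA_zero], ?_⟩
    have : hmap s.1 (0 : HTensor E₁ ρ.L →L[ℂ] HTensor E₂ ρ.L) = 0 := by
      simpa using hmap_smul_right (0 : ℂ) s.1 (0 : HTensor E₁ ρ.L →L[ℂ] HTensor E₂ ρ.L)
    rw [map_zero, this]
    simp [isomB_zero]
  | add x y hx hy =>
    obtain ⟨z₁, h₁, h₁'⟩ := hx
    obtain ⟨z₂, h₂, h₂'⟩ := hy
    refine ⟨z₁ + z₂, ?_, ?_⟩
    · rw [map_add, map_add, add_apply, h₁, h₂, map_add]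
    · rw [map_add, hmap_add_right, add_apply, h₁', h₂', map_add]
  | tmul k a =>
    refine ⟨TensorProduct.map (TensorProduct.map s.1.toLinearMap k.1.toLinearMap)
      (ρ.π a).toLinearMap z, ?_, ?_⟩
    · rw [AlgKT.tensorLeft_tmul, StarRep.ampl_tmul]
      induction z using TensorProduct.induction_on with
      | zero => simp [isomA_zero]
      | add z z' h h' => simp only [map_add, h, h']
      | tmul y l =>
        change hmap (hmap s.1 k.1) (ρ.π a) (HTensor.of (HTensor.of y ⊗ₜ l)) = _
        rw [hmap_coe, TensorProduct.mapL_tmul, hmap_coe, TensorProduct.mapL_apply]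
        rfl
    · rw [StarRep.ampl_tmul]
      induction z using TensorProduct.induction_on with
      | zero => simp [isomB_zero]
      | add z z' h h' => simp only [map_add, h, h']
      | tmul y l =>
        induction y using TensorProduct.induction_on with
        | zero => simp [isomB_zero]
        | add z z' h h' => simp only [map_add, TensorProduct.add_tmul, h, h']
        | tmul f e =>
          change hmap s.1 (hmap k.1 (ρ.π a)) (HTensor.of (f ⊗ₜ HTensor.of (e ⊗ₜ l))) = _
          rw [hmap_coe, TensorProduct.mapL_tmul, hmap_coe, TensorProduct.mapL_tmul]
          rfl

lemma AlgKT.norm_tensorLeft_le (s : Cpt F₁ F₂) (t : AlgKT E₁ E₂ A) :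
    ‖AlgKT.tensorLeft s t‖ ≤ ‖s‖ * ‖t‖ := AlgKT.norm_le fun ρ => by
  have h0 : 0 ≤ ‖s‖ * ‖t‖ := by positivity
  refine ContinuousLinearMap.opNorm_le_bound _ h0 fun x => ?_
  refine (isomA_denseRange F₁ E₁ ρ.L).induction ?_
    (isClosed_le (by fun_prop) (by fun_prop)) x
  rintro _ ⟨z, rfl⟩
  obtain ⟨z', h, h'⟩ := StarRep.tensorLeft_aux ρ s t z
  rw [h, LinearIsometry.norm_map, LinearIsometry.norm_map, ← (isomB F₂ E₂ ρ.L).norm_map, ← h',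
    ← (isomB F₁ E₁ ρ.L).norm_map z]
  refine (ContinuousLinearMap.le_opNorm _ _).trans
    (mul_le_mul_of_nonneg_right ((norm_hmap_le _ _).trans ?_) (norm_nonneg _))
  exact mul_le_mul_of_nonneg_left (AlgKT.le_norm ρ t) (norm_nonneg _)

/-- The map `x ↦ s ⊗ x` from `K(E₁, E₂) ⊗ A` to `K(F₁ ⊗ E₁, F₂ ⊗ E₂) ⊗ A`, determined by
`s ⊗ (k ⊗ a) = (s ⊗ k) ⊗ a`. -/
def KT.tensorLeft (s : Cpt F₁ F₂) :
    KT E₁ E₂ A →L[ℂ] KT (HTensor F₁ E₁) (HTensor F₂ E₂) A :=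
  LinearMap.extendOfNorm (KT.of.toLinearMap ∘ₗ AlgKT.tensorLeft s) KT.of.toLinearMap

lemma KT.tensorLeft_of (s : Cpt F₁ F₂) (t : AlgKT E₁ E₂ A) :
    KT.tensorLeft s (KT.of t) = KT.of (AlgKT.tensorLeft s t) :=
  LinearMap.extendOfNorm_eq KT.denseRange
    ⟨‖s‖, fun t => by simpa using AlgKT.norm_tensorLeft_le s t⟩ t

lemma KT.tensorLeft_comp (s : Cpt F₂ F₃) (r : Cpt F₁ F₂) (x : KT E₂ E₃ A) (y : KT E₁ E₂ A) :
    KT.tensorLeft (Cpt.comp s r) (KT.comp x y)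
      = KT.comp (KT.tensorLeft s x) (KT.tensorLeft r y) := by
  induction x using KT.induction with
  | hp => exact isClosed_eq (by fun_prop) (by fun_prop)
  | ih x =>
  induction y using KT.induction with
  | hp => exact isClosed_eq (by fun_prop) (by fun_prop)
  | ih y =>
    simp only [KT.tensorLeft_of, KT.comp_of]
    congr 1
    induction x using AlgKT.induction with
    | zero => simp
    | add x x' hx hx' => simp only [map_add, LinearMap.add_apply, hx, hx']
    | tmul k a =>
      induction y using AlgKT.induction with
      | zero => simp
      | add x x' hx hx' => simp only [map_add, hx, hx']
      | tmul l b =>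
        simp only [AlgKT.tensorLeft_tmul, AlgKT.comp_tmul]
        congr 1
        exact Subtype.ext (hmap_comp _ _ _ _)

lemma KT.tensorLeft_adj (s : Cpt F₁ F₂) (x : KT E₁ E₂ A) :
    KT.adj (KT.tensorLeft s x) = KT.tensorLeft (Cpt.adj s) (KT.adj x) := by
  induction x using KT.induction with
  | hp => exact isClosed_eq (by fun_prop) (by fun_prop)
  | ih x =>
    simp only [KT.tensorLeft_of, KT.adj_of]
    congr 1
    induction x using AlgKT.induction with
    | zero => simp
    | add x x' hx hx' => simp only [map_add, hx, hx']
    | tmul k a =>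
      simp only [AlgKT.tensorLeft_tmul, AlgKT.adj_tmul]
      congr 1
      exact Subtype.ext (adjoint_hmap _ _)

lemma KT.tensorLeft_sandwich {F₃ F₄ : Type} [NormedAddCommGroup F₃] [InnerProductSpace ℂ F₃]
    [CompleteSpace F₃] [NormedAddCommGroup F₄] [InnerProductSpace ℂ F₄] [CompleteSpace F₄]
    {G₁ G₂ : Type} [NormedAddCommGroup G₁] [InnerProductSpace ℂ G₁]
    [CompleteSpace G₁] [NormedAddCommGroup G₂] [InnerProductSpace ℂ G₂] [CompleteSpace G₂]
    (s : Cpt F₁ F₂) (v : F₂ →L[ℂ] F₃) (w : F₄ →L[ℂ] F₁) (v' : E₂ →L[ℂ] G₂) (w' : G₁ →L[ℂ] E₁)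
    (ψ : A →⋆ₙₐ[ℂ] B) (x : KT E₁ E₂ A) :
    KT.sandwich (hmap v v') (hmap w w') ψ (KT.tensorLeft s x)
      = KT.tensorLeft (Cpt.sandwich v w s) (KT.sandwich v' w' ψ x) := by
  induction x using KT.induction with
  | hp => exact isClosed_eq (by fun_prop) (by fun_prop)
  | ih x =>
    simp only [KT.tensorLeft_of, KT.sandwich_of]
    congr 1
    induction x using AlgKT.induction with
    | zero => simp
    | add x x' hx hx' => simp only [map_add, hx, hx']
    | tmul k a =>
      simp only [AlgKT.tensorLeft_tmul, AlgKT.sandwich_tmul]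
      congr 1
      refine Subtype.ext ?_
      change hmap v v' ∘L hmap s.1 k.1 ∘L hmap w w' = hmap (v ∘L s.1 ∘L w) (v' ∘L k.1 ∘L w')
      rw [hmap_comp, hmap_comp]

end Maps

/-! ### Separable unitary representations and the semiring `Cu(G)` -/

section Reps

set_option linter.unusedSectionVars false

/-- A strongly continuous unitary representation of `G` on a separable Hilbert space. -/
structure URep (G : Type u) [TopologicalSpace G] [Group G] where
  H : Type
  [normed : NormedAddCommGroup H]
  [inner : InnerProductSpace ℂ H]
  [complete : CompleteSpace H]
  [separable : TopologicalSpace.SeparableSpace H]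
  U : G →* (H ≃ₗᵢ[ℂ] H)
  continuous_apply : ∀ x, Continuous fun g => U g x

attribute [instance] URep.normed URep.inner URep.complete URep.separable

variable {G : Type u} [TopologicalSpace G] [Group G]

/-- The unitary `μ_g` as a bounded operator. -/
def URep.op (μ : URep G) (g : G) : μ.H →L[ℂ] μ.H := (μ.U g).toContinuousLinearEquiv

lemma URep.op_apply (μ : URep G) (g : G) (x : μ.H) : μ.op g x = μ.U g x := rfl

lemma URep.op_one (μ : URep G) : μ.op 1 = .id ℂ μ.H := by
  ext x; rw [URep.op_apply, map_one]; rfl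

lemma URep.op_mul (μ : URep G) (g h : G) : μ.op (g * h) = μ.op g ∘L μ.op h := by
  ext x; rw [URep.op_apply, map_mul]; rfl

lemma URep.op_comp_inv (μ : URep G) (g : G) : μ.op g ∘L μ.op g⁻¹ = .id ℂ μ.H := by
  rw [← URep.op_mul, mul_inv_cancel, URep.op_one]

lemma URep.op_inv_comp (μ : URep G) (g : G) : μ.op g⁻¹ ∘L μ.op g = .id ℂ μ.H := by
  rw [← URep.op_mul, inv_mul_cancel, URep.op_one]

lemma URep.adjoint_op (μ : URep G) (g : G) : (μ.op g).adjoint = μ.op g⁻¹ := by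
  have h : (μ.op g).adjoint = ((μ.U g).symm.toContinuousLinearEquiv : μ.H →L[ℂ] μ.H) :=
    LinearIsometryEquiv.adjoint_eq_symm _
  rw [h]
  ext x
  rw [URep.op_apply, map_inv]
  rfl

/-- The direct sum `μ ⊕ ν`. -/
def URep.sum (μ ν : URep G) : URep G where
  H := WithLp 2 (μ.H × ν.H)
  separable := (WithLp.homeomorphProd 2 μ.H ν.H).symm.surjective.denseRange.separableSpace
    (WithLp.homeomorphProd 2 μ.H ν.H).symm.continuous
  U :=
    { toFun := fun g => LinearIsometryEquiv.withLpProdCongr 2 (μ.U g) (ν.U g)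
      map_one' := by rw [map_one, map_one]; rfl
      map_mul' := fun g h => by rw [map_mul, map_mul]; rfl }
  continuous_apply x := (WithLp.prod_continuous_toLp 2 μ.H ν.H).comp
    ((μ.continuous_apply x.fst).prodMk (ν.continuous_apply x.snd))

/-- The unitary `u ⊗ u'`. -/
def hmapIso {E₁ E₂ F₁ F₂ : Type} [NormedAddCommGroup E₁] [InnerProductSpace ℂ E₁]
    [NormedAddCommGroup E₂] [InnerProductSpace ℂ E₂] [NormedAddCommGroup F₁]
    [InnerProductSpace ℂ F₁] [NormedAddCommGroup F₂] [InnerProductSpace ℂ F₂]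
    (s : E₁ ≃ₗᵢ[ℂ] E₂) (t : F₁ ≃ₗᵢ[ℂ] F₂) : HTensor E₁ F₁ ≃ₗᵢ[ℂ] HTensor E₂ F₂ :=
  LinearIsometryEquiv.mk
    (LinearEquiv.ofLinearMap
      (hmap (s.toContinuousLinearEquiv : E₁ →L[ℂ] E₂)
        (t.toContinuousLinearEquiv : F₁ →L[ℂ] F₂)).toLinearMap
      (hmap (s.symm.toContinuousLinearEquiv : E₂ →L[ℂ] E₁)
        (t.symm.toContinuousLinearEquiv : F₂ →L[ℂ] F₁)).toLinearMap
      (by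
        have h1 : (s.toContinuousLinearEquiv : E₁ →L[ℂ] E₂) ∘L
          (s.symm.toContinuousLinearEquiv : E₂ →L[ℂ] E₁) = .id ℂ E₂ := by ext; simp
        have h2 : (t.toContinuousLinearEquiv : F₁ →L[ℂ] F₂) ∘L
          (t.symm.toContinuousLinearEquiv : F₂ →L[ℂ] F₁) = .id ℂ F₂ := by ext; simp
        refine LinearMap.ext fun x => ?_
        change (hmap _ _ ∘L hmap _ _) x = x
        rw [← hmap_comp, h1, h2, hmap_id]; rfl)
      (by
        have h1 : (s.symm.toContinuousLinearEquiv : E₂ →L[ℂ] E₁) ∘L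
          (s.toContinuousLinearEquiv : E₁ →L[ℂ] E₂) = .id ℂ E₁ := by ext; simp
        have h2 : (t.symm.toContinuousLinearEquiv : F₂ →L[ℂ] F₁) ∘L
          (t.toContinuousLinearEquiv : F₁ →L[ℂ] F₂) = .id ℂ F₁ := by ext; simp
        refine LinearMap.ext fun x => ?_
        change (hmap _ _ ∘L hmap _ _) x = x
        rw [← hmap_comp, h1, h2, hmap_id]; rfl))
    (by
      intro x
      refine HTensor.induction x (isClosed_eq
        (hmap (s.toContinuousLinearEquiv : E₁ →L[ℂ] E₂) _).continuous.norm continuous_norm) ?_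
      intro y
      change ‖hmap _ _ (HTensor.of y)‖ = _
      rw [hmap_coe, LinearIsometry.norm_map, LinearIsometry.norm_map, TensorProduct.mapL_apply]
      exact (TensorProduct.mapIsometry s.toLinearIsometry t.toLinearIsometry).norm_map y)

lemma HTensor.separableSpace (E F : Type) [NormedAddCommGroup E] [InnerProductSpace ℂ E]
    [NormedAddCommGroup F] [InnerProductSpace ℂ F] [TopologicalSpace.SeparableSpace E]
    [TopologicalSpace.SeparableSpace F] : TopologicalSpace.SeparableSpace (HTensor E F) := by
  have h1 : TopologicalSpace.IsSeparable
      (Set.range fun p : E × F => (HTensor.of (p.1 ⊗ₜ[ℂ] p.2) : HTensor E F)) := by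
    refine TopologicalSpace.isSeparable_range (HTensor.of.continuous.comp ?_)
    exact (TensorProduct.mkL ℂ E F).continuous₂
  have h2 := (h1.span (R := ℂ)).closure
  refine TopologicalSpace.isSeparable_univ_iff.1 (h2.mono fun x _ => ?_)
  refine HTensor.induction x isClosed_closure fun y => subset_closure ?_
  induction y using TensorProduct.induction_on with
  | zero => rw [map_zero]; exact Submodule.zero_mem _
  | add y y' h h' => rw [map_add]; exact Submodule.add_mem _ h h'
  | tmul e f => exact Submodule.subset_span ⟨(e, f), rfl⟩

/-- The tensor product `μ ⊗ ν`. -/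
def URep.tensor (μ ν : URep G) : URep G where
  H := HTensor μ.H ν.H
  separable := HTensor.separableSpace μ.H ν.H
  U :=
    { toFun := fun g => hmapIso (μ.U g) (ν.U g)
      map_one' := by
        ext x
        change hmap (μ.op 1) (ν.op 1) x = x
        rw [URep.op_one, URep.op_one, hmap_id]; rfl
      map_mul' := fun g h => by
        ext x
        change hmap (μ.op (g * h)) (ν.op (g * h)) x
          = hmap (μ.op g) (ν.op g) (hmap (μ.op h) (ν.op h) x)
        rw [URep.op_mul, URep.op_mul, hmap_comp]; rfl }
  continuous_apply x := by
    have h0 (y : μ.H ⊗[ℂ] ν.H) : Continuous fun g => hmapIso (μ.U g) (ν.U g) (HTensor.of y) := by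
      induction y using TensorProduct.induction_on with
      | zero => simpa only [map_zero] using continuous_const
      | add y y' h h' => simp only [map_add]; exact h.add h'
      | tmul e f =>
        have : ∀ g, hmapIso (μ.U g) (ν.U g) (HTensor.of (e ⊗ₜ[ℂ] f))
            = HTensor.of ((μ.U g e) ⊗ₜ[ℂ] (ν.U g f)) := fun g => hmap_coe _ _ _
        simp only [this]
        refine HTensor.of.continuous.comp ?_
        exact (TensorProduct.mkL ℂ μ.H ν.H).continuous₂.comp
          ((μ.continuous_apply e).prodMk (ν.continuous_apply f))
    refine continuous_of_uniform_approx_of_continuous fun u hu => ?_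
    obtain ⟨ε, hε, hu⟩ := Metric.mem_uniformity_dist.1 hu
    obtain ⟨_, hy, ⟨y, rfl⟩⟩ := Metric.dense_iff.1 HTensor.denseRange x ε hε
    refine ⟨_, h0 y, fun g => hu ?_⟩
    change dist (hmapIso (μ.U g) (ν.U g) x) (hmapIso (μ.U g) (ν.U g) (HTensor.of y)) < ε
    rw [LinearIsometryEquiv.dist_map, dist_comm]
    exact hy

lemma URep.tensor_op (μ ν : URep G) (g : G) : (μ.tensor ν).op g = hmap (μ.op g) (ν.op g) := rfl

/-- The trivial one dimensional representation. -/
def URep.trivial : URep G where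
  H := ℂ
  U := 1
  continuous_apply _ := continuous_const

/-- The representation on the zero space. -/
def URep.zero : URep G where
  H := EuclideanSpace ℂ (Fin 0)
  U := 1
  continuous_apply _ := continuous_const

/-- `μ` is unitarily equivalent to a subrepresentation of `ν`. -/
def URep.Sub (μ ν : URep G) : Prop :=
  ∃ v : μ.H →ₗᵢ[ℂ] ν.H, ∀ g x, v (μ.U g x) = ν.U g (v x)

/-- Unitary equivalence of representations. -/
instance URep.setoid : Setoid (URep G) where
  r μ ν := ∃ v : μ.H ≃ₗᵢ[ℂ] ν.H, ∀ g x, v (μ.U g x) = ν.U g (v x)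
  iseqv :=
    { refl := fun μ => ⟨.refl ℂ μ.H, fun _ _ => rfl⟩
      symm := fun {μ ν} ⟨v, hv⟩ => ⟨v.symm, fun g x => by
        rw [LinearIsometryEquiv.symm_apply_eq, hv, v.apply_symm_apply]⟩
      trans := fun ⟨v, hv⟩ ⟨v', hv'⟩ => ⟨v.trans v', fun g x => by
        simp only [LinearIsometryEquiv.trans_apply, hv, hv']⟩ }

variable (G) in
/-- The representation semiring `Cu(G)`: unitary equivalence classes of separable unitary
representations, with the operations induced by `⊕` and `⊗`, and with `[μ] ≤ [ν]` if `μ` is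
equivalent to a subrepresentation of `ν`. -/
def CuRep : Type (max 1 u) := Quotient (URep.setoid : Setoid (URep G))

/-- The class of a representation in `Cu(G)`. -/
def CuRep.mk (μ : URep G) : CuRep G := Quotient.mk _ μ

instance : Zero (CuRep G) := ⟨CuRep.mk URep.zero⟩
instance : One (CuRep G) := ⟨CuRep.mk URep.trivial⟩

instance : Add (CuRep G) :=
  ⟨Quotient.map₂ URep.sum (by
    rintro μ μ' ⟨v, hv⟩ ν ν' ⟨v', hv'⟩
    refine ⟨LinearIsometryEquiv.withLpProdCongr 2 v v', fun g x => ?_⟩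
    change WithLp.toLp 2 (v (μ.U g x.fst), v' (ν.U g x.snd))
      = WithLp.toLp 2 (μ'.U g (v x.fst), ν'.U g (v' x.snd))
    rw [hv, hv'])⟩

instance : Mul (CuRep G) :=
  ⟨Quotient.map₂ URep.tensor (by
    rintro μ μ' ⟨v, hv⟩ ν ν' ⟨v', hv'⟩
    refine ⟨hmapIso v v', fun g x => ?_⟩
    change (hmap (v.toContinuousLinearEquiv : μ.H →L[ℂ] μ'.H)
        (v'.toContinuousLinearEquiv : ν.H →L[ℂ] ν'.H) ∘L hmap (μ.op g) (ν.op g)) x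
      = (hmap (μ'.op g) (ν'.op g) ∘L hmap (v.toContinuousLinearEquiv : μ.H →L[ℂ] μ'.H)
        (v'.toContinuousLinearEquiv : ν.H →L[ℂ] ν'.H)) x
    rw [← hmap_comp, ← hmap_comp]
    have h1 : (v.toContinuousLinearEquiv : μ.H →L[ℂ] μ'.H) ∘L μ.op g
      = μ'.op g ∘L (v.toContinuousLinearEquiv : μ.H →L[ℂ] μ'.H) := by ext x; exact hv g x
    have h2 : (v'.toContinuousLinearEquiv : ν.H →L[ℂ] ν'.H) ∘L ν.op g
      = ν'.op g ∘L (v'.toContinuousLinearEquiv : ν.H →L[ℂ] ν'.H) := by ext x; exact hv' g x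
    rw [h1, h2])⟩

instance : Preorder (CuRep G) where
  le := Quotient.lift₂ URep.Sub (by
    have key (μ μ' ν ν' : URep G) (h1 : μ ≈ μ') (h2 : ν ≈ ν') (h : μ.Sub ν) : μ'.Sub ν' := by
      obtain ⟨u, hu⟩ := Setoid.symm h1
      obtain ⟨u', hu'⟩ := h2
      obtain ⟨v, hv⟩ := h
      exact ⟨(u'.toLinearIsometry.comp v).comp u.toLinearIsometry, fun g x => by
        simp [hu, hv, hu']⟩
    intro μ ν μ' ν' h1 h2
    exact propext ⟨key _ _ _ _ h1 h2, key _ _ _ _ (Setoid.symm h1) (Setoid.symm h2)⟩)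
  le_refl := by
    rintro ⟨μ⟩
    exact ⟨.id, fun _ _ => rfl⟩
  le_trans := by
    rintro ⟨μ⟩ ⟨ν⟩ ⟨ω⟩ ⟨v, hv⟩ ⟨v', hv'⟩
    exact ⟨v'.comp v, fun g x => by simp [hv, hv']⟩

lemma CuRep.mk_le_mk {μ ν : URep G} : CuRep.mk μ ≤ CuRep.mk ν ↔ μ.Sub ν := Iff.rfl

end Reps

/-! ### `C*`-dynamical systems -/

/-- A `C*`-algebra with a continuous action of `G`. -/
structure GAlg (G : Type u) [TopologicalSpace G] [Group G] where
  carrier : Type v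
  [cstar : NonUnitalCStarAlgebra carrier]
  α : G →* (carrier ≃⋆ₐ[ℂ] carrier)
  continuous_apply : ∀ a, Continuous fun g => α g a

attribute [instance] GAlg.cstar

/-- An equivariant `*`-homomorphism. -/
structure GHom {G : Type u} [TopologicalSpace G] [Group G] (A B : GAlg.{u, v} G) where
  toHom : A.carrier →⋆ₙₐ[ℂ] B.carrier
  equivariant : ∀ g a, toHom (A.α g a) = B.α g (toHom a)

section Cuntz

set_option linter.unusedSectionVars false

variable {G : Type u} [TopologicalSpace G] [Group G]

/-- The automorphism `α_g` as a `*`-homomorphism. -/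
def GAlg.act (A : GAlg.{u, v} G) (g : G) : A.carrier →⋆ₙₐ[ℂ] A.carrier where
  toFun a := A.α g a
  map_smul' c a := map_smul (A.α g) c a
  map_zero' := map_zero (A.α g)
  map_add' := map_add (A.α g)
  map_mul' := map_mul (A.α g)
  map_star' := map_star (A.α g)

lemma GHom.comp_act {A B : GAlg.{u, v} G} (ψ : GHom A B) (g : G) :
    ψ.toHom.comp (A.act g) = (B.act g).comp ψ.toHom := by
  ext a
  exact ψ.equivariant g a

/-- The space `K(H_μ, H_ν) ⊗ A`. -/
abbrev KTG (μ ν : URep G) (A : GAlg.{u, v} G) : Type v := KT μ.H ν.H A.carrier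

variable {A B : GAlg.{u, v} G} {μ ν ω μ' ν' : URep G}

/-- The action of `G` on `K(H_μ, H_ν) ⊗ A`: `g • (k ⊗ a) = (ν_g k μ_g*) ⊗ α_g(a)`. -/
def KTG.act (g : G) : KTG μ ν A →L[ℂ] KTG μ ν A :=
  KT.sandwich (ν.op g) (μ.op g⁻¹) (A.act g)

/-- The fixed elements of `K(H_μ, H_ν) ⊗ A`. -/
def KTG.IsInv (x : KTG μ ν A) : Prop := ∀ g, KTG.act g x = x

lemma KTG.act_comp (g : G) (x : KTG ν ω A) (y : KTG μ ν A) :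
    KTG.act g (KT.comp x y) = KT.comp (KTG.act g x) (KTG.act g y) := by
  unfold KTG.act
  rw [KT.comp_sandwich, URep.op_inv_comp, KT.sandwich_id]

lemma KTG.act_adj (g : G) (x : KTG μ ν A) : KTG.act g (KT.adj x) = KT.adj (KTG.act g x) := by
  unfold KTG.act
  rw [KT.sandwich_adj, URep.adjoint_op, URep.adjoint_op, inv_inv]

lemma KTG.IsInv.comp {x : KTG ν ω A} {y : KTG μ ν A} (hx : KTG.IsInv x) (hy : KTG.IsInv y) :
    KTG.IsInv (KT.comp x y) := fun g => by rw [KTG.act_comp, hx g, hy g]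

lemma KTG.IsInv.adj {x : KTG μ ν A} (hx : KTG.IsInv x) : KTG.IsInv (KT.adj x) :=
  fun g => by rw [KTG.act_adj, hx g]

lemma KTG.IsInv.add {x y : KTG μ ν A} (hx : KTG.IsInv x) (hy : KTG.IsInv y) :
    KTG.IsInv (x + y) := fun g => by rw [map_add, hx g, hy g]

/-- `v x w` is fixed if `v`, `w` are intertwiners and `x` is fixed. -/
lemma KTG.IsInv.sandwich {x : KTG μ ν A} (hx : KTG.IsInv x) (ψ : GHom A B)
    {v : ν.H →L[ℂ] ν'.H} {w : μ'.H →L[ℂ] μ.H} (hv : ∀ g, ν'.op g ∘L v = v ∘L ν.op g)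
    (hw : ∀ g, w ∘L μ'.op g = μ.op g ∘L w) :
    KTG.IsInv (KT.sandwich v w ψ.toHom x : KTG μ' ν' B) := fun g => by
  conv_rhs => rw [← hx g]
  unfold KTG.act
  rw [KT.sandwich_sandwich, KT.sandwich_sandwich, hv, hw, GHom.comp_act]

/-- The action as a `*`-endomorphism of the `C*`-algebra `K(H_μ) ⊗ A`. -/
def KTG.actHom (g : G) : KTG μ μ A →⋆ₙₐ[ℂ] KTG μ μ A where
  toFun := KTG.act g
  map_smul' c x := map_smul (KTG.act g) c x
  map_zero' := map_zero (KTG.act g)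
  map_add' := map_add (KTG.act g)
  map_mul' x y := KTG.act_comp g x y
  map_star' x := KTG.act_adj g x

/-- Approximate units inside the fixed point algebra. -/
lemma KTG.IsInv.exists_approx {a : KTG μ μ A} (ha : KTG.IsInv a) (hsa : IsSelfAdjoint a)
    {ε : ℝ} (hε : 0 < ε) :
    ∃ d : KTG μ μ A, KTG.IsInv d ∧ ‖KT.comp (KT.comp d a) (KT.adj d) - a‖ ≤ ε := by
  have hpos (x : ℝ) : 0 < x ^ 2 + ε ^ 2 := by positivity
  have hf : Continuous fun x : ℝ => x ^ 2 / (x ^ 2 + ε ^ 2) :=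
    (by fun_prop : Continuous fun x : ℝ => x ^ 2).div (by fun_prop) fun x => (hpos x).ne'
  set f : ℝ → ℝ := fun x => x ^ 2 / (x ^ 2 + ε ^ 2) with hfdef
  have f0 : f 0 = 0 := by simp [hfdef]
  have hd : IsSelfAdjoint (cfcₙ f a) := cfcₙ_predicate f a
  refine ⟨cfcₙ f a, fun g => ?_, ?_⟩
  · have h := NonUnitalStarAlgHom.map_cfcₙ (KTG.actHom g : KTG μ μ A →⋆ₙₐ[ℂ] KTG μ μ A) f a
      hf.continuousOn f0 (KTG.act (A := A) g).continuous hsa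
      (by change IsSelfAdjoint (KTG.act g a); rwa [ha g])
    change KTG.act g (cfcₙ f a) = cfcₙ f (KTG.act g a) at h
    rw [h, ha g]
  · rw [← KT.star_def, ← KT.mul_def, ← KT.mul_def, hd.star_eq]
    have e : cfcₙ f a * a * cfcₙ f a - a = cfcₙ (fun x => f x * x * f x - x) a := by
      rw [cfcₙ_sub (fun x => f x * x * f x) (fun x => x) a (by fun_prop) (by simp [f0])
        (by fun_prop) rfl,
        cfcₙ_mul (fun x => f x * x) f a (by fun_prop) (by simp [f0]) (by fun_prop) f0,
        cfcₙ_mul f (fun x => x) a (by fun_prop) f0 (by fun_prop) rfl, cfcₙ_id' ℝ a]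
    rw [e]
    refine norm_cfcₙ_le fun x _ => ?_
    have e2 : f x * x * f x - x = -(x * (ε ^ 2 / (x ^ 2 + ε ^ 2)) * (1 + f x)) := by
      have := (hpos x).ne'
      simp only [hfdef]
      field_simp
      ring
    have h1 : |1 + f x| ≤ 2 := by
      have h2 : 0 ≤ f x := by simp only [hfdef]; positivity
      have h3 : f x ≤ 1 := by
        simp only [hfdef]
        rw [div_le_one (hpos x)]
        nlinarith [sq_nonneg ε]
      rw [abs_of_nonneg (by linarith)]
      linarith
    have h4 : |x * (ε ^ 2 / (x ^ 2 + ε ^ 2))| ≤ ε / 2 := by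
      rw [abs_mul, abs_of_nonneg (by positivity : 0 ≤ ε ^ 2 / (x ^ 2 + ε ^ 2)), mul_div_assoc',
        div_le_div_iff₀ (hpos x) two_pos]
      nlinarith [sq_nonneg (|x| - ε), sq_abs x]
    rw [e2, Real.norm_eq_abs, abs_neg, abs_mul]
    calc _ ≤ ε / 2 * 2 := by gcongr
      _ = ε := by ring

end Cuntz

/-! ### The equivariant Cuntz semigroup -/

section CuG

set_option linter.unusedSectionVars false

variable {G : Type u} [TopologicalSpace G] [Group G] {A B C : GAlg.{u, v} G}
  {μ ν ω μ' ν' ω' : URep G}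

/-- The identity homomorphism. -/
def GHom.id (A : GAlg.{u, v} G) : GHom A A := ⟨NonUnitalStarAlgHom.id ℂ A.carrier, fun _ _ => rfl⟩

/-- The inclusion of the first summand. -/
def URep.inl (μ ν : URep G) : μ.H →L[ℂ] (μ.sum ν).H :=
  (WithLp.prodContinuousLinearEquiv 2 ℂ μ.H ν.H).symm.toContinuousLinearMap
    ∘L ContinuousLinearMap.inl ℂ μ.H ν.H

/-- The inclusion of the second summand. -/
def URep.inr (μ ν : URep G) : ν.H →L[ℂ] (μ.sum ν).H :=
  (WithLp.prodContinuousLinearEquiv 2 ℂ μ.H ν.H).symm.toContinuousLinearMap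
    ∘L ContinuousLinearMap.inr ℂ μ.H ν.H

/-- The projection to the first summand. -/
def URep.fst (μ ν : URep G) : (μ.sum ν).H →L[ℂ] μ.H := WithLp.fstL 2 ℂ μ.H ν.H

/-- The projection to the second summand. -/
def URep.snd (μ ν : URep G) : (μ.sum ν).H →L[ℂ] ν.H := WithLp.sndL 2 ℂ μ.H ν.H

lemma URep.fst_inl (μ ν : URep G) : μ.fst ν ∘L μ.inl ν = .id ℂ μ.H := rfl
lemma URep.snd_inr (μ ν : URep G) : μ.snd ν ∘L μ.inr ν = .id ℂ ν.H := rfl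
lemma URep.fst_inr (μ ν : URep G) : μ.fst ν ∘L μ.inr ν = 0 := rfl
lemma URep.snd_inl (μ ν : URep G) : μ.snd ν ∘L μ.inl ν = 0 := rfl

lemma URep.adjoint_fst (μ ν : URep G) : (μ.fst ν).adjoint = μ.inl ν := by
  symm
  rw [ContinuousLinearMap.eq_adjoint_iff]
  intro x y
  change Inner.inner ℂ x (WithLp.fst y) + Inner.inner ℂ (0 : ν.H) (WithLp.snd y) = Inner.inner ℂ x (WithLp.fst y)
  rw [inner_zero_left, add_zero]

lemma URep.adjoint_snd (μ ν : URep G) : (μ.snd ν).adjoint = μ.inr ν := by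
  symm
  rw [ContinuousLinearMap.eq_adjoint_iff]
  intro x y
  change Inner.inner ℂ (0 : μ.H) (WithLp.fst y) + Inner.inner ℂ x (WithLp.snd y) = Inner.inner ℂ x (WithLp.snd y)
  rw [inner_zero_left, zero_add]

lemma URep.adjoint_inl (μ ν : URep G) : (μ.inl ν).adjoint = μ.fst ν := by
  rw [← URep.adjoint_fst, ContinuousLinearMap.adjoint_adjoint]

lemma URep.adjoint_inr (μ ν : URep G) : (μ.inr ν).adjoint = μ.snd ν := by
  rw [← URep.adjoint_snd, ContinuousLinearMap.adjoint_adjoint]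

lemma URep.op_inl (μ ν : URep G) (g : G) : (μ.sum ν).op g ∘L μ.inl ν = μ.inl ν ∘L μ.op g := by
  ext x
  change WithLp.toLp 2 (μ.U g x, ν.U g 0) = WithLp.toLp 2 (μ.U g x, (0 : ν.H))
  rw [map_zero]

lemma URep.op_inr (μ ν : URep G) (g : G) : (μ.sum ν).op g ∘L μ.inr ν = μ.inr ν ∘L ν.op g := by
  ext x
  change WithLp.toLp 2 (μ.U g 0, ν.U g x) = WithLp.toLp 2 ((0 : μ.H), ν.U g x)
  rw [map_zero]

lemma URep.op_fst (μ ν : URep G) (g : G) : μ.fst ν ∘L (μ.sum ν).op g = μ.op g ∘L μ.fst ν := rfl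
lemma URep.op_snd (μ ν : URep G) (g : G) : μ.snd ν ∘L (μ.sum ν).op g = ν.op g ∘L μ.snd ν := rfl

/-- The block diagonal sum `x ⊕ y`. -/
def KTG.blockSum (x : KTG μ ν A) (y : KTG μ' ν' A) : KTG (μ.sum μ') (ν.sum ν') A :=
  KT.sandwich (ν.inl ν') (μ.fst μ') (GHom.id A).toHom x
    + KT.sandwich (ν.inr ν') (μ.snd μ') (GHom.id A).toHom y

lemma KTG.IsInv.blockSum {x : KTG μ ν A} {y : KTG μ' ν' A} (hx : KTG.IsInv x)
    (hy : KTG.IsInv y) : KTG.IsInv (KTG.blockSum x y) :=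
  (hx.sandwich (GHom.id A) (fun g => URep.op_inl _ _ g) (fun g => URep.op_fst _ _ g)).add
    (hy.sandwich (GHom.id A) (fun g => URep.op_inr _ _ g) (fun g => URep.op_snd _ _ g))

lemma KTG.blockSum_adj (x : KTG μ ν A) (y : KTG μ' ν' A) :
    KT.adj (KTG.blockSum x y) = KTG.blockSum (KT.adj x) (KT.adj y) := by
  unfold KTG.blockSum
  rw [map_add, KT.sandwich_adj, KT.sandwich_adj, URep.adjoint_fst, URep.adjoint_snd,
    URep.adjoint_inl, URep.adjoint_inr]

lemma KTG.blockSum_comp (x : KTG ν ω A) (y : KTG ν' ω' A) (x' : KTG μ ν A) (y' : KTG μ' ν' A) :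
    KT.comp (KTG.blockSum x y) (KTG.blockSum x' y')
      = KTG.blockSum (KT.comp x x') (KT.comp y y') := by
  unfold KTG.blockSum
  simp only [map_add, add_apply, KT.comp_sandwich, URep.fst_inl, URep.fst_inr, URep.snd_inl,
    URep.snd_inr, KT.sandwich_id, KT.sandwich_zero_left, map_zero, add_zero, zero_add]

lemma KTG.continuous_blockSum :
    Continuous fun p : KTG μ ν A × KTG μ' ν' A => KTG.blockSum p.1 p.2 := by
  unfold KTG.blockSum
  fun_prop

variable (A) in
/-- A positive element of the fixed point algebra `(K(H_μ) ⊗ A)^G`, for some separable unitary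
representation `μ` of `G`. -/
structure GPos where
  μ : URep G
  a : KTG μ μ A
  inv : KTG.IsInv a
  pos : ∃ b : KTG μ μ A, a = star b * b

/-- `G`-Cuntz subequivalence: `a ≲ b` if `d_n b d_n* → a` for a sequence `d_n` in the fixed
elements of `K(H_ν, H_μ) ⊗ A`, where `a` lives on `H_μ` and `b` lives on `H_ν`. -/
def GPos.Sub (x y : GPos A) : Prop :=
  ∃ d : ℕ → KTG y.μ x.μ A, (∀ n, KTG.IsInv (d n)) ∧
    Tendsto (fun n => ‖KT.comp (KT.comp (d n) y.a) (KT.adj (d n)) - x.a‖) atTop (𝓝 0)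

lemma GPos.sub_of_approx {x y : GPos A} (h : ∀ ε : ℝ, 0 < ε → ∃ d : KTG y.μ x.μ A,
    KTG.IsInv d ∧ ‖KT.comp (KT.comp d y.a) (KT.adj d) - x.a‖ ≤ ε) : x.Sub y := by
  choose d hd hd' using fun n : ℕ => h (1 / (n + 1)) (by positivity)
  exact ⟨d, hd, squeeze_zero (fun _ => norm_nonneg _) hd' tendsto_one_div_add_atTop_nhds_zero_nat⟩

lemma GPos.Sub.approx {x y : GPos A} (h : x.Sub y) {ε : ℝ} (hε : 0 < ε) :
    ∃ d : KTG y.μ x.μ A, KTG.IsInv d ∧ ‖KT.comp (KT.comp d y.a) (KT.adj d) - x.a‖ ≤ ε := by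
  obtain ⟨d, hd, ht⟩ := h
  obtain ⟨n, hn⟩ := (ht.eventually (ge_mem_nhds hε)).exists
  exact ⟨d n, hd n, hn⟩

instance : Preorder (GPos A) where
  le := GPos.Sub
  le_refl x := GPos.sub_of_approx fun ε hε => x.inv.exists_approx (by
    obtain ⟨b, hb⟩ := x.pos
    rw [hb]
    exact IsSelfAdjoint.star_mul_self b) hε
  le_trans x y z hxy hyz := GPos.sub_of_approx fun ε hε => by
    obtain ⟨d, hd, h1⟩ := hxy.approx (half_pos hε)
    have hδ : 0 < ε / 2 / (‖d‖ * ‖KT.adj d‖ + 1) := by positivity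
    obtain ⟨e, he, h2⟩ := hyz.approx hδ
    refine ⟨KT.comp d e, hd.comp he, ?_⟩
    have e1 : KT.comp (KT.comp (KT.comp d e) z.a) (KT.adj (KT.comp d e)) - x.a
        = KT.comp (KT.comp d (KT.comp (KT.comp e z.a) (KT.adj e) - y.a)) (KT.adj d)
          + (KT.comp (KT.comp d y.a) (KT.adj d) - x.a) := by
      rw [KT.adj_comp, map_sub, map_sub, sub_apply]
      simp only [KT.comp_assoc]
      abel
    rw [e1]
    refine (norm_add_le _ _).trans ?_
    have h3 : ‖KT.comp (KT.comp d (KT.comp (KT.comp e z.a) (KT.adj e) - y.a)) (KT.adj d)‖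
        ≤ ε / 2 := by
      refine (KT.norm_comp_le _ _).trans ?_
      refine (mul_le_mul_of_nonneg_right (KT.norm_comp_le _ _) (norm_nonneg _)).trans ?_
      rw [le_div_iff₀ (by positivity)] at h2
      nlinarith [norm_nonneg (KT.comp (KT.comp e z.a) (KT.adj e) - y.a)]
    linarith

lemma GPos.le_def {x y : GPos A} : x ≤ y ↔ x.Sub y := Iff.rfl

variable (A) in
/-- The equivariant Cuntz semigroup `Cu^G(A, α)`: the positive elements of all the algebras
`(K(H_μ) ⊗ A)^G` modulo `G`-Cuntz equivalence, ordered by `G`-Cuntz subequivalence. -/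
def CuG : Type (max 1 u v) := Antisymmetrization (GPos A) (· ≤ ·)

instance : PartialOrder (CuG A) :=
  inferInstanceAs (PartialOrder (Antisymmetrization (GPos A) (· ≤ ·)))

/-- The class `[a]` in `Cu^G(A, α)`. -/
def CuG.mk (x : GPos A) : CuG A := toAntisymmetrization (· ≤ ·) x

lemma CuG.mk_le_mk {x y : GPos A} : CuG.mk x ≤ CuG.mk y ↔ x.Sub y := Iff.rfl

/-- The zero element on the zero representation. -/
instance : Zero (CuG A) :=
  ⟨CuG.mk ⟨URep.zero, 0, fun g => map_zero _, 0, by simp⟩⟩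

/-- The direct sum `a ⊕ b` of positive elements. -/
def GPos.sum (x y : GPos A) : GPos A where
  μ := x.μ.sum y.μ
  a := KTG.blockSum x.a y.a
  inv := x.inv.blockSum y.inv
  pos := by
    obtain ⟨b, hb⟩ := x.pos
    obtain ⟨c, hc⟩ := y.pos
    refine ⟨KTG.blockSum b c, ?_⟩
    rw [KT.mul_def, KT.star_def, KTG.blockSum_adj, KTG.blockSum_comp, hb, hc]
    rfl

lemma GPos.sum_mono {x x' y y' : GPos A} (h : x ≤ x') (h' : y ≤ y') : x.sum y ≤ x'.sum y' := by
  obtain ⟨d, hd, ht⟩ := h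
  obtain ⟨e, he, ht'⟩ := h'
  refine ⟨fun n => KTG.blockSum (d n) (e n), fun n => (hd n).blockSum (he n), ?_⟩
  rw [← tendsto_iff_norm_sub_tendsto_zero] at ht ht' ⊢
  have h := (KTG.continuous_blockSum.tendsto (x.a, y.a)).comp (ht.prodMk_nhds ht')
  refine h.congr fun n => ?_
  change _ = KT.comp (KT.comp (KTG.blockSum (d n) (e n)) (KTG.blockSum x'.a y'.a))
    (KT.adj (KTG.blockSum (d n) (e n)))
  rw [KTG.blockSum_adj, KTG.blockSum_comp, KTG.blockSum_comp]
  rfl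

/-- `[a] + [b] = [a ⊕ b]`. -/
instance : Add (CuG A) :=
  ⟨Quotient.map₂ GPos.sum fun _ _ h _ _ h' =>
    ⟨GPos.sum_mono h.1 h'.1, GPos.sum_mono h.2 h'.2⟩⟩

lemma CuG.mk_add_mk (x y : GPos A) : CuG.mk x + CuG.mk y = CuG.mk (x.sum y) := rfl

lemma KT.sandwich_id_comp (ψ : GHom A B) (x : KTG ν ω A) (y : KTG μ ν A) :
    KT.comp (KT.sandwich (.id ℂ ω.H) (.id ℂ ν.H) ψ.toHom x)
      (KT.sandwich (.id ℂ ν.H) (.id ℂ μ.H) ψ.toHom y)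
      = KT.sandwich (.id ℂ ω.H) (.id ℂ μ.H) ψ.toHom (KT.comp x y) := by
  rw [KT.comp_sandwich, ContinuousLinearMap.comp_id, KT.sandwich_id]

/-- The image of a positive element under `id ⊗ ψ`. -/
def GPos.map (ψ : GHom A B) (x : GPos A) : GPos B where
  μ := x.μ
  a := KT.sandwich (.id ℂ x.μ.H) (.id ℂ x.μ.H) ψ.toHom x.a
  inv := x.inv.sandwich ψ (fun _ => rfl) (fun _ => rfl)
  pos := by
    obtain ⟨b, hb⟩ := x.pos
    refine ⟨KT.sandwich (.id ℂ x.μ.H) (.id ℂ x.μ.H) ψ.toHom b, ?_⟩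
    rw [hb, KT.mul_def, KT.mul_def, KT.star_def, KT.star_def, KT.sandwich_adj,
      ContinuousLinearMap.adjoint_id, KT.sandwich_id_comp]

lemma GPos.map_mono (ψ : GHom A B) {x y : GPos A} (h : x ≤ y) : x.map ψ ≤ y.map ψ := by
  obtain ⟨d, hd, ht⟩ := h
  refine ⟨fun n => KT.sandwich (.id ℂ x.μ.H) (.id ℂ y.μ.H) ψ.toHom (d n),
    fun n => (hd n).sandwich ψ (fun _ => rfl) (fun _ => rfl), ?_⟩
  rw [← tendsto_iff_norm_sub_tendsto_zero] at ht ⊢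
  have h := ((KT.sandwich (.id ℂ x.μ.H) (.id ℂ x.μ.H) ψ.toHom).continuous.tendsto x.a).comp ht
  refine h.congr fun n => ?_
  change _ = KT.comp (KT.comp (KT.sandwich (.id ℂ x.μ.H) (.id ℂ y.μ.H) ψ.toHom (d n))
    (KT.sandwich (.id ℂ y.μ.H) (.id ℂ y.μ.H) ψ.toHom y.a))
    (KT.adj (KT.sandwich (.id ℂ x.μ.H) (.id ℂ y.μ.H) ψ.toHom (d n)))
  rw [KT.sandwich_adj, ContinuousLinearMap.adjoint_id, ContinuousLinearMap.adjoint_id,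
    KT.sandwich_id_comp, KT.sandwich_id_comp]
  rfl

/-- The map `Cu^G(ψ)`, `[a] ↦ [(id ⊗ ψ)(a)]`. -/
def CuG.map (ψ : GHom A B) : CuG A → CuG B :=
  Quotient.map (GPos.map ψ) fun _ _ h => ⟨GPos.map_mono ψ h.1, GPos.map_mono ψ h.2⟩

lemma CuG.map_mk (ψ : GHom A B) (x : GPos A) : CuG.map ψ (CuG.mk x) = CuG.mk (x.map ψ) := rfl

/-! #### The action of `Cu(G)` -/

/-- A strictly positive element of `K(E)`: a positive element `s` with `τ(s) > 0` for every nonzero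
positive linear functional `τ` on `K(E)`. -/
def IsStrictlyPos {E : Type} [NormedAddCommGroup E] [InnerProductSpace ℂ E] [CompleteSpace E]
    (s : Cpt E E) : Prop :=
  (∃ r : Cpt E E, s = Cpt.comp (Cpt.adj r) r) ∧
    ∀ τ : Cpt E E →ₗ[ℂ] ℂ, (∀ k : Cpt E E, 0 ≤ τ (Cpt.comp (Cpt.adj k) k)) → τ ≠ 0 → 0 < τ s

/-- A `G`-invariant strictly positive element of `K(H_ν)`. -/
structure InvStrictlyPos (ν : URep G) where
  s : Cpt ν.H ν.H
  strictlyPos : IsStrictlyPos s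
  inv : ∀ g, Cpt.sandwich (ν.op g) (ν.op g⁻¹) s = s

/-- The positive element `s ⊗ a` on `H_ν ⊗ H_μ`. -/
def GPos.tensor (s : InvStrictlyPos ν) (x : GPos A) : GPos A where
  μ := ν.tensor x.μ
  a := KT.tensorLeft s.s x.a
  inv g := by
    have h := KT.tensorLeft_sandwich s.s (ν.op g) (ν.op g⁻¹) (x.μ.op g) (x.μ.op g⁻¹) (A.act g) x.a
    refine h.trans ?_
    rw [s.inv g]
    congr 1
    exact x.inv g
  pos := by
    obtain ⟨r, hr⟩ := s.strictlyPos.1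
    obtain ⟨b, hb⟩ := x.pos
    refine ⟨KT.tensorLeft r b, ?_⟩
    rw [hr, hb, KT.mul_def, KT.star_def, KT.tensorLeft_comp, ← KT.tensorLeft_adj]
    rfl

/-- `z = [s ⊗ a]` for some representatives `r = [ν]`, `x = [a]`, and some `G`-invariant strictly
positive `s ∈ K(H_ν)`. -/
def CuG.IsSMul (r : CuRep G) (x z : CuG A) : Prop :=
  ∃ (ν : URep G) (s : InvStrictlyPos ν) (a : GPos A),
    r = CuRep.mk ν ∧ x = CuG.mk a ∧ z = CuG.mk (a.tensor s)

open Classical in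
/-- `[ν] • [a] = [s_ν ⊗ a]`, where `s_ν ∈ K(H_ν)` is `G`-invariant and strictly positive. -/
instance : SMul (CuRep G) (CuG A) :=
  ⟨fun r x => if h : ∃ z, CuG.IsSMul r x z then h.choose else 0⟩

end CuG

/-! ### The category `CCu^G` -/

section Category

/-- `x ≪ y`: compact containment. -/
def WayBelow {S : Type w} [Preorder S] (x y : S) : Prop :=
  ∀ (t : ℕ → S) (z : S), Monotone t → IsLUB (Set.range t) z → y ≤ z → ∃ k, x ≤ t k

/-- Objects of the category `CCu`. -/
structure IsCCu (S : Type w) [PartialOrder S] [Zero S] [Add S] : Prop where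
  add_assoc : ∀ x y z : S, x + y + z = x + (y + z)
  add_comm : ∀ x y : S, x + y = y + x
  zero_add : ∀ x : S, 0 + x = x
  add_le_add : ∀ x x' y y' : S, x ≤ x' → y ≤ y' → x + y ≤ x' + y'
  exists_sup : ∀ s : ℕ → S, Monotone s → ∃ x, IsLUB (Set.range s) x
  exists_rapid : ∀ x : S, ∃ s : ℕ → S, (∀ n, WayBelow (s n) (s (n + 1))) ∧ IsLUB (Set.range s) x
  sup_add : ∀ (s t : ℕ → S) (x y : S), Monotone s → Monotone t →
    IsLUB (Set.range s) x → IsLUB (Set.range t) y → IsLUB (Set.range fun n => s n + t n) (x + y)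
  wayBelow_add : ∀ x x' y y' : S, WayBelow x x' → WayBelow y y' → WayBelow (x + y) (x' + y')

/-- Morphisms of the category `CCu`. -/
structure IsCCuHom {S T : Type*} [PartialOrder S] [Zero S] [Add S] [PartialOrder T] [Zero T]
    [Add T] (φ : S → T) : Prop where
  monotone : Monotone φ
  map_zero : φ 0 = 0
  map_add : ∀ x y, φ (x + y) = φ x + φ y
  map_sup : ∀ (s : ℕ → S) (x : S), Monotone s → IsLUB (Set.range s) x →
    IsLUB (Set.range fun n => φ (s n)) (φ x)
  map_wayBelow : ∀ x y, WayBelow x y → WayBelow (φ x) (φ y)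

variable (G : Type u) [TopologicalSpace G] [Group G]

/-- Objects of the category `CCu^G`. -/
structure IsCCuG (S : Type w) [PartialOrder S] [Zero S] [Add S] [SMul (CuRep G) S] : Prop
    extends IsCCu S where
  add_smul : ∀ (r r' : CuRep G) (x : S), (r + r') • x = r • x + r' • x
  smul_add : ∀ (r : CuRep G) (x y : S), r • (x + y) = r • x + r • y
  mul_smul : ∀ (r r' : CuRep G) (x : S), (r * r') • x = r • (r' • x)
  one_smul : ∀ x : S, (1 : CuRep G) • x = x
  zero_smul : ∀ x : S, (0 : CuRep G) • x = 0
  smul_zero : ∀ r : CuRep G, r • (0 : S) = 0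
  smul_le_smul : ∀ (r r' : CuRep G) (x y : S), r ≤ r' → x ≤ y → r • x ≤ r' • y
  wayBelow_smul : ∀ (r r' : CuRep G) (x y : S),
    WayBelow r r' → WayBelow x y → WayBelow (r • x) (r' • y)
  sup_smul : ∀ (r : ℕ → CuRep G) (s : ℕ → S) (q : CuRep G) (x : S), Monotone r → Monotone s →
    IsLUB (Set.range r) q → IsLUB (Set.range s) x → IsLUB (Set.range fun n => r n • s n) (q • x)

/-- Morphisms of the category `CCu^G`. -/
structure IsCCuGHom {S T : Type*} [PartialOrder S] [Zero S] [Add S] [SMul (CuRep G) S]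
    [PartialOrder T] [Zero T] [Add T] [SMul (CuRep G) T] (φ : S → T) : Prop
    extends IsCCuHom φ where
  map_smul : ∀ (r : CuRep G) (x : S), φ (r • x) = r • φ x

/-- Isomorphisms of the category `CCu^G`. -/
def IsCCuGIso {S T : Type*} [PartialOrder S] [Zero S] [Add S] [SMul (CuRep G) S]
    [PartialOrder T] [Zero T] [Add T] [SMul (CuRep G) T] (φ : S → T) : Prop :=
  IsCCuGHom G φ ∧ ∃ φ' : T → S, IsCCuGHom G φ' ∧ (∀ x, φ' (φ x) = x) ∧ ∀ y, φ (φ' y) = y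

/-- `(L, ψ)` is the inductive limit of `S 0 → S 1 → ⋯` in the category `CCu^G`. -/
structure IsCCuGLimit (S : ℕ → Type w) [∀ n, PartialOrder (S n)] [∀ n, Zero (S n)]
    [∀ n, Add (S n)] [∀ n, SMul (CuRep G) (S n)] (φ : ∀ n, S n → S (n + 1))
    (L : Type w) [PartialOrder L] [Zero L] [Add L] [SMul (CuRep G) L]
    (ψ : ∀ n, S n → L) : Prop where
  isCCuG : IsCCuG G L
  isHom : ∀ n, IsCCuGHom G (ψ n)
  compatible : ∀ n x, ψ (n + 1) (φ n x) = ψ n x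
  universal : ∀ (T : Type w) [PartialOrder T] [Zero T] [Add T] [SMul (CuRep G) T],
    IsCCuG G T → ∀ θ : ∀ n, S n → T, (∀ n, IsCCuGHom G (θ n)) →
      (∀ n x, θ (n + 1) (φ n x) = θ n x) →
      ∃! χ : L → T, IsCCuGHom G χ ∧ ∀ n x, χ (ψ n x) = θ n x

end Category

/-! ### Inductive limits of `C*`-dynamical systems -/

section Limit

variable {G : Type u} [TopologicalSpace G] [Group G]

/-- The composition `A n → A (n + m)` of the connecting maps. -/
def connect {A : ℕ → GAlg.{u, v} G} (ι : ∀ n, GHom (A n) (A (n + 1))) (n : ℕ) :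
    ∀ m, (A n).carrier → (A (n + m)).carrier
  | 0 => id
  | m + 1 => fun a => (ι (n + m)).toHom (connect ι n m a)

/-- `(L, j)` is the inductive limit of `A 0 → A 1 → ⋯`: the maps `j n` are equivariant and
compatible, their images are dense, and `‖j n a‖` is the limit of the norms of the images of `a`
in the algebras `A (n + m)`. (Equivalently `L` is the completion of the algebraic limit in the
limit seminorm, with the action induced by the actions on the `A n`.) -/
structure IsInductiveLimit (A : ℕ → GAlg.{u, v} G) (ι : ∀ n, GHom (A n) (A (n + 1)))
    (L : GAlg.{u, v} G) (j : ∀ n, GHom (A n) L) : Prop where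
  compatible : ∀ n a, (j (n + 1)).toHom ((ι n).toHom a) = (j n).toHom a
  dense : Dense (⋃ n, Set.range (j n).toHom)
  tendsto_norm : ∀ n a,
    Tendsto (fun m => ‖connect ι n m a‖) atTop (𝓝 ‖(j n).toHom a‖)

end Limit

end EquivCuntz

end

open EquivCuntz

/-!
The functor `Cu^G` preserves sequential inductive limits because comparison of positive elements is
an approximate relation: it involves only norm inequalities with finitely many elements, and such
inequalities over the limit algebra already hold at some stage.

*Comparison.* The basic tool is the element `(a - ε)₊`, written `cut ε a`. If `‖a - b‖ < ε`, then
`(a - ε)₊ ≲ b` (`GPos.cut_le_of_norm_lt`), and if `d b d*` is within `ε` of `a` for some invariant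
`d`, then `(a - ε)₊ ≲ b` (`GPos.cut_le_of_sand`). The witnesses `d` are obtained by functional
calculus, which makes them invariant. Direct sums, unitary equivalences and subrepresentations are
handled by a single observation: `v a v* ≲ a` for every bounded intertwiner `v`
(`GPos.le_of_eq_conj`).

*The objects.* Suprema of increasing sequences in `Cu^G(A)` are constructed on the Hilbert sum of the
underlying representations, by perturbing `X* a X` step by step so that each perturbation is too
small to destroy the comparisons achieved before (`GPos.exists_sup`). It follows that `u ≪ [a]` means
`u ≤ [(a - δ)₊]` for some `δ > 0` (`CuG.wayBelow_mk`), and the axioms of `CCu` are consequences.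

*The action of `Cu(G)`.* A strictly positive element of `K(H)` is a positive compact operator with
strictly positive quadratic form (`isStrictlyPos_iff`), so that invariant ones are obtained by
averaging over `G`. If `ν` embeds in `ν'`, then `s_ν` is a limit of elements `e s_ν' e*` with
invariant compact `e` (`InvStrictlyPos.exists_approx`), which yields monotonicity of the action and
its independence of all choices. For the compatibility with suprema, an increasing sequence in
`Cu(G)` is realized by isometric intertwiners and its supremum by their direct limit
(`CuG.sup_smul`). For the compatibility with `≪`, every representation is the supremum of an
increasing sequence of finite dimensional ones, the spectral subspaces of `s_ν`
(`InvStrictlyPos.exists_isLUB`). That this is a supremum requires embeddings of finite dimensional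
representations to be extended to larger ones (`Intertwines.exists_extension`), and takes the place
of decompositions into irreducible representations.

*Norms in the limit.* The norms of `(id ⊗ c_m)(t)` for `t ∈ K(E, F) ⊗ A_n` are eventually bounded by
any number larger than the norm in `K(E, F) ⊗ L` (`NormLE.of_tendsto`). For matrices over `A_n` this
holds up to a constant by looking at the entries, and the constant disappears by passing to high
powers of a self-adjoint element; the case of `1 ⊗ a` needs the existence of a representation which
does not vanish at `a` (`StarRep.exists_apply_ne_zero`).

*The limit.* Averaging over `G` shows that invariant elements over `L` are approximated by invariant
elements over the `A_n`. Two facts follow: every `z' ≪ z` in `Cu^G(L)` is separated by a class coming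
from a stage (`IsInductiveLimit.exists_le_map`), and if `x' ≪ x` and `[x] ≤ [y]` in the limit, then
`x' ≤ y` at a later stage (`IsInductiveLimit.exists_map_le`). A cocone with these two properties is
an inductive limit in `CCu^G` (`isCCuGLimit_of_approx`): a compatible family of morphisms defines a
morphism on a dense part of the limit, which extends by suprema of rapidly increasing sequences
(`IsPartialHom.existsUnique_extension`). Hence `Cu^G(L)` itself is an inductive limit, and every other
one is isomorphic to it by the universal property.
-/

noncomputable section

namespace EquivCuntz

set_option linter.unusedSectionVars false

/-! ### Multiplying elements of `K(E₁, E₂) ⊗ A` by bounded operators -/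

section Multipliers

variable {E E₁ E₂ E₃ F F₁ F₂ F₃ : Type} {A B : Type v}
  [NormedAddCommGroup E] [InnerProductSpace ℂ E] [CompleteSpace E]
  [NormedAddCommGroup E₁] [InnerProductSpace ℂ E₁] [CompleteSpace E₁]
  [NormedAddCommGroup E₂] [InnerProductSpace ℂ E₂] [CompleteSpace E₂]
  [NormedAddCommGroup E₃] [InnerProductSpace ℂ E₃] [CompleteSpace E₃]
  [NormedAddCommGroup F] [InnerProductSpace ℂ F] [CompleteSpace F]
  [NormedAddCommGroup F₁] [InnerProductSpace ℂ F₁] [CompleteSpace F₁]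
  [NormedAddCommGroup F₂] [InnerProductSpace ℂ F₂] [CompleteSpace F₂]
  [NormedAddCommGroup F₃] [InnerProductSpace ℂ F₃] [CompleteSpace F₃]
  [NonUnitalCStarAlgebra A] [NonUnitalCStarAlgebra B]

lemma KT.norm_sandwich_le (v : E₂ →L[ℂ] F₂) (w : F₁ →L[ℂ] E₁) (ψ : A →⋆ₙₐ[ℂ] B)
    (x : KT E₁ E₂ A) : ‖KT.sandwich v w ψ x‖ ≤ ‖v‖ * ‖w‖ * ‖x‖ := by
  induction x using KT.induction with
  | hp => exact isClosed_le (by fun_prop) (by fun_prop)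
  | ih t =>
    rw [KT.sandwich_of, LinearIsometry.norm_map, LinearIsometry.norm_map]
    exact AlgKT.norm_sandwich_le v w ψ t

lemma KT.sandwich_add_left (v v' : E₂ →L[ℂ] F₂) (w : F₁ →L[ℂ] E₁) (ψ : A →⋆ₙₐ[ℂ] B)
    (x : KT E₁ E₂ A) :
    KT.sandwich (v + v') w ψ x = KT.sandwich v w ψ x + KT.sandwich v' w ψ x := by
  induction x using KT.induction with
  | hp => exact isClosed_eq (by fun_prop) (by fun_prop)
  | ih t =>
    rw [KT.sandwich_of, KT.sandwich_of, KT.sandwich_of, ← map_add]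
    congr 1
    induction t using AlgKT.induction with
    | zero => simp
    | add x x' hx hx' => simp only [map_add, hx, hx']; abel
    | tmul k a =>
      simp only [AlgKT.sandwich_tmul]
      have : Cpt.sandwich (v + v') w k = Cpt.sandwich v w k + Cpt.sandwich v' w k :=
        Subtype.ext (ContinuousLinearMap.add_comp _ _ _)
      rw [this]
      exact TensorProduct.add_tmul _ _ _

/-- The product `v x` of a bounded operator `v` and `x ∈ K(E₁, E₂) ⊗ A`. -/
def KT.lmul (v : E₂ →L[ℂ] F₂) : KT E₁ E₂ A →L[ℂ] KT E₁ F₂ A :=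
  KT.sandwich v (.id ℂ E₁) (NonUnitalStarAlgHom.id ℂ A)

/-- The product `x w` of `x ∈ K(E₁, E₂) ⊗ A` and a bounded operator `w`. -/
def KT.rmul (w : F₁ →L[ℂ] E₁) : KT E₁ E₂ A →L[ℂ] KT F₁ E₂ A :=
  KT.sandwich (.id ℂ E₂) w (NonUnitalStarAlgHom.id ℂ A)

lemma KT.lmul_rmul (v : E₂ →L[ℂ] F₂) (w : F₁ →L[ℂ] E₁) (x : KT E₁ E₂ A) :
    KT.lmul v (KT.rmul w x) = KT.sandwich v w (NonUnitalStarAlgHom.id ℂ A) x :=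
  KT.sandwich_sandwich _ _ _ _ _ _ _

lemma KT.rmul_lmul (v : E₂ →L[ℂ] F₂) (w : F₁ →L[ℂ] E₁) (x : KT E₁ E₂ A) :
    KT.rmul w (KT.lmul v x) = KT.sandwich v w (NonUnitalStarAlgHom.id ℂ A) x :=
  KT.sandwich_sandwich _ _ _ _ _ _ _

lemma KT.rmul_lmul_comm (v : E₂ →L[ℂ] F₂) (w : F₁ →L[ℂ] E₁) (x : KT E₁ E₂ A) :
    KT.rmul w (KT.lmul v x) = KT.lmul v (KT.rmul w x) := by rw [KT.rmul_lmul, KT.lmul_rmul]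

lemma KT.lmul_lmul (v : F₂ →L[ℂ] F₃) (v' : E₂ →L[ℂ] F₂) (x : KT E₁ E₂ A) :
    KT.lmul v (KT.lmul v' x) = KT.lmul (v ∘L v') x :=
  KT.sandwich_sandwich _ _ _ _ _ _ _

lemma KT.rmul_rmul (w : F₂ →L[ℂ] F₁) (w' : F₁ →L[ℂ] E₁) (x : KT E₁ E₂ A) :
    KT.rmul w (KT.rmul w' x) = KT.rmul (w' ∘L w) x :=
  KT.sandwich_sandwich _ _ _ _ _ _ _

lemma KT.lmul_id (x : KT E₁ E₂ A) : KT.lmul (.id ℂ E₂) x = x := KT.sandwich_id x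

lemma KT.rmul_id (x : KT E₁ E₂ A) : KT.rmul (.id ℂ E₁) x = x := KT.sandwich_id x

lemma KT.adj_lmul (v : E₂ →L[ℂ] F₂) (x : KT E₁ E₂ A) :
    KT.adj (KT.lmul v x) = KT.rmul v.adjoint (KT.adj x) := by
  unfold KT.lmul KT.rmul
  rw [KT.sandwich_adj, ContinuousLinearMap.adjoint_id]

lemma KT.adj_rmul (w : F₁ →L[ℂ] E₁) (x : KT E₁ E₂ A) :
    KT.adj (KT.rmul w x) = KT.lmul w.adjoint (KT.adj x) := by
  unfold KT.lmul KT.rmul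
  rw [KT.sandwich_adj, ContinuousLinearMap.adjoint_id]

lemma KT.lmul_comp (v : E₃ →L[ℂ] F₃) (x : KT E₂ E₃ A) (y : KT E₁ E₂ A) :
    KT.comp (KT.lmul v x) y = KT.lmul v (KT.comp x y) := by
  have h := KT.comp_sandwich v (.id ℂ E₂) (.id ℂ E₂) (.id ℂ E₁) (NonUnitalStarAlgHom.id ℂ A) x y
  rwa [KT.sandwich_id, ContinuousLinearMap.comp_id, KT.sandwich_id] at h

lemma KT.comp_rmul (w : F₁ →L[ℂ] E₁) (x : KT E₂ E₃ A) (y : KT E₁ E₂ A) :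
    KT.comp x (KT.rmul w y) = KT.rmul w (KT.comp x y) := by
  have h := KT.comp_sandwich (.id ℂ E₃) (.id ℂ E₂) (.id ℂ E₂) w (NonUnitalStarAlgHom.id ℂ A) x y
  rwa [KT.sandwich_id, ContinuousLinearMap.comp_id, KT.sandwich_id] at h

lemma KT.rmul_comp (w : F₂ →L[ℂ] E₂) (x : KT E₂ E₃ A) (y : KT E₁ F₂ A) :
    KT.comp (KT.rmul w x) y = KT.comp x (KT.lmul w y) := by
  have h := KT.comp_sandwich (.id ℂ E₃) w (.id ℂ F₂) (.id ℂ E₁) (NonUnitalStarAlgHom.id ℂ A) x y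
  rwa [KT.sandwich_id, ContinuousLinearMap.comp_id, KT.sandwich_id] at h

lemma KT.lmul_zero_left (x : KT E₁ E₂ A) : KT.lmul (0 : E₂ →L[ℂ] F₂) x = 0 :=
  KT.sandwich_zero_left _ _ _

lemma KT.rmul_zero_left (x : KT E₁ E₂ A) : KT.rmul (0 : F₁ →L[ℂ] E₁) x = 0 := by
  have h := KT.adj_lmul (0 : E₁ →L[ℂ] F₁) (KT.adj x)
  rw [KT.lmul_zero_left, map_zero, KT.adj_adj, map_zero] at h
  exact h.symm

lemma KT.lmul_add_left (v v' : E₂ →L[ℂ] F₂) (x : KT E₁ E₂ A) :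
    KT.lmul (v + v') x = KT.lmul v x + KT.lmul v' x := KT.sandwich_add_left _ _ _ _ _

lemma KT.rmul_add_left (w w' : F₁ →L[ℂ] E₁) (x : KT E₁ E₂ A) :
    KT.rmul (w + w') x = KT.rmul w x + KT.rmul w' x := by
  have h := KT.adj_lmul (w.adjoint + w'.adjoint) (KT.adj x)
  rw [KT.lmul_add_left, map_add, KT.adj_lmul, KT.adj_lmul, KT.adj_adj, map_add] at h
  simpa only [ContinuousLinearMap.adjoint_adjoint] using h.symm

lemma KT.norm_lmul_le (v : E₂ →L[ℂ] F₂) (x : KT E₁ E₂ A) : ‖KT.lmul v x‖ ≤ ‖v‖ * ‖x‖ := by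
  refine (KT.norm_sandwich_le _ _ _ _).trans ?_
  gcongr
  exact mul_le_of_le_one_right (norm_nonneg _) ContinuousLinearMap.norm_id_le

lemma KT.norm_rmul_le (w : F₁ →L[ℂ] E₁) (x : KT E₁ E₂ A) : ‖KT.rmul w x‖ ≤ ‖w‖ * ‖x‖ := by
  refine (KT.norm_sandwich_le _ _ _ _).trans ?_
  gcongr
  exact mul_le_of_le_one_left (norm_nonneg _) ContinuousLinearMap.norm_id_le

lemma KT.norm_adj (x : KT E₁ E₂ A) : ‖KT.adj x‖ = ‖x‖ := by
  induction x using KT.induction with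
  | hp => exact isClosed_eq (by fun_prop) (by fun_prop)
  | ih t => rw [KT.adj_of, LinearIsometry.norm_map, LinearIsometry.norm_map, AlgKT.norm_adj]

lemma KT.norm_adj_comp_self (x : KT E₁ E₂ A) : ‖KT.comp (KT.adj x) x‖ = ‖x‖ * ‖x‖ :=
  le_antisymm ((KT.norm_comp_le _ _).trans_eq (by rw [KT.norm_adj])) (KT.norm_star_comp x)

/-- The spectral order on `K(E) ⊗ A`. -/
instance : PartialOrder (KT E E A) := CStarAlgebra.spectralOrder _

instance : StarOrderedRing (KT E E A) := CStarAlgebra.spectralOrderedRing _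

lemma KT.nonneg_iff {a : KT E E A} : 0 ≤ a ↔ ∃ b, a = star b * b :=
  CStarAlgebra.nonneg_iff_eq_star_mul_self

/-- If `i` is an isometry and `i z i*` is positive, then `z` is positive. -/
lemma KT.nonneg_of_lmul_rmul_nonneg {i : E →L[ℂ] F} (hi : i.adjoint ∘L i = .id ℂ E)
    {z : KT E E A} (h : 0 ≤ KT.lmul i (KT.rmul i.adjoint z)) : 0 ≤ z := by
  -- the square root `r` of `i z i*` is supported on the range of `i`
  set r := CFC.sqrt (KT.lmul i (KT.rmul i.adjoint z)) with hr
  have hsa : KT.adj r = r := (CFC.sqrt_nonneg (KT.lmul i (KT.rmul i.adjoint z))).isSelfAdjoint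
  have hrr : KT.comp r r = KT.lmul i (KT.rmul i.adjoint z) := CFC.sqrt_mul_sqrt_self _ h
  set q : F →L[ℂ] F := .id ℂ F - i ∘L i.adjoint with hq
  have hiq : i.adjoint ∘L q = 0 := by
    rw [hq, ContinuousLinearMap.comp_sub, ← ContinuousLinearMap.comp_assoc, hi,
      ContinuousLinearMap.id_comp, ContinuousLinearMap.comp_id, sub_self]
  have h0 : KT.rmul q r = 0 := by
    rw [← norm_eq_zero, ← mul_self_eq_zero, ← KT.norm_adj_comp_self, KT.adj_rmul, hsa,
      KT.lmul_comp, KT.comp_rmul, hrr, KT.rmul_lmul_comm,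
      KT.rmul_rmul, hiq, KT.rmul_zero_left, map_zero, map_zero, norm_zero]
  have h1 : KT.rmul (i ∘L i.adjoint) r = r := by
    have := KT.rmul_add_left q (i ∘L i.adjoint) r
    rw [h0, zero_add, hq, sub_add_cancel, KT.rmul_id] at this
    exact this.symm
  have h2 : z = KT.comp (KT.adj (KT.lmul i.adjoint (KT.rmul i r)))
      (KT.lmul i.adjoint (KT.rmul i r)) := by
    rw [KT.adj_lmul, KT.adj_rmul, hsa, KT.rmul_comp, KT.lmul_lmul,
      ContinuousLinearMap.adjoint_adjoint, KT.lmul_comp, ← KT.rmul_comp, h1, KT.comp_rmul, hrr,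
      KT.lmul_rmul, KT.lmul_rmul, KT.sandwich_sandwich, hi]
    exact (KT.sandwich_id z).symm
  rw [h2]
  exact star_mul_self_nonneg (KT.lmul i.adjoint (KT.rmul i r))

/-- The inclusion of the first summand of a direct sum of Hilbert spaces. -/
def inlL (E F : Type) [NormedAddCommGroup E] [InnerProductSpace ℂ E]
    [NormedAddCommGroup F] [InnerProductSpace ℂ F] : E →L[ℂ] WithLp 2 (E × F) :=
  (WithLp.prodContinuousLinearEquiv 2 ℂ E F).symm.toContinuousLinearMap
    ∘L ContinuousLinearMap.inl ℂ E F

/-- The inclusion of the second summand of a direct sum of Hilbert spaces. -/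
def inrL (E F : Type) [NormedAddCommGroup E] [InnerProductSpace ℂ E]
    [NormedAddCommGroup F] [InnerProductSpace ℂ F] : F →L[ℂ] WithLp 2 (E × F) :=
  (WithLp.prodContinuousLinearEquiv 2 ℂ E F).symm.toContinuousLinearMap
    ∘L ContinuousLinearMap.inr ℂ E F

lemma inlL_adjoint_comp : (inlL E F).adjoint ∘L inlL E F = .id ℂ E := by
  have h : (inlL E F).adjoint = WithLp.fstL 2 ℂ E F := by
    symm
    rw [ContinuousLinearMap.eq_adjoint_iff]
    intro x y
    change _ = Inner.inner ℂ (WithLp.fst x) y + Inner.inner ℂ (WithLp.snd x) (0 : F)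
    rw [inner_zero_right, add_zero]; rfl
  rw [h]; rfl

lemma inrL_adjoint_comp : (inrL E F).adjoint ∘L inrL E F = .id ℂ F := by
  have h : (inrL E F).adjoint = WithLp.sndL 2 ℂ E F := by
    symm
    rw [ContinuousLinearMap.eq_adjoint_iff]
    intro x y
    change _ = Inner.inner ℂ (WithLp.fst x) (0 : E) + Inner.inner ℂ (WithLp.snd x) y
    rw [inner_zero_right, zero_add]; rfl
  rw [h]; rfl

/-- Elements `x* x` are positive also for `x` between different Hilbert spaces: place `x` in a
corner of the algebra of the direct sum. -/
lemma KT.adj_comp_self_nonneg (x : KT E F A) : 0 ≤ KT.comp (KT.adj x) x := by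
  refine KT.nonneg_of_lmul_rmul_nonneg (inlL_adjoint_comp (E := E) (F := F)) ?_
  have h : star (KT.lmul (inrL E F) (KT.rmul (inlL E F).adjoint x)) *
      KT.lmul (inrL E F) (KT.rmul (inlL E F).adjoint x)
      = KT.lmul (inlL E F) (KT.rmul (inlL E F).adjoint (KT.comp (KT.adj x) x)) := by
    rw [KT.mul_def, KT.star_def]
    simp only [KT.adj_lmul, KT.adj_rmul, KT.rmul_comp, KT.lmul_lmul, inrL_adjoint_comp,
      KT.lmul_id, ContinuousLinearMap.adjoint_adjoint, KT.lmul_comp, KT.comp_rmul, KT.rmul_lmul_comm]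
  rw [← h]
  exact star_mul_self_nonneg _

/-- `x b x* ≥ 0` for `b ≥ 0`. -/
lemma KT.conj_nonneg (x : KT E F A) {b : KT E E A} (hb : 0 ≤ b) :
    0 ≤ KT.comp (KT.comp x b) (KT.adj x) := by
  obtain ⟨c, rfl⟩ := KT.nonneg_iff.1 hb
  have := KT.adj_comp_self_nonneg (KT.comp c (KT.adj x))
  rwa [KT.adj_comp, KT.adj_adj, KT.comp_assoc, ← KT.comp_assoc (KT.adj c), ← KT.star_def,
    ← KT.mul_def (star c), ← KT.comp_assoc] at this

end Multipliers

/-! ### Functional calculus: cutting down positive elements -/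

section CStar

open scoped CStarAlgebra

/-- The element `(a - ε)₊`. -/
def cut {D : Type*} [NonUnitalCStarAlgebra D] (ε : ℝ) (a : D) : D :=
  cfcₙ (fun t : ℝ => max (t - ε) 0) a

lemma map_cut {D D' : Type*} [NonUnitalCStarAlgebra D] [NonUnitalCStarAlgebra D']
    (Φ : D →⋆ₙₐ[ℂ] D') {ε : ℝ} (hε : 0 ≤ ε) {a : D} (ha : IsSelfAdjoint a) :
    Φ (cut ε a) = cut ε (Φ a) :=
  NonUnitalStarAlgHom.map_cfcₙ Φ (fun t : ℝ => max (t - ε) 0) a (by fun_prop)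
    (by simpa using hε) (map_continuous Φ) ha (ha.map Φ)

lemma cut_prod {D D' : Type*} [NonUnitalCStarAlgebra D] [NonUnitalCStarAlgebra D'] {ε : ℝ}
    (hε : 0 ≤ ε) {a : D} {b : D'} (ha : IsSelfAdjoint a) (hb : IsSelfAdjoint b) :
    cut ε (a, b) = (cut ε a, cut ε b) :=
  Prod.ext (map_cut (NonUnitalStarAlgHom.fst ℂ D D') hε (Prod.ext ha hb))
    (map_cut (NonUnitalStarAlgHom.snd ℂ D D') hε (Prod.ext ha hb))

variable {D : Type*} [NonUnitalCStarAlgebra D] [PartialOrder D] [StarOrderedRing D]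

lemma cut_nonneg (ε : ℝ) (a : D) : 0 ≤ cut ε a := cfcₙ_nonneg fun _ _ => le_max_right _ _

lemma norm_cut_sub_le {ε : ℝ} (hε : 0 ≤ ε) {a : D} (ha : 0 ≤ a) : ‖cut ε a - a‖ ≤ ε := by
  have hsa := ha.isSelfAdjoint
  have e : cut ε a - a = cfcₙ (fun t : ℝ => max (t - ε) 0 - t) a := by
    rw [cfcₙ_sub (fun t : ℝ => max (t - ε) 0) (fun t => t) a (by fun_prop) (by simpa using hε)
      (by fun_prop) rfl, cfcₙ_id' ℝ a]
    rfl
  rw [e]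
  refine norm_cfcₙ_le fun t ht => ?_
  have ht0 : 0 ≤ t := quasispectrum_nonneg_of_nonneg a ha t ht
  rw [Real.norm_eq_abs, abs_le]
  constructor
  · linarith [le_max_left (t - ε) 0]
  · rcases max_cases (t - ε) 0 with h | h <;> linarith

lemma cut_cut {ε δ : ℝ} (hε : 0 ≤ ε) (hδ : 0 ≤ δ) {a : D} (ha : IsSelfAdjoint a) :
    cut ε (cut δ a) = cut (δ + ε) a := by
  unfold cut
  rw [← cfcₙ_comp' (fun t : ℝ => max (t - ε) 0) (fun t : ℝ => max (t - δ) 0) a (by fun_prop)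
    (by simpa using hε) (by fun_prop) (by simpa using hδ)]
  congr 1
  ext t
  rcases le_total t δ with h | h
  · rw [max_eq_right (by linarith : t - δ ≤ 0), max_eq_right, max_eq_right] <;> linarith
  · rw [max_eq_left (by linarith : 0 ≤ t - δ), sub_sub]

/-- If `0 ≤ u ≤ v`, then `u` is a limit of elements `d v d*`. Here `d = √u ψ(v)`, and the error is
controlled by the norm of `(1 - χ(v)) u (1 - χ(v)) ≤ (1 - χ(v)) v (1 - χ(v))`, where
`1 - ψ(t)² t = (1 - χ(t))²` and `χ(t) = t² / (t² + η²)`. -/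
lemma exists_conj_of_le {u v : D} (hu : 0 ≤ u) (huv : u ≤ v) {η : ℝ} (hη : 0 < η) :
    ∃ d : D, ‖d * v * star d - u‖ ≤ η ∧
      ∀ Φ : D →⋆ₙₐ[ℂ] D, Φ u = u → Φ v = v → Φ d = d := by
  have hv : 0 ≤ v := hu.trans huv
  have hpos (t : ℝ) : 0 < t ^ 2 + η ^ 2 := by positivity
  set χ : ℝ → ℝ := fun t => t ^ 2 / (t ^ 2 + η ^ 2) with hχ
  have hχc : Continuous χ :=
    (by fun_prop : Continuous fun t : ℝ => t ^ 2).div (by fun_prop) fun t => (hpos t).ne'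
  have hχ0 : χ 0 = 0 := by simp [hχ]
  set ψ : ℝ → ℝ := fun t => √(t * (t ^ 2 + 2 * η ^ 2) / (t ^ 2 + η ^ 2) ^ 2) with hψ
  have hψc : Continuous ψ := Real.continuous_sqrt.comp
    ((by fun_prop : Continuous fun t : ℝ => t * (t ^ 2 + 2 * η ^ 2)).div (by fun_prop)
      fun t => (pow_pos (hpos t) 2).ne')
  have hψ0 : ψ 0 = 0 := by simp [hψ]
  set w := CFC.sqrt u with hw
  have hwsa : star w = w := (CFC.sqrt_nonneg u).isSelfAdjoint
  have hww : w * w = u := CFC.sqrt_mul_sqrt_self u hu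
  set p := cfcₙ ψ v with hp
  have hpsa : star p = p := cfcₙ_predicate ψ v
  set q := cfcₙ χ v with hq
  have hqsa : star q = q := cfcₙ_predicate χ v
  have hpvp : p * v * p = q + q - q * q := by
    have e1 : p * v * p = cfcₙ (fun t => ψ t * t * ψ t) v := by
      rw [cfcₙ_mul (fun t => ψ t * t) ψ v (by fun_prop) (by simp [hψ0]) (by fun_prop) hψ0,
        cfcₙ_mul ψ (fun t => t) v (by fun_prop) hψ0 (by fun_prop) rfl, cfcₙ_id' ℝ v]
    have e2 : q + q - q * q = cfcₙ (fun t => χ t + χ t - χ t * χ t) v := by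
      rw [cfcₙ_sub (fun t => χ t + χ t) (fun t => χ t * χ t) v (by fun_prop) (by simp [hχ0])
        (by fun_prop) (by simp [hχ0]),
        cfcₙ_mul χ χ v (by fun_prop) hχ0 (by fun_prop) hχ0,
        cfcₙ_add χ χ v (by fun_prop) hχ0 (by fun_prop) hχ0]
    rw [e1, e2]
    refine cfcₙ_congr fun t ht => ?_
    have ht0 : 0 ≤ t := quasispectrum_nonneg_of_nonneg v hv t ht
    have h1 : ψ t * ψ t = t * (t ^ 2 + 2 * η ^ 2) / (t ^ 2 + η ^ 2) ^ 2 :=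
      Real.mul_self_sqrt (by positivity)
    have := (hpos t).ne'
    calc ψ t * t * ψ t = t * (ψ t * ψ t) := by ring
      _ = _ := by rw [h1]; simp only [hχ]; field_simp; ring
  refine ⟨w * p, ?_, fun Φ h1 h2 => ?_⟩
  · have e1 : w * p * v * star (w * p) - u = -((w - w * q) * star (w - w * q)) := by
      rw [star_mul, hpsa, hwsa, star_sub, star_mul, hqsa, hwsa]
      calc w * p * v * (p * w) - u = w * (p * v * p) * w - w * w := by
            rw [hww]; simp only [mul_assoc]
        _ = _ := by rw [hpvp]; noncomm_ring
    rw [e1, norm_neg, CStarRing.norm_self_mul_star, ← CStarRing.norm_star_mul_self]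
    have e2 : star (w - w * q) * (w - w * q) = u - q * u - u * q + q * u * q := by
      rw [star_sub, star_mul, hqsa, hwsa, ← hww]; noncomm_ring
    have h3 : star (w - w * q) * (w - w * q) ≤ v - q * v - v * q + q * v * q := by
      rw [e2, ← sub_nonneg]
      obtain ⟨y, hy⟩ := CStarAlgebra.nonneg_iff_eq_star_mul_self.1 (sub_nonneg.2 huv)
      have : v - q * v - v * q + q * v * q - (u - q * u - u * q + q * u * q)
          = star (y - y * q) * (y - y * q) := by
        rw [star_sub, star_mul, hqsa]
        calc _ = (v - u) - q * (v - u) - (v - u) * q + q * (v - u) * q := by noncomm_ring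
          _ = _ := by rw [hy]; noncomm_ring
      rw [this]
      exact star_mul_self_nonneg _
    refine (CStarAlgebra.norm_le_norm_of_nonneg_of_le (star_mul_self_nonneg _) h3).trans ?_
    have e4 : v - q * v - v * q + q * v * q
        = cfcₙ (fun t => t - χ t * t - t * χ t + χ t * t * χ t) v := by
      rw [cfcₙ_add (fun t => t - χ t * t - t * χ t) (fun t => χ t * t * χ t) v (by fun_prop)
        (by simp) (by fun_prop) (by simp),
        cfcₙ_sub (fun t => t - χ t * t) (fun t => t * χ t) v (by fun_prop) (by simp) (by fun_prop)
        (by simp), cfcₙ_sub (fun t => t) (fun t => χ t * t) v (by fun_prop) (by simp) (by fun_prop)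
        (by simp), cfcₙ_mul (fun t => χ t * t) χ v (by fun_prop) (by simp) (by fun_prop) hχ0,
        cfcₙ_mul χ (fun t => t) v (by fun_prop) hχ0 (by fun_prop) (by simp),
        cfcₙ_mul (fun t => t) χ v (by fun_prop) (by simp) (by fun_prop) hχ0, cfcₙ_id' ℝ v]
    rw [e4]
    refine norm_cfcₙ_le fun t ht => ?_
    have ht0 : 0 ≤ t := quasispectrum_nonneg_of_nonneg v hv t ht
    have e5 : t - χ t * t - t * χ t + χ t * t * χ t
        = t * (η ^ 2 / (t ^ 2 + η ^ 2)) ^ 2 := by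
      have := (hpos t).ne'
      simp only [hχ]; field_simp; ring
    rw [e5, Real.norm_of_nonneg (by positivity), div_pow, mul_div_assoc',
      div_le_iff₀ (pow_pos (hpos t) 2)]
    have h6 : t * η ≤ t ^ 2 + η ^ 2 := by nlinarith [sq_nonneg (t - η)]
    have h7 : η ^ 2 ≤ t ^ 2 + η ^ 2 := by nlinarith
    calc t * (η ^ 2) ^ 2 = η * ((t * η) * η ^ 2) := by ring
      _ ≤ η * ((t ^ 2 + η ^ 2) * (t ^ 2 + η ^ 2)) := by gcongr
      _ = _ := by ring
  · have e1 : Φ w = w := by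
      rw [hw, CFC.sqrt_eq_real_sqrt u hu, NonUnitalStarAlgHom.map_cfcₙ Φ Real.sqrt u (by fun_prop)
        (by simp) (map_continuous Φ) hu.isSelfAdjoint
        (hu.isSelfAdjoint.map Φ), h1]
    have e2 : Φ p = p := by
      rw [hp, NonUnitalStarAlgHom.map_cfcₙ Φ ψ v (by fun_prop)
        hψ0 (map_continuous Φ) hv.isSelfAdjoint
        (hv.isSelfAdjoint.map Φ), h2]
    rw [map_mul, e1, e2]

/-- If `‖a - b‖ < ε`, then `(a - ε)₊` is a limit of elements `d b d*`: for `δ = ‖a - b‖` and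
`f(t)² (t - δ) = (t - ε)₊`, one has `(a - ε)₊ = f(a) (a - δ) f(a) ≤ f(a) b f(a)`. -/
lemma exists_conj_cut {a b : D} (ha : 0 ≤ a) (hb : 0 ≤ b) {ε : ℝ} (hab : ‖a - b‖ < ε)
    {η : ℝ} (hη : 0 < η) :
    ∃ d : D, ‖d * b * star d - cut ε a‖ ≤ η ∧
      ∀ Φ : D →⋆ₙₐ[ℂ] D, Φ a = a → Φ b = b → Φ d = d := by
  set δ := ‖a - b‖ with hδ
  have hδ0 : 0 ≤ δ := norm_nonneg _
  have hε : 0 ≤ ε := hδ0.trans hab.le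
  have hpos (t : ℝ) : 0 < max (t - δ) (ε - δ) := lt_max_of_lt_right (sub_pos.2 hab)
  set f : ℝ → ℝ := fun t => √(max (t - ε) 0 / max (t - δ) (ε - δ)) with hf
  have hfc : Continuous f := Real.continuous_sqrt.comp
    ((by fun_prop : Continuous fun t : ℝ => max (t - ε) 0).div (by fun_prop) fun t => (hpos t).ne')
  have hf0 : f 0 = 0 := by simp [hf, hε]
  set F := cfcₙ f a with hF
  have hFsa : star F = F := cfcₙ_predicate f a
  have hFF : F * a * F - cut ε a = δ • (star F * F) := by
    have e1 : F * a * F - cut ε a = cfcₙ (fun t => f t * t * f t - max (t - ε) 0) a := by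
      rw [cfcₙ_sub (fun t => f t * t * f t) (fun t => max (t - ε) 0) a (by fun_prop)
        (by simp) (by fun_prop) (by simpa using hε),
        cfcₙ_mul (fun t => f t * t) f a (by fun_prop) (by simp) (by fun_prop) hf0,
        cfcₙ_mul f (fun t => t) a (by fun_prop) hf0 (by fun_prop) rfl, cfcₙ_id' ℝ a]
      rfl
    have e2 : δ • (star F * F) = cfcₙ (fun t => δ • (f t * f t)) a := by
      rw [hFsa, cfcₙ_smul δ (fun t => f t * f t) a (by fun_prop) (by simp [hf0]),
        cfcₙ_mul f f a (by fun_prop) hf0 (by fun_prop) hf0]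
    rw [e1, e2]
    refine cfcₙ_congr fun t _ => ?_
    have h1 : f t * f t = max (t - ε) 0 / max (t - δ) (ε - δ) :=
      Real.mul_self_sqrt (div_nonneg (le_max_right _ _) (hpos t).le)
    simp only [smul_eq_mul]
    calc f t * t * f t - max (t - ε) 0 = t * (f t * f t) - max (t - ε) 0 := by ring
      _ = _ := by
        rw [h1]
        rcases le_total ε t with h | h
        · have := sub_pos.2 (hab.trans_le h)
          rw [max_eq_left (sub_le_sub_right h δ)]
          field_simp
          ring
        · rw [max_eq_right (sub_nonpos.2 h)]; simp
  have hle : cut ε a ≤ F * b * star F := by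
    have h1 := CStarAlgebra.star_left_conjugate_le_norm_smul (a := F) (b := a - b)
      (ha.isSelfAdjoint.sub hb.isSelfAdjoint)
    rw [← hδ, ← hFF, hFsa, mul_sub, sub_mul] at h1
    rw [hFsa]
    exact (sub_le_sub_iff_left _).1 h1
  obtain ⟨d, hd, hd'⟩ := exists_conj_of_le (cut_nonneg ε a) hle hη
  refine ⟨d * F, ?_, fun Φ h1 h2 => ?_⟩
  · simpa only [star_mul, mul_assoc] using hd
  · have e1 : Φ F = F := by
      rw [hF, NonUnitalStarAlgHom.map_cfcₙ Φ f a (by fun_prop)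
        hf0 (map_continuous Φ) ha.isSelfAdjoint
        (ha.isSelfAdjoint.map Φ), h1]
    have e2 : Φ (cut ε a) = cut ε a := by rw [map_cut Φ hε ha.isSelfAdjoint, h1]
    have e3 : Φ d = d := hd' Φ e2 (by rw [map_mul, map_mul, map_star, e1, h2])
    rw [map_mul, e1, e3]

end CStar

/-! ### Comparison of positive elements -/

section Conj

variable {E E₁ E₂ F F₁ : Type} {A B : Type v}
  [NormedAddCommGroup E] [InnerProductSpace ℂ E] [CompleteSpace E]
  [NormedAddCommGroup E₁] [InnerProductSpace ℂ E₁] [CompleteSpace E₁]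
  [NormedAddCommGroup F] [InnerProductSpace ℂ F] [CompleteSpace F]
  [NormedAddCommGroup F₁] [InnerProductSpace ℂ F₁] [CompleteSpace F₁]
  [NonUnitalCStarAlgebra A] [NonUnitalCStarAlgebra B]

/-- The compression `v x v*` by a bounded operator `v`. -/
def KT.conj (v : E →L[ℂ] F) : KT E E A →L[ℂ] KT F F A :=
  KT.sandwich v v.adjoint (NonUnitalStarAlgHom.id ℂ A)

lemma KT.conj_id (x : KT E E A) : KT.conj (.id ℂ E) x = x := by
  unfold KT.conj
  rw [ContinuousLinearMap.adjoint_id, KT.sandwich_id]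

lemma KT.conj_conj (v : F →L[ℂ] F₁) (w : E →L[ℂ] F) (x : KT E E A) :
    KT.conj v (KT.conj w x) = KT.conj (v ∘L w) x := by
  unfold KT.conj
  rw [KT.sandwich_sandwich, ContinuousLinearMap.adjoint_comp]
  rfl

/-- The product `x b x*`. -/
def KT.sand (x : KT E F A) (b : KT E E A) : KT F F A := KT.comp (KT.comp x b) (KT.adj x)

lemma KT.sand_lmul (v : F →L[ℂ] F₁) (x : KT E F A) (b : KT E E A) :
    KT.sand (KT.lmul v x) b = KT.conj v (KT.sand x b) := by
  unfold KT.sand KT.conj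
  rw [KT.lmul_comp, KT.lmul_comp, KT.adj_lmul, KT.comp_rmul, KT.lmul_rmul]

lemma KT.sand_rmul (w : E₁ →L[ℂ] E) (x : KT E F A) (b : KT E₁ E₁ A) :
    KT.sand (KT.rmul w x) b = KT.sand x (KT.conj w b) := by
  unfold KT.sand KT.conj
  rw [KT.adj_rmul, KT.rmul_comp, ← KT.rmul_comp, ← KT.comp_rmul, KT.rmul_lmul]

lemma KT.sand_sub (x : KT E F A) (b c : KT E E A) :
    KT.sand x (b - c) = KT.sand x b - KT.sand x c := by
  unfold KT.sand
  rw [map_sub, map_sub, sub_apply]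

lemma KT.sand_sand (x : KT F F₁ A) (y : KT E F A) (b : KT E E A) :
    KT.sand x (KT.sand y b) = KT.sand (KT.comp x y) b := by
  unfold KT.sand
  simp only [KT.adj_comp, KT.comp_assoc]

lemma KT.norm_sand_le (x : KT E F A) (b : KT E E A) : ‖KT.sand x b‖ ≤ ‖x‖ ^ 2 * ‖b‖ := by
  refine (KT.norm_comp_le _ _).trans ?_
  rw [KT.norm_adj]
  nlinarith [KT.norm_comp_le x b, norm_nonneg x]

lemma KT.norm_conj_le (v : E →L[ℂ] F) (x : KT E E A) : ‖KT.conj v x‖ ≤ ‖v‖ ^ 2 * ‖x‖ := by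
  refine (KT.norm_sandwich_le _ _ _ _).trans_eq ?_
  rw [LinearIsometryEquiv.norm_map, sq]

lemma KT.conj_nonneg' (v : E →L[ℂ] F) {x : KT E E A} (hx : 0 ≤ x) : 0 ≤ KT.conj v x := by
  obtain ⟨b, rfl⟩ := KT.nonneg_iff.1 hx
  have := KT.adj_comp_self_nonneg (KT.rmul v.adjoint b)
  rwa [KT.adj_rmul, KT.lmul_comp, KT.comp_rmul, KT.lmul_rmul,
    ContinuousLinearMap.adjoint_adjoint] at this

end Conj

section Compare

variable {G : Type u} [TopologicalSpace G] [Group G] {A B : GAlg.{u, v} G}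
  {μ ν ω μ' ν' : URep G}

/-- `v` intertwines the representations `μ` and `ν`. -/
def Intertwines (μ ν : URep G) (v : μ.H →L[ℂ] ν.H) : Prop := ∀ g, ν.op g ∘L v = v ∘L μ.op g

lemma Intertwines.comp {v : ν.H →L[ℂ] ω.H} {w : μ.H →L[ℂ] ν.H} (hv : Intertwines ν ω v)
    (hw : Intertwines μ ν w) : Intertwines μ ω (v ∘L w) := fun g => by
  rw [← ContinuousLinearMap.comp_assoc, hv g, ContinuousLinearMap.comp_assoc, hw g]
  rfl

lemma Intertwines.adjoint {v : μ.H →L[ℂ] ν.H} (hv : Intertwines μ ν v) :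
    Intertwines ν μ v.adjoint := fun g => by
  have h := congrArg ContinuousLinearMap.adjoint (hv g⁻¹)
  rw [ContinuousLinearMap.adjoint_comp, ContinuousLinearMap.adjoint_comp, URep.adjoint_op,
    URep.adjoint_op, inv_inv] at h
  exact h.symm

lemma Intertwines.id (μ : URep G) : Intertwines μ μ (.id ℂ μ.H) := fun _ => rfl

lemma Intertwines.zero (μ ν : URep G) : Intertwines μ ν 0 := fun g => by
  rw [ContinuousLinearMap.comp_zero, ContinuousLinearMap.zero_comp]

lemma Intertwines.add {v w : μ.H →L[ℂ] ν.H} (hv : Intertwines μ ν v) (hw : Intertwines μ ν w) :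
    Intertwines μ ν (v + w) := fun g => by
  rw [ContinuousLinearMap.comp_add, ContinuousLinearMap.add_comp, hv g, hw g]

lemma Intertwines.inl (μ ν : URep G) : Intertwines μ (μ.sum ν) (μ.inl ν) := URep.op_inl μ ν
lemma Intertwines.inr (μ ν : URep G) : Intertwines ν (μ.sum ν) (μ.inr ν) := URep.op_inr μ ν
lemma Intertwines.fst (μ ν : URep G) : Intertwines (μ.sum ν) μ (μ.fst ν) := fun _ => rfl
lemma Intertwines.snd (μ ν : URep G) : Intertwines (μ.sum ν) ν (μ.snd ν) := fun _ => rfl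

lemma KTG.IsInv.lmul {x : KTG μ ν A} (hx : KTG.IsInv x) {v : ν.H →L[ℂ] ν'.H}
    (hv : Intertwines ν ν' v) : KTG.IsInv (KT.lmul v x : KTG μ ν' A) :=
  hx.sandwich (GHom.id A) hv (fun _ => rfl)

lemma KTG.IsInv.rmul {x : KTG μ ν A} (hx : KTG.IsInv x) {w : μ'.H →L[ℂ] μ.H}
    (hw : Intertwines μ' μ w) : KTG.IsInv (KT.rmul w x : KTG μ' ν A) :=
  hx.sandwich (GHom.id A) (fun _ => rfl) (fun g => (hw g).symm)

lemma KTG.IsInv.conj {x : KTG μ μ A} (hx : KTG.IsInv x) {v : μ.H →L[ℂ] ν.H}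
    (hv : Intertwines μ ν v) : KTG.IsInv (KT.conj v x : KTG ν ν A) :=
  hx.sandwich (GHom.id A) hv (fun g => (hv.adjoint g).symm)

lemma KTG.IsInv.zero : KTG.IsInv (0 : KTG μ ν A) := fun _ => map_zero _

lemma KTG.IsInv.smul {x : KTG μ ν A} (hx : KTG.IsInv x) (c : ℂ) : KTG.IsInv (c • x) :=
  fun g => by rw [map_smul, hx g]

lemma KTG.IsInv.sand {d : KTG μ ν A} (hd : KTG.IsInv d) {x : KTG μ μ A} (hx : KTG.IsInv x) :
    KTG.IsInv (KT.sand d x : KTG ν ν A) := (hd.comp hx).comp hd.adj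

lemma KTG.isClosed_isInv : IsClosed {x : KTG μ ν A | KTG.IsInv x} := by
  have : {x : KTG μ ν A | KTG.IsInv x} = ⋂ g, {x | KTG.act g x = x} := by
    ext x; simp [KTG.IsInv]
  rw [this]
  exact isClosed_iInter fun g => isClosed_eq (KTG.act g).continuous continuous_id

lemma KTG.IsInv.cut {x : KTG μ μ A} (hx : KTG.IsInv x) (hsa : IsSelfAdjoint x) {ε : ℝ}
    (hε : 0 ≤ ε) : KTG.IsInv (cut ε x) := fun g => by
  have h := map_cut (KTG.actHom g : KTG μ μ A →⋆ₙₐ[ℂ] KTG μ μ A) hε hsa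
  change KTG.act g (EquivCuntz.cut ε x) = EquivCuntz.cut ε (KTG.act g x) at h
  rw [h, hx g]

lemma KTG.blockSum_eq (x : KTG μ μ A) (y : KTG ν ν A) :
    KTG.blockSum x y = KT.conj (μ.inl ν) x + KT.conj (μ.inr ν) y := by
  unfold KTG.blockSum KT.conj
  rw [URep.adjoint_inl, URep.adjoint_inr]
  rfl

lemma GPos.nonneg (x : GPos A) : 0 ≤ x.a := KT.nonneg_iff.2 x.pos

/-- The element `(a - ε)₊`. -/
def GPos.cut (x : GPos A) (ε : ℝ) (hε : 0 ≤ ε) : GPos A :=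
  ⟨x.μ, EquivCuntz.cut ε x.a, x.inv.cut x.nonneg.isSelfAdjoint hε,
    KT.nonneg_iff.1 (cut_nonneg _ _)⟩

/-- Every element of the fixed point algebra is the square of a positive one. -/
lemma GPos.exists_sqrt (x : GPos A) :
    ∃ b : KTG x.μ x.μ A, KTG.IsInv b ∧ KT.adj b = b ∧ KT.comp b b = x.a := by
  refine ⟨CFC.sqrt x.a, fun g => ?_, (CFC.sqrt_nonneg x.a).isSelfAdjoint,
    CFC.sqrt_mul_sqrt_self _ x.nonneg⟩
  have h := NonUnitalStarAlgHom.map_cfcₙ (KTG.actHom g : KTG x.μ x.μ A →⋆ₙₐ[ℂ] KTG x.μ x.μ A)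
    Real.sqrt x.a (by fun_prop) (by simp) (KTG.act (A := A) g).continuous x.nonneg.isSelfAdjoint
    (by change IsSelfAdjoint (KTG.act g x.a); rw [x.inv g]; exact x.nonneg.isSelfAdjoint)
  change KTG.act g (cfcₙ _ _) = cfcₙ _ (KTG.act g x.a) at h
  rw [CFC.sqrt_eq_real_sqrt x.a x.nonneg, h, x.inv g]

lemma GPos.sub_of_sand {x y : GPos A} (h : ∀ ε : ℝ, 0 < ε → ∃ d : KTG y.μ x.μ A,
    KTG.IsInv d ∧ ‖KT.sand d y.a - x.a‖ ≤ ε) : x ≤ y := GPos.sub_of_approx h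

lemma GPos.exists_sand {x y : GPos A} (h : x ≤ y) {ε : ℝ} (hε : 0 < ε) :
    ∃ d : KTG y.μ x.μ A, KTG.IsInv d ∧ ‖KT.sand d y.a - x.a‖ ≤ ε := h.approx hε

lemma GPos.le_of_eq_sand {x y : GPos A} {d : KTG y.μ x.μ A} (hd : KTG.IsInv d)
    (h : x.a = KT.sand d y.a) : x ≤ y :=
  GPos.sub_of_sand fun ε hε => ⟨d, hd, by rw [h, sub_self, norm_zero]; exact hε.le⟩

/-- `v b v* ≲ b` for every bounded intertwiner `v`. -/
lemma GPos.le_of_eq_conj {x y : GPos A} {v : y.μ.H →L[ℂ] x.μ.H} (hv : Intertwines y.μ x.μ v)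
    (h : x.a = KT.conj v y.a) : x ≤ y := GPos.sub_of_sand fun ε hε => by
  have hpos : 0 < ‖v‖ ^ 2 + 1 := by positivity
  obtain ⟨d, hd, hd'⟩ := GPos.exists_sand (le_refl y) (div_pos hε hpos)
  refine ⟨KT.lmul v d, hd.lmul hv, ?_⟩
  rw [KT.sand_lmul, h, ← map_sub]
  refine (KT.norm_conj_le _ _).trans ?_
  calc ‖v‖ ^ 2 * ‖KT.sand d y.a - y.a‖ ≤ (‖v‖ ^ 2 + 1) * (ε / (‖v‖ ^ 2 + 1)) := by
        gcongr; linarith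
    _ = ε := by field_simp

/-- If `‖a - b‖ < ε`, then `(a - ε)₊ ≲ b`; the element `d` of `exists_conj_cut` is invariant because
it is fixed by every homomorphism fixing `a` and `b`. -/
lemma GPos.cut_le_of_norm_lt {a b : KTG μ μ A} (ha : KTG.IsInv a) (hb : KTG.IsInv b)
    (ha' : ∃ c, a = star c * c) (hb' : ∃ c, b = star c * c) {ε : ℝ} (h : ‖a - b‖ < ε) :
    (⟨μ, a, ha, ha'⟩ : GPos A).cut ε ((norm_nonneg _).trans h.le) ≤ ⟨μ, b, hb, hb'⟩ := by
  refine GPos.sub_of_sand fun η hη => ?_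
  obtain ⟨d, hd, hd'⟩ := exists_conj_cut (KT.nonneg_iff.2 ha') (KT.nonneg_iff.2 hb') h hη
  exact ⟨d, fun g => hd' (KTG.actHom g) (ha g) (hb g), hd⟩

/-- If `d b d*` is at distance less than `ε` from `a`, then `(a - ε)₊ ≲ b`. -/
lemma GPos.cut_le_of_sand {x y : GPos A} {d : KTG y.μ x.μ A} (hd : KTG.IsInv d) {ε : ℝ}
    (h : ‖KT.sand d y.a - x.a‖ < ε) : x.cut ε ((norm_nonneg _).trans h.le) ≤ y := by
  have h1 : ∃ c, KT.sand d y.a = star c * c := KT.nonneg_iff.1 (KT.conj_nonneg _ y.nonneg)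
  rw [norm_sub_rev] at h
  refine (GPos.cut_le_of_norm_lt x.inv (hd.sand y.inv) x.pos h1 h).trans ?_
  exact GPos.le_of_eq_sand hd rfl

lemma GPos.cut_le_of_le {x y : GPos A} (h : x ≤ y) {ε : ℝ} (hε : 0 < ε) :
    x.cut ε hε.le ≤ y := by
  obtain ⟨d, hd, hd'⟩ := GPos.exists_sand h (half_pos hε)
  exact GPos.cut_le_of_sand hd (hd'.trans_lt (half_lt_self hε))

lemma GPos.cut_le {x : GPos A} {ε : ℝ} (hε : 0 < ε) : x.cut ε hε.le ≤ x :=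
  GPos.cut_le_of_le le_rfl hε

lemma GPos.cut_cut {x : GPos A} {ε δ : ℝ} (hε : 0 ≤ ε) (hδ : 0 ≤ δ) :
    (x.cut δ hδ).cut ε hε = x.cut (δ + ε) (add_nonneg hδ hε) := by
  unfold GPos.cut
  simp only [EquivCuntz.cut_cut hε hδ x.nonneg.isSelfAdjoint]

lemma GPos.cut_anti {x : GPos A} {ε δ : ℝ} (hε : 0 ≤ ε) (h : ε ≤ δ) :
    x.cut δ (hε.trans h) ≤ x.cut ε hε := by
  rcases h.eq_or_lt with rfl | h
  · exact le_rfl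
  · have := GPos.cut_le (x := x.cut ε hε) (sub_pos.2 h)
    rw [GPos.cut_cut] at this
    simpa only [add_sub_cancel] using this

lemma GPos.exists_approx_cut {x y : GPos A} {ε : ℝ} (hε : 0 < ε)
    (h : x.cut (ε / 2) (half_pos hε).le ≤ y) :
    ∃ d : KTG y.μ x.μ A, KTG.IsInv d ∧ ‖KT.sand d y.a - x.a‖ ≤ ε := by
  obtain ⟨d, hd, hd'⟩ := GPos.exists_sand h (half_pos hε)
  refine ⟨d, hd, ?_⟩
  have h2 := norm_cut_sub_le (half_pos hε).le x.nonneg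
  have := norm_sub_le_norm_sub_add_norm_sub (KT.sand d y.a) (EquivCuntz.cut (ε / 2) x.a) x.a
  exact this.trans ((add_le_add hd' h2).trans_eq (add_halves ε))

/-- `a ≲ b` as soon as `(a - ε)₊ ≲ b` for all `ε > 0`. -/
lemma GPos.le_of_cut_le {x y : GPos A} (h : ∀ ε (hε : 0 < ε), x.cut ε hε.le ≤ y) : x ≤ y :=
  GPos.sub_of_sand fun _ hε => GPos.exists_approx_cut hε (h _ (half_pos hε))

/-- The condition `‖d b d* - a‖ ≤ ε` is stable under small perturbations of `b`. -/
lemma GPos.exists_sand_stable {x y : GPos A} (h : x ≤ y) {ε : ℝ} (hε : 0 < ε) :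
    ∃ κ > 0, ∃ d : KTG y.μ x.μ A, KTG.IsInv d ∧
      ∀ c : KTG y.μ y.μ A, ‖c - y.a‖ ≤ κ → ‖KT.sand d c - x.a‖ ≤ ε := by
  obtain ⟨d, hd, hd'⟩ := GPos.exists_sand h (half_pos hε)
  have hpos : 0 < ‖d‖ ^ 2 + 1 := by positivity
  refine ⟨ε / 2 / (‖d‖ ^ 2 + 1), div_pos (half_pos hε) hpos, d, hd, fun c hc => ?_⟩
  have h1 : ‖KT.sand d c - KT.sand d y.a‖ ≤ ε / 2 := by
    rw [← KT.sand_sub]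
    refine (KT.norm_sand_le _ _).trans ?_
    calc ‖d‖ ^ 2 * ‖c - y.a‖ ≤ (‖d‖ ^ 2 + 1) * (ε / 2 / (‖d‖ ^ 2 + 1)) := by
          gcongr; linarith
      _ = ε / 2 := by field_simp
  have := norm_sub_le_norm_sub_add_norm_sub (KT.sand d c) (KT.sand d y.a) x.a
  linarith

/-- If `a ≲ b`, then for every `ε > 0` there is `δ > 0` with `(a - ε)₊ ≲ (b - δ)₊`. -/
lemma GPos.exists_cut_le_cut {x y : GPos A} (h : x ≤ y) {ε : ℝ} (hε : 0 < ε) :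
    ∃ δ, ∃ hδ : 0 < δ, x.cut ε hε.le ≤ y.cut δ hδ.le := by
  obtain ⟨κ, hκ, d, hd, hd'⟩ := GPos.exists_sand_stable h (half_pos hε)
  have h1 := hd' (EquivCuntz.cut κ y.a) (norm_cut_sub_le hκ.le y.nonneg)
  exact ⟨κ, hκ, GPos.cut_le_of_sand (y := y.cut κ hκ.le) hd (h1.trans_lt (half_lt_self hε))⟩

/-! #### Direct sums -/

lemma GPos.le_sum_of_eq {x y z : GPos A} {v : x.μ.H →L[ℂ] z.μ.H} {w : y.μ.H →L[ℂ] z.μ.H}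
    (hv : Intertwines x.μ z.μ v) (hw : Intertwines y.μ z.μ w)
    (h : z.a = KT.conj v x.a + KT.conj w y.a) : z ≤ x.sum y := by
  refine GPos.le_of_eq_conj (y := x.sum y) (v := v ∘L x.μ.fst y.μ + w ∘L x.μ.snd y.μ)
    ((hv.comp (Intertwines.fst _ _)).add (hw.comp (Intertwines.snd _ _))) ?_
  change z.a = KT.conj _ (KTG.blockSum x.a y.a)
  rw [KTG.blockSum_eq, map_add, KT.conj_conj, KT.conj_conj, h]
  have e1 : (v ∘L x.μ.fst y.μ + w ∘L x.μ.snd y.μ) ∘L x.μ.inl y.μ = v := by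
    rw [ContinuousLinearMap.add_comp, ContinuousLinearMap.comp_assoc,
      ContinuousLinearMap.comp_assoc, URep.fst_inl, URep.snd_inl, ContinuousLinearMap.comp_zero,
      add_zero, ContinuousLinearMap.comp_id]
  have e2 : (v ∘L x.μ.fst y.μ + w ∘L x.μ.snd y.μ) ∘L x.μ.inr y.μ = w := by
    rw [ContinuousLinearMap.add_comp, ContinuousLinearMap.comp_assoc,
      ContinuousLinearMap.comp_assoc, URep.fst_inr, URep.snd_inr, ContinuousLinearMap.comp_zero,
      zero_add, ContinuousLinearMap.comp_id]
  rw [e1, e2]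

lemma GPos.sum_le_of_eq {x y z : GPos A} {v : x.μ.H →L[ℂ] z.μ.H} {w : y.μ.H →L[ℂ] z.μ.H}
    (hv : Intertwines x.μ z.μ v) (hw : Intertwines y.μ z.μ w)
    (h : z.a = KT.conj v x.a + KT.conj w y.a) (hvv : v.adjoint ∘L v = .id ℂ x.μ.H)
    (hww : w.adjoint ∘L w = .id ℂ y.μ.H) (hvw : v.adjoint ∘L w = 0) : x.sum y ≤ z := by
  have hwv : w.adjoint ∘L v = 0 := by
    have := congrArg ContinuousLinearMap.adjoint hvw
    rwa [ContinuousLinearMap.adjoint_comp, ContinuousLinearMap.adjoint_adjoint, map_zero] at this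
  have key : KTG.blockSum x.a y.a = KT.conj (F := (x.μ.sum y.μ).H)
      (x.μ.inl y.μ ∘L v.adjoint + x.μ.inr y.μ ∘L w.adjoint) z.a := by
    rw [KTG.blockSum_eq, h, map_add, KT.conj_conj, KT.conj_conj]
    simp only [ContinuousLinearMap.add_comp, ContinuousLinearMap.comp_assoc, hvv, hww, hvw, hwv,
      ContinuousLinearMap.comp_zero, ContinuousLinearMap.comp_id, add_zero, zero_add]
  exact GPos.le_of_eq_conj (x := x.sum y)
    (((Intertwines.inl _ _).comp hv.adjoint).add ((Intertwines.inr _ _).comp hw.adjoint)) key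

/-- If `a` is the orthogonal sum of copies of `x` and `y`, then `[a] = [x] + [y]`. -/
lemma CuG.mk_eq_add {x y z : GPos A} {v : x.μ.H →L[ℂ] z.μ.H} {w : y.μ.H →L[ℂ] z.μ.H}
    (hv : Intertwines x.μ z.μ v) (hw : Intertwines y.μ z.μ w)
    (h : z.a = KT.conj v x.a + KT.conj w y.a) (hvv : v.adjoint ∘L v = .id ℂ x.μ.H)
    (hww : w.adjoint ∘L w = .id ℂ y.μ.H) (hvw : v.adjoint ∘L w = 0) :
    CuG.mk z = CuG.mk x + CuG.mk y :=
  le_antisymm (GPos.le_sum_of_eq hv hw h) (GPos.sum_le_of_eq hv hw h hvv hww hvw)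

/-- The functional calculus respects direct sums, as `(a, b) ↦ a ⊕ b` is a homomorphism. -/
lemma GPos.cut_sum (x y : GPos A) {ε : ℝ} (hε : 0 ≤ ε) :
    (x.sum y).cut ε hε = (x.cut ε hε).sum (y.cut ε hε) := by
  let Φ : (KTG x.μ x.μ A × KTG y.μ y.μ A) →⋆ₙₐ[ℂ] KTG (x.μ.sum y.μ) (x.μ.sum y.μ) A :=
    { toFun := fun p => KTG.blockSum p.1 p.2
      map_smul' := by intro c p; simp [KTG.blockSum]
      map_zero' := by simp [KTG.blockSum]
      map_add' := by intro p q; simp only [KTG.blockSum, Prod.fst_add, Prod.snd_add, map_add]; abel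
      map_mul' := fun p q => (KTG.blockSum_comp _ _ _ _).symm
      map_star' := fun p => (KTG.blockSum_adj _ _).symm }
  have h := map_cut Φ hε (a := (x.a, y.a))
    (Prod.ext x.nonneg.isSelfAdjoint y.nonneg.isSelfAdjoint)
  rw [cut_prod hε x.nonneg.isSelfAdjoint y.nonneg.isSelfAdjoint] at h
  change KTG.blockSum _ _ = EquivCuntz.cut ε (KTG.blockSum _ _) at h
  unfold GPos.cut GPos.sum
  simp only [h]

lemma GPos.cut_map (ψ : GHom A B) (x : GPos A) {ε : ℝ} (hε : 0 ≤ ε) :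
    (x.map ψ).cut ε hε = (x.cut ε hε).map ψ := by
  let Φ : KTG x.μ x.μ A →⋆ₙₐ[ℂ] KTG x.μ x.μ B :=
    { toFun := KT.sandwich (.id ℂ x.μ.H) (.id ℂ x.μ.H) ψ.toHom
      map_smul' := fun c x => map_smul _ c x
      map_zero' := map_zero _
      map_add' := map_add _
      map_mul' := fun p q => (KT.sandwich_id_comp ψ p q).symm
      map_star' := fun p => by
        rw [KT.star_def, KT.star_def, KT.sandwich_adj, ContinuousLinearMap.adjoint_id] }
  have h := map_cut Φ hε x.nonneg.isSelfAdjoint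
  change KT.sandwich _ _ _ _ = EquivCuntz.cut ε (KT.sandwich _ _ _ _) at h
  unfold GPos.cut GPos.map
  simp only [h]

end Compare

/-! ### Countable direct sums of representations -/

section ISum

variable {G : Type u} [TopologicalSpace G] [Group G]

/-- The unitary of a Hilbert sum defined by unitaries of the summands. -/
def lpCongr {E : ℕ → Type} [∀ n, NormedAddCommGroup (E n)] [∀ n, InnerProductSpace ℂ (E n)]
    (u : ∀ n, E n ≃ₗᵢ[ℂ] E n) : lp E 2 ≃ₗᵢ[ℂ] lp E 2 where
  toFun f := ⟨fun n => u n (f n), by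
    change Memℓp _ 2
    have h := lp.memℓp f
    rw [← memℓp_norm_iff] at h ⊢
    simpa only [LinearIsometryEquiv.norm_map] using h⟩
  invFun f := ⟨fun n => (u n).symm (f n), by
    change Memℓp _ 2
    have h := lp.memℓp f
    rw [← memℓp_norm_iff] at h ⊢
    simpa only [LinearIsometryEquiv.norm_map] using h⟩
  map_add' f g := lp.ext (funext fun n => (u n).map_add _ _)
  map_smul' c f := lp.ext (funext fun n => (u n).map_smul _ _)
  left_inv f := lp.ext (funext fun n => (u n).symm_apply_apply _)
  right_inv f := lp.ext (funext fun n => (u n).apply_symm_apply _)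
  norm_map' f := by
    rw [lp.norm_eq_tsum_rpow (by norm_num), lp.norm_eq_tsum_rpow (by norm_num)]
    congr 1
    exact tsum_congr fun n => congrArg (· ^ _) ((u n).norm_map (f n))

lemma lpCongr_apply {E : ℕ → Type} [∀ n, NormedAddCommGroup (E n)]
    [∀ n, InnerProductSpace ℂ (E n)] (u : ∀ n, E n ≃ₗᵢ[ℂ] E n) (f : lp E 2) (n : ℕ) :
    lpCongr u f n = u n (f n) := rfl

lemma lpCongr_single {E : ℕ → Type} [∀ n, NormedAddCommGroup (E n)]
    [∀ n, InnerProductSpace ℂ (E n)] (u : ∀ n, E n ≃ₗᵢ[ℂ] E n) (n : ℕ) (x : E n) :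
    lpCongr u (lp.single 2 n x) = lp.single 2 n (u n x) := by
  refine lp.ext (funext fun m => ?_)
  rw [lpCongr_apply]
  by_cases h : m = n
  · subst h
    rw [lp.single_apply_self, lp.single_apply_self]
  · rw [lp.single_apply_ne _ _ _ h, lp.single_apply_ne _ _ _ h, map_zero]

/-- Finitely supported vectors are dense in a Hilbert sum. -/
lemma lp_induction {E : ℕ → Type} [∀ n, NormedAddCommGroup (E n)]
    [∀ n, InnerProductSpace ℂ (E n)] {p : lp E 2 → Prop} (f : lp E 2) (hp : IsClosed {f | p f})
    (zero : p 0) (single : ∀ n x, p (lp.single 2 n x)) (add : ∀ f g, p f → p g → p (f + g)) :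
    p f := by
  have h := lp.hasSum_single (p := 2) (by norm_num) f
  refine hp.mem_of_tendsto h (Eventually.of_forall fun s => ?_)
  change p _
  induction s using Finset.induction_on with
  | empty => simpa using zero
  | insert a s ha ih => rw [Finset.sum_insert ha]; exact add _ _ (single _ _) ih

/-- The countable direct sum of representations. -/
def URep.iSum (μ : ℕ → URep G) : URep G where
  H := lp (fun n => (μ n).H) 2
  separable := by
    have h1 : TopologicalSpace.IsSeparable
        (⋃ n, Set.range fun x : (μ n).H => (lp.single 2 n x : lp (fun n => (μ n).H) 2)) :=
      .iUnion fun n => TopologicalSpace.isSeparable_range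
        (lp.singleContinuousLinearMap ℂ (fun n => (μ n).H) 2 n).continuous
    have h2 := (h1.span (R := ℂ)).closure
    refine TopologicalSpace.isSeparable_univ_iff.1 (h2.mono fun x _ => ?_)
    let W := (Submodule.span ℂ (⋃ n, Set.range fun x : (μ n).H =>
      (lp.single 2 n x : lp (fun n => (μ n).H) 2))).topologicalClosure
    refine lp_induction (p := fun x => x ∈ W) x (Submodule.isClosed_topologicalClosure _)
      W.zero_mem (fun n x => Submodule.le_topologicalClosure _ (Submodule.subset_span
        (Set.mem_iUnion.2 ⟨n, x, rfl⟩))) fun f g => W.add_mem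
  U :=
    { toFun := fun g => lpCongr fun n => (μ n).U g
      map_one' := by
        ext f n
        rw [lpCongr_apply, map_one]; rfl
      map_mul' := fun g h => by
        ext f n
        rw [lpCongr_apply, map_mul]; rfl }
  continuous_apply f := by
    have h0 : IsClosed {f : lp (fun n => (μ n).H) 2 |
        Continuous fun g => lpCongr (fun n => (μ n).U g) f} := by
      refine isClosed_of_closure_subset fun f hf => ?_
      refine continuous_of_uniform_approx_of_continuous fun u hu => ?_
      obtain ⟨ε, hε, hu⟩ := Metric.mem_uniformity_dist.1 hu
      obtain ⟨f', hf', hd⟩ := Metric.mem_closure_iff.1 hf ε hε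
      refine ⟨_, hf', fun g => hu ?_⟩
      rwa [LinearIsometryEquiv.dist_map]
    refine lp_induction (p := fun f => Continuous fun g => lpCongr (fun n => (μ n).U g) f) f h0
      (by simpa only [map_zero] using continuous_const) (fun n x => ?_) fun f f' h h' => by
        simp only [map_add]; exact h.add h'
    simp only [lpCongr_single]
    exact (lp.singleContinuousLinearMap ℂ (fun n => (μ n).H) 2 n).continuous.comp ((μ n).continuous_apply x)

/-- The inclusion of a summand. -/
def URep.single (μ : ℕ → URep G) (n : ℕ) : (μ n).H →L[ℂ] (URep.iSum μ).H :=
  lp.singleContinuousLinearMap ℂ (fun n => (μ n).H) 2 n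

/-- The projection to a summand. -/
def URep.coord (μ : ℕ → URep G) (n : ℕ) : (URep.iSum μ).H →L[ℂ] (μ n).H :=
  lp.evalCLM ℂ (fun n => (μ n).H) 2 n

lemma URep.adjoint_single (μ : ℕ → URep G) (n : ℕ) :
    (URep.single μ n).adjoint = URep.coord μ n := by
  symm
  rw [ContinuousLinearMap.eq_adjoint_iff]
  exact fun f x => (lp.inner_single_right n x f).symm

lemma URep.adjoint_coord (μ : ℕ → URep G) (n : ℕ) :
    (URep.coord μ n).adjoint = URep.single μ n := by
  rw [← URep.adjoint_single, ContinuousLinearMap.adjoint_adjoint]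

lemma URep.coord_single (μ : ℕ → URep G) (n : ℕ) :
    URep.coord μ n ∘L URep.single μ n = .id ℂ (μ n).H := by
  ext x
  exact lp.single_apply_self (E := fun n => (μ n).H) 2 n x

lemma URep.coord_single_ne (μ : ℕ → URep G) {m n : ℕ} (h : m ≠ n) :
    URep.coord μ m ∘L URep.single μ n = 0 := by
  ext x
  exact lp.single_apply_ne (E := fun n => (μ n).H) 2 n x h

lemma Intertwines.single (μ : ℕ → URep G) (n : ℕ) :
    Intertwines (μ n) (URep.iSum μ) (URep.single μ n) := fun g => by
  ext1 x
  exact lpCongr_single (E := fun n => (μ n).H) _ n x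

lemma Intertwines.coord (μ : ℕ → URep G) (n : ℕ) :
    Intertwines (URep.iSum μ) (μ n) (URep.coord μ n) := fun _ => rfl

end ISum

/-! ### Suprema in the equivariant Cuntz semigroup -/

section Sup

variable {G : Type u} [TopologicalSpace G] [Group G] {A B : GAlg.{u, v} G}
  {μ ν ω μ' ν' : URep G}

/-- `a ≲ s a²`, because `(a - ε)₊ = f(a) s a² f(a)` for `f(t)² s t² = (t - ε)₊`. -/
lemma GPos.le_of_eq_smul_sq {x y : GPos A} {v : x.μ.H →L[ℂ] y.μ.H} (hv : Intertwines x.μ y.μ v)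
    {s : ℝ} (hs : 0 < s) (h : KT.conj v.adjoint y.a = s • KT.comp x.a x.a) : x ≤ y := by
  refine GPos.le_of_cut_le fun ε hε => ?_
  have hpos (t : ℝ) : 0 < max t ε := lt_max_of_lt_right hε
  set f : ℝ → ℝ := fun t => √(max (t - ε) 0 / s) / max t ε with hf
  have hfc : Continuous f := (by fun_prop : Continuous fun t : ℝ => √(max (t - ε) 0 / s)).div
    (by fun_prop) fun t => (hpos t).ne'
  have hf0 : f 0 = 0 := by simp [hf, hε.le]
  have hx := x.nonneg.isSelfAdjoint
  have hinv : KTG.IsInv (cfcₙ f x.a) := fun g => by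
    have h := NonUnitalStarAlgHom.map_cfcₙ (KTG.actHom g : KTG x.μ x.μ A →⋆ₙₐ[ℂ] KTG x.μ x.μ A)
      f x.a (by fun_prop) hf0 (KTG.act (A := A) g).continuous hx
      (by change IsSelfAdjoint (KTG.act g x.a); rwa [x.inv g])
    change KTG.act g (cfcₙ _ _) = cfcₙ _ (KTG.act g x.a) at h
    rw [h, x.inv g]
  refine GPos.le_of_eq_sand (hinv.rmul hv.adjoint) ?_
  have hsa : KT.adj (cfcₙ f x.a) = cfcₙ f x.a := cfcₙ_predicate f x.a
  change EquivCuntz.cut ε x.a = KT.sand (KT.rmul v.adjoint (cfcₙ f x.a)) y.a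
  rw [KT.sand_rmul, h, KT.sand, hsa, ← KT.mul_def, ← KT.mul_def, ← KT.mul_def]
  have e : cfcₙ f x.a * (s • (x.a * x.a)) * cfcₙ f x.a
      = cfcₙ (fun t => f t * (s • (t * t)) * f t) x.a := by
    rw [cfcₙ_mul (fun t => f t * (s • (t * t))) f x.a (by fun_prop) (by simp) (by fun_prop) hf0,
      cfcₙ_mul f (fun t => s • (t * t)) x.a (by fun_prop) hf0 (by fun_prop) (by simp),
      cfcₙ_smul s (fun t => t * t) x.a (by fun_prop) (by simp),
      cfcₙ_mul (fun t => t) (fun t => t) x.a (by fun_prop) rfl (by fun_prop) rfl, cfcₙ_id' ℝ x.a]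
  rw [e]
  refine cfcₙ_congr fun t _ => ?_
  have h1 := Real.mul_self_sqrt (div_nonneg (le_max_right (t - ε) 0) hs.le)
  have h2 : f t * (s • (t * t)) * f t
      = (√(max (t - ε) 0 / s) * √(max (t - ε) 0 / s)) * (s * (t * t)) / (max t ε * max t ε) := by
    simp only [hf, smul_eq_mul]
    have := (hpos t).ne'
    field_simp
  rw [h2, h1]
  rcases le_total ε t with h3 | h3
  · have : 0 < t := hε.trans_le h3
    rw [max_eq_left h3]
    field_simp
  · rw [max_eq_right (sub_nonpos.2 h3)]; simp

/-- One step in the construction of suprema: if `a ≲ b` and `X* a X` is an element on a large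
Hilbert space on which a copy of the space of `b` is still free, then `X* a X` is close to some
`X'* b X'` whose corner at the free copy is a multiple of `b²`. -/
lemma GPos.sup_step {x y : GPos A} (hxy : x ≤ y) {ρ : URep G} {q : ρ.H →L[ℂ] y.μ.H}
    (hq : Intertwines ρ y.μ q) (hqq : q ∘L q.adjoint = .id ℂ y.μ.H)
    (X : KTG ρ x.μ A) (hX : KTG.IsInv X) (hX0 : KT.rmul q.adjoint X = 0) {κ : ℝ} (hκ : 0 < κ) :
    ∃ X' : KTG ρ y.μ A, KTG.IsInv X' ∧
      (∀ (σ : URep G) (w : σ.H →L[ℂ] ρ.H), KT.rmul w X = 0 → q ∘L w = 0 → KT.rmul w X' = 0) ∧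
      ‖KT.sand (KT.adj X') y.a - KT.sand (KT.adj X) x.a‖ ≤ κ ∧
      ∃ s : ℝ, 0 < s ∧ KT.conj q (KT.sand (KT.adj X') y.a) = s • KT.comp y.a y.a := by
  obtain ⟨b, hb, hbs, hbb⟩ := y.exists_sqrt
  have hpos : 0 < ‖X‖ ^ 2 + 1 := by positivity
  obtain ⟨d, hd, hd'⟩ := GPos.exists_sand hxy (div_pos (half_pos hκ) hpos)
  obtain ⟨Y, hY⟩ : ∃ Y : KTG ρ y.μ A, Y = KT.comp (KT.adj d) X := ⟨_, rfl⟩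
  obtain ⟨B, hB⟩ : ∃ B : KTG ρ y.μ A, B = KT.rmul q b := ⟨_, rfl⟩
  have hY0 (σ : URep G) (w : σ.H →L[ℂ] ρ.H) (h : KT.rmul w X = 0) : KT.rmul w Y = 0 := by
    rw [hY, ← KT.comp_rmul, h, map_zero]
  set M := ‖KT.comp (KT.comp (KT.adj B) y.a) Y‖ + ‖KT.comp (KT.comp (KT.adj Y) y.a) B‖
    + ‖KT.comp (KT.comp (KT.adj B) y.a) B‖ with hM
  have hM0 : 0 ≤ M := by positivity
  -- the weight of the new summand is small compared with the tolerance
  obtain ⟨t, ht0, ht1, htM⟩ : ∃ t : ℝ, 0 < t ∧ t ≤ 1 ∧ t * M ≤ κ / 2 := by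
    refine ⟨min 1 (κ / 2 / (M + 1)), by positivity, min_le_left _ _, ?_⟩
    calc _ ≤ κ / 2 / (M + 1) * (M + 1) := by
          gcongr
          · exact min_le_right _ _
          · linarith
      _ = κ / 2 := by field_simp
  have hadj : KT.adj (Y + (t : ℂ) • B) = KT.adj Y + (t : ℂ) • KT.adj B := by
    rw [map_add, map_smulₛₗ, Complex.conj_ofReal]
  have hexp : KT.sand (KT.adj (Y + (t : ℂ) • B)) y.a
      = KT.sand (KT.adj Y) y.a + ((t : ℂ) • KT.comp (KT.comp (KT.adj B) y.a) Y
        + (t : ℂ) • KT.comp (KT.comp (KT.adj Y) y.a) B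
        + ((t : ℂ) * (t : ℂ)) • KT.comp (KT.comp (KT.adj B) y.a) B) := by
    unfold KT.sand
    rw [KT.adj_adj, KT.adj_adj, hadj]
    simp only [map_add, map_smul, add_apply, smul_apply, smul_add, smul_smul]
    abel
  refine ⟨Y + (t : ℂ) • B, KTG.IsInv.add (hY ▸ hd.adj.comp hX) ((hB ▸ hb.rmul hq).smul _),
    fun σ w hw hqw => ?_, ?_, t * t, by positivity, ?_⟩
  · rw [map_add, map_smul, hY0 σ w hw, hB, KT.rmul_rmul, hqw, KT.rmul_zero_left, smul_zero,
      add_zero]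
  · have h1 : KT.sand (KT.adj Y) y.a = KT.sand (KT.adj X) (KT.sand d y.a) := by
      rw [KT.sand_sand, hY, KT.adj_comp, KT.adj_adj]
    have h2 : ‖KT.sand (KT.adj X) (KT.sand d y.a) - KT.sand (KT.adj X) x.a‖ ≤ κ / 2 := by
      rw [← KT.sand_sub]
      refine (KT.norm_sand_le _ _).trans ?_
      rw [KT.norm_adj]
      calc _ ≤ (‖X‖ ^ 2 + 1) * (κ / 2 / (‖X‖ ^ 2 + 1)) := by
            gcongr; linarith
        _ = κ / 2 := by field_simp
    have h3 : ‖(t : ℂ) • KT.comp (KT.comp (KT.adj B) y.a) Y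
        + (t : ℂ) • KT.comp (KT.comp (KT.adj Y) y.a) B
        + ((t : ℂ) * (t : ℂ)) • KT.comp (KT.comp (KT.adj B) y.a) B‖ ≤ κ / 2 := by
      refine (norm_add₃_le).trans ((le_trans ?_ htM))
      rw [norm_smul, norm_smul, norm_smul, norm_mul, Complex.norm_real, Real.norm_of_nonneg ht0.le,
        hM, mul_add, mul_add]
      gcongr
      exact mul_le_of_le_one_left ht0.le ht1
    rw [hexp, h1, add_sub_right_comm]
    exact (norm_add_le _ _).trans ((add_le_add h2 h3).trans_eq (add_halves κ))
  · have h1 : KT.rmul q.adjoint (Y + (t : ℂ) • B) = (t : ℂ) • b := by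
      rw [map_add, map_smul, hY0 y.μ _ hX0, hB, KT.rmul_rmul, hqq, zero_add, KT.rmul_id]
    have h2 : KT.lmul q (KT.adj (Y + (t : ℂ) • B)) = (t : ℂ) • b := by
      have := congrArg KT.adj h1
      rwa [KT.adj_rmul, ContinuousLinearMap.adjoint_adjoint, map_smulₛₗ, Complex.conj_ofReal,
        hbs] at this
    have h3 : KT.adj ((t : ℂ) • b) = (t : ℂ) • b := by
      rw [map_smulₛₗ, Complex.conj_ofReal, hbs]
    rw [← KT.sand_lmul, h2, KT.sand, h3, ← hbb]
    simp only [map_smul, smul_apply, smul_smul, KT.comp_assoc]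
    rw [← Complex.ofReal_mul, Complex.coe_smul]

/-- A stage in the construction of the supremum of `x 0 ≲ x 1 ≲ ⋯`: an element `X* a X` on the
Hilbert sum of all the spaces, supported on the first summands, together with a radius `κ` such
that every element within `κ` of `X* a X` nearly dominates `x 0, …, x n`. -/
structure SupStage (x : ℕ → GPos A) (n : ℕ) where
  X : KTG (URep.iSum fun n => (x n).μ) (x n).μ A
  inv : KTG.IsInv X
  vanish : ∀ k, n < k → KT.rmul (URep.single (fun n => (x n).μ) k) X = 0
  κ : ℝ
  pos : 0 < κ
  le : κ ≤ (1 / 2) ^ n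
  stable : ∀ m ≤ n, ∃ d : KTG (URep.iSum fun n => (x n).μ) (x m).μ A, KTG.IsInv d ∧
    ∀ c, ‖c - KT.sand (KT.adj X) (x n).a‖ ≤ κ → ‖KT.sand d c - (x m).a‖ ≤ 1 / (n + 1)

/-- The operator `X* a X` of a stage. -/
def SupStage.val {x : ℕ → GPos A} {n : ℕ} (s : SupStage x n) :
    KTG (URep.iSum fun n => (x n).μ) (URep.iSum fun n => (x n).μ) A :=
  KT.sand (KT.adj s.X) (x n).a

/-- The positive element `X* a X` of a stage. -/
def SupStage.elt {x : ℕ → GPos A} {n : ℕ} (s : SupStage x n) : GPos A where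
  μ := URep.iSum fun n => (x n).μ
  a := s.val
  inv := s.inv.adj.sand (x n).inv
  pos := KT.nonneg_iff.1 (KT.conj_nonneg _ (x n).nonneg)

lemma SupStage.exists_of_step {x : ℕ → GPos A} (h : ∀ n, x n ≤ x (n + 1)) {n : ℕ}
    (X : KTG (URep.iSum fun n => (x n).μ) (x n).μ A) (hX : KTG.IsInv X)
    (hv : ∀ k, n < k → KT.rmul (URep.single (fun n => (x n).μ) k) X = 0) {s : ℝ} (hs : 0 < s)
    (hc : KT.conj (URep.coord (fun n => (x n).μ) n) (KT.sand (KT.adj X) (x n).a)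
      = s • KT.comp (x n).a (x n).a) {β : ℝ} (hβ : 0 < β) :
    ∃ t : SupStage x n, t.X = X ∧ t.κ ≤ β := by
  let y : GPos A := ⟨URep.iSum fun n => (x n).μ, KT.sand (KT.adj X) (x n).a,
    hX.adj.sand (x n).inv, KT.nonneg_iff.1 (KT.conj_nonneg _ (x n).nonneg)⟩
  have hy : x n ≤ y := by
    refine GPos.le_of_eq_smul_sq (y := y) (Intertwines.single (fun n => (x n).μ) n) hs ?_
    rw [← URep.adjoint_single] at hc
    exact hc
  have hm : Monotone x := monotone_nat_of_le_succ h
  have h1 : ∀ᶠ κ in 𝓝[>] (0 : ℝ), ∀ m ∈ Set.Iic n,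
      ∃ d : KTG (URep.iSum fun n => (x n).μ) (x m).μ A, KTG.IsInv d ∧
        ∀ c, ‖c - y.a‖ ≤ κ → ‖KT.sand d c - (x m).a‖ ≤ 1 / (n + 1) := by
    refine (eventually_all_finite (Set.finite_Iic n)).2 fun m hmn => ?_
    obtain ⟨κ, hκ, d, hd, hd'⟩ := GPos.exists_sand_stable ((hm hmn).trans hy)
      (show (0 : ℝ) < 1 / (n + 1) by positivity)
    filter_upwards [Ioc_mem_nhdsGT hκ] with κ' hκ'
    exact ⟨d, hd, fun c hc => hd' c (hc.trans hκ'.2)⟩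
  obtain ⟨κ, h2, h3, h4⟩ := ((h1.and (Ioc_mem_nhdsGT (show 0 < min β ((1 / 2) ^ n) by
    positivity)))).exists
  exact ⟨⟨X, hX, hv, κ, h3, h4.trans (min_le_right _ _), h2⟩, rfl, h4.trans (min_le_left _ _)⟩

/-- Increasing sequences have suprema. The values of successive stages change by at most a fraction
of the radius `κ` of the current stage, so their limit `z` is within `κ` of every one of them: hence
`z` dominates all `x n`, and `(z - ε)₊` is dominated by some `x n`. -/
lemma GPos.exists_sup (x : ℕ → GPos A) (h : ∀ n, x n ≤ x (n + 1)) :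
    ∃ z : GPos A, (∀ n, x n ≤ z) ∧ ∀ ε (hε : 0 < ε), ∃ n, z.cut ε hε.le ≤ x n := by
  have hqq (n : ℕ) : URep.coord (fun n => (x n).μ) n ∘L (URep.coord (fun n => (x n).μ) n).adjoint
      = .id ℂ (x n).μ.H := by rw [URep.adjoint_coord, URep.coord_single]
  have h0 : Nonempty (SupStage x 0) := by
    obtain ⟨X, hX, hv, -, s, hs, hc⟩ := GPos.sup_step (le_refl (x 0))
      (ρ := URep.iSum fun n => (x n).μ) (Intertwines.coord (fun n => (x n).μ) 0) (hqq 0)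
      (0 : KTG (URep.iSum fun n => (x n).μ) (x 0).μ A) KTG.IsInv.zero (map_zero _) one_pos
    obtain ⟨t, -, -⟩ := SupStage.exists_of_step h X hX (fun k hk => hv (x k).μ _ (map_zero _)
      (URep.coord_single_ne (fun n => (x n).μ) hk.ne)) hs hc one_pos
    exact ⟨t⟩
  have h1 (n : ℕ) (s : SupStage x n) : ∃ t : SupStage x (n + 1),
      ‖t.val - s.val‖ ≤ s.κ / 4 ∧ t.κ ≤ s.κ / 2 := by
    have hX0 := s.vanish (n + 1) n.lt_succ_self
    rw [← URep.adjoint_coord] at hX0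
    obtain ⟨X, hX, hv, hd, r, hr, hc⟩ := GPos.sup_step (h n)
      (Intertwines.coord (fun n => (x n).μ) (n + 1)) (hqq (n + 1)) s.X s.inv hX0
      (show 0 < s.κ / 4 by linarith [s.pos])
    obtain ⟨t, rfl, ht⟩ := SupStage.exists_of_step h X hX (fun k hk => hv (x k).μ _
      (s.vanish k (n.lt_succ_self.trans hk))
      (URep.coord_single_ne (fun n => (x n).μ) hk.ne)) hr hc (half_pos s.pos)
    exact ⟨t, hd, ht⟩
  choose f hf1 hf2 using h1
  let st : ∀ n, SupStage x n := fun n => Nat.rec h0.some (fun n s => f n s) n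
  have hs1 (n : ℕ) : ‖(st (n + 1)).val - (st n).val‖ ≤ (st n).κ / 4 := hf1 n (st n)
  have hs2 (n : ℕ) : (st (n + 1)).κ ≤ (st n).κ / 2 := hf2 n (st n)
  let c : ℕ → KTG (URep.iSum fun n => (x n).μ) (URep.iSum fun n => (x n).μ) A :=
    fun n => (st n).val
  have hc (n k : ℕ) : dist (c n) (c (n + k)) ≤ (st n).κ / 2 - (st (n + k)).κ / 2 := by
    induction k with
    | zero => simp
    | succ k ih =>
      have h1 : dist (c (n + k)) (c (n + (k + 1))) ≤ (st (n + k)).κ / 4 := by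
        rw [dist_comm, dist_eq_norm]; exact hs1 (n + k)
      have h2 : (st (n + (k + 1))).κ ≤ (st (n + k)).κ / 2 := hs2 (n + k)
      linarith [dist_triangle (c n) (c (n + k)) (c (n + (k + 1)))]
  have hc' (n k : ℕ) (hk : n ≤ k) : dist (c n) (c k) ≤ (st n).κ / 2 := by
    obtain ⟨k, rfl⟩ := Nat.exists_eq_add_of_le hk
    linarith [hc n k, (st (n + k)).pos]
  have hκ : Tendsto (fun n => (st n).κ / 2) atTop (𝓝 0) := by
    refine squeeze_zero (fun n => (half_pos (st n).pos).le)
      (fun n => (half_le_self (st n).pos.le).trans (st n).le)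
      (tendsto_pow_atTop_nhds_zero_of_lt_one (by norm_num) (by norm_num))
  obtain ⟨z, hz⟩ := cauchySeq_tendsto_of_complete (cauchySeq_of_le_tendsto_0' _ hc' hκ)
  have hzc (n : ℕ) : ‖z - c n‖ ≤ (st n).κ / 2 := by
    rw [← dist_eq_norm, dist_comm]
    exact le_of_tendsto (tendsto_const_nhds.dist hz)
      ((eventually_ge_atTop n).mono fun k hk => hc' n k hk)
  have hzpos : 0 ≤ z := CStarAlgebra.isClosed_nonneg.mem_of_tendsto hz
    (Eventually.of_forall fun n => (st n).elt.nonneg)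
  have hzinv : KTG.IsInv z := KTG.isClosed_isInv.mem_of_tendsto hz
    (Eventually.of_forall fun n => (st n).elt.inv)
  refine ⟨⟨_, z, hzinv, KT.nonneg_iff.1 hzpos⟩, fun m => GPos.sub_of_sand fun ε hε => ?_,
    fun ε hε => ?_⟩
  · obtain ⟨n, hn⟩ := exists_nat_one_div_lt hε
    obtain ⟨d, hd, hd'⟩ := (st (max m n)).stable m (le_max_left _ _)
    refine ⟨d, hd, (hd' z ((hzc _).trans (half_le_self (st _).pos.le))).trans ?_⟩
    refine le_trans ?_ hn.le
    gcongr
    exact le_max_right _ _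
  · obtain ⟨n, hn⟩ := (hκ.eventually (gt_mem_nhds hε)).exists
    refine ⟨n, (GPos.cut_le_of_norm_lt hzinv (st n).elt.inv (KT.nonneg_iff.1 hzpos)
      (st n).elt.pos ((hzc n).trans_lt hn)).trans ?_⟩
    exact GPos.le_of_eq_sand (x := (st n).elt) (st n).inv.adj rfl

end Sup

/-! ### The equivariant Cuntz semigroup as an object of the category `CCu` -/

section CCu

variable {G : Type u} [TopologicalSpace G] [Group G] {A B C : GAlg.{u, v} G}
  {μ ν ω μ' ν' : URep G}

lemma CuG.exists_rep (u : CuG A) : ∃ x, CuG.mk x = u := Quotient.exists_rep u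

lemma CuG.mk_cut_anti (x : GPos A) {ε δ : ℝ} (hε : 0 ≤ ε) (h : ε ≤ δ) :
    CuG.mk (x.cut δ (hε.trans h)) ≤ CuG.mk (x.cut ε hε) := GPos.cut_anti hε h

/-- `[z]` is a supremum of `t n ≤ [z]` as soon as every `[(z - ε)₊]` lies below some `t n`. -/
lemma CuG.isLUB_mk {t : ℕ → CuG A} {z : GPos A} (h1 : ∀ n, t n ≤ CuG.mk z)
    (h2 : ∀ ε (hε : 0 < ε), ∃ n, CuG.mk (z.cut ε hε.le) ≤ t n) :
    IsLUB (Set.range t) (CuG.mk z) := by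
  refine ⟨by rintro _ ⟨n, rfl⟩; exact h1 n, fun u hu => ?_⟩
  obtain ⟨y, rfl⟩ := CuG.exists_rep u
  refine GPos.le_of_cut_le (x := z) (y := y) fun ε hε => ?_
  obtain ⟨n, hn⟩ := h2 ε hε
  exact hn.trans (hu ⟨n, rfl⟩)

lemma CuG.exists_sup {t : ℕ → CuG A} (ht : Monotone t) : ∃ z : GPos A,
    (∀ n, t n ≤ CuG.mk z) ∧ ∀ ε (hε : 0 < ε), ∃ n, CuG.mk (z.cut ε hε.le) ≤ t n := by
  choose x hx using fun n => CuG.exists_rep (t n)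
  obtain ⟨z, h1, h2⟩ := GPos.exists_sup x fun n => by
    have := ht n.le_succ
    rwa [← hx, ← hx] at this
  refine ⟨z, fun n => ?_, fun ε hε => ?_⟩
  · rw [← hx]; exact h1 n
  · obtain ⟨n, hn⟩ := h2 ε hε
    exact ⟨n, by rw [← hx]; exact hn⟩

/-- If `[y] ≤ sup t n`, then each `[(y - ε)₊]` lies below some `t n`. -/
lemma CuG.exists_cut_le {t : ℕ → CuG A} (ht : Monotone t) {u : CuG A}
    (hu : IsLUB (Set.range t) u) {y : GPos A} (hy : CuG.mk y ≤ u) {ε : ℝ} (hε : 0 < ε) :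
    ∃ n, CuG.mk (y.cut ε hε.le) ≤ t n := by
  obtain ⟨z, h1, h2⟩ := CuG.exists_sup ht
  have hyz : y ≤ z := hy.trans ((isLUB_le_iff hu).2 (by rintro _ ⟨n, rfl⟩; exact h1 n))
  obtain ⟨δ, hδ, h⟩ := GPos.exists_cut_le_cut hyz hε
  obtain ⟨n, hn⟩ := h2 δ hδ
  exact ⟨n, le_trans (b := CuG.mk (z.cut δ hδ.le)) h hn⟩

lemma CuG.isLUB_cut (y : GPos A) {δ : ℕ → ℝ} (hδ : ∀ n, 0 < δ n)
    (hlim : Tendsto δ atTop (𝓝 0)) :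
    IsLUB (Set.range fun n => CuG.mk (y.cut (δ n) (hδ n).le)) (CuG.mk y) := by
  refine CuG.isLUB_mk (fun n => GPos.cut_le (hδ n)) fun ε hε => ?_
  obtain ⟨n, hn⟩ := (hlim.eventually (ge_mem_nhds hε)).exists
  exact ⟨n, CuG.mk_cut_anti y (hδ n).le hn⟩

/-- `u ≪ [a]` if and only if `u ≤ [(a - δ)₊]` for some `δ > 0`. -/
lemma CuG.wayBelow_mk {u : CuG A} {y : GPos A} :
    WayBelow u (CuG.mk y) ↔ ∃ δ, ∃ hδ : 0 < δ, u ≤ CuG.mk (y.cut δ hδ.le) := by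
  refine ⟨fun h => ?_, fun ⟨δ, hδ, h⟩ t z ht hz hy => ?_⟩
  · obtain ⟨k, hk⟩ := h (fun n => CuG.mk (y.cut (1 / ((n : ℝ) + 1)) (by positivity))) (CuG.mk y)
      (fun m n hmn => CuG.mk_cut_anti y (by positivity) (by gcongr))
      (CuG.isLUB_cut y (fun n => by positivity) tendsto_one_div_add_atTop_nhds_zero_nat) le_rfl
    exact ⟨1 / ((k : ℝ) + 1), by positivity, hk⟩
  · obtain ⟨n, hn⟩ := CuG.exists_cut_le ht hz hy hδ
    exact ⟨n, h.trans hn⟩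

lemma CuG.mk_cut_wayBelow (y : GPos A) {δ ε : ℝ} (hδ : 0 ≤ δ) (h : δ < ε) :
    WayBelow (CuG.mk (y.cut ε (hδ.trans h.le))) (CuG.mk (y.cut δ hδ)) :=
  CuG.wayBelow_mk.2 ⟨ε - δ, sub_pos.2 h, by simp only [GPos.cut_cut, add_sub_cancel, le_refl]⟩

lemma URep.fst_inl_apply (μ ν : URep G) (x : μ.H) : μ.fst ν (μ.inl ν x) = x := rfl
lemma URep.fst_inr_apply (μ ν : URep G) (x : ν.H) : μ.fst ν (μ.inr ν x) = 0 := rfl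
lemma URep.snd_inl_apply (μ ν : URep G) (x : μ.H) : μ.snd ν (μ.inl ν x) = 0 := rfl
lemma URep.snd_inr_apply (μ ν : URep G) (x : ν.H) : μ.snd ν (μ.inr ν x) = x := rfl

lemma GPos.sum_comm_le (x y : GPos A) : x.sum y ≤ y.sum x := by
  refine GPos.le_of_eq_conj (x := x.sum y) (y := y.sum x)
    (v := x.μ.inl y.μ ∘L y.μ.snd x.μ + x.μ.inr y.μ ∘L y.μ.fst x.μ)
    (((Intertwines.inl _ _).comp (Intertwines.snd _ _)).add
      ((Intertwines.inr _ _).comp (Intertwines.fst _ _))) ?_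
  change KTG.blockSum x.a y.a = KT.conj _ (KTG.blockSum y.a x.a)
  rw [KTG.blockSum_eq, KTG.blockSum_eq, map_add, KT.conj_conj, KT.conj_conj, add_comm]
  congr 2 <;> congr 1 <;> ext1 a <;>
  simp only [add_apply, ContinuousLinearMap.comp_apply, URep.fst_inl_apply, URep.fst_inr_apply,
    URep.snd_inl_apply, URep.snd_inr_apply, map_zero, add_zero, zero_add]

lemma GPos.sum_assoc_le (x y z : GPos A) : (x.sum y).sum z ≤ x.sum (y.sum z) := by
  refine GPos.le_of_eq_conj (x := (x.sum y).sum z) (y := x.sum (y.sum z))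
    (v := ((x.μ.sum y.μ).inl z.μ ∘L x.μ.inl y.μ) ∘L x.μ.fst (y.μ.sum z.μ)
      + (((x.μ.sum y.μ).inl z.μ ∘L x.μ.inr y.μ) ∘L y.μ.fst z.μ
        + (x.μ.sum y.μ).inr z.μ ∘L y.μ.snd z.μ) ∘L x.μ.snd (y.μ.sum z.μ))
    ((((Intertwines.inl _ _).comp (Intertwines.inl _ _)).comp (Intertwines.fst _ _)).add
      (((((Intertwines.inl _ _).comp (Intertwines.inr _ _)).comp (Intertwines.fst _ _)).add
      ((Intertwines.inr _ _).comp (Intertwines.snd _ _))).comp (Intertwines.snd _ _))) ?_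
  change KTG.blockSum (KTG.blockSum x.a y.a) z.a
    = KT.conj _ (KTG.blockSum x.a (KTG.blockSum y.a z.a))
  simp only [KTG.blockSum_eq, map_add, KT.conj_conj, ← add_assoc]
  congr 3 <;> congr 1 <;> ext1 a <;>
  simp only [add_apply, ContinuousLinearMap.comp_apply, URep.fst_inl_apply, URep.fst_inr_apply,
    URep.snd_inl_apply, URep.snd_inr_apply, map_zero, add_zero, zero_add]

lemma CuG.add_comm (x y : CuG A) : x + y = y + x := by
  obtain ⟨x, rfl⟩ := CuG.exists_rep x
  obtain ⟨y, rfl⟩ := CuG.exists_rep y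
  exact le_antisymm (GPos.sum_comm_le x y) (GPos.sum_comm_le y x)

lemma CuG.add_le_add {x x' y y' : CuG A} (h : x ≤ x') (h' : y ≤ y') : x + y ≤ x' + y' := by
  obtain ⟨x, rfl⟩ := CuG.exists_rep x
  obtain ⟨y, rfl⟩ := CuG.exists_rep y
  obtain ⟨x', rfl⟩ := CuG.exists_rep x'
  obtain ⟨y', rfl⟩ := CuG.exists_rep y'
  exact GPos.sum_mono h h'

lemma CuG.add_assoc (x y z : CuG A) : x + y + z = x + (y + z) := by
  have h (x y z : CuG A) : x + y + z ≤ x + (y + z) := by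
    obtain ⟨x, rfl⟩ := CuG.exists_rep x
    obtain ⟨y, rfl⟩ := CuG.exists_rep y
    obtain ⟨z, rfl⟩ := CuG.exists_rep z
    exact GPos.sum_assoc_le x y z
  refine le_antisymm (h x y z) ?_
  -- the reverse inequality follows from commutativity
  rw [CuG.add_comm x, CuG.add_comm y, CuG.add_comm (x + y), CuG.add_comm x]
  exact h z y x

lemma URep.zero_eq (x : (URep.zero : URep G).H) : x = 0 :=
  Subsingleton.elim (α := EuclideanSpace ℂ (Fin 0)) x 0

lemma CuG.zero_add (x : CuG A) : 0 + x = x := by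
  obtain ⟨x, rfl⟩ := CuG.exists_rep x
  refine (CuG.mk_eq_add (z := x) (x := ⟨URep.zero, 0, fun g => map_zero _, 0, by simp⟩) (y := x)
    (Intertwines.zero _ _) (Intertwines.id _) ?_ ?_ ?_ ?_).symm
  · rw [map_zero, KT.conj_id, _root_.zero_add]
  · ext1 x
    rw [URep.zero_eq x, map_zero, map_zero]
  · rw [ContinuousLinearMap.adjoint_id]; rfl
  · rw [map_zero, ContinuousLinearMap.zero_comp]

lemma CuG.isCCu (A : GAlg.{u, v} G) : IsCCu (CuG A) where
  add_assoc := CuG.add_assoc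
  add_comm := CuG.add_comm
  zero_add := CuG.zero_add
  add_le_add _ _ _ _ := CuG.add_le_add
  exists_sup s hs := by
    obtain ⟨z, h1, h2⟩ := CuG.exists_sup hs
    exact ⟨_, CuG.isLUB_mk h1 h2⟩
  exists_rapid x := by
    obtain ⟨x, rfl⟩ := CuG.exists_rep x
    refine ⟨fun n => CuG.mk (x.cut (1 / ((n : ℝ) + 1)) (by positivity)), fun n => ?_,
      CuG.isLUB_cut x (fun n => by positivity) tendsto_one_div_add_atTop_nhds_zero_nat⟩
    refine CuG.mk_cut_wayBelow x _ ?_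
    push_cast
    gcongr
    linarith
  sup_add s t x y hs ht hx hy := by
    obtain ⟨x, rfl⟩ := CuG.exists_rep x
    obtain ⟨y, rfl⟩ := CuG.exists_rep y
    refine CuG.isLUB_mk (z := x.sum y)
      (fun n => CuG.add_le_add (hx.1 ⟨n, rfl⟩) (hy.1 ⟨n, rfl⟩)) fun ε hε => ?_
    obtain ⟨n, hn⟩ := CuG.exists_cut_le hs hx le_rfl hε
    obtain ⟨m, hm⟩ := CuG.exists_cut_le ht hy le_rfl hε
    refine ⟨max n m, ?_⟩
    rw [GPos.cut_sum]
    exact CuG.add_le_add (hn.trans (hs (le_max_left _ _))) (hm.trans (ht (le_max_right _ _)))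
  wayBelow_add x x' y y' hx hy := by
    obtain ⟨x', rfl⟩ := CuG.exists_rep x'
    obtain ⟨y', rfl⟩ := CuG.exists_rep y'
    obtain ⟨δ, hδ, h⟩ := CuG.wayBelow_mk.1 hx
    obtain ⟨δ', hδ', h'⟩ := CuG.wayBelow_mk.1 hy
    have hm : 0 < min δ δ' := lt_min hδ hδ'
    refine CuG.wayBelow_mk (y := x'.sum y').2 ⟨min δ δ', hm, ?_⟩
    rw [GPos.cut_sum]
    exact CuG.add_le_add (h.trans (CuG.mk_cut_anti _ hm.le (min_le_left _ _)))
      (h'.trans (CuG.mk_cut_anti _ hm.le (min_le_right _ _)))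

/-! #### Functoriality -/

lemma CuG.mk_congr {μ : URep G} {a b : KTG μ μ A} (h : a = b) (ha : KTG.IsInv a)
    (ha' : ∃ c, a = star c * c) (hb : KTG.IsInv b) (hb' : ∃ c, b = star c * c) :
    CuG.mk ⟨μ, a, ha, ha'⟩ = CuG.mk ⟨μ, b, hb, hb'⟩ := by
  subst h; rfl

lemma CuG.map_mono (ψ : GHom A B) : Monotone (CuG.map ψ) := fun x y h => by
  obtain ⟨x, rfl⟩ := CuG.exists_rep x
  obtain ⟨y, rfl⟩ := CuG.exists_rep y
  exact GPos.map_mono ψ h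

lemma KT.conj_sandwich (ψ : GHom A B) (v : μ.H →L[ℂ] ν.H) (x : KTG μ μ A) :
    KT.sandwich (.id ℂ ν.H) (.id ℂ ν.H) ψ.toHom (KT.conj v x)
      = KT.conj v (KT.sandwich (.id ℂ μ.H) (.id ℂ μ.H) ψ.toHom x) := by
  unfold KT.conj
  rw [KT.sandwich_sandwich, KT.sandwich_sandwich]
  rfl

lemma CuG.map_isCCuHom (ψ : GHom A B) : IsCCuHom (CuG.map ψ) where
  monotone := CuG.map_mono ψ
  map_zero := CuG.mk_congr (map_zero _) _ _ _ _
  map_add x y := by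
    obtain ⟨x, rfl⟩ := CuG.exists_rep x
    obtain ⟨y, rfl⟩ := CuG.exists_rep y
    refine CuG.mk_congr (μ := x.μ.sum y.μ) ?_ _ _ _ _
    have key : KT.sandwich (.id ℂ (x.μ.sum y.μ).H) (.id ℂ (x.μ.sum y.μ).H) ψ.toHom
        (KTG.blockSum x.a y.a) = KTG.blockSum (KT.sandwich (.id ℂ x.μ.H) (.id ℂ x.μ.H) ψ.toHom x.a :
          KTG x.μ x.μ B) (KT.sandwich (.id ℂ y.μ.H) (.id ℂ y.μ.H) ψ.toHom y.a) := by
      rw [KTG.blockSum_eq, KTG.blockSum_eq, map_add, KT.conj_sandwich, KT.conj_sandwich]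
    exact key
  map_sup s x hs hx := by
    obtain ⟨x, rfl⟩ := CuG.exists_rep x
    refine CuG.isLUB_mk (z := x.map ψ) (fun n => CuG.map_mono ψ (hx.1 ⟨n, rfl⟩)) fun ε hε => ?_
    obtain ⟨n, hn⟩ := CuG.exists_cut_le hs hx le_rfl hε
    refine ⟨n, ?_⟩
    rw [GPos.cut_map]
    exact CuG.map_mono ψ hn
  map_wayBelow x y h := by
    obtain ⟨y, rfl⟩ := CuG.exists_rep y
    obtain ⟨δ, hδ, h⟩ := CuG.wayBelow_mk.1 h
    refine CuG.wayBelow_mk (y := y.map ψ).2 ⟨δ, hδ, ?_⟩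
    rw [GPos.cut_map]
    exact CuG.map_mono ψ h

lemma CuG.map_map (ψ : GHom B C) (φ : GHom A B) (χ : GHom A C)
    (h : ∀ a, ψ.toHom (φ.toHom a) = χ.toHom a) (x : CuG A) :
    CuG.map ψ (CuG.map φ x) = CuG.map χ x := by
  obtain ⟨x, rfl⟩ := CuG.exists_rep x
  refine CuG.mk_congr (μ := x.μ) ?_ _ _ _ _
  have hc : ψ.toHom.comp φ.toHom = χ.toHom := NonUnitalStarAlgHom.ext h
  refine (KT.sandwich_sandwich _ _ _ _ _ _ _).trans ?_
  rw [hc]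
  rfl

end CCu

/-! ### Compact operators as a `C*`-algebra -/

section CStarGeneral

variable {D : Type*} [NonUnitalCStarAlgebra D]

/-- For `m = t₋` and `p = m^{1/2}`, one has `p t p = -m²`. -/
lemma negPart_mul_mul_negPart {t : D} (ht : IsSelfAdjoint t) :
    cfcₙ (fun s : ℝ => √(max (-s) 0)) t * t * cfcₙ (fun s : ℝ => √(max (-s) 0)) t
      = -(cfcₙ (fun s : ℝ => max (-s) 0) t * cfcₙ (fun s : ℝ => max (-s) 0) t) := by
  have e : cfcₙ (fun s : ℝ => √(max (-s) 0)) t * t * cfcₙ (fun s : ℝ => √(max (-s) 0)) t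
      = cfcₙ (fun s : ℝ => √(max (-s) 0) * s * √(max (-s) 0)) t := by
    rw [cfcₙ_mul (fun s : ℝ => √(max (-s) 0) * s) (fun s : ℝ => √(max (-s) 0)) t (by fun_prop)
      (by simp) (by fun_prop) (by simp), cfcₙ_mul (fun s : ℝ => √(max (-s) 0)) (fun s => s) t
      (by fun_prop) (by simp) (by fun_prop) rfl, cfcₙ_id' ℝ t]
  rw [e, ← cfcₙ_mul _ _ t (by fun_prop) (by simp) (by fun_prop) (by simp), ← cfcₙ_neg]
  refine cfcₙ_congr fun s _ => ?_
  change √(max (-s) 0) * s * √(max (-s) 0) = -(max (-s) 0 * max (-s) 0)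
  have h := Real.mul_self_sqrt (le_max_right (-s) 0)
  rcases le_total (-s) 0 with h1 | h1
  · simp [max_eq_right h1]
  · rw [max_eq_left h1] at h ⊢
    linear_combination s * h

lemma quasispectrum_nonneg_of_negPart_eq_zero {t : D} (ht : IsSelfAdjoint t)
    (h : cfcₙ (fun s : ℝ => max (-s) 0) t = 0) {s : ℝ} (hs : s ∈ quasispectrum ℝ t) : 0 ≤ s := by
  have h2 := norm_apply_le_norm_cfcₙ (fun s : ℝ => max (-s) 0) t hs (by fun_prop) (by simp)
  rw [h, norm_zero] at h2
  exact neg_nonpos.1 (max_eq_right_iff.1 (norm_le_zero_iff.1 h2))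

lemma sqrt_mul_sqrt_of_quasispectrum_nonneg {t : D} (ht : IsSelfAdjoint t)
    (hq : ∀ s ∈ quasispectrum ℝ t, 0 ≤ s) : cfcₙ Real.sqrt t * cfcₙ Real.sqrt t = t := by
  rw [← cfcₙ_mul _ _ t (by fun_prop) (by simp) (by fun_prop) (by simp)]
  conv_rhs => rw [← cfcₙ_id' ℝ t]
  exact cfcₙ_congr fun s hs => Real.mul_self_sqrt (hq s hs)

lemma map_cfcₙ_of_map_eq {t : D} (ht : IsSelfAdjoint t) {f : ℝ → ℝ} (hf : Continuous f)
    (hf0 : f 0 = 0) (Φ : D →⋆ₙₐ[ℂ] D) (hΦ : Φ t = t) : Φ (cfcₙ f t) = cfcₙ f t := by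
  open scoped CStarAlgebra in
  rw [NonUnitalStarAlgHom.map_cfcₙ Φ f t hf.continuousOn hf0 (map_continuous Φ) ht
    (by rwa [hΦ]), hΦ]

/-- The approximate unit `s² / (|s| + 1/(n+1))²`. -/
def approxUnit (s : D) (n : ℕ) : D := cfcₙ (fun t : ℝ => (t / (|t| + 1 / ((n : ℝ) + 1))) ^ 2) s

lemma abs_add_one_div_pos (n : ℕ) (t : ℝ) : 0 < |t| + 1 / ((n : ℝ) + 1) := by positivity

lemma continuous_div_abs_add (n : ℕ) {f : ℝ → ℝ} (hf : Continuous f) :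
    Continuous fun t : ℝ => f t / (|t| + 1 / ((n : ℝ) + 1)) :=
  hf.div (by fun_prop) fun t => (abs_add_one_div_pos n t).ne'

lemma abs_div_abs_add_le_one (n : ℕ) (t : ℝ) : |t / (|t| + 1 / ((n : ℝ) + 1))| ≤ 1 := by
  rw [abs_div, abs_of_pos (abs_add_one_div_pos n t), div_le_one (abs_add_one_div_pos n t)]
  have : (0 : ℝ) ≤ 1 / ((n : ℝ) + 1) := by positivity
  linarith

lemma norm_approxUnit_le (s : D) (n : ℕ) : ‖approxUnit s n‖ ≤ 1 :=
  norm_cfcₙ_le fun t _ => by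
    rw [norm_pow, Real.norm_eq_abs]
    exact pow_le_one₀ (abs_nonneg _) (abs_div_abs_add_le_one n t)

lemma isSelfAdjoint_approxUnit (s : D) (n : ℕ) : IsSelfAdjoint (approxUnit s n) :=
  cfcₙ_predicate _ s

lemma norm_approxUnit_mul_sub_le {s : D} (hs : IsSelfAdjoint s) (n : ℕ) :
    ‖approxUnit s n * s - s‖ ≤ 2 / ((n : ℝ) + 1) := by
  have hc := continuous_div_abs_add n continuous_id
  simp only [id] at hc
  have e : approxUnit s n * s - s
      = cfcₙ (fun t : ℝ => (t / (|t| + 1 / ((n : ℝ) + 1))) ^ 2 * t - t) s := by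
    rw [cfcₙ_sub (fun t : ℝ => (t / (|t| + 1 / ((n : ℝ) + 1))) ^ 2 * t) (fun t => t) s
      ((hc.pow 2).mul continuous_id).continuousOn (by simp) (by fun_prop) rfl,
      cfcₙ_mul (fun t : ℝ => (t / (|t| + 1 / ((n : ℝ) + 1))) ^ 2) (fun t => t) s
      (hc.pow 2).continuousOn (by simp) (by fun_prop) rfl, cfcₙ_id' ℝ s]
    rfl
  rw [e]
  refine norm_cfcₙ_le fun t _ => ?_
  obtain ⟨δ, hδ⟩ : ∃ δ : ℝ, δ = 1 / ((n : ℝ) + 1) := ⟨_, rfl⟩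
  have hδ0 : 0 < δ := by rw [hδ]; positivity
  have h2 : 2 / ((n : ℝ) + 1) = 2 * δ := by rw [hδ]; ring
  rw [← hδ, h2, Real.norm_eq_abs]
  have hp : 0 < |t| + δ := by positivity
  have e2 : (t / (|t| + δ)) ^ 2 * t - t = -(t * (δ * (2 * |t| + δ)) / (|t| + δ) ^ 2) := by
    field_simp
    rw [← sq_abs t]
    ring
  rw [e2, abs_neg, abs_div, abs_mul, abs_of_pos (by positivity : 0 < δ * (2 * |t| + δ)),
    abs_of_pos (by positivity : 0 < (|t| + δ) ^ 2), div_le_iff₀ (by positivity)]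
  nlinarith [mul_nonneg hδ0.le (mul_nonneg (abs_nonneg t) hδ0.le), pow_pos hδ0 3]

lemma exists_mul_eq_approxUnit {s : D} (hs : IsSelfAdjoint s) (n : ℕ) :
    ∃ l, l * s = approxUnit s n := by
  have hc := continuous_div_abs_add n (continuous_div_abs_add n continuous_id)
  simp only [id] at hc
  refine ⟨cfcₙ (fun t : ℝ => t / (|t| + 1 / ((n : ℝ) + 1)) / (|t| + 1 / ((n : ℝ) + 1))) s, ?_⟩
  nth_rewrite 2 [← cfcₙ_id' ℝ s]
  rw [← cfcₙ_mul _ _ s hc.continuousOn (by simp) (by fun_prop) rfl]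
  refine cfcₙ_congr fun t _ => ?_
  change t / (|t| + 1 / ((n : ℝ) + 1)) / (|t| + 1 / ((n : ℝ) + 1)) * t
    = (t / (|t| + 1 / ((n : ℝ) + 1))) ^ 2
  ring

/-- The approximate unit associated with `s ≥ 0` is of the form `g s g`, with `g` in the functional
calculus of `s`. -/
lemma exists_conj_eq_approxUnit {s : D} (hs : IsSelfAdjoint s)
    (hq : ∀ t ∈ quasispectrum ℝ s, 0 ≤ t) (n : ℕ) :
    ∃ g : D, IsSelfAdjoint g ∧ g * s * g = approxUnit s n ∧
      ∀ Φ : D →⋆ₙₐ[ℂ] D, Φ s = s → Φ g = g := by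
  have hc := continuous_div_abs_add n Real.continuous_sqrt
  refine ⟨cfcₙ (fun t : ℝ => √t / (|t| + 1 / ((n : ℝ) + 1))) s, cfcₙ_predicate _ s, ?_,
    fun Φ hΦ => map_cfcₙ_of_map_eq hs hc (by simp) Φ hΦ⟩
  nth_rewrite 2 [← cfcₙ_id' ℝ s]
  rw [← cfcₙ_mul _ _ s hc.continuousOn (by simp) (by fun_prop) rfl,
    ← cfcₙ_mul _ _ s (by exact (hc.mul continuous_id).continuousOn) (by simp) hc.continuousOn (by simp)]
  refine cfcₙ_congr fun t ht => ?_
  have h := Real.mul_self_sqrt (hq t ht)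
  change √t / (|t| + 1 / ((n : ℝ) + 1)) * t * (√t / (|t| + 1 / ((n : ℝ) + 1)))
    = (t / (|t| + 1 / ((n : ℝ) + 1))) ^ 2
  generalize |t| + 1 / ((n : ℝ) + 1) = b
  calc _ = (√t * √t) * t / b ^ 2 := by ring
    _ = _ := by rw [h, div_pow, sq t]

/-- A positive linear functional is continuous, and the Cauchy–Schwarz inequality holds. -/
lemma continuous_and_cauchySchwarz_of_nonneg (τ : D →ₗ[ℂ] ℂ) (h : ∀ k, 0 ≤ τ (star k * k)) :
    Continuous τ ∧ ∀ r, τ (star r * r) = 0 → ∀ k, τ (k * r) = 0 := by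
  let _ := CStarAlgebra.spectralOrder D
  have _ := CStarAlgebra.spectralOrderedRing D
  let f : D →ₚ[ℂ] ℂ := PositiveLinearMap.mk₀ τ fun a ha => by
    obtain ⟨b, rfl⟩ := CStarAlgebra.nonneg_iff_eq_star_mul_self.1 ha
    exact h b
  refine ⟨map_continuous f, fun r hr k => ?_⟩
  have h1 := norm_inner_le_norm (𝕜 := ℂ) (f.toPreGNS (star k)) (f.toPreGNS r)
  have h2 : ‖f.toPreGNS r‖ = 0 := by
    have h3 := f.preGNS_norm_sq (f.toPreGNS r)
    change _ = τ (star r * r) at h3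
    rw [hr] at h3
    have : ‖f.toPreGNS r‖ ^ 2 = 0 := by exact_mod_cast h3
    exact pow_eq_zero_iff two_ne_zero |>.1 this
  rw [h2, mul_zero, PositiveLinearMap.preGNS_inner_def] at h1
  have h4 := norm_le_zero_iff.1 h1
  change τ (star (star k) * r) = 0 at h4
  rwa [star_star] at h4

end CStarGeneral

section Compact

variable {E F F₁ : Type}
  [NormedAddCommGroup E] [InnerProductSpace ℂ E] [CompleteSpace E]
  [NormedAddCommGroup F] [InnerProductSpace ℂ F] [CompleteSpace F]
  [NormedAddCommGroup F₁] [InnerProductSpace ℂ F₁] [CompleteSpace F₁]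

/-- Strong convergence of a bounded family becomes norm convergence after composition with a
compact operator. -/
lemma tendsto_comp_of_isCompactOperator {α : Type*} {l : Filter α} {T : α → F →L[ℂ] F₁}
    {T₀ : F →L[ℂ] F₁} {C : ℝ} (hC : ∀ i, ‖T i‖ ≤ C)
    (hT : ∀ x, Tendsto (fun i => T i x) l (𝓝 (T₀ x))) {k : E →L[ℂ] F}
    (hk : IsCompactOperator k) : Tendsto (fun i => T i ∘L k) l (𝓝 (T₀ ∘L k)) := by
  rw [tendsto_iff_norm_sub_tendsto_zero, Metric.tendsto_nhds]
  intro ε hε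
  have hpos : 0 < |C| + ‖T₀‖ + 1 := by positivity
  obtain ⟨δ, hδ0, hδ⟩ : ∃ δ : ℝ, 0 < δ ∧ δ * (|C| + ‖T₀‖ + 1) = ε / 2 :=
    ⟨ε / 2 / (|C| + ‖T₀‖ + 1), by positivity, by field_simp⟩
  obtain ⟨t, ht, hcov⟩ := Metric.totallyBounded_iff.1
    (hk.isCompact_closure_image_closedBall 1).totallyBounded δ hδ0
  have h1 : ∀ᶠ i in l, ∀ y ∈ t, dist (T i y) (T₀ y) < δ :=
    (eventually_all_finite ht).2 fun y _ => Metric.tendsto_nhds.1 (hT y) δ hδ0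
  filter_upwards [h1] with i hi
  rw [Real.dist_0_eq_abs, abs_of_nonneg (norm_nonneg _)]
  refine lt_of_le_of_lt (b := ε / 2) ?_ (half_lt_self hε)
  refine ContinuousLinearMap.opNorm_le_of_unit_norm (half_pos hε).le fun x hx => ?_
  have hx' : k x ∈ closure (k '' Metric.closedBall 0 1) :=
    subset_closure ⟨x, by simp [hx], rfl⟩
  obtain ⟨y, hy, hxy⟩ := Set.mem_iUnion₂.1 (hcov hx')
  have e : (T i ∘L k - T₀ ∘L k) x = T i (k x - y) + (T i y - T₀ y) - T₀ (k x - y) := by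
    simp only [sub_apply, ContinuousLinearMap.comp_apply, map_sub]
    abel
  have hxy' : ‖k x - y‖ ≤ δ := by rw [← dist_eq_norm]; exact (Metric.mem_ball.1 hxy).le
  have hi' := hi y hy
  rw [dist_eq_norm] at hi'
  rw [e]
  calc _ ≤ ‖T i‖ * ‖k x - y‖ + ‖T i y - T₀ y‖ + ‖T₀‖ * ‖k x - y‖ :=
        (norm_sub_le _ _).trans (add_le_add ((norm_add_le _ _).trans
          (add_le_add_left ((T i).le_opNorm _) _)) (T₀.le_opNorm _))
    _ ≤ |C| * δ + δ + ‖T₀‖ * δ := by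
        gcongr
        exact (hC i).trans (le_abs_self C)
    _ = ε / 2 := by rw [← hδ]; ring

lemma Cpt.norm_def (k : Cpt E F) : ‖k‖ = ‖k.1‖ := rfl

instance : CompleteSpace (Cpt E F) :=
  (isClosed_setOfPred_isCompactOperator (σ₁₂ := RingHom.id ℂ) (M₁ := E) (M₂ := F)).completeSpace_coe

/-- The `C*`-algebra `K(E)`. -/
instance : NonUnitalCStarAlgebra (Cpt E E) where
  __ := (inferInstance : NormedAddCommGroup (Cpt E E))
  __ := (inferInstance : NormedSpace ℂ (Cpt E E))
  mul k l := Cpt.comp k l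
  mul_assoc _ _ _ := rfl
  left_distrib k l l' := map_add (Cpt.comp k) l l'
  right_distrib k k' l := by
    change Cpt.comp (k + k') l = _
    rw [map_add]; rfl
  zero_mul k := by
    change Cpt.comp 0 k = 0
    rw [map_zero]; rfl
  mul_zero k := map_zero (Cpt.comp k)
  star := Cpt.adj
  star_involutive k := Subtype.ext (ContinuousLinearMap.adjoint_adjoint _)
  star_mul k l := Subtype.ext (ContinuousLinearMap.adjoint_comp _ _)
  star_add k l := map_add Cpt.adj k l
  star_smul c k := map_smulₛₗ Cpt.adj c k
  complete := CompleteSpace.complete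
  norm_mul_le k l := ContinuousLinearMap.opNorm_comp_le k.1 l.1
  norm_mul_self_le k := (ContinuousLinearMap.norm_adjoint_comp_self k.1).ge
  smul_assoc c k l := Subtype.ext (ContinuousLinearMap.smul_comp _ _ _)
  smul_comm c k l := Subtype.ext (ContinuousLinearMap.comp_smul _ _ _).symm

lemma Cpt.mul_apply (k l : Cpt E E) (x : E) : (k * l).1 x = k.1 (l.1 x) := rfl

lemma Cpt.inner_left {k : Cpt E E} (hk : IsSelfAdjoint k) (x y : E) :
    ⟪k.1 x, y⟫_ℂ = ⟪x, k.1 y⟫_ℂ := by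
  have h : k.1.adjoint = k.1 := congrArg Subtype.val hk.star_eq
  rw [← ContinuousLinearMap.adjoint_inner_right, h]

lemma Cpt.inner_mul_self {k : Cpt E E} (hk : IsSelfAdjoint k) (x : E) :
    ⟪x, (k * k).1 x⟫_ℂ = (‖k.1 x‖ : ℂ) ^ 2 := by
  rw [Cpt.mul_apply, ← Cpt.inner_left hk, inner_self_eq_norm_sq_to_K]
  rfl

/-- A self-adjoint compact operator with positive quadratic form is the square of a self-adjoint
compact operator: for `m = t₋` and `p = m^{1/2}`, one has `p t p = -m²`, hence `m = 0`. -/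
lemma Cpt.exists_sqrt {t : Cpt E E} (ht : IsSelfAdjoint t)
    (hpos : ∀ x, 0 ≤ (⟪x, t.1 x⟫_ℂ).re) :
    ∃ r : Cpt E E, IsSelfAdjoint r ∧ r * r = t ∧
      (∀ s ∈ quasispectrum ℝ t, 0 ≤ s) ∧ ∀ Φ : Cpt E E →⋆ₙₐ[ℂ] Cpt E E, Φ t = t → Φ r = r := by
  have hptp := negPart_mul_mul_negPart ht
  have hpsa : IsSelfAdjoint (cfcₙ (fun s : ℝ => √(max (-s) 0)) t) := cfcₙ_predicate _ t
  have hmsa : IsSelfAdjoint (cfcₙ (fun s : ℝ => max (-s) 0) t) := cfcₙ_predicate _ t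
  have hq : ∀ s ∈ quasispectrum ℝ t, 0 ≤ s := by
    refine fun s => quasispectrum_nonneg_of_negPart_eq_zero ht ?_
    generalize cfcₙ (fun s : ℝ => √(max (-s) 0)) t = p at hptp hpsa
    generalize cfcₙ (fun s : ℝ => max (-s) 0) t = m at hptp hmsa
    refine Subtype.ext (ContinuousLinearMap.ext fun x => ?_)
    have h1 := hpos (p.1 x)
    rw [Cpt.inner_left hpsa] at h1
    have h0 : p.1 (t.1 (p.1 x)) = -(m * m).1 x :=
      congrArg (fun k : Cpt E E => k.1 x) hptp
    rw [h0, inner_neg_right, Cpt.inner_mul_self hmsa, Complex.neg_re, ← Complex.ofReal_pow,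
      Complex.ofReal_re] at h1
    have h3 : ‖m.1 x‖ = 0 := by nlinarith [norm_nonneg (m.1 x)]
    exact norm_eq_zero.1 h3
  exact ⟨cfcₙ Real.sqrt t, cfcₙ_predicate _ t, sqrt_mul_sqrt_of_quasispectrum_nonneg ht hq, hq,
    fun Φ hΦ => map_cfcₙ_of_map_eq ht Real.continuous_sqrt Real.sqrt_zero Φ hΦ⟩

lemma denseRange_of_injective {T : E →L[ℂ] E} (hT : T.adjoint = T) (h : ∀ x, T x = 0 → x = 0) :
    DenseRange T := by
  have h1 : (T.range)ᗮ = ⊥ := by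
    rw [ContinuousLinearMap.orthogonal_range, hT]
    exact (Submodule.eq_bot_iff _).2 h
  have h2 := (Submodule.topologicalClosure_eq_top_iff (K := T.range)).2 h1
  have h3 := (Submodule.dense_iff_topologicalClosure_eq_top).2 h2
  exact h3

/-- A compact self-adjoint operator with strictly positive quadratic form; this is the same thing
as a strictly positive element of `K(E)`. -/
def Cpt.IsFull (s : Cpt E E) : Prop := IsSelfAdjoint s ∧ ∀ x ≠ 0, 0 < (⟪x, s.1 x⟫_ℂ).re

lemma Cpt.IsFull.re_nonneg {s : Cpt E E} (hs : Cpt.IsFull s) (x : E) :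
    0 ≤ (⟪x, s.1 x⟫_ℂ).re := by
  rcases eq_or_ne x 0 with rfl | h
  · simp
  · exact (hs.2 x h).le

lemma Cpt.IsFull.injective {s : Cpt E E} (hs : Cpt.IsFull s) (x : E) (hx : s.1 x = 0) :
    x = 0 := by
  by_contra h
  have := hs.2 x h
  simp [hx] at this

lemma Cpt.IsFull.quasispectrum_nonneg {s : Cpt E E} (hs : Cpt.IsFull s) :
    ∀ t ∈ quasispectrum ℝ s, 0 ≤ t := by
  obtain ⟨r, hr, hr', h, -⟩ := Cpt.exists_sqrt hs.1 hs.re_nonneg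
  exact h

/-- Strong convergence of a bounded family of operators may be checked on a dense set. -/
lemma tendsto_clm_of_dense {V W : Type*} [NormedAddCommGroup V] [NormedSpace ℂ V]
    [NormedAddCommGroup W] [NormedSpace ℂ W] {α : Type*} {l : Filter α} {T : α → V →L[ℂ] W}
    {T₀ : V →L[ℂ] W} {C : ℝ} (hC : ∀ i, ‖T i‖ ≤ C) {S : Set V} (hS : Dense S)
    (hT : ∀ x ∈ S, Tendsto (fun i => T i x) l (𝓝 (T₀ x))) (x : V) :
    Tendsto (fun i => T i x) l (𝓝 (T₀ x)) := by
  rw [Metric.tendsto_nhds]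
  intro ε hε
  have hpos : 0 < |C| + ‖T₀‖ + 1 := by positivity
  obtain ⟨δ, hδ0, hδ⟩ : ∃ δ : ℝ, 0 < δ ∧ δ * (|C| + ‖T₀‖ + 1) = ε :=
    ⟨ε / (|C| + ‖T₀‖ + 1), by positivity, by field_simp⟩
  obtain ⟨y, hy, hxy⟩ := Metric.dense_iff.1 hS x δ hδ0
  filter_upwards [Metric.tendsto_nhds.1 (hT y hxy) δ hδ0] with i hi
  have hxy' : ‖x - y‖ ≤ δ := by rw [← dist_eq_norm, dist_comm]; exact (Metric.mem_ball.1 hy).le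
  rw [dist_eq_norm] at hi ⊢
  have e : T i x - T₀ x = T i (x - y) + (T i y - T₀ y) - T₀ (x - y) := by
    simp only [map_sub]
    abel
  rw [e]
  calc _ ≤ ‖T i‖ * ‖x - y‖ + ‖T i y - T₀ y‖ + ‖T₀‖ * ‖x - y‖ :=
        (norm_sub_le _ _).trans (add_le_add ((norm_add_le _ _).trans
          (add_le_add_left ((T i).le_opNorm _) _)) (T₀.le_opNorm _))
    _ < |C| * δ + δ + ‖T₀‖ * δ := by
        have h1 := mul_le_mul ((hC i).trans (le_abs_self C)) hxy' (norm_nonneg _) (abs_nonneg C)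
        have h2 := mul_le_mul_of_nonneg_left hxy' (norm_nonneg T₀)
        linarith
    _ = ε := by rw [← hδ]; ring

/-- The approximate unit in the algebra generated by a strictly positive `s` is an approximate unit
of all compact operators, because the range of `s` is dense. -/
lemma Cpt.IsFull.tendsto_unit_mul {s : Cpt E E} (hs : Cpt.IsFull s) (k : Cpt F E) :
    Tendsto (fun n => Cpt.comp (approxUnit s n) k) atTop (𝓝 k) := by
  have hb (n : ℕ) : ‖(approxUnit s n).1‖ ≤ 1 :=
    (Cpt.norm_def _).symm.trans_le (norm_approxUnit_le s n)
  have hd : DenseRange s.1 :=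
    denseRange_of_injective (congrArg Subtype.val hs.1.star_eq) hs.injective
  have hk : IsCompactOperator k.1 := k.2
  have h0 (x : E) : Tendsto (fun n => (approxUnit s n).1 x) atTop
      (𝓝 (ContinuousLinearMap.id ℂ E x)) := by
    refine tendsto_clm_of_dense hb hd ?_ x
    rintro _ ⟨x, rfl⟩
    rw [tendsto_iff_norm_sub_tendsto_zero]
    have h2 : Tendsto (fun n : ℕ => 2 / ((n : ℝ) + 1) * ‖x‖) atTop (𝓝 0) := by
      have := (tendsto_one_div_add_atTop_nhds_zero_nat (𝕜 := ℝ)).const_mul (2 * ‖x‖)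
      rw [mul_zero] at this
      exact this.congr fun n => by ring
    refine squeeze_zero (fun _ => norm_nonneg _) (fun n => ?_) h2
    exact ((approxUnit s n * s - s).1.le_opNorm x).trans
      (mul_le_mul_of_nonneg_right (norm_approxUnit_mul_sub_le hs.1 n) (norm_nonneg _))
  have h1 : Tendsto (fun n => (approxUnit s n).1 ∘L k.1) atTop (𝓝 (.id ℂ E ∘L k.1)) :=
    tendsto_comp_of_isCompactOperator hb h0 hk
  exact tendsto_subtype_rng.2 h1

/-- An element of `K(E)` is strictly positive if and only if it is a positive operator with strictly
positive quadratic form. -/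
lemma isStrictlyPos_iff {s : Cpt E E} : IsStrictlyPos s ↔ Cpt.IsFull s := by
  constructor
  · rintro ⟨⟨r, rfl⟩, h⟩
    refine ⟨IsSelfAdjoint.star_mul_self r, fun x hx => ?_⟩
    -- vector functionals are nonzero
    let τ : Cpt E E →ₗ[ℂ] ℂ :=
      { toFun := fun k => ⟪x, k.1 x⟫_ℂ
        map_add' := fun k l => inner_add_right _ _ _
        map_smul' := fun c k => inner_smul_right _ _ _ }
    refine (Complex.lt_def.1 (h τ (fun k => ?_) fun h0 => ?_)).1
    · change 0 ≤ ⟪x, k.1.adjoint (k.1 x)⟫_ℂ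
      rw [ContinuousLinearMap.adjoint_inner_right]
      exact Complex.le_def.2 ⟨inner_self_nonneg (𝕜 := ℂ), (inner_self_im (𝕜 := ℂ) _).symm⟩
    · let p : Cpt E E := ⟨(ℂ ∙ x).starProjection,
        isCompactOperator_of_range_le (V := ℂ ∙ x) _ (by simp)⟩
      have h1 : τ p = 0 := by rw [h0]; rfl
      have h2 : p.1 x = x :=
        Submodule.starProjection_eq_self_iff.2 (Submodule.mem_span_singleton_self x)
      change ⟪x, p.1 x⟫_ℂ = 0 at h1
      rw [h2] at h1
      exact hx (inner_self_eq_zero.1 h1)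
  · intro hs
    obtain ⟨r, hr, hrs, -, -⟩ := Cpt.exists_sqrt hs.1 hs.re_nonneg
    have hrs' : star r * r = s := by rw [hr.star_eq, hrs]
    refine ⟨⟨r, hrs'.symm⟩, fun τ hτ hτ0 => lt_of_le_of_ne ?_ fun h0 => hτ0 ?_⟩
    · rw [← hrs']; exact hτ r
    · obtain ⟨hc, hcs⟩ := continuous_and_cauchySchwarz_of_nonneg τ hτ
      have h1 := hcs r (by rw [hrs']; exact h0.symm)
      ext k
      have h2 : Tendsto (fun n => k * approxUnit s n) atTop (𝓝 k) := by
        have := (continuous_star.tendsto _).comp (hs.tendsto_unit_mul (star k))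
        rw [star_star] at this
        refine this.congr fun n => ?_
        change star (approxUnit s n * star k) = _
        rw [star_mul, star_star, (isSelfAdjoint_approxUnit s n).star_eq]
      refine tendsto_nhds_unique ((hc.tendsto k).comp h2) ?_
      refine tendsto_const_nhds.congr fun n => ?_
      obtain ⟨l, hl⟩ := exists_mul_eq_approxUnit hs.1 n
      change 0 = τ (k * approxUnit s n)
      rw [← hl, ← hrs, ← mul_assoc, ← mul_assoc, h1]

end Compact

/-! ### The action of `Cu(G)` -/

section Action

variable {G : Type u} [TopologicalSpace G] [Group G] {A B : GAlg.{u, v} G}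
  {μ ν ω μ' ν' : URep G}

/-- Conjugation by `ν_g` as a `*`-endomorphism of `K(H_ν)`. -/
def URep.conjHom (ν : URep G) (g : G) : Cpt ν.H ν.H →⋆ₙₐ[ℂ] Cpt ν.H ν.H where
  toFun := Cpt.sandwich (ν.op g) (ν.op g⁻¹)
  map_smul' c k := map_smul _ c k
  map_zero' := map_zero _
  map_add' := map_add _
  map_mul' k l := Subtype.ext (by
    change ν.op g ∘L (k.1 ∘L l.1) ∘L ν.op g⁻¹
      = (ν.op g ∘L k.1 ∘L ν.op g⁻¹) ∘L (ν.op g ∘L l.1 ∘L ν.op g⁻¹)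
    ext x
    simp only [ContinuousLinearMap.comp_apply]
    rw [← ContinuousLinearMap.comp_apply (ν.op g⁻¹), URep.op_inv_comp]
    rfl)
  map_star' k := Subtype.ext (by
    change ν.op g ∘L k.1.adjoint ∘L ν.op g⁻¹ = (ν.op g ∘L k.1 ∘L ν.op g⁻¹).adjoint
    rw [ContinuousLinearMap.adjoint_comp, ContinuousLinearMap.adjoint_comp, URep.adjoint_op,
      URep.adjoint_op, inv_inv]
    rfl)

lemma Intertwines.sandwich_eq {k : Cpt μ.H ν.H} (hk : Intertwines μ ν k.1) (g : G) :
    Cpt.sandwich (ν.op g) (μ.op g⁻¹) k = k := Subtype.ext (by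
  change ν.op g ∘L k.1 ∘L μ.op g⁻¹ = k.1
  rw [← ContinuousLinearMap.comp_assoc, hk g, ContinuousLinearMap.comp_assoc, URep.op_comp_inv]
  rfl)

lemma Intertwines.of_sandwich_eq {k : Cpt μ.H ν.H}
    (hk : ∀ g, Cpt.sandwich (ν.op g) (μ.op g⁻¹) k = k) : Intertwines μ ν k.1 := fun g => by
  have h : ν.op g ∘L k.1 ∘L μ.op g⁻¹ = k.1 := congrArg Subtype.val (hk g)
  conv_rhs => rw [← h]
  rw [ContinuousLinearMap.comp_assoc, ContinuousLinearMap.comp_assoc, URep.op_inv_comp]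
  rfl

lemma InvStrictlyPos.isFull (s : InvStrictlyPos ν) : Cpt.IsFull s.s :=
  isStrictlyPos_iff.1 s.strictlyPos

lemma InvStrictlyPos.intertwines (s : InvStrictlyPos ν) : Intertwines ν ν s.s.1 :=
  .of_sandwich_eq s.inv

/-- A positive compact intertwiner with strictly positive quadratic form. -/
def InvStrictlyPos.ofFull {k : Cpt ν.H ν.H} (hk : Cpt.IsFull k) (h : Intertwines ν ν k.1) :
    InvStrictlyPos ν := ⟨k, isStrictlyPos_iff.2 hk, h.sandwich_eq⟩

lemma KT.norm_tensorLeft_le {E₁ E₂ F₁ F₂ : Type} {A : Type v}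
    [NormedAddCommGroup E₁] [InnerProductSpace ℂ E₁] [CompleteSpace E₁]
    [NormedAddCommGroup E₂] [InnerProductSpace ℂ E₂] [CompleteSpace E₂]
    [NormedAddCommGroup F₁] [InnerProductSpace ℂ F₁] [CompleteSpace F₁]
    [NormedAddCommGroup F₂] [InnerProductSpace ℂ F₂] [CompleteSpace F₂]
    [NonUnitalCStarAlgebra A] (s : Cpt F₁ F₂) (x : KT E₁ E₂ A) :
    ‖KT.tensorLeft s x‖ ≤ ‖s‖ * ‖x‖ := by
  induction x using KT.induction with
  | hp => exact isClosed_le (by fun_prop) (by fun_prop)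
  | ih t =>
    rw [KT.tensorLeft_of, LinearIsometry.norm_map, LinearIsometry.norm_map]
    exact AlgKT.norm_tensorLeft_le s t

lemma KT.tensorLeft_add_left {E₁ E₂ F₁ F₂ : Type} {A : Type v}
    [NormedAddCommGroup E₁] [InnerProductSpace ℂ E₁] [CompleteSpace E₁]
    [NormedAddCommGroup E₂] [InnerProductSpace ℂ E₂] [CompleteSpace E₂]
    [NormedAddCommGroup F₁] [InnerProductSpace ℂ F₁] [CompleteSpace F₁]
    [NormedAddCommGroup F₂] [InnerProductSpace ℂ F₂] [CompleteSpace F₂]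
    [NonUnitalCStarAlgebra A] (s s' : Cpt F₁ F₂) (x : KT E₁ E₂ A) :
    KT.tensorLeft (s + s') x = KT.tensorLeft s x + KT.tensorLeft s' x := by
  induction x using KT.induction with
  | hp => exact isClosed_eq (by fun_prop) (by fun_prop)
  | ih t =>
    rw [KT.tensorLeft_of, KT.tensorLeft_of, KT.tensorLeft_of, ← map_add]
    congr 1
    induction t using AlgKT.induction with
    | zero => simp
    | add x x' hx hx' => simp only [map_add, hx, hx']; abel
    | tmul k a =>
      simp only [AlgKT.tensorLeft_tmul]
      rw [map_add, LinearMap.add_apply]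
      exact TensorProduct.add_tmul _ _ _

lemma KTG.IsInv.tensorLeft {e : Cpt ν.H ν'.H} (he : Intertwines ν ν' e.1) {x : KTG μ μ' A}
    (hx : KTG.IsInv x) :
    KTG.IsInv (μ := ν.tensor μ) (ν := ν'.tensor μ') (KT.tensorLeft e x) := fun g => by
  refine (KT.tensorLeft_sandwich e (ν'.op g) (ν.op g⁻¹) (μ'.op g) (μ.op g⁻¹) (A.act g) x).trans ?_
  rw [he.sandwich_eq g]
  congr 1
  exact hx g

/-- If `v : ν → ν'` is an isometric intertwiner and `s`, `s'` are strictly positive, there are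
invariant compact operators `e` with `e s' e*` close to `s`. -/
lemma InvStrictlyPos.exists_approx (s : InvStrictlyPos ν) (s' : InvStrictlyPos ν')
    {v : ν.H →L[ℂ] ν'.H} (hv : Intertwines ν ν' v) (hvv : v.adjoint ∘L v = .id ℂ ν.H)
    {ε : ℝ} (hε : 0 < ε) : ∃ e : Cpt ν'.H ν.H, Intertwines ν' ν e.1 ∧
      ‖Cpt.comp (Cpt.comp e s'.s) (Cpt.adj e) - s.s‖ ≤ ε := by
  obtain ⟨h, hh⟩ : ∃ h, h = Cpt.sandwich v v.adjoint s.s := ⟨_, rfl⟩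
  have hh' : h.1 = v ∘L s.s.1 ∘L v.adjoint := by rw [hh]; rfl
  have hsa : IsSelfAdjoint h := Subtype.ext (by
    change h.1.adjoint = h.1
    have : s.s.1.adjoint = s.s.1 := congrArg Subtype.val s.isFull.1.star_eq
    rw [hh', ContinuousLinearMap.adjoint_comp, ContinuousLinearMap.adjoint_comp,
      ContinuousLinearMap.adjoint_adjoint, this]
    rfl)
  obtain ⟨r, hr, hrh, -, hrinv⟩ := Cpt.exists_sqrt hsa fun x => by
    rw [hh', ContinuousLinearMap.comp_apply, ← ContinuousLinearMap.adjoint_inner_left]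
    exact s.isFull.re_nonneg _
  have hhI : Intertwines ν' ν' h.1 := by
    rw [hh']; exact hv.comp (s.intertwines.comp hv.adjoint)
  have hrI : Intertwines ν' ν' r.1 :=
    .of_sandwich_eq fun g => hrinv (ν'.conjHom g) (hhI.sandwich_eq g)
  have h1 : Tendsto (fun n => Cpt.sandwich v.adjoint v (r * (approxUnit s'.s n * r))) atTop
      (𝓝 s.s) := by
    have h2 : Cpt.sandwich v.adjoint v (r * r) = s.s := Subtype.ext (by
      rw [hrh]
      change v.adjoint ∘L h.1 ∘L v = s.s.1
      rw [hh', ContinuousLinearMap.comp_assoc, ContinuousLinearMap.comp_assoc, hvv,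
        ContinuousLinearMap.comp_id, ← ContinuousLinearMap.comp_assoc, hvv,
        ContinuousLinearMap.id_comp])
    have h3 : Continuous (Cpt.sandwich v.adjoint v : Cpt ν'.H ν'.H →ₗ[ℂ] Cpt ν.H ν.H) :=
      continuous_induced_rng.2 (by
        change Continuous fun k : Cpt ν'.H ν'.H => v.adjoint ∘L k.1 ∘L v
        fun_prop)
    rw [← h2]
    exact (h3.tendsto _).comp ((s'.isFull.tendsto_unit_mul r).const_mul r)
  rw [tendsto_iff_norm_sub_tendsto_zero] at h1
  obtain ⟨n, hn⟩ := (h1.eventually (ge_mem_nhds hε)).exists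
  obtain ⟨g, hg, hgs, hginv⟩ := exists_conj_eq_approxUnit s'.isFull.1
    s'.isFull.quasispectrum_nonneg n
  have hgI : Intertwines ν' ν' g.1 :=
    .of_sandwich_eq fun a => hginv (ν'.conjHom a) (s'.inv a)
  have hr' : r.1.adjoint = r.1 := congrArg Subtype.val hr.star_eq
  have hg' : g.1.adjoint = g.1 := congrArg Subtype.val hg.star_eq
  refine ⟨Cpt.sandwich v.adjoint (.id ℂ ν'.H) (r * g), hv.adjoint.comp (hrI.comp hgI), ?_⟩
  have key : Cpt.comp (Cpt.comp (Cpt.sandwich v.adjoint (.id ℂ ν'.H) (r * g)) s'.s)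
      (Cpt.adj (Cpt.sandwich v.adjoint (.id ℂ ν'.H) (r * g)))
      = Cpt.sandwich v.adjoint v (r * (approxUnit s'.s n * r)) := Subtype.ext (by
    rw [← hgs]
    change ((v.adjoint ∘L (r.1 ∘L g.1)) ∘L s'.s.1) ∘L (v.adjoint ∘L (r.1 ∘L g.1)).adjoint
      = v.adjoint ∘L (r.1 ∘L (((g.1 ∘L s'.s.1) ∘L g.1) ∘L r.1)) ∘L v
    rw [ContinuousLinearMap.adjoint_comp, ContinuousLinearMap.adjoint_comp,
      ContinuousLinearMap.adjoint_adjoint, hr', hg']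
    rfl)
  rw [key]
  exact hn

/-- The action is monotone; this includes that it does not depend on the choices. -/
lemma GPos.tensor_le (s : InvStrictlyPos ν) (s' : InvStrictlyPos ν')
    {v : ν.H →L[ℂ] ν'.H} (hv : Intertwines ν ν' v) (hvv : v.adjoint ∘L v = .id ℂ ν.H)
    {x y : GPos A} (hxy : x ≤ y) : x.tensor s ≤ y.tensor s' := by
  refine GPos.sub_of_sand fun ε hε => ?_
  have hx : 0 < ‖x.a‖ + 1 := by positivity
  obtain ⟨e, he, he'⟩ := s.exists_approx s' hv hvv (div_pos (half_pos hε) hx)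
  obtain ⟨t, ht⟩ : ∃ t, t = Cpt.comp (Cpt.comp e s'.s) (Cpt.adj e) := ⟨_, rfl⟩
  rw [← ht] at he'
  have ht0 : 0 < ‖t‖ + 1 := by positivity
  obtain ⟨d, hd, hd'⟩ := GPos.exists_sand hxy (div_pos (half_pos hε) ht0)
  refine ⟨KT.tensorLeft e d, KTG.IsInv.tensorLeft he hd, ?_⟩
  have e1 : KT.sand (KT.tensorLeft e d) (KT.tensorLeft s'.s y.a)
      = KT.tensorLeft t (KT.sand d y.a) := by
    unfold KT.sand
    rw [KT.tensorLeft_adj, ht, KT.tensorLeft_comp, KT.tensorLeft_comp]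
  have e2 : KT.tensorLeft t (KT.sand d y.a) - KT.tensorLeft s.s x.a
      = KT.tensorLeft t (KT.sand d y.a - x.a) + KT.tensorLeft (t - s.s) x.a := by
    have := KT.tensorLeft_add_left (t - s.s) s.s x.a
    rw [sub_add_cancel] at this
    rw [map_sub, this]
    abel
  change ‖KT.sand (KT.tensorLeft e d) (KT.tensorLeft s'.s y.a) - KT.tensorLeft s.s x.a‖ ≤ ε
  rw [e1, e2]
  calc _ ≤ ‖t‖ * ‖KT.sand d y.a - x.a‖ + ‖t - s.s‖ * ‖x.a‖ :=
        (norm_add_le _ _).trans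
          (add_le_add (KT.norm_tensorLeft_le _ _) (KT.norm_tensorLeft_le _ _))
    _ ≤ (‖t‖ + 1) * (ε / 2 / (‖t‖ + 1)) + ε / 2 / (‖x.a‖ + 1) * (‖x.a‖ + 1) := by
        gcongr <;> linarith
    _ = ε := by field_simp; ring

end Action

/-! ### Averaging over the group -/

section Haar

variable {G : Type u} [TopologicalSpace G] [Group G] [IsTopologicalGroup G] [CompactSpace G]

/-- The mean of a function on a compact group with respect to normalized Haar measure. -/
def haarAvg {W : Type*} [NormedAddCommGroup W] [NormedSpace ℝ W] (f : G → W) : W :=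
  letI : MeasurableSpace G := borel G
  haveI : BorelSpace G := ⟨rfl⟩
  ∫ g, f g ∂(MeasureTheory.Measure.haarMeasure ⊤)

variable {W W' : Type*} [NormedAddCommGroup W] [NormedSpace ℝ W] [NormedAddCommGroup W']
  [NormedSpace ℝ W']

lemma haarAvg_mul_left (f : G → W) (h : G) : haarAvg (fun g => f (h * g)) = haarAvg f := by
  let _ : MeasurableSpace G := borel G
  have _ : BorelSpace G := ⟨rfl⟩
  exact MeasureTheory.integral_mul_left_eq_self f h

lemma haarAvg_const [CompleteSpace W] (c : W) : haarAvg (fun _ : G => c) = c := by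
  let _ : MeasurableSpace G := borel G
  have _ : BorelSpace G := ⟨rfl⟩
  have h : (MeasureTheory.Measure.haarMeasure (⊤ : TopologicalSpace.PositiveCompacts G))
      Set.univ = 1 := MeasureTheory.Measure.haarMeasure_self
  change ∫ _, c ∂_ = c
  rw [MeasureTheory.integral_const, MeasureTheory.measureReal_def, h]
  simp

lemma norm_haarAvg_le {f : G → W} {C : ℝ} (hf : ∀ g, ‖f g‖ ≤ C) : ‖haarAvg f‖ ≤ C := by
  let _ : MeasurableSpace G := borel G
  have _ : BorelSpace G := ⟨rfl⟩
  have h : (MeasureTheory.Measure.haarMeasure (⊤ : TopologicalSpace.PositiveCompacts G))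
      Set.univ = 1 := MeasureTheory.Measure.haarMeasure_self
  have h1 := MeasureTheory.norm_integral_le_of_norm_le_const
    (μ := MeasureTheory.Measure.haarMeasure (⊤ : TopologicalSpace.PositiveCompacts G))
    (Eventually.of_forall hf)
  rwa [MeasureTheory.measureReal_def, h, ENNReal.toReal_one, mul_one] at h1

lemma map_haarAvg [CompleteSpace W] [CompleteSpace W'] (T : W →L[ℝ] W') {f : G → W}
    (hf : Continuous f) : T (haarAvg f) = haarAvg fun g => T (f g) := by
  let _ : MeasurableSpace G := borel G
  have _ : BorelSpace G := ⟨rfl⟩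
  exact (T.integral_comp_comm (hf.integrable_of_hasCompactSupport
    (HasCompactSupport.of_compactSpace f))).symm

lemma haarAvg_sub {f f' : G → W} (hf : Continuous f) (hf' : Continuous f') :
    haarAvg (fun g => f g - f' g) = haarAvg f - haarAvg f' := by
  let _ : MeasurableSpace G := borel G
  have _ : BorelSpace G := ⟨rfl⟩
  exact MeasureTheory.integral_sub
    (hf.integrable_of_hasCompactSupport (HasCompactSupport.of_compactSpace f))
    (hf'.integrable_of_hasCompactSupport (HasCompactSupport.of_compactSpace f'))

lemma haarAvg_pos {f : G → ℝ} (hf : Continuous f) (h : ∀ g, 0 < f g) : 0 < haarAvg f := by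
  let _ : MeasurableSpace G := borel G
  have _ : BorelSpace G := ⟨rfl⟩
  exact hf.integral_pos_of_hasCompactSupport_nonneg_nonzero
    (HasCompactSupport.of_compactSpace f) (fun g => (h g).le) (h 1).ne'

end Haar

section Invariants

variable {G : Type u} [TopologicalSpace G] [Group G] [IsTopologicalGroup G]
  {A B : GAlg.{u, v} G} {μ ν ω μ' ν' : URep G}

lemma URep.norm_op_le (μ : URep G) (g : G) : ‖μ.op g‖ ≤ 1 :=
  ContinuousLinearMap.opNorm_le_bound _ zero_le_one fun x => by
    rw [URep.op_apply, LinearIsometryEquiv.norm_map, one_mul]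

lemma URep.continuous_op_comp {E : Type} [NormedAddCommGroup E] [InnerProductSpace ℂ E]
    [CompleteSpace E] (ν : URep G) {k : E →L[ℂ] ν.H} (hk : IsCompactOperator k) :
    Continuous fun g => ν.op g ∘L k :=
  continuous_iff_continuousAt.2 fun g => tendsto_comp_of_isCompactOperator (T₀ := ν.op g)
    ν.norm_op_le (fun x => (ν.continuous_apply x).tendsto g) hk

/-- The action on compact operators is norm continuous. -/
lemma continuous_sandwich_op (k : Cpt μ.H ν.H) :
    Continuous fun g => Cpt.sandwich (ν.op g) (μ.op g⁻¹) k := by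
  refine continuous_induced_rng.2 (continuous_iff_continuousAt.2 fun g₀ => ?_)
  have hk : IsCompactOperator k.1 := k.2
  have h1 := ν.continuous_op_comp hk
  have h2 : Continuous fun g => k.1 ∘L μ.op g⁻¹ := by
    have := (ContinuousLinearMap.adjoint (𝕜 := ℂ) (E := ν.H) (F := μ.H)).continuous.comp
      (μ.continuous_op_comp (isCompactOperator_adjoint hk))
    refine this.congr fun g => ?_
    rw [Function.comp_apply, ContinuousLinearMap.adjoint_comp,
      ContinuousLinearMap.adjoint_adjoint, URep.adjoint_op]
  rw [ContinuousAt, tendsto_iff_norm_sub_tendsto_zero]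
  have h3 : Tendsto (fun g => ‖k.1 ∘L μ.op g⁻¹ - k.1 ∘L μ.op g₀⁻¹‖
      + ‖ν.op g ∘L k.1 - ν.op g₀ ∘L k.1‖) (𝓝 g₀) (𝓝 (0 + 0)) :=
    (tendsto_iff_norm_sub_tendsto_zero.1 (h2.tendsto g₀)).add
      (tendsto_iff_norm_sub_tendsto_zero.1 (h1.tendsto g₀))
  rw [add_zero] at h3
  refine squeeze_zero (fun _ => norm_nonneg _) (fun g => ?_) h3
  have e : ν.op g ∘L k.1 ∘L μ.op g⁻¹ - ν.op g₀ ∘L k.1 ∘L μ.op g₀⁻¹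
      = ν.op g ∘L (k.1 ∘L μ.op g⁻¹ - k.1 ∘L μ.op g₀⁻¹)
        + (ν.op g ∘L k.1 - ν.op g₀ ∘L k.1) ∘L μ.op g₀⁻¹ := by
    ext x
    simp
  change ‖ν.op g ∘L k.1 ∘L μ.op g⁻¹ - ν.op g₀ ∘L k.1 ∘L μ.op g₀⁻¹‖ ≤ _
  rw [e]
  refine (norm_add_le _ _).trans (add_le_add ?_ ?_)
  · refine (ContinuousLinearMap.opNorm_comp_le _ _).trans ?_
    exact mul_le_of_le_one_left (norm_nonneg _) (ν.norm_op_le g)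
  · refine (ContinuousLinearMap.opNorm_comp_le _ _).trans ?_
    exact mul_le_of_le_one_right (norm_nonneg _) (μ.norm_op_le _)

lemma KTG.norm_act_le (g : G) (x : KTG μ ν A) : ‖KTG.act g x‖ ≤ ‖x‖ := by
  refine (KT.norm_sandwich_le _ _ _ _).trans ?_
  have := mul_le_one₀ (ν.norm_op_le g) (norm_nonneg _) (μ.norm_op_le g⁻¹)
  exact mul_le_of_le_one_left (norm_nonneg _) this

lemma KT.norm_tmul_le {E F : Type} {A : Type v} [NormedAddCommGroup E] [InnerProductSpace ℂ E]
    [CompleteSpace E] [NormedAddCommGroup F] [InnerProductSpace ℂ F] [CompleteSpace F]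
    [NonUnitalCStarAlgebra A] (k : Cpt E F) (a : A) : ‖KT.tmul k a‖ ≤ ‖k‖ * ‖a‖ := by
  unfold KT.tmul
  rw [LinearIsometry.norm_map]
  refine AlgKT.norm_le fun ρ => ?_
  rw [StarRep.ampl_tmul]
  exact (norm_hmap_le _ _).trans (mul_le_mul_of_nonneg_left (ρ.norm_le a) (norm_nonneg _))

lemma KT.continuous_tmul {X : Type*} {E F : Type} {A : Type v} [TopologicalSpace X]
    [NormedAddCommGroup E] [InnerProductSpace ℂ E] [CompleteSpace E]
    [NormedAddCommGroup F] [InnerProductSpace ℂ F] [CompleteSpace F] [NonUnitalCStarAlgebra A]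
    {k : X → Cpt E F} {a : X → A} (hk : Continuous k) (ha : Continuous a) :
    Continuous fun x => KT.tmul (k x) (a x) := by
  refine continuous_iff_continuousAt.2 fun x₀ => ?_
  have h : Tendsto (fun x => ‖k x - k x₀‖ * ‖a x‖ + ‖k x₀‖ * ‖a x - a x₀‖) (𝓝 x₀)
      (𝓝 (0 * ‖a x₀‖ + ‖k x₀‖ * 0)) :=
    ((tendsto_iff_norm_sub_tendsto_zero.1 (hk.tendsto x₀)).mul (ha.norm.tendsto x₀)).add
      ((tendsto_iff_norm_sub_tendsto_zero.1 (ha.tendsto x₀)).const_mul _)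
  rw [zero_mul, mul_zero, add_zero] at h
  rw [ContinuousAt, tendsto_iff_norm_sub_tendsto_zero]
  refine squeeze_zero (fun _ => norm_nonneg _) (fun x => ?_) h
  have e : KT.tmul (k x) (a x) - KT.tmul (k x₀) (a x₀)
      = KT.tmul (k x - k x₀) (a x) + KT.tmul (k x₀) (a x - a x₀) := by
    unfold KT.tmul
    rw [← map_sub, ← map_add]
    congr 1
    have e1 : AlgKT.tmul (k x - k x₀) (a x) = AlgKT.tmul (k x) (a x) - AlgKT.tmul (k x₀) (a x) :=
      TensorProduct.sub_tmul _ _ _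
    have e2 : AlgKT.tmul (k x₀) (a x - a x₀)
        = AlgKT.tmul (k x₀) (a x) - AlgKT.tmul (k x₀) (a x₀) := TensorProduct.tmul_sub _ _ _
    rw [e1, e2]
    abel
  rw [e]
  exact (norm_add_le _ _).trans (add_le_add (KT.norm_tmul_le _ _) (KT.norm_tmul_le _ _))

/-- The action on `K(H_μ, H_ν) ⊗ A` is continuous. -/
lemma KTG.continuous_act (x : KTG μ ν A) : Continuous fun g => KTG.act g x := by
  have h0 (t : AlgKT μ.H ν.H A.carrier) :
      Continuous fun g => (KTG.act g (KT.of t) : KTG μ ν A) := by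
    induction t using AlgKT.induction with
    | zero => simpa only [map_zero] using continuous_const
    | add x y hx hy =>
      simp only [map_add]
      exact hx.add hy
    | tmul k a =>
      exact (KT.continuous_tmul (continuous_sandwich_op k) (A.continuous_apply a)).congr
        fun g => (KT.sandwich_of (ν.op g) (μ.op g⁻¹) (A.act g) (AlgKT.tmul k a)).symm
  refine continuous_of_uniform_approx_of_continuous fun u hu => ?_
  obtain ⟨ε, hε, hu⟩ := Metric.mem_uniformity_dist.1 hu
  obtain ⟨_, hy, ⟨t, rfl⟩⟩ := Metric.dense_iff.1 KT.denseRange x ε hε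
  refine ⟨fun g => KTG.act g (KT.of t), h0 t, fun g => hu ?_⟩
  rw [dist_eq_norm, ← map_sub]
  refine (KTG.norm_act_le _ _).trans_lt ?_
  rw [← dist_eq_norm, dist_comm]
  exact hy

lemma KTG.act_act (g h : G) (x : KTG μ ν A) : KTG.act g (KTG.act h x) = KTG.act (g * h) x := by
  unfold KTG.act
  rw [KT.sandwich_sandwich, ← URep.op_mul, ← URep.op_mul, mul_inv_rev]
  congr 2
  ext a
  change A.α g (A.α h a) = A.α (g * h) a
  rw [map_mul]; rfl

/-- Averaging approximants of an invariant element: an element `x` close to an invariant one can be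
replaced by an invariant one which is equally close, also after a homomorphism `ψ`. -/
lemma KTG.exists_isInv_norm_le [CompactSpace G] (ψ : GHom A B) (x : KTG μ ν A) {y : KTG μ ν B}
    (hy : KTG.IsInv y) {ε : ℝ}
    (h : ‖KT.sandwich (.id ℂ ν.H) (.id ℂ μ.H) ψ.toHom x - y‖ ≤ ε) :
    ∃ x' : KTG μ ν A, KTG.IsInv x' ∧
      ‖KT.sandwich (.id ℂ ν.H) (.id ℂ μ.H) ψ.toHom x' - y‖ ≤ ε := by
  let T : KTG μ ν A →L[ℂ] KTG μ ν B := KT.sandwich (.id ℂ ν.H) (.id ℂ μ.H) ψ.toHom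
  have hT (g : G) (x : KTG μ ν A) : T (KTG.act g x) = KTG.act g (T x) := by
    unfold T KTG.act
    rw [KT.sandwich_sandwich, KT.sandwich_sandwich, GHom.comp_act]
    rfl
  refine ⟨haarAvg fun g => KTG.act g x, fun g => ?_, ?_⟩
  · refine (map_haarAvg ((KTG.act g : KTG μ ν A →L[ℂ] KTG μ ν A).restrictScalars ℝ)
      (KTG.continuous_act x)).trans ?_
    simp only [ContinuousLinearMap.coe_restrictScalars', KTG.act_act]
    exact haarAvg_mul_left (fun g => KTG.act g x) g
  · change ‖T (haarAvg fun g => KTG.act g x) - y‖ ≤ ε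
    have h1 : T (haarAvg fun g => KTG.act g x) = haarAvg fun g => KTG.act g (T x) := by
      refine (map_haarAvg (T.restrictScalars ℝ) (KTG.continuous_act x)).trans ?_
      congr 1
      exact funext fun g => hT g x
    have h2 : T (haarAvg fun g => KTG.act g x) - y
        = haarAvg fun g => KTG.act g (T x) - y := by
      rw [haarAvg_sub (KTG.continuous_act (T x)) continuous_const, h1, haarAvg_const]
    rw [h2]
    refine norm_haarAvg_le fun g => ?_
    conv_lhs => rw [← hy g]
    rw [← map_sub]
    exact (KTG.norm_act_le _ _).trans h

/-- The projection to the line spanned by a vector. -/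
def Cpt.proj {E : Type} [NormedAddCommGroup E] [InnerProductSpace ℂ E] [CompleteSpace E] (y : E) :
    Cpt E E := ⟨(ℂ ∙ y).starProjection, isCompactOperator_of_range_le (V := ℂ ∙ y) _ (by simp)⟩

lemma Cpt.inner_proj {E : Type} [NormedAddCommGroup E] [InnerProductSpace ℂ E] [CompleteSpace E]
    (x y : E) : (⟪x, (Cpt.proj y).1 x⟫_ℂ).re = ‖(Cpt.proj y).1 x‖ ^ 2 := by
  have h1 : IsSelfAdjoint (Cpt.proj y) :=
    Subtype.ext (isSelfAdjoint_starProjection (ℂ ∙ y)).star_eq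
  have h2 : Cpt.proj y * Cpt.proj y = Cpt.proj y :=
    Subtype.ext (ℂ ∙ y).isIdempotentElem_starProjection
  conv_lhs => rw [← h2]
  rw [Cpt.inner_mul_self h1, ← Complex.ofReal_pow, Complex.ofReal_re]

/-- The quadratic form of a compact operator at a vector, as a function of the operator. -/
def Cpt.form {E : Type} [NormedAddCommGroup E] [InnerProductSpace ℂ E] [CompleteSpace E] (x : E) :
    Cpt E E →L[ℝ] ℝ :=
  Complex.reCLM ∘L (((innerSL ℂ x).comp (ContinuousLinearMap.apply ℂ E x)).comp
    (Cpt E E).subtypeL).restrictScalars ℝ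

lemma Cpt.form_apply {E : Type} [NormedAddCommGroup E] [InnerProductSpace ℂ E] [CompleteSpace E]
    (x : E) (k : Cpt E E) : Cpt.form x k = (⟪x, k.1 x⟫_ℂ).re := rfl

/-- On a separable space, a convergent weighted sum of the projections to the lines spanned by the
members of a dense sequence is strictly positive. -/
lemma Cpt.exists_isFull (E : Type) [NormedAddCommGroup E] [InnerProductSpace ℂ E]
    [CompleteSpace E] [TopologicalSpace.SeparableSpace E] : ∃ s : Cpt E E, Cpt.IsFull s := by
  have hn (y : E) : ‖Cpt.proj y‖ ≤ 1 := (ℂ ∙ y).starProjection_norm_le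
  let f : ℕ → Cpt E E := fun n => ((1 / 2 : ℝ) ^ n) • Cpt.proj (TopologicalSpace.denseSeq E n)
  have hf : Summable f := by
    refine Summable.of_norm_bounded (summable_geometric_of_lt_one (r := (1 / 2 : ℝ)) (by norm_num)
      (by norm_num)) fun n => ?_
    rw [norm_smul, norm_pow, Real.norm_of_nonneg (by norm_num : (0 : ℝ) ≤ 1 / 2)]
    exact mul_le_of_le_one_right (by positivity) (hn _)
  refine ⟨∑' n, f n, ?_, fun x hx => ?_⟩
  · change star (∑' n, f n) = ∑' n, f n
    rw [tsum_star]
    refine tsum_congr fun n => ?_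
    have h1 : IsSelfAdjoint (Cpt.proj (TopologicalSpace.denseSeq E n)) :=
      Subtype.ext (isSelfAdjoint_starProjection _).star_eq
    rw [star_smul, h1.star_eq, star_trivial]
  · rw [← Cpt.form_apply, (Cpt.form x).map_tsum hf]
    have h0 (n : ℕ) : Cpt.form x (f n)
        = (1 / 2 : ℝ) ^ n * ‖(Cpt.proj (TopologicalSpace.denseSeq E n)).1 x‖ ^ 2 := by
      rw [map_smul, Cpt.form_apply, Cpt.inner_proj, smul_eq_mul]
    obtain ⟨n, hn⟩ : ∃ n, ⟪TopologicalSpace.denseSeq E n, x⟫_ℂ ≠ 0 := by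
      by_contra! h
      have h1 : ∀ y : E, ⟪y, x⟫_ℂ = 0 := fun y =>
        (TopologicalSpace.denseRange_denseSeq E).induction (P := fun y => ⟪y, x⟫_ℂ = 0)
          (by rintro _ ⟨n, rfl⟩; exact h n)
          (isClosed_eq (continuous_id.inner continuous_const) continuous_const) y
      exact hx (inner_self_eq_zero.1 (h1 x))
    refine (hf.mapL (Cpt.form x)).tsum_pos (fun n => by rw [h0]; positivity) n ?_
    rw [h0]
    have h2 : (Cpt.proj (TopologicalSpace.denseSeq E n)).1 x ≠ 0 := fun h => hn (by
      have h3 : x ∈ (ℂ ∙ TopologicalSpace.denseSeq E n)ᗮ :=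
        (Submodule.starProjection_apply_eq_zero_iff _).1 h
      exact Submodule.mem_orthogonal_singleton_iff_inner_right.1 h3)
    positivity

/-- Strictly positive invariant compact operators exist: average one over the group. -/
lemma URep.exists_invStrictlyPos [CompactSpace G] (ν : URep G) : Nonempty (InvStrictlyPos ν) := by
  obtain ⟨s, hs⟩ := Cpt.exists_isFull ν.H
  have hc := continuous_sandwich_op (μ := ν) (ν := ν) s
  have hn (g : G) (k : Cpt ν.H ν.H) : ‖Cpt.sandwich (ν.op g) (ν.op g⁻¹) k‖ ≤ ‖k‖ := by
    refine (ContinuousLinearMap.opNorm_comp_le _ _).trans ?_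
    refine mul_le_of_le_one_left (norm_nonneg _) (ν.norm_op_le g) |>.trans ?_
    refine (ContinuousLinearMap.opNorm_comp_le _ _).trans ?_
    exact mul_le_of_le_one_right (norm_nonneg _) (ν.norm_op_le _)
  let T (g : G) : Cpt ν.H ν.H →L[ℂ] Cpt ν.H ν.H :=
    (Cpt.sandwich (ν.op g) (ν.op g⁻¹)).mkContinuous 1 fun k => by rw [one_mul]; exact hn g k
  have hc' : Continuous fun g => T g s := hc
  have hT (g h : G) : T g (T h s) = T (g * h) s := Subtype.ext (by
    change ν.op g ∘L (ν.op h ∘L s.1 ∘L ν.op h⁻¹) ∘L ν.op g⁻¹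
      = ν.op (g * h) ∘L s.1 ∘L ν.op (g * h)⁻¹
    rw [mul_inv_rev, URep.op_mul, URep.op_mul]
    rfl)
  refine ⟨⟨haarAvg fun g => T g s, isStrictlyPos_iff.2 ⟨?_, fun x hx => ?_⟩, fun g => ?_⟩⟩
  · change starL' ℝ (haarAvg fun g => T g s) = _
    refine (map_haarAvg (starL' ℝ : Cpt ν.H ν.H ≃L[ℝ] Cpt ν.H ν.H).toContinuousLinearMap hc).trans ?_
    congr 1
    funext g
    change star (ν.conjHom g s) = ν.conjHom g s
    rw [← map_star, hs.1.star_eq]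
  · rw [← Cpt.form_apply, map_haarAvg (Cpt.form x) hc']
    refine haarAvg_pos ((Cpt.form x).continuous.comp hc) fun g => ?_
    have h1 : ν.op g⁻¹ x ≠ 0 := fun h => hx ((ν.U g⁻¹).map_eq_zero_iff.1 h)
    have h2 := hs.2 _ h1
    rw [← URep.adjoint_op, ContinuousLinearMap.adjoint_inner_left, URep.adjoint_op] at h2
    exact h2
  · change T g (haarAvg fun g => T g s) = _
    refine (map_haarAvg ((T g).restrictScalars ℝ) hc).trans ?_
    refine Eq.trans ?_ (haarAvg_mul_left (fun g => T g s) g)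
    congr 1
    exact funext fun h => hT g h

end Invariants

/-! ### Tensor products of Hilbert spaces: associativity and unit -/

section Tensor

variable {E F K E₁ F₁ K₁ : Type}
  [NormedAddCommGroup E] [InnerProductSpace ℂ E] [CompleteSpace E]
  [NormedAddCommGroup F] [InnerProductSpace ℂ F] [CompleteSpace F]
  [NormedAddCommGroup K] [InnerProductSpace ℂ K] [CompleteSpace K]
  [NormedAddCommGroup E₁] [InnerProductSpace ℂ E₁] [CompleteSpace E₁]
  [NormedAddCommGroup F₁] [InnerProductSpace ℂ F₁] [CompleteSpace F₁]
  [NormedAddCommGroup K₁] [InnerProductSpace ℂ K₁] [CompleteSpace K₁]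

lemma hmap_of_tmul (S : E →L[ℂ] E₁) (T : F →L[ℂ] F₁) (x : E) (y : F) :
    hmap S T (HTensor.of (x ⊗ₜ[ℂ] y)) = HTensor.of (S x ⊗ₜ[ℂ] T y) := hmap_coe S T _

lemma HTensor.continuous_of_tmul : Continuous fun p : E × F => HTensor.of (p.1 ⊗ₜ[ℂ] p.2) :=
  HTensor.of.continuous.comp (TensorProduct.mkL ℂ E F).continuous₂

/-- A closed subspace which contains the elementary tensors of a dense set of vectors is everything. -/
lemma HTensor.mem_of_dense {R : Submodule ℂ (HTensor E F)}
    (hR : IsClosed (R : Set (HTensor E F))) {S : Set E} {T : Set F} (hS : Dense S) (hT : Dense T)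
    (h : ∀ x ∈ S, ∀ y ∈ T, HTensor.of (x ⊗ₜ[ℂ] y) ∈ R) (z : HTensor E F) : z ∈ R := by
  refine HTensor.induction z hR fun z => ?_
  induction z using TensorProduct.induction_on with
  | zero => rw [map_zero]; exact R.zero_mem
  | add z z' h h' => rw [map_add]; exact R.add_mem h h'
  | tmul x y =>
    have h1 : closure (S ×ˢ T) ⊆ {p : E × F | HTensor.of (p.1 ⊗ₜ[ℂ] p.2) ∈ R} :=
      closure_minimal (fun p hp => h _ hp.1 _ hp.2) (hR.preimage HTensor.continuous_of_tmul)
    exact h1 (show (x, y) ∈ closure (S ×ˢ T) by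
      rw [closure_prod_eq]; exact ⟨hS x, hT y⟩)

lemma isomA_tmul (x : E) (y : F) (z : K) :
    isomA E F K ((x ⊗ₜ y) ⊗ₜ z) = HTensor.of (HTensor.of (x ⊗ₜ[ℂ] y) ⊗ₜ[ℂ] z) := rfl

lemma isomB_tmul (x : E) (y : F) (z : K) :
    isomB E F K ((x ⊗ₜ y) ⊗ₜ z) = HTensor.of (x ⊗ₜ[ℂ] HTensor.of (y ⊗ₜ[ℂ] z)) := rfl

lemma isomB_denseRange : DenseRange (isomB E F K) := by
  let R := (LinearMap.range (isomB E F K).toLinearMap).topologicalClosure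
  refine fun x => HTensor.mem_of_dense (R := R) (Submodule.isClosed_topologicalClosure _)
    dense_univ HTensor.denseRange ?_ x
  rintro x - _ ⟨y, rfl⟩
  induction y using TensorProduct.induction_on with
  | zero => rw [map_zero, TensorProduct.tmul_zero, map_zero]; exact R.zero_mem
  | add z z' h h' => rw [map_add, TensorProduct.tmul_add, map_add]; exact R.add_mem h h'
  | tmul y z => exact subset_closure ⟨(x ⊗ₜ y) ⊗ₜ z, isomB_tmul x y z⟩

variable (E F K) in
/-- The associator `(E ⊗ F) ⊗ K → E ⊗ (F ⊗ K)`. -/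
def hassoc : HTensor (HTensor E F) K →L[ℂ] HTensor E (HTensor F K) :=
  LinearMap.extendOfNorm (isomB E F K).toLinearMap (isomA E F K).toLinearMap

variable (E F K) in
/-- The inverse associator `E ⊗ (F ⊗ K) → (E ⊗ F) ⊗ K`. -/
def hassocInv : HTensor E (HTensor F K) →L[ℂ] HTensor (HTensor E F) K :=
  LinearMap.extendOfNorm (isomA E F K).toLinearMap (isomB E F K).toLinearMap

lemma hassoc_isomA (z : (E ⊗[ℂ] F) ⊗[ℂ] K) : hassoc E F K (isomA E F K z) = isomB E F K z :=
  LinearMap.extendOfNorm_eq (isomA_denseRange E F K) ⟨1, fun z => by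
    rw [one_mul]
    exact ((isomB E F K).norm_map z).trans_le ((isomA E F K).norm_map z).ge⟩ z

lemma hassocInv_isomB (z : (E ⊗[ℂ] F) ⊗[ℂ] K) :
    hassocInv E F K (isomB E F K z) = isomA E F K z :=
  LinearMap.extendOfNorm_eq isomB_denseRange ⟨1, fun z => by
    rw [one_mul]
    exact ((isomA E F K).norm_map z).trans_le ((isomB E F K).norm_map z).ge⟩ z

lemma hassoc_comp_hassocInv : hassoc E F K ∘L hassocInv E F K = .id ℂ _ := by
  ext x
  refine isomB_denseRange.induction (P := fun x => (hassoc E F K ∘L hassocInv E F K) x = x) ?_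
    (isClosed_eq (ContinuousLinearMap.continuous _) continuous_id) x
  rintro _ ⟨z, rfl⟩
  rw [ContinuousLinearMap.comp_apply, hassocInv_isomB, hassoc_isomA]

lemma hassocInv_comp_hassoc : hassocInv E F K ∘L hassoc E F K = .id ℂ _ := by
  ext x
  refine (isomA_denseRange E F K).induction
    (P := fun x => (hassocInv E F K ∘L hassoc E F K) x = x) ?_
    (isClosed_eq (ContinuousLinearMap.continuous _) continuous_id) x
  rintro _ ⟨z, rfl⟩
  rw [ContinuousLinearMap.comp_apply, hassoc_isomA, hassocInv_isomB]

lemma adjoint_hassoc : (hassoc E F K).adjoint = hassocInv E F K := by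
  have h1 : (hassoc E F K).adjoint ∘L hassoc E F K = .id ℂ _ := by
    refine (ContinuousLinearMap.norm_map_iff_adjoint_comp_self _).1 fun x => ?_
    refine (isomA_denseRange E F K).induction (P := fun x => ‖hassoc E F K x‖ = ‖x‖) ?_
      (isClosed_eq (hassoc E F K).continuous.norm continuous_norm) x
    rintro _ ⟨z, rfl⟩
    rw [hassoc_isomA, LinearIsometry.norm_map, LinearIsometry.norm_map]
  calc _ = ((hassoc E F K).adjoint ∘L hassoc E F K) ∘L hassocInv E F K := by
        rw [ContinuousLinearMap.comp_assoc, hassoc_comp_hassocInv]; rfl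
    _ = _ := by rw [h1]; rfl

lemma hassoc_comp_hmap (S : E →L[ℂ] E₁) (T : F →L[ℂ] F₁) (R : K →L[ℂ] K₁) :
    hassoc E₁ F₁ K₁ ∘L hmap (hmap S T) R = hmap S (hmap T R) ∘L hassoc E F K := by
  ext x
  refine (isomA_denseRange E F K).induction (P := fun x =>
    (hassoc E₁ F₁ K₁ ∘L hmap (hmap S T) R) x = (hmap S (hmap T R) ∘L hassoc E F K) x) ?_
    (isClosed_eq (ContinuousLinearMap.continuous _) (ContinuousLinearMap.continuous _)) x
  rintro _ ⟨z, rfl⟩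
  rw [ContinuousLinearMap.comp_apply, ContinuousLinearMap.comp_apply, hassoc_isomA]
  induction z using TensorProduct.induction_on with
  | zero => simp only [isomA_zero, isomB_zero, map_zero]
  | add z z' h h' => simp only [map_add, h, h']
  | tmul y z =>
    induction y using TensorProduct.induction_on with
    | zero => simp only [TensorProduct.zero_tmul, isomA_zero, isomB_zero, map_zero]
    | add y y' h h' => simp only [TensorProduct.add_tmul, map_add, h, h']
    | tmul x y =>
      rw [isomA_tmul, isomB_tmul, hmap_of_tmul, hmap_of_tmul, hmap_of_tmul, hmap_of_tmul,
        ← isomA_tmul, hassoc_isomA, isomB_tmul]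

variable (E) in
/-- The unitary `E → ℂ ⊗ E`, `x ↦ 1 ⊗ x`. -/
def hunit : E →L[ℂ] HTensor ℂ E :=
  HTensor.of.toContinuousLinearMap ∘L (TensorProduct.mkL ℂ ℂ E 1)

lemma hunit_apply (x : E) : hunit E x = HTensor.of ((1 : ℂ) ⊗ₜ[ℂ] x) := rfl

lemma adjoint_hunit_comp : (hunit E).adjoint ∘L hunit E = .id ℂ E :=
  (ContinuousLinearMap.norm_map_iff_adjoint_comp_self _).1 fun x => by
    rw [hunit_apply, LinearIsometry.norm_map, TensorProduct.norm_tmul, norm_one, one_mul]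

lemma hunit_comp_adjoint : hunit E ∘L (hunit E).adjoint = .id ℂ _ := by
  refine HTensor.clm_ext fun z => ?_
  induction z using TensorProduct.induction_on with
  | zero => simp only [map_zero]
  | add z z' h h' => simp only [map_add, h, h']
  | tmul c x =>
    have h1 : HTensor.of (c ⊗ₜ[ℂ] x) = hunit E (c • x) := by
      rw [hunit_apply, ← TensorProduct.smul_tmul, smul_eq_mul, mul_one]
    have h2 : (hunit E).adjoint (hunit E (c • x)) = c • x :=
      congrArg (fun T => T (c • x)) adjoint_hunit_comp
    rw [ContinuousLinearMap.comp_apply, h1, h2]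
    rfl

lemma hunit_comp (T : E →L[ℂ] F) : hunit F ∘L T = hmap (.id ℂ ℂ) T ∘L hunit E := by
  ext x
  rw [ContinuousLinearMap.comp_apply, ContinuousLinearMap.comp_apply, hunit_apply, hunit_apply,
    hmap_of_tmul]
  rfl

variable {A : Type v} [NonUnitalCStarAlgebra A]

/-- Identities between the maps `x ↦ v x w` and `x ↦ s ⊗ x` may be checked on elementary tensors. -/
lemma KT.clm_ext {Z : Type*} [NormedAddCommGroup Z] [NormedSpace ℂ Z]
    {f f' : KT E F A →L[ℂ] Z} (h : ∀ k a, f (KT.tmul k a) = f' (KT.tmul k a)) (x : KT E F A) :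
    f x = f' x := by
  refine KT.funext f.continuous f'.continuous (fun t => ?_) x
  induction t using AlgKT.induction with
  | zero => simp only [map_zero]
  | add x y hx hy => simp only [map_add, hx, hy]
  | tmul k a => exact h k a

lemma KT.conj_tmul (v : E →L[ℂ] F) (k : Cpt E E) (a : A) :
    KT.conj v (KT.tmul k a) = KT.tmul (Cpt.sandwich v v.adjoint k) a := KT.sandwich_of _ _ _ _

lemma KT.tensorLeft_tmul (s : Cpt E E₁) (k : Cpt F F₁) (a : A) :
    KT.tensorLeft s (KT.tmul k a) = KT.tmul (Cpt.tensor s k) a := KT.tensorLeft_of _ _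

lemma KT.conj_hassoc (s : Cpt E E) (s' : Cpt F F) (x : KT K K A) :
    KT.conj (hassoc E F K) (KT.tensorLeft (Cpt.tensor s s') x)
      = KT.tensorLeft s (KT.tensorLeft s' x) := by
  refine KT.clm_ext (f := (KT.conj (hassoc E F K)) ∘L (KT.tensorLeft (Cpt.tensor s s')))
    (f' := KT.tensorLeft s ∘L KT.tensorLeft s') (fun k a => ?_) x
  simp only [ContinuousLinearMap.comp_apply, KT.tensorLeft_tmul, KT.conj_tmul]
  congr 1
  refine Subtype.ext ?_
  change hassoc E F K ∘L (hmap (hmap s.1 s'.1) k.1 ∘L (hassoc E F K).adjoint)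
    = hmap s.1 (hmap s'.1 k.1)
  rw [← ContinuousLinearMap.comp_assoc, hassoc_comp_hmap, adjoint_hassoc,
    ContinuousLinearMap.comp_assoc, hassoc_comp_hassocInv]
  rfl

lemma KT.conj_hunit {s : Cpt ℂ ℂ} (hs : s.1 = .id ℂ ℂ) (x : KT K K A) :
    KT.conj (hunit K) x = KT.tensorLeft s x := by
  refine KT.clm_ext (f := KT.conj (hunit K)) (f' := KT.tensorLeft s) (fun k a => ?_) x
  rw [KT.tensorLeft_tmul, KT.conj_tmul]
  congr 1
  refine Subtype.ext ?_
  change hunit K ∘L (k.1 ∘L (hunit K).adjoint) = hmap s.1 k.1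
  rw [← ContinuousLinearMap.comp_assoc, hunit_comp, ContinuousLinearMap.comp_assoc,
    hunit_comp_adjoint, hs]
  rfl

end Tensor

/-! ### Constructions with strictly positive elements -/

section StrictlyPos

variable {G : Type u} [TopologicalSpace G] [Group G] {A B : GAlg.{u, v} G}
  {μ ν ω μ' ν' : URep G}

/-- If `s = r²` and `s' = r'²`, then `s ⊗ s'` is the square of `r ⊗ r'`, which has dense range and is
therefore injective. -/
lemma Cpt.IsFull.tensor {E F : Type} [NormedAddCommGroup E] [InnerProductSpace ℂ E]
    [CompleteSpace E] [NormedAddCommGroup F] [InnerProductSpace ℂ F] [CompleteSpace F]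
    {s : Cpt E E} {s' : Cpt F F} (hs : Cpt.IsFull s) (hs' : Cpt.IsFull s') :
    Cpt.IsFull (Cpt.tensor s s') := by
  obtain ⟨r, hr, hrs, -, -⟩ := Cpt.exists_sqrt hs.1 hs.re_nonneg
  obtain ⟨r', hr', hrs', -, -⟩ := Cpt.exists_sqrt hs'.1 hs'.re_nonneg
  have hadj : r.1.adjoint = r.1 := congrArg Subtype.val hr.star_eq
  have hadj' : r'.1.adjoint = r'.1 := congrArg Subtype.val hr'.star_eq
  have ht : IsSelfAdjoint (Cpt.tensor r r') := Subtype.ext (by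
    change (hmap r.1 r'.1).adjoint = hmap r.1 r'.1
    rw [adjoint_hmap, hadj, hadj'])
  have e : Cpt.tensor s s' = Cpt.tensor r r' * Cpt.tensor r r' := by
    rw [← hrs, ← hrs']
    exact Subtype.ext (hmap_comp _ _ _ _)
  rw [e]
  refine ⟨by rw [IsSelfAdjoint, star_mul, ht.star_eq], fun x hx => ?_⟩
  rw [Cpt.inner_mul_self ht, ← Complex.ofReal_pow, Complex.ofReal_re]
  suffices h : (Cpt.tensor r r').1 x ≠ 0 by positivity
  intro h
  have h1 : DenseRange r.1 := denseRange_of_injective hadj fun y hy => hs.injective y (by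
    rw [← hrs, Cpt.mul_apply, hy, map_zero])
  have h2 : DenseRange r'.1 := denseRange_of_injective hadj' fun y hy => hs'.injective y (by
    rw [← hrs', Cpt.mul_apply, hy, map_zero])
  -- `x` is orthogonal to the range of `r ⊗ r'`
  have h3 := HTensor.mem_of_dense (R := (ℂ ∙ x)ᗮ) (Submodule.isClosed_orthogonal _) h1 h2 (by
    rintro _ ⟨y, rfl⟩ _ ⟨z, rfl⟩
    rw [Submodule.mem_orthogonal_singleton_iff_inner_left]
    have h4 := Cpt.inner_left ht (HTensor.of (y ⊗ₜ[ℂ] z)) x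
    rw [h, inner_zero_right] at h4
    change ⟪hmap r.1 r'.1 (HTensor.of (y ⊗ₜ[ℂ] z)), x⟫_ℂ = 0 at h4
    rwa [hmap_of_tmul] at h4) x
  exact hx (inner_self_eq_zero.1 (Submodule.mem_orthogonal_singleton_iff_inner_left.1 h3))

lemma Cpt.IsFull.conj_isometry {E F : Type} [NormedAddCommGroup E] [InnerProductSpace ℂ E]
    [CompleteSpace E] [NormedAddCommGroup F] [InnerProductSpace ℂ F] [CompleteSpace F]
    {s : Cpt F F} (hs : Cpt.IsFull s) {v : E →L[ℂ] F} (hv : ∀ x, v x = 0 → x = 0) :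
    Cpt.IsFull (Cpt.sandwich v.adjoint v s) := by
  have hadj : s.1.adjoint = s.1 := congrArg Subtype.val hs.1.star_eq
  refine ⟨Subtype.ext ?_, fun x hx => ?_⟩
  · change (v.adjoint ∘L s.1 ∘L v).adjoint = v.adjoint ∘L s.1 ∘L v
    rw [ContinuousLinearMap.adjoint_comp, ContinuousLinearMap.adjoint_comp, hadj,
      ContinuousLinearMap.adjoint_adjoint]
    rfl
  · change 0 < (⟪x, v.adjoint (s.1 (v x))⟫_ℂ).re
    rw [ContinuousLinearMap.adjoint_inner_right]
    exact hs.2 _ fun h => hx (hv x h)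

/-- The strictly positive element `v* s v` for an isometric intertwiner `v`. -/
def InvStrictlyPos.pull (s : InvStrictlyPos ν) {v : μ.H →L[ℂ] ν.H} (hv : Intertwines μ ν v)
    (hvv : v.adjoint ∘L v = .id ℂ μ.H) : InvStrictlyPos μ :=
  .ofFull (k := Cpt.sandwich v.adjoint v s.s) (s.isFull.conj_isometry fun x hx => by
    have := congrArg (fun T => T x) hvv
    rw [ContinuousLinearMap.comp_apply, hx, map_zero] at this
    exact this.symm) (hv.adjoint.comp (s.intertwines.comp hv))

/-- The strictly positive element `s ⊗ s'`. -/
def InvStrictlyPos.tensor (s : InvStrictlyPos ν) (s' : InvStrictlyPos ν') :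
    InvStrictlyPos (ν.tensor ν') :=
  .ofFull (ν := ν.tensor ν') (k := Cpt.tensor s.s s'.s) (s.isFull.tensor s'.isFull) fun g => by
    change hmap (ν.op g) (ν'.op g) ∘L hmap s.s.1 s'.s.1
      = hmap s.s.1 s'.s.1 ∘L hmap (ν.op g) (ν'.op g)
    rw [← hmap_comp, ← hmap_comp, s.intertwines g, s'.intertwines g]

/-- The strictly positive element `s ⊕ s'`. -/
def InvStrictlyPos.sum (s : InvStrictlyPos ν) (s' : InvStrictlyPos ν') :
    InvStrictlyPos (ν.sum ν') :=
  .ofFull (ν := ν.sum ν') (k := Cpt.sandwich (ν.inl ν') (ν.fst ν') s.s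
      + Cpt.sandwich (ν.inr ν') (ν.snd ν') s'.s) (by
    have hadj : s.s.1.adjoint = s.s.1 := congrArg Subtype.val s.isFull.1.star_eq
    have hadj' : s'.s.1.adjoint = s'.s.1 := congrArg Subtype.val s'.isFull.1.star_eq
    refine ⟨Subtype.ext ?_, fun x hx => ?_⟩
    · change (ν.inl ν' ∘L s.s.1 ∘L ν.fst ν' + ν.inr ν' ∘L s'.s.1 ∘L ν.snd ν').adjoint
        = ν.inl ν' ∘L s.s.1 ∘L ν.fst ν' + ν.inr ν' ∘L s'.s.1 ∘L ν.snd ν'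
      simp only [map_add, ContinuousLinearMap.adjoint_comp, hadj, hadj', URep.adjoint_inl,
        URep.adjoint_inr, URep.adjoint_fst, URep.adjoint_snd]
      rfl
    · change 0 < (⟪x, ν.inl ν' (s.s.1 (ν.fst ν' x)) + ν.inr ν' (s'.s.1 (ν.snd ν' x))⟫_ℂ).re
      rw [inner_add_right, ← URep.adjoint_fst, ← URep.adjoint_snd,
        ContinuousLinearMap.adjoint_inner_right, ContinuousLinearMap.adjoint_inner_right,
        Complex.add_re]
      rcases eq_or_ne (ν.fst ν' x) 0 with h1 | h1
      · rcases eq_or_ne (ν.snd ν' x) 0 with h2 | h2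
        · exact absurd (WithLp.ofLp_injective 2 (Prod.ext h1 h2)) hx
        · exact add_pos_of_nonneg_of_pos (s.isFull.re_nonneg _) (s'.isFull.2 _ h2)
      · exact add_pos_of_pos_of_nonneg (s.isFull.2 _ h1) (s'.isFull.re_nonneg _))
    (((Intertwines.inl _ _).comp (s.intertwines.comp (Intertwines.fst _ _))).add
      ((Intertwines.inr _ _).comp (s'.intertwines.comp (Intertwines.snd _ _))))

/-- The identity of a finite dimensional representation. -/
def InvStrictlyPos.one (ν : URep G) [FiniteDimensional ℂ ν.H] : InvStrictlyPos ν :=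
  .ofFull (k := ⟨.id ℂ ν.H, isCompactOperator_of_range_le (V := ⊤) _ fun _ => trivial⟩)
    ⟨Subtype.ext ContinuousLinearMap.adjoint_id, fun x hx => by
      have h : (⟪x, x⟫_ℂ).re = ‖x‖ ^ 2 := inner_self_eq_norm_sq (𝕜 := ℂ) x
      change 0 < (⟪x, x⟫_ℂ).re
      rw [h]
      positivity⟩ (Intertwines.id ν)

/-! #### The module axioms -/

lemma URep.sub_iff_exists_intertwines :
    μ.Sub ν ↔ ∃ v : μ.H →L[ℂ] ν.H, Intertwines μ ν v ∧ v.adjoint ∘L v = .id ℂ μ.H := by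
  constructor
  · rintro ⟨v, hv⟩
    exact ⟨v.toContinuousLinearMap, fun g => ContinuousLinearMap.ext fun x => (hv g x).symm,
      (ContinuousLinearMap.norm_map_iff_adjoint_comp_self _).1 v.norm_map⟩
  · rintro ⟨v, hv, hvv⟩
    exact ⟨⟨v.toLinearMap, (ContinuousLinearMap.norm_map_iff_adjoint_comp_self _).2 hvv⟩,
      fun g x => (congrArg (fun T => T x) (hv g)).symm⟩

lemma CuRep.exists_rep (r : CuRep G) : ∃ ν, CuRep.mk ν = r := Quotient.exists_rep r

lemma CuRep.mk_le_iff {μ ν : URep G} : CuRep.mk μ ≤ CuRep.mk ν ↔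
    ∃ v : μ.H →L[ℂ] ν.H, Intertwines μ ν v ∧ v.adjoint ∘L v = .id ℂ μ.H :=
  CuRep.mk_le_mk.trans URep.sub_iff_exists_intertwines

lemma CuG.mk_tensor_le {x y : GPos A} (s : InvStrictlyPos ν) (s' : InvStrictlyPos ν')
    (h : CuRep.mk ν ≤ CuRep.mk ν') (hxy : CuG.mk x ≤ CuG.mk y) :
    CuG.mk (x.tensor s) ≤ CuG.mk (y.tensor s') := by
  obtain ⟨v, hv, hvv⟩ := CuRep.mk_le_iff.1 h
  exact GPos.tensor_le s s' hv hvv hxy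

/-- The action does not depend on choices. -/
lemma CuG.smul_mk (ν : URep G) (s : InvStrictlyPos ν) (a : GPos A) :
    CuRep.mk ν • CuG.mk a = CuG.mk (a.tensor s) := by
  have h : ∃ z, CuG.IsSMul (CuRep.mk ν) (CuG.mk a) z := ⟨_, ν, s, a, rfl, rfl, rfl⟩
  obtain ⟨ν', s', a', hν, ha, hz⟩ := h.choose_spec
  have h1 : CuRep.mk ν • CuG.mk a = h.choose := dif_pos h
  rw [h1, hz]
  exact le_antisymm (CuG.mk_tensor_le s' s hν.ge ha.ge) (CuG.mk_tensor_le s s' hν.le ha.le)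

lemma CuG.mk_eq_zero {x : GPos A} (h : x.a = 0) : CuG.mk x = 0 := by
  refine le_antisymm ?_ ?_
  · refine GPos.le_of_eq_conj (x := x) (y := ⟨URep.zero, 0, fun g => map_zero _, 0, by simp⟩)
      (Intertwines.zero _ _) ?_
    rw [h, map_zero]
  · refine GPos.le_of_eq_conj (x := ⟨URep.zero, 0, fun g => map_zero _, 0, by simp⟩) (y := x)
      (Intertwines.zero _ _) ?_
    rw [h, map_zero]

lemma Intertwines.hmap {v : μ.H →L[ℂ] ν.H} {w : μ'.H →L[ℂ] ν'.H} (hv : Intertwines μ ν v)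
    (hw : Intertwines μ' ν' w) :
    Intertwines (μ.tensor μ') (ν.tensor ν') (EquivCuntz.hmap v w) := fun g => by
  change EquivCuntz.hmap (ν.op g) (ν'.op g) ∘L EquivCuntz.hmap v w
    = EquivCuntz.hmap v w ∘L EquivCuntz.hmap (μ.op g) (μ'.op g)
  rw [← hmap_comp, ← hmap_comp, hv g, hw g]

lemma KT.conj_hmap (s : Cpt μ.H μ.H) (v : μ.H →L[ℂ] ν.H) (w : μ'.H →L[ℂ] ν'.H)
    (x : KTG μ' μ' A) : KT.conj (EquivCuntz.hmap v w) (KT.tensorLeft s x)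
      = KT.tensorLeft (Cpt.sandwich v v.adjoint s) (KT.conj w x) := by
  unfold KT.conj
  rw [adjoint_hmap]
  exact KT.tensorLeft_sandwich s v v.adjoint w w.adjoint _ x

lemma adjoint_comp_hmap {v : μ.H →L[ℂ] ν.H} {w : μ'.H →L[ℂ] ν'.H}
    (hv : v.adjoint ∘L v = .id ℂ _) (hw : w.adjoint ∘L w = .id ℂ _) :
    (hmap v w).adjoint ∘L hmap v w = .id ℂ _ := by
  rw [adjoint_hmap, ← hmap_comp, hv, hw, hmap_id]

lemma hmap_zero_left {E F E₁ F₁ : Type*} [NormedAddCommGroup E] [InnerProductSpace ℂ E]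
    [NormedAddCommGroup F] [InnerProductSpace ℂ F] [NormedAddCommGroup E₁] [InnerProductSpace ℂ E₁]
    [NormedAddCommGroup F₁] [InnerProductSpace ℂ F₁] (T : F →L[ℂ] F₁) :
    hmap (0 : E →L[ℂ] E₁) T = 0 := by
  simpa using hmap_smul_left (0 : ℂ) (0 : E →L[ℂ] E₁) T

lemma hmap_zero_right {E F E₁ F₁ : Type*} [NormedAddCommGroup E] [InnerProductSpace ℂ E]
    [NormedAddCommGroup F] [InnerProductSpace ℂ F] [NormedAddCommGroup E₁] [InnerProductSpace ℂ E₁]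
    [NormedAddCommGroup F₁] [InnerProductSpace ℂ F₁] (T : E →L[ℂ] E₁) :
    hmap T (0 : F →L[ℂ] F₁) = 0 := by
  simpa using hmap_smul_right (0 : ℂ) T (0 : F →L[ℂ] F₁)

variable [IsTopologicalGroup G] [CompactSpace G]

lemma CuG.smul_le_smul {r r' : CuRep G} {x y : CuG A} (hr : r ≤ r') (hx : x ≤ y) :
    r • x ≤ r' • y := by
  obtain ⟨ν, rfl⟩ := CuRep.exists_rep r
  obtain ⟨ν', rfl⟩ := CuRep.exists_rep r'
  obtain ⟨x, rfl⟩ := CuG.exists_rep x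
  obtain ⟨y, rfl⟩ := CuG.exists_rep y
  obtain ⟨s⟩ := ν.exists_invStrictlyPos
  obtain ⟨s'⟩ := ν'.exists_invStrictlyPos
  rw [CuG.smul_mk ν s, CuG.smul_mk ν' s']
  exact CuG.mk_tensor_le s s' hr hx

lemma CuG.add_smul (r r' : CuRep G) (x : CuG A) : (r + r') • x = r • x + r' • x := by
  obtain ⟨ν, rfl⟩ := CuRep.exists_rep r
  obtain ⟨ν', rfl⟩ := CuRep.exists_rep r'
  obtain ⟨x, rfl⟩ := CuG.exists_rep x
  obtain ⟨s⟩ := ν.exists_invStrictlyPos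
  obtain ⟨s'⟩ := ν'.exists_invStrictlyPos
  rw [CuG.smul_mk ν s, CuG.smul_mk ν' s']
  refine (CuG.smul_mk (ν.sum ν') (s.sum s') x).trans ?_
  have h1 : (ν.inl ν').adjoint ∘L ν.inl ν' = .id ℂ _ := by rw [URep.adjoint_inl, URep.fst_inl]
  have h2 : (ν.inr ν').adjoint ∘L ν.inr ν' = .id ℂ _ := by rw [URep.adjoint_inr, URep.snd_inr]
  have h3 : (.id ℂ x.μ.H : x.μ.H →L[ℂ] x.μ.H).adjoint ∘L .id ℂ x.μ.H = .id ℂ _ := by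
    rw [ContinuousLinearMap.adjoint_id]; rfl
  refine CuG.mk_eq_add (z := x.tensor (s.sum s')) (x := x.tensor s) (y := x.tensor s')
    ((Intertwines.inl ν ν').hmap (Intertwines.id x.μ))
    ((Intertwines.inr ν ν').hmap (Intertwines.id x.μ)) ?_ (adjoint_comp_hmap h1 h3)
    (adjoint_comp_hmap h2 h3) ?_
  · have key : KT.tensorLeft (Cpt.sandwich (ν.inl ν') (ν.fst ν') s.s
        + Cpt.sandwich (ν.inr ν') (ν.snd ν') s'.s) x.a
        = KT.conj (hmap (ν.inl ν') (.id ℂ x.μ.H)) (KT.tensorLeft s.s x.a)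
          + KT.conj (hmap (ν.inr ν') (.id ℂ x.μ.H)) (KT.tensorLeft s'.s x.a) := by
      rw [KT.tensorLeft_add_left, KT.conj_hmap, KT.conj_hmap, KT.conj_id, URep.adjoint_inl,
        URep.adjoint_inr]
    exact key
  · have key : (hmap (ν.inl ν') (.id ℂ x.μ.H)).adjoint ∘L hmap (ν.inr ν') (.id ℂ x.μ.H) = 0 := by
      rw [adjoint_hmap, ← hmap_comp, URep.adjoint_inl, URep.fst_inr, hmap_zero_left]
    exact key

lemma CuG.smul_add (r : CuRep G) (x y : CuG A) : r • (x + y) = r • x + r • y := by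
  obtain ⟨ν, rfl⟩ := CuRep.exists_rep r
  obtain ⟨x, rfl⟩ := CuG.exists_rep x
  obtain ⟨y, rfl⟩ := CuG.exists_rep y
  obtain ⟨s⟩ := ν.exists_invStrictlyPos
  rw [CuG.smul_mk ν s, CuG.smul_mk ν s]
  refine (CuG.smul_mk ν s (x.sum y)).trans ?_
  have h1 : (x.μ.inl y.μ).adjoint ∘L x.μ.inl y.μ = .id ℂ _ := by
    rw [URep.adjoint_inl, URep.fst_inl]
  have h2 : (x.μ.inr y.μ).adjoint ∘L x.μ.inr y.μ = .id ℂ _ := by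
    rw [URep.adjoint_inr, URep.snd_inr]
  have h3 : (.id ℂ ν.H : ν.H →L[ℂ] ν.H).adjoint ∘L .id ℂ ν.H = .id ℂ _ := by
    rw [ContinuousLinearMap.adjoint_id]; rfl
  refine CuG.mk_eq_add (z := (x.sum y).tensor s) (x := x.tensor s) (y := y.tensor s)
    ((Intertwines.id ν).hmap (Intertwines.inl x.μ y.μ))
    ((Intertwines.id ν).hmap (Intertwines.inr x.μ y.μ)) ?_ (adjoint_comp_hmap h3 h1)
    (adjoint_comp_hmap h3 h2) ?_
  · have key : KT.tensorLeft s.s (KTG.blockSum x.a y.a)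
        = KT.conj (hmap (.id ℂ ν.H) (x.μ.inl y.μ)) (KT.tensorLeft s.s x.a)
          + KT.conj (hmap (.id ℂ ν.H) (x.μ.inr y.μ)) (KT.tensorLeft s.s y.a) := by
      rw [KTG.blockSum_eq, map_add, KT.conj_hmap, KT.conj_hmap, ContinuousLinearMap.adjoint_id]
      rfl
    exact key
  · have key : (hmap (.id ℂ ν.H) (x.μ.inl y.μ)).adjoint ∘L hmap (.id ℂ ν.H) (x.μ.inr y.μ) = 0 := by
      rw [adjoint_hmap, ← hmap_comp, URep.adjoint_inl, URep.fst_inr, hmap_zero_right]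
    exact key

lemma CuG.mul_smul (r r' : CuRep G) (x : CuG A) : (r * r') • x = r • (r' • x) := by
  obtain ⟨ν, rfl⟩ := CuRep.exists_rep r
  obtain ⟨ν', rfl⟩ := CuRep.exists_rep r'
  obtain ⟨x, rfl⟩ := CuG.exists_rep x
  obtain ⟨s⟩ := ν.exists_invStrictlyPos
  obtain ⟨s'⟩ := ν'.exists_invStrictlyPos
  rw [CuG.smul_mk ν' s', CuG.smul_mk ν s]
  refine (CuG.smul_mk (ν.tensor ν') (s.tensor s') x).trans ?_
  have hI : Intertwines ((ν.tensor ν').tensor x.μ) (ν.tensor (ν'.tensor x.μ))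
      (hassoc ν.H ν'.H x.μ.H) := fun g => (hassoc_comp_hmap (ν.op g) (ν'.op g) (x.μ.op g)).symm
  have h1 : KT.conj (hassoc ν.H ν'.H x.μ.H) (KT.tensorLeft (Cpt.tensor s.s s'.s) x.a)
      = KT.tensorLeft s.s (KT.tensorLeft s'.s x.a) := KT.conj_hassoc _ _ _
  refine le_antisymm ?_ ?_
  · refine GPos.le_of_eq_conj (x := x.tensor (s.tensor s')) (y := (x.tensor s').tensor s)
      hI.adjoint ?_
    have key : KT.tensorLeft (Cpt.tensor s.s s'.s) x.a
        = KT.conj (hassoc ν.H ν'.H x.μ.H).adjoint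
          (KT.tensorLeft s.s (KT.tensorLeft s'.s x.a)) := by
      rw [← h1, KT.conj_conj, adjoint_hassoc, hassocInv_comp_hassoc, KT.conj_id]
    exact key
  · exact GPos.le_of_eq_conj (x := (x.tensor s').tensor s) (y := x.tensor (s.tensor s')) hI
      h1.symm

lemma CuG.one_smul (x : CuG A) : (1 : CuRep G) • x = x := by
  obtain ⟨x, rfl⟩ := CuG.exists_rep x
  have : FiniteDimensional ℂ (URep.trivial : URep G).H := inferInstanceAs (FiniteDimensional ℂ ℂ)
  refine (CuG.smul_mk URep.trivial (.one _) x).trans ?_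
  have hI : Intertwines x.μ (URep.trivial.tensor x.μ) (hunit x.μ.H) :=
    fun g => (hunit_comp (x.μ.op g)).symm
  have h1 : KT.conj (hunit x.μ.H) x.a
      = KT.tensorLeft (InvStrictlyPos.one (URep.trivial : URep G)).s x.a := KT.conj_hunit rfl _
  refine le_antisymm ?_ ?_
  · exact GPos.le_of_eq_conj (x := x.tensor (.one URep.trivial)) (y := x) hI h1.symm
  · refine GPos.le_of_eq_conj (x := x) (y := x.tensor (.one URep.trivial)) hI.adjoint ?_
    have key : x.a = KT.conj (hunit x.μ.H).adjoint (KT.conj (hunit x.μ.H) x.a) := by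
      rw [KT.conj_conj, adjoint_hunit_comp, KT.conj_id]
    rw [h1] at key
    exact key

lemma CuG.zero_smul (x : CuG A) : (0 : CuRep G) • x = 0 := by
  obtain ⟨x, rfl⟩ := CuG.exists_rep x
  obtain ⟨s⟩ := (URep.zero : URep G).exists_invStrictlyPos
  refine (CuG.smul_mk URep.zero s x).trans (CuG.mk_eq_zero ?_)
  have hs : s.s = 0 := Subtype.ext (ContinuousLinearMap.ext fun y => by
    rw [URep.zero_eq y, map_zero, map_zero])
  have h := KT.norm_tensorLeft_le s.s x.a
  rw [hs, norm_zero, zero_mul] at h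
  change KT.tensorLeft s.s x.a = 0
  rw [hs]
  exact norm_le_zero_iff.1 h

lemma CuG.smul_zero (r : CuRep G) : r • (0 : CuG A) = 0 := by
  obtain ⟨ν, rfl⟩ := CuRep.exists_rep r
  obtain ⟨s⟩ := ν.exists_invStrictlyPos
  exact (CuG.smul_mk ν s _).trans (CuG.mk_eq_zero (map_zero _))

end StrictlyPos

/-! ### Subrepresentations and suprema in the representation semiring -/

section Subrep

variable {G : Type u} [TopologicalSpace G] [Group G] {A B : GAlg.{u, v} G}
  {μ ν ω μ' ν' : URep G}

/-- The restriction of a representation to a closed invariant subspace. -/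
def URep.restrict (μ : URep G) (W : Submodule ℂ μ.H) (hc : IsClosed (W : Set μ.H))
    (hW : ∀ g, ∀ x ∈ W, μ.U g x ∈ W) : URep G where
  H := W
  complete := hc.completeSpace_coe
  separable := (TopologicalSpace.IsSeparable.of_separableSpace (W : Set μ.H)).separableSpace
  U :=
    { toFun := fun g =>
        { toFun := fun x => ⟨μ.U g x, hW g x x.2⟩
          invFun := fun x => ⟨μ.U g⁻¹ x, hW g⁻¹ x x.2⟩
          left_inv := fun x => Subtype.ext (by
            change (μ.U g⁻¹ * μ.U g) x.1 = x.1
            rw [← map_mul, inv_mul_cancel, map_one]; rfl)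
          right_inv := fun x => Subtype.ext (by
            change (μ.U g * μ.U g⁻¹) x.1 = x.1
            rw [← map_mul, mul_inv_cancel, map_one]; rfl)
          map_add' := fun x y => Subtype.ext (map_add (μ.U g) x.1 y.1)
          map_smul' := fun c x => Subtype.ext (map_smul (μ.U g) c x.1)
          norm_map' := fun x => (μ.U g).norm_map x.1 }
      map_one' := by ext x; change μ.U 1 x.1 = x.1; rw [map_one]; rfl
      map_mul' := fun g h => by ext x; change μ.U (g * h) x.1 = _; rw [map_mul]; rfl }
  continuous_apply x := (μ.continuous_apply x.1).subtype_mk _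

/-- A subrepresentation: an isometric intertwiner `v` with range `W`. -/
lemma URep.exists_restrict (μ : URep G) (W : Submodule ℂ μ.H) (hc : IsClosed (W : Set μ.H))
    (hW : ∀ g, ∀ x ∈ W, μ.U g x ∈ W) :
    ∃ (κ : URep G) (v : κ.H →L[ℂ] μ.H), Intertwines κ μ v ∧ v.adjoint ∘L v = .id ℂ κ.H ∧
      (∀ y, v y ∈ W) ∧ (∀ x ∈ W, v (v.adjoint x) = x) ∧
      (FiniteDimensional ℂ W → FiniteDimensional ℂ κ.H) := by
  let v : (μ.restrict W hc hW).H →L[ℂ] μ.H := W.subtypeL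
  have hv : v.adjoint ∘L v = .id ℂ _ :=
    (ContinuousLinearMap.norm_map_iff_adjoint_comp_self v).1 fun _ => rfl
  refine ⟨μ.restrict W hc hW, v, fun _ => rfl, hv, fun y => y.2, fun x hx => ?_, fun h => h⟩
  exact congrArg v (DFunLike.congr_fun hv (⟨x, hx⟩ : W))

lemma eq_of_adjoint_comp_self {E F : Type} [NormedAddCommGroup E] [InnerProductSpace ℂ E]
    [CompleteSpace E] [NormedAddCommGroup F] [InnerProductSpace ℂ F] [CompleteSpace F]
    {v : E →L[ℂ] F} (hv : v.adjoint ∘L v = .id ℂ E) (x : E) : v.adjoint (v x) = x :=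
  DFunLike.congr_fun hv x

lemma norm_map_of_adjoint_comp_self {E F : Type} [NormedAddCommGroup E] [InnerProductSpace ℂ E]
    [CompleteSpace E] [NormedAddCommGroup F] [InnerProductSpace ℂ F] [CompleteSpace F]
    {v : E →L[ℂ] F} (hv : v.adjoint ∘L v = .id ℂ E) (x : E) : ‖v x‖ = ‖x‖ :=
  (ContinuousLinearMap.norm_map_iff_adjoint_comp_self v).2 hv x

lemma norm_le_one_of_adjoint_comp_self {E F : Type} [NormedAddCommGroup E]
    [InnerProductSpace ℂ E] [CompleteSpace E] [NormedAddCommGroup F] [InnerProductSpace ℂ F]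
    [CompleteSpace F] {v : E →L[ℂ] F} (hv : v.adjoint ∘L v = .id ℂ E) : ‖v‖ ≤ 1 :=
  v.opNorm_le_bound zero_le_one fun x => by rw [norm_map_of_adjoint_comp_self hv, one_mul]

lemma norm_comp_adjoint_le_one {E F F' : Type} [NormedAddCommGroup E]
    [InnerProductSpace ℂ E] [CompleteSpace E] [NormedAddCommGroup F] [InnerProductSpace ℂ F]
    [CompleteSpace F] [NormedAddCommGroup F'] [InnerProductSpace ℂ F'] [CompleteSpace F']
    {v : E →L[ℂ] F} (hv : v.adjoint ∘L v = .id ℂ E)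
    {w : E →L[ℂ] F'} (hw : w.adjoint ∘L w = .id ℂ E) : ‖v ∘L w.adjoint‖ ≤ 1 := by
  refine (ContinuousLinearMap.opNorm_comp_le _ _).trans (mul_le_one₀ ?_ (norm_nonneg _) ?_)
  · exact norm_le_one_of_adjoint_comp_self hv
  · rw [LinearIsometryEquiv.norm_map]
    exact norm_le_one_of_adjoint_comp_self hw

/-- Compatible isometries out of a sequence of isometries have increasing ranges. -/
lemma exists_factor {E : ℕ → Type} {F : Type} [∀ n, NormedAddCommGroup (E n)]
    [∀ n, InnerProductSpace ℂ (E n)] [NormedAddCommGroup F] [InnerProductSpace ℂ F]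
    {F' : Type} [NormedAddCommGroup F'] [InnerProductSpace ℂ F']
    {i : ∀ n, E n →L[ℂ] E (n + 1)} {v : ∀ n, E n →L[ℂ] F} {w : ∀ n, E n →L[ℂ] F'}
    (hv : ∀ n, v (n + 1) ∘L i n = v n) (hw : ∀ n, w (n + 1) ∘L i n = w n)
    {m n : ℕ} (h : m ≤ n) : ∃ j : E m →L[ℂ] E n, v m = v n ∘L j ∧ w m = w n ∘L j := by
  induction n, h using Nat.le_induction with
  | base => exact ⟨.id ℂ _, rfl, rfl⟩
  | succ n h ih =>
    obtain ⟨j, h1, h2⟩ := ih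
    refine ⟨i n ∘L j, ?_, ?_⟩
    · rw [← ContinuousLinearMap.comp_assoc, hv, h1]
    · rw [← ContinuousLinearMap.comp_assoc, hw, h2]

/-- The projections to the ranges of compatible isometries converge strongly to the identity if
the union of the ranges is dense. -/
lemma tendsto_comp_adjoint {E : ℕ → Type} {F : Type} [∀ n, NormedAddCommGroup (E n)]
    [∀ n, InnerProductSpace ℂ (E n)] [∀ n, CompleteSpace (E n)] [NormedAddCommGroup F]
    [InnerProductSpace ℂ F] [CompleteSpace F]
    {i : ∀ n, E n →L[ℂ] E (n + 1)} {v : ∀ n, E n →L[ℂ] F}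
    (hv : ∀ n, v (n + 1) ∘L i n = v n) (hvv : ∀ n, (v n).adjoint ∘L v n = .id ℂ (E n))
    (hd : Dense (⋃ n, Set.range (v n))) (x : F) :
    Tendsto (fun n => (v n ∘L (v n).adjoint) x) atTop (𝓝 x) := by
  refine tendsto_clm_of_dense (T₀ := .id ℂ F) (fun n => norm_comp_adjoint_le_one (hvv n) (hvv n))
    hd ?_ x
  intro x hx
  obtain ⟨m, y, rfl⟩ := Set.mem_iUnion.1 hx
  refine tendsto_const_nhds.congr' ?_
  filter_upwards [eventually_ge_atTop m] with n hn
  obtain ⟨j, hj, -⟩ := exists_factor hv hv hn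
  rw [hj]
  simp only [ContinuousLinearMap.comp_apply, eq_of_adjoint_comp_self (hvv n)]
  rfl

/-- A sequence of isometric intertwiners has a direct limit. -/
lemma URep.exists_directLimit (ρ : ℕ → URep G) (v : ∀ n, (ρ n).H →L[ℂ] (ρ (n + 1)).H)
    (hv : ∀ n, Intertwines (ρ n) (ρ (n + 1)) (v n))
    (hvv : ∀ n, (v n).adjoint ∘L v n = .id ℂ (ρ n).H) :
    ∃ (ω : URep G) (j : ∀ n, (ρ n).H →L[ℂ] ω.H), (∀ n, Intertwines (ρ n) ω (j n)) ∧
      (∀ n, (j n).adjoint ∘L j n = .id ℂ (ρ n).H) ∧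
      ∀ x, Tendsto (fun n => (j n ∘L (j n).adjoint) x) atTop (𝓝 x) := by
  -- embed `ρ (n + 1) = ρ n ⊕ (range of v n)ᗮ` into the Hilbert sum of all `ρ n`
  let J : ∀ n, (ρ n).H →L[ℂ] (URep.iSum ρ).H := fun n => Nat.rec (URep.single ρ 0)
    (fun n Jn => Jn ∘L (v n).adjoint
      + URep.single ρ (n + 1) ∘L (.id ℂ _ - v n ∘L (v n).adjoint)) n
  have J0 : J 0 = URep.single ρ 0 := rfl
  have Js (n : ℕ) : J (n + 1) = J n ∘L (v n).adjoint
      + URep.single ρ (n + 1) ∘L (.id ℂ _ - v n ∘L (v n).adjoint) := rfl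
  have hJ (n : ℕ) : Intertwines (ρ n) (URep.iSum ρ) (J n) := by
    induction n with
    | zero => exact Intertwines.single ρ 0
    | succ n ih =>
      rw [Js]
      refine (ih.comp (hv n).adjoint).add ((Intertwines.single ρ (n + 1)).comp fun g => ?_)
      rw [ContinuousLinearMap.comp_sub, ContinuousLinearMap.sub_comp,
        ((hv n).comp (hv n).adjoint) g]
      rfl
  have hc (n : ℕ) : ∀ k, n < k → URep.coord ρ k ∘L J n = 0 := by
    induction n with
    | zero => intro k hk; exact URep.coord_single_ne ρ hk.ne'
    | succ n ih =>
      intro k hk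
      rw [Js, ContinuousLinearMap.comp_add, ← ContinuousLinearMap.comp_assoc,
        ← ContinuousLinearMap.comp_assoc, ih k (by omega), URep.coord_single_ne ρ hk.ne',
        ContinuousLinearMap.zero_comp, ContinuousLinearMap.zero_comp, add_zero]
  have hJv (n : ℕ) : J (n + 1) ∘L v n = J n := by
    rw [Js, ContinuousLinearMap.add_comp, ContinuousLinearMap.comp_assoc, hvv,
      ContinuousLinearMap.comp_assoc, ContinuousLinearMap.sub_comp,
      ContinuousLinearMap.comp_assoc, hvv]
    simp
  have hJJ (n : ℕ) : (J n).adjoint ∘L J n = .id ℂ (ρ n).H := by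
    induction n with
    | zero => rw [J0, URep.adjoint_single, URep.coord_single]
    | succ n ih =>
      refine (ContinuousLinearMap.norm_map_iff_adjoint_comp_self _).1 fun x => ?_
      -- Pythagoras, for the two orthogonal summands of `J (n + 1)`
      have e1 : ‖J n ((v n).adjoint x)‖ = ‖v n ((v n).adjoint x)‖ := by
        rw [norm_map_of_adjoint_comp_self ih, norm_map_of_adjoint_comp_self (hvv n)]
      have e2 : ‖URep.single ρ (n + 1) (x - v n ((v n).adjoint x))‖
          = ‖x - v n ((v n).adjoint x)‖ := by
        refine norm_map_of_adjoint_comp_self ?_ _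
        rw [URep.adjoint_single, URep.coord_single]
      have o1 : ⟪J n ((v n).adjoint x),
          URep.single ρ (n + 1) (x - v n ((v n).adjoint x))⟫_ℂ = 0 := by
        rw [← ContinuousLinearMap.adjoint_inner_left, URep.adjoint_single]
        have := DFunLike.congr_fun (hc n (n + 1) n.lt_succ_self) ((v n).adjoint x)
        rw [ContinuousLinearMap.comp_apply] at this
        rw [this, zero_apply, inner_zero_left]
      have o2 : ⟪v n ((v n).adjoint x), x - v n ((v n).adjoint x)⟫_ℂ = 0 := by
        rw [← ContinuousLinearMap.adjoint_inner_right, map_sub,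
          eq_of_adjoint_comp_self (hvv n), sub_self, inner_zero_right]
      have p1 := norm_add_sq_eq_norm_sq_add_norm_sq_of_inner_eq_zero _ _ o1
      have p2 := norm_add_sq_eq_norm_sq_add_norm_sq_of_inner_eq_zero _ _ o2
      rw [add_sub_cancel] at p2
      have e : J (n + 1) x = J n ((v n).adjoint x)
          + URep.single ρ (n + 1) (x - v n ((v n).adjoint x)) := rfl
      rw [e]
      rw [e1, e2, ← p2] at p1
      exact (mul_self_inj (norm_nonneg _) (norm_nonneg _)).1 p1
  have hmono : Monotone fun n => LinearMap.range (J n).toLinearMap := monotone_nat_of_le_succ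
    fun n => by
      rintro _ ⟨x, rfl⟩
      exact ⟨v n x, DFunLike.congr_fun (hJv n) x⟩
  let W : Submodule ℂ (URep.iSum ρ).H := ⨆ n, LinearMap.range (J n).toLinearMap
  have hWd (x) : x ∈ W ↔ ∃ n y, J n y = x := by
    rw [Submodule.mem_iSup_of_directed _ hmono.directed_le]; rfl
  obtain ⟨ω, w, hw, hww, hr, hi, -⟩ := (URep.iSum ρ).exists_restrict W.topologicalClosure
    W.isClosed_topologicalClosure (fun g x hx => by
      refine map_mem_closure ((URep.iSum ρ).U g).continuous hx ?_
      intro y hy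
      obtain ⟨n, z, rfl⟩ := (hWd y).1 hy
      exact (hWd _).2 ⟨n, (ρ n).U g z, (DFunLike.congr_fun (hJ n g) z).symm⟩)
  have hwJ (n : ℕ) : w ∘L (w.adjoint ∘L J n) = J n := by
    ext1 y
    exact hi _ (subset_closure ((hWd _).2 ⟨n, y, rfl⟩))
  have hj (n : ℕ) : (w.adjoint ∘L J n).adjoint ∘L (w.adjoint ∘L J n) = .id ℂ _ := by
    rw [ContinuousLinearMap.adjoint_comp, ContinuousLinearMap.adjoint_adjoint,
      ContinuousLinearMap.comp_assoc, hwJ, hJJ]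
  refine ⟨ω, fun n => w.adjoint ∘L J n, fun n => hw.adjoint.comp (hJ n), hj, ?_⟩
  refine tendsto_comp_adjoint (i := v) (fun n => ?_) hj ?_
  · rw [ContinuousLinearMap.comp_assoc, hJv]
  · intro y
    have h1 : w y ∈ closure (W : Set (URep.iSum ρ).H) := hr y
    have h2 := map_mem_closure (t := ⋃ n, Set.range (w.adjoint ∘L J n)) w.adjoint.continuous h1
      (fun z hz => by
        obtain ⟨n, u, rfl⟩ := (hWd z).1 hz
        exact Set.mem_iUnion.2 ⟨n, u, rfl⟩)
    rwa [eq_of_adjoint_comp_self hww] at h2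

end Subrep

section SupSMul

variable {G : Type u} [TopologicalSpace G] [Group G] [IsTopologicalGroup G] [CompactSpace G]
  {A B : GAlg.{u, v} G} {μ ν ω μ' ν' : URep G}

/-- The supremum of `[ρ n] • [x n]` is `[ω] • [x]` for the direct limit `ω` of the `ρ n`. Since the
projections `j n (j n)*` converge strongly to the identity, `s ⊗ x` is approximated by the elements
`j n (j n)* s j n (j n)* ⊗ x`, which lie below `[ρ n] • [x]`. -/
lemma CuG.sup_smul (r : ℕ → CuRep G) (s : ℕ → CuG A) (q : CuRep G) (x : CuG A)
    (hr : Monotone r) (hs : Monotone s) (hq : IsLUB (Set.range r) q)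
    (hx : IsLUB (Set.range s) x) : IsLUB (Set.range fun n => r n • s n) (q • x) := by
  choose ρ hρ using fun n => CuRep.exists_rep (r n)
  choose v hv hvv using fun n => CuRep.mk_le_iff.1
    (show CuRep.mk (ρ n) ≤ CuRep.mk (ρ (n + 1)) by rw [hρ, hρ]; exact hr n.le_succ)
  obtain ⟨ω, j, hj, hjj, ht⟩ := URep.exists_directLimit ρ v hv hvv
  obtain ⟨S⟩ := URep.exists_invStrictlyPos ω
  obtain ⟨X, rfl⟩ := CuG.exists_rep x
  have hle (n : ℕ) : r n ≤ CuRep.mk ω := by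
    rw [← hρ]; exact CuRep.mk_le_iff.2 ⟨j n, hj n, hjj n⟩
  have hqω : q ≤ CuRep.mk ω := hq.2 (by rintro _ ⟨n, rfl⟩; exact hle n)
  have key : IsLUB (Set.range fun n => r n • s n) (CuG.mk (X.tensor S)) := by
    rw [← CuG.smul_mk ω S X]
    have hX := CuG.smul_mk ω S X
    rw [hX]
    refine CuG.isLUB_mk (fun n => ?_) fun ε hε => ?_
    · rw [← hX]; exact CuG.smul_le_smul (hle n) (hx.1 ⟨n, rfl⟩)
    let P : ℕ → ω.H →L[ℂ] ω.H := fun n => j n ∘L (j n).adjoint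
    have hPC (n : ℕ) : ‖P n‖ ≤ 1 := norm_comp_adjoint_le_one (hjj n) (hjj n)
    have hPa (n : ℕ) : (P n).adjoint = P n := by
      simp only [P, ContinuousLinearMap.adjoint_comp, ContinuousLinearMap.adjoint_adjoint]
    have hSa : S.s.1.adjoint = S.s.1 := congrArg Subtype.val S.isFull.1.star_eq
    have l1 : Tendsto (fun n => P n ∘L S.s.1) atTop (𝓝 S.s.1) :=
      tendsto_comp_of_isCompactOperator (T₀ := .id ℂ ω.H) hPC ht S.s.2
    have l2 : Tendsto (fun n => S.s.1 ∘L P n) atTop (𝓝 S.s.1) := by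
      have h := (ContinuousLinearMap.adjoint (𝕜 := ℂ) (E := ω.H) (F := ω.H)).continuous.tendsto
        S.s.1
      rw [hSa] at h
      refine (h.comp l1).congr fun n => ?_
      change (P n ∘L S.s.1).adjoint = _
      rw [ContinuousLinearMap.adjoint_comp, hPa, hSa]
    have l3 : Tendsto (fun n => ‖P n ∘L S.s.1 ∘L P n - S.s.1‖) atTop (𝓝 0) := by
      have h1 := (tendsto_iff_norm_sub_tendsto_zero.1 l1).add
        (tendsto_iff_norm_sub_tendsto_zero.1 l2)
      rw [add_zero] at h1
      refine squeeze_zero (fun _ => norm_nonneg _) (fun n => ?_) h1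
      have e : P n ∘L S.s.1 ∘L P n - S.s.1
          = P n ∘L (S.s.1 ∘L P n - S.s.1) + (P n ∘L S.s.1 - S.s.1) := by
        rw [ContinuousLinearMap.comp_sub]; abel
      rw [e, _root_.add_comm ‖P n ∘L S.s.1 - S.s.1‖]
      refine (norm_add_le _ _).trans (_root_.add_le_add ?_ le_rfl)
      refine (ContinuousLinearMap.opNorm_comp_le _ _).trans ?_
      exact mul_le_of_le_one_left (norm_nonneg _) (hPC n)
    let δ : ℝ := ε / (4 * (‖S.s‖ + 1))
    have hδ : 0 < δ := by positivity
    have hδ' : ‖S.s‖ * δ < ε / 2 := by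
      have h0 := norm_nonneg S.s
      have : δ * (4 * (‖S.s‖ + 1)) = ε := div_mul_cancel₀ _ (by positivity)
      nlinarith
    obtain ⟨m, hm⟩ := CuG.exists_cut_le hs hx le_rfl hδ
    let C : ℝ := ‖cut δ X.a‖ + 1
    have hC : 0 < C := by positivity
    obtain ⟨n, hn, hmn⟩ := ((l3.eventually (gt_mem_nhds (show 0 < ε / (2 * C) by positivity))).and
      (eventually_ge_atTop m)).exists
    refine ⟨n, ?_⟩
    let Y := (X.cut δ hδ.le).tensor (S.pull (hj n) (hjj n))
    have hY : CuG.mk Y ≤ r n • s n := by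
      have h : CuRep.mk (ρ n) • CuG.mk (X.cut δ hδ.le) = CuG.mk Y := CuG.smul_mk _ _ _
      rw [← h, hρ]
      exact CuG.smul_le_smul le_rfl (hm.trans (hs hmn))
    refine le_trans ?_ hY
    let V : ((ρ n).tensor X.μ).H →L[ℂ] (ω.tensor X.μ).H := hmap (j n) (.id ℂ X.μ.H)
    have hV : Intertwines ((ρ n).tensor X.μ) (ω.tensor X.μ) V :=
      (hj n).hmap (Intertwines.id X.μ)
    let b : KTG (ω.tensor X.μ) (ω.tensor X.μ) A := KT.conj V Y.a
    let p : Cpt ω.H ω.H := Cpt.sandwich (P n) (P n) S.s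
    have hb : b = KT.tensorLeft p (cut δ X.a) := by
      have h := KT.conj_hmap (Cpt.sandwich (j n).adjoint (j n) S.s) (j n) (.id ℂ X.μ.H)
        (cut δ X.a)
      rw [KT.conj_id] at h
      exact h
    have hb0 : 0 ≤ b := KT.conj_nonneg' V Y.nonneg
    have hbi : KTG.IsInv b := Y.inv.conj hV
    let a : KTG (ω.tensor X.μ) (ω.tensor X.μ) A := KT.tensorLeft S.s X.a
    have hnorm : ‖a - b‖ < ε := by
      have e : a - b = KT.tensorLeft (S.s - p) (cut δ X.a)
          + KT.tensorLeft S.s (X.a - cut δ X.a) := by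
        have e1 := KT.tensorLeft_add_left (S.s - p) p (cut δ X.a)
        rw [sub_add_cancel] at e1
        rw [hb, map_sub, e1]
        change KT.tensorLeft S.s X.a - _ = _
        abel
      rw [e]
      refine (norm_add_le _ _).trans_lt ?_
      have h1 : ‖KT.tensorLeft (S.s - p) (cut δ X.a)‖ ≤ ε / 2 := by
        refine (KT.norm_tensorLeft_le _ _).trans ?_
        have h2 : ‖S.s - p‖ = ‖P n ∘L S.s.1 ∘L P n - S.s.1‖ := by
          rw [norm_sub_rev]; rfl
        rw [h2]
        have h3 : ‖cut δ X.a‖ ≤ C := le_add_of_nonneg_right zero_le_one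
        calc _ ≤ ε / (2 * C) * C := by gcongr
          _ = ε / 2 := by field_simp
      have h2 : ‖KT.tensorLeft S.s (X.a - cut δ X.a)‖ ≤ ‖S.s‖ * δ := by
        refine (KT.norm_tensorLeft_le _ _).trans ?_
        rw [norm_sub_rev]
        exact mul_le_mul_of_nonneg_left (norm_cut_sub_le hδ.le X.nonneg) (norm_nonneg _)
      exact (_root_.add_le_add h1 h2).trans_lt (by linarith)
    have h1 := GPos.cut_le_of_norm_lt (X.tensor S).inv hbi (X.tensor S).pos
      (KT.nonneg_iff.1 hb0) hnorm
    have h2 : (⟨ω.tensor X.μ, b, hbi, KT.nonneg_iff.1 hb0⟩ : GPos A) ≤ Y :=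
      GPos.le_of_eq_conj (v := V) hV rfl
    exact h1.trans h2
  refine ⟨?_, fun w hw => ?_⟩
  · rintro _ ⟨n, rfl⟩
    exact CuG.smul_le_smul (hq.1 ⟨n, rfl⟩) (hx.1 ⟨n, rfl⟩)
  · refine (CuG.smul_le_smul hqω le_rfl).trans ?_
    rw [CuG.smul_mk ω S X]
    exact key.2 hw

end SupSMul

/-! ### Finite dimensional subrepresentations and compact containment -/

section FiniteDim

variable {G : Type u} [TopologicalSpace G] [Group G] {A B : GAlg.{u, v} G}
  {μ ν ω μ' ν' κ : URep G}

/-- An injective intertwiner on a finite dimensional representation can be made isometric. -/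
lemma Intertwines.exists_isometry [FiniteDimensional ℂ μ.H] {b : μ.H →L[ℂ] ν.H}
    (hb : Intertwines μ ν b) (hinj : ∀ x, b x = 0 → x = 0) :
    ∃ h : μ.H →L[ℂ] μ.H, Intertwines μ μ h ∧
      (b ∘L h).adjoint ∘L (b ∘L h) = .id ℂ μ.H := by
  let t : Cpt μ.H μ.H :=
    ⟨b.adjoint ∘L b, isCompactOperator_of_range_le (V := ⊤) _ fun _ => trivial⟩
  have ht : IsSelfAdjoint t := Subtype.ext (by
    change (b.adjoint ∘L b).adjoint = b.adjoint ∘L b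
    rw [ContinuousLinearMap.adjoint_comp, ContinuousLinearMap.adjoint_adjoint])
  obtain ⟨r, hr, hrr, -, hΦ⟩ := Cpt.exists_sqrt ht fun x => by
    change 0 ≤ (⟪x, b.adjoint (b x)⟫_ℂ).re
    rw [ContinuousLinearMap.adjoint_inner_right]
    exact inner_self_nonneg (𝕜 := ℂ)
  have hri : Intertwines μ μ r.1 := Intertwines.of_sandwich_eq fun g =>
    hΦ (μ.conjHom g) ((hb.adjoint.comp hb).sandwich_eq (k := t) g)
  have hr' : r.1 ∘L r.1 = b.adjoint ∘L b := congrArg Subtype.val hrr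
  have hrinj : Function.Injective r.1.toLinearMap := by
    refine (injective_iff_map_eq_zero _).2 fun x hx => hinj x ?_
    have h1 : b.adjoint (b x) = 0 := by
      have := DFunLike.congr_fun hr' x
      change r.1 (r.1 x) = b.adjoint (b x) at this
      rw [← this]
      change r.1 (r.1.toLinearMap x) = 0
      rw [hx, map_zero]
    have h2 : ⟪b x, b x⟫_ℂ = 0 := by
      rw [← ContinuousLinearMap.adjoint_inner_right, h1, inner_zero_right]
    exact inner_self_eq_zero.1 h2
  let e := LinearEquiv.ofInjectiveEndo r.1.toLinearMap hrinj
  let h : μ.H →L[ℂ] μ.H := LinearMap.toContinuousLinearMap e.symm.toLinearMap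
  have hrh : r.1 ∘L h = .id ℂ μ.H := by ext x; exact e.apply_symm_apply x
  have hhr : h ∘L r.1 = .id ℂ μ.H := by ext x; exact e.symm_apply_apply x
  have hra : r.1.adjoint = r.1 := congrArg Subtype.val hr.star_eq
  refine ⟨h, fun g => ?_, ?_⟩
  · calc μ.op g ∘L h = h ∘L (r.1 ∘L μ.op g) ∘L h := by
          rw [ContinuousLinearMap.comp_assoc, ← ContinuousLinearMap.comp_assoc h, hhr]; rfl
      _ = h ∘L (μ.op g ∘L r.1) ∘L h := by rw [hri g]
      _ = h ∘L μ.op g := by rw [ContinuousLinearMap.comp_assoc, hrh]; rfl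
  · have h1 : h.adjoint ∘L r.1 = .id ℂ μ.H := by
      have := congrArg ContinuousLinearMap.adjoint hrh
      rwa [ContinuousLinearMap.adjoint_comp, hra, ContinuousLinearMap.adjoint_id] at this
    calc _ = (h.adjoint ∘L (b.adjoint ∘L b)) ∘L h := by
          rw [ContinuousLinearMap.adjoint_comp]; rfl
      _ = (h.adjoint ∘L r.1) ∘L (r.1 ∘L h) := by rw [← hr']; rfl
      _ = _ := by rw [h1, hrh]; rfl

/-- For an operator `T` on a finite dimensional space, `T + t` is invertible for small `t`. -/
lemma exists_inverse_add_smul {E : Type} [NormedAddCommGroup E] [InnerProductSpace ℂ E]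
    [CompleteSpace E] [FiniteDimensional ℂ E] (T : E →L[ℂ] E) : ∃ t : ℝ, 0 < t ∧ t < 1 ∧
      ∃ c : E →L[ℂ] E, (T + (t : ℂ) • .id ℂ E) ∘L c = .id ℂ E ∧
        c ∘L (T + (t : ℂ) • .id ℂ E) = .id ℂ E := by
  have hfin : Set.Finite {t : ℝ | Module.End.HasEigenvalue T.toLinearMap (-(t : ℂ))} := by
    refine (Module.End.finite_hasEigenvalue T.toLinearMap).preimage
      (f := fun t : ℝ => -(t : ℂ)) fun a _ b _ h => ?_
    exact Complex.ofReal_injective (neg_injective h)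
  obtain ⟨t, ⟨h0, h1⟩, ht⟩ := ((Set.Ioo_infinite (zero_lt_one (α := ℝ))).sdiff hfin).nonempty
  refine ⟨t, h0, h1, ?_⟩
  have hinj : Function.Injective (T + (t : ℂ) • .id ℂ E).toLinearMap := by
    refine (injective_iff_map_eq_zero _).2 fun x hx => ?_
    by_contra hx0
    refine ht (Module.End.hasEigenvalue_of_hasEigenvector (x := x) ⟨?_, hx0⟩)
    rw [Module.End.mem_eigenspace_iff, neg_smul]
    exact eq_neg_of_add_eq_zero_left hx
  let e := LinearEquiv.ofInjectiveEndo _ hinj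
  refine ⟨LinearMap.toContinuousLinearMap e.symm.toLinearMap, ?_, ?_⟩
  · ext x; exact e.apply_symm_apply x
  · ext x; exact e.symm_apply_apply x

/-- Two embeddings `b`, `w` of a finite dimensional representation: some intertwiner `Y` moves the
complement of the range of `b` to a subspace which meets the range of `w` trivially. It is the
inverse of `t + b w*`, where `0 < t < 1` is such that `t + w* b` is invertible. -/
lemma Intertwines.exists_shear [FiniteDimensional ℂ μ.H] {b w : μ.H →L[ℂ] ω.H}
    (hb : Intertwines μ ω b) (hw : Intertwines μ ω w) (hbb : b.adjoint ∘L b = .id ℂ μ.H)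
    (hww : w.adjoint ∘L w = .id ℂ μ.H) : ∃ Y : ω.H →L[ℂ] ω.H, Intertwines ω ω Y ∧
      ∀ x, b.adjoint x = 0 → Y x = w (w.adjoint (Y x)) → x = 0 := by
  obtain ⟨t, ht0, ht1, c, hc, hc'⟩ := exists_inverse_add_smul (w.adjoint ∘L b)
  have hT : Intertwines μ μ (w.adjoint ∘L b + (t : ℂ) • .id ℂ μ.H) :=
    (hw.adjoint.comp hb).add fun g => by
      rw [ContinuousLinearMap.comp_smul, ContinuousLinearMap.smul_comp]; rfl
  have hci : Intertwines μ μ c := fun g => by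
    calc μ.op g ∘L c = (c ∘L (w.adjoint ∘L b + (t : ℂ) • .id ℂ μ.H)) ∘L μ.op g ∘L c := by
          rw [hc']; rfl
      _ = c ∘L ((w.adjoint ∘L b + (t : ℂ) • .id ℂ μ.H) ∘L μ.op g) ∘L c := rfl
      _ = c ∘L (μ.op g ∘L (w.adjoint ∘L b + (t : ℂ) • .id ℂ μ.H)) ∘L c := by rw [hT g]
      _ = c ∘L μ.op g ∘L ((w.adjoint ∘L b + (t : ℂ) • .id ℂ μ.H) ∘L c) := rfl
      _ = c ∘L μ.op g := by rw [hc]; rfl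
  -- the inverse of `t + b w*`, multiplied by `t`
  let Y : ω.H →L[ℂ] ω.H := .id ℂ ω.H - b ∘L c ∘L w.adjoint
  have hY : Intertwines ω ω Y := fun g => by
    change ω.op g ∘L (.id ℂ ω.H - b ∘L c ∘L w.adjoint) = _
    rw [ContinuousLinearMap.comp_sub, hb.comp (hci.comp hw.adjoint) g,
      ContinuousLinearMap.sub_comp]
    rfl
  have hYinv (x : ω.H) : (t : ℂ) • Y x + b (w.adjoint (Y x)) = (t : ℂ) • x := by
    have h1 := DFunLike.congr_fun hc (w.adjoint x)
    change w.adjoint (b (c (w.adjoint x))) + (t : ℂ) • c (w.adjoint x) = w.adjoint x at h1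
    change (t : ℂ) • (x - b (c (w.adjoint x))) + b (w.adjoint (x - b (c (w.adjoint x)))) = _
    rw [map_sub w.adjoint]
    nth_rewrite 2 [← h1]
    rw [add_sub_cancel_left, map_smul, smul_sub, sub_add_cancel]
  refine ⟨Y, hY, fun x h3 h1 => ?_⟩
  have h2 := hYinv x
  generalize hy : w.adjoint (Y x) = y at h1 h2
  have h4 : y = -((t : ℂ) • b.adjoint (w y)) := by
    have h5 := congrArg b.adjoint h2
    rw [map_add, map_smul, map_smul, h3, smul_zero, eq_of_adjoint_comp_self hbb, h1] at h5
    exact eq_neg_of_add_eq_zero_right h5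
  have h6 : ‖y‖ ≤ t * ‖y‖ := by
    conv_lhs => rw [h4]
    rw [norm_neg, norm_smul, Complex.norm_of_nonneg ht0.le]
    refine mul_le_mul_of_nonneg_left ?_ ht0.le
    refine (ContinuousLinearMap.le_of_opNorm_le _ (c := 1) ?_ _).trans ?_
    · rw [LinearIsometryEquiv.norm_map]; exact norm_le_one_of_adjoint_comp_self hbb
    · rw [norm_map_of_adjoint_comp_self hww, one_mul]
  have h7 : y = 0 := norm_eq_zero.1 (by nlinarith [norm_nonneg y])
  rw [h7, map_zero, add_zero, h1, h7, map_zero, smul_zero] at h2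
  exact (smul_eq_zero.1 h2.symm).resolve_left (Complex.ofReal_ne_zero.2 ht0.ne')

/-- The complement of a subrepresentation. -/
lemma Intertwines.exists_complement {i : μ.H →L[ℂ] κ.H} (hi : Intertwines μ κ i)
    (hii : i.adjoint ∘L i = .id ℂ μ.H) : ∃ (σ : URep G) (k : σ.H →L[ℂ] κ.H),
      Intertwines σ κ k ∧ k.adjoint ∘L k = .id ℂ σ.H ∧ i.adjoint ∘L k = 0 ∧ k.adjoint ∘L i = 0 ∧
      i ∘L i.adjoint + k ∘L k.adjoint = .id ℂ κ.H ∧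
      (FiniteDimensional ℂ κ.H → FiniteDimensional ℂ σ.H) := by
  obtain ⟨σ, k, hk, hkk, hkr, hks, hkf⟩ := κ.exists_restrict (LinearMap.ker i.adjoint.toLinearMap)
    (ContinuousLinearMap.isClosed_ker i.adjoint) (fun g x hx => by
      change i.adjoint (κ.op g x) = 0
      have := DFunLike.congr_fun (hi.adjoint g) x
      change μ.op g (i.adjoint x) = i.adjoint (κ.op g x) at this
      rw [← this, show i.adjoint x = 0 from hx, map_zero])
  have hik : i.adjoint ∘L k = 0 := by ext1 z; exact hkr z
  have hki : k.adjoint ∘L i = 0 := by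
    have := congrArg ContinuousLinearMap.adjoint hik
    rwa [ContinuousLinearMap.adjoint_comp, ContinuousLinearMap.adjoint_adjoint, map_zero] at this
  have hcompl : i ∘L i.adjoint + k ∘L k.adjoint = .id ℂ κ.H := by
    ext1 x
    have h1 : x - i (i.adjoint x) ∈ LinearMap.ker i.adjoint.toLinearMap := by
      change i.adjoint (x - i (i.adjoint x)) = 0
      rw [map_sub, eq_of_adjoint_comp_self hii, sub_self]
    have h2 : k (k.adjoint (x - i (i.adjoint x))) = x - i (i.adjoint x) := hks _ h1
    have h3 : k.adjoint (i (i.adjoint x)) = 0 := DFunLike.congr_fun hki (i.adjoint x)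
    rw [map_sub, h3, sub_zero] at h2
    change i (i.adjoint x) + k (k.adjoint x) = x
    rw [h2, add_sub_cancel]
  exact ⟨σ, k, hk, hkk, hik, hki, hcompl, fun _ => hkf inferInstance⟩

/-- Embeddings of finite dimensional representations extend: if `i` embeds `μ` in the finite
dimensional `κ`, `w` embeds `μ` in `ω`, and `κ` embeds in `ω`, then `w` extends along `i`. -/
lemma Intertwines.exists_extension [FiniteDimensional ℂ κ.H] [FiniteDimensional ℂ μ.H]
    {i : μ.H →L[ℂ] κ.H} {u : κ.H →L[ℂ] ω.H} {w : μ.H →L[ℂ] ω.H} (hi : Intertwines μ κ i)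
    (hu : Intertwines κ ω u) (hw : Intertwines μ ω w) (hii : i.adjoint ∘L i = .id ℂ μ.H)
    (huu : u.adjoint ∘L u = .id ℂ κ.H) (hww : w.adjoint ∘L w = .id ℂ μ.H) :
    ∃ u' : κ.H →L[ℂ] ω.H, Intertwines κ ω u' ∧ u'.adjoint ∘L u' = .id ℂ κ.H ∧
      u' ∘L i = w := by
  let b : μ.H →L[ℂ] ω.H := u ∘L i
  have hb : Intertwines μ ω b := hu.comp hi
  have hbb : b.adjoint ∘L b = .id ℂ μ.H := by
    change (u ∘L i).adjoint ∘L (u ∘L i) = _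
    rw [ContinuousLinearMap.adjoint_comp]
    calc _ = i.adjoint ∘L (u.adjoint ∘L u) ∘L i := rfl
      _ = _ := by rw [huu]; exact hii
  obtain ⟨Y, hY, hYx⟩ := hb.exists_shear hw hbb hww
  obtain ⟨σ, k, hk, hkk, hik, hki, hcompl, hkf⟩ := hi.exists_complement hii
  have hσ : FiniteDimensional ℂ σ.H := hkf inferInstance
  let R : σ.H →L[ℂ] ω.H := (.id ℂ ω.H - w ∘L w.adjoint) ∘L Y ∘L u ∘L k
  have hR : Intertwines σ ω R := by
    refine Intertwines.comp (ν := ω) (fun g => ?_) (hY.comp (hu.comp hk))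
    rw [ContinuousLinearMap.comp_sub, hw.comp hw.adjoint g, ContinuousLinearMap.sub_comp]
    rfl
  have hwR : w.adjoint ∘L R = 0 := by
    ext1 z
    change w.adjoint (Y (u (k z)) - w (w.adjoint (Y (u (k z))))) = 0
    rw [map_sub, eq_of_adjoint_comp_self hww, sub_self]
  have hRinj (z : σ.H) (hz : R z = 0) : z = 0 := by
    have h8 := hYx (u (k z)) (by
      change (u ∘L i).adjoint (u (k z)) = 0
      rw [ContinuousLinearMap.adjoint_comp, ContinuousLinearMap.comp_apply,
        eq_of_adjoint_comp_self huu]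
      exact DFunLike.congr_fun hik z) (sub_eq_zero.1 hz)
    rw [← norm_eq_zero, norm_map_of_adjoint_comp_self huu, norm_map_of_adjoint_comp_self hkk,
      norm_eq_zero] at h8
    exact h8
  obtain ⟨h, hh, hq⟩ := hR.exists_isometry hRinj
  have hwq : w.adjoint ∘L (R ∘L h) = 0 := by
    rw [← ContinuousLinearMap.comp_assoc, hwR, ContinuousLinearMap.zero_comp]
  have hqi : Intertwines σ ω (R ∘L h) := hR.comp hh
  generalize R ∘L h = q at hq hwq hqi
  have hqw : q.adjoint ∘L w = 0 := by
    have := congrArg ContinuousLinearMap.adjoint hwq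
    rwa [ContinuousLinearMap.adjoint_comp, ContinuousLinearMap.adjoint_adjoint, map_zero] at this
  refine ⟨w ∘L i.adjoint + q ∘L k.adjoint, (hw.comp hi.adjoint).add (hqi.comp hk.adjoint), ?_, ?_⟩
  · rw [map_add, ContinuousLinearMap.adjoint_comp, ContinuousLinearMap.adjoint_comp,
      ContinuousLinearMap.adjoint_adjoint, ContinuousLinearMap.adjoint_adjoint, ← hcompl]
    ext1 x
    have e1 (y) : w.adjoint (q y) = 0 := DFunLike.congr_fun hwq y
    have e2 (y) : q.adjoint (w y) = 0 := DFunLike.congr_fun hqw y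
    simp only [add_apply, ContinuousLinearMap.comp_apply, map_add, eq_of_adjoint_comp_self hww,
      eq_of_adjoint_comp_self hq, e1, e2, map_zero, add_zero, zero_add]
  · ext1 x
    have e1 : k.adjoint (i x) = 0 := DFunLike.congr_fun hki x
    change w (i.adjoint (i x)) + q (k.adjoint (i x)) = w x
    rw [e1, map_zero, add_zero, eq_of_adjoint_comp_self hii]

/-- The fixed space `{x | k x = x}` of a compact operator is finite dimensional. -/
lemma finiteDimensional_fixed {E : Type} [NormedAddCommGroup E] [InnerProductSpace ℂ E]
    [CompleteSpace E] (k : Cpt E E) :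
    FiniteDimensional ℂ (LinearMap.ker (k.1 - .id ℂ E).toLinearMap) := by
  let V := LinearMap.ker (k.1 - .id ℂ E).toLinearMap
  have hc : IsClosed (V : Set E) := ContinuousLinearMap.isClosed_ker (k.1 - .id ℂ E)
  have hV (x : V) : k.1 x = x := sub_eq_zero.1 x.2
  have hk : IsCompactOperator k.1 := k.2
  have h1 : IsCompactOperator (k.1 ∘L V.subtypeL) := hk.comp_clm V.subtypeL
  have h2 := h1.codRestrict (V := V) (fun x => by
    change k.1 x ∈ V; rw [hV x]; exact x.2) hc
  refine (isCompactOperator_id_iff_finiteDimensional (𝕜 := ℂ)).1 ?_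
  have e : (_root_.id : V → V)
      = Set.codRestrict (k.1 ∘L V.subtypeL) V (fun x => by change k.1 x ∈ V; rw [hV x]; exact x.2) :=
    funext fun x => Subtype.ext (hV x).symm
  rw [e]
  exact h2

/-- Every representation is the closure of the union of an increasing sequence of finite
dimensional subrepresentations, given by spectral subspaces of a strictly positive element. -/
lemma InvStrictlyPos.exists_exhaustion (s : InvStrictlyPos ν) : ∃ (κ : ℕ → URep G)
    (v : ∀ n, (κ n).H →L[ℂ] ν.H) (i : ∀ n, (κ n).H →L[ℂ] (κ (n + 1)).H),
    (∀ n, FiniteDimensional ℂ (κ n).H) ∧ (∀ n, Intertwines (κ n) ν (v n)) ∧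
    (∀ n, (v n).adjoint ∘L v n = .id ℂ (κ n).H) ∧
    (∀ n, Intertwines (κ n) (κ (n + 1)) (i n)) ∧ (∀ n, (i n).adjoint ∘L i n = .id ℂ (κ n).H) ∧
    (∀ n, v (n + 1) ∘L i n = v n) ∧ Dense (⋃ n, Set.range (v n)) := by
  let ε : ℕ → ℝ := fun n => 1 / ((n : ℝ) + 1)
  have hε (n) : 0 < ε n := by positivity
  let f : ℕ → ℝ → ℝ := fun n t => min (max t 0 / ε n) 1
  have hf (n) : Continuous (f n) := ((continuous_id.max continuous_const).div_const _).min
    continuous_const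
  have hf0 (n) : f n 0 = 0 := by simp [f]
  let k : ℕ → Cpt ν.H ν.H := fun n => cfcₙ (f n) s.s
  have hk (n) : Intertwines ν ν (k n).1 := Intertwines.of_sandwich_eq fun g =>
    map_cfcₙ_of_map_eq s.isFull.1 (hf n) (hf0 n) (ν.conjHom g) (s.inv g)
  have hkcut (n) : k n * cut (ε n) s.s = cut (ε n) s.s := by
    have hcut : Continuous fun t : ℝ => max (t - ε n) 0 := by fun_prop
    have hcut0 : max (0 - ε n) 0 = 0 := max_eq_right (by linarith [hε n])
    change cfcₙ (f n) s.s * cfcₙ (fun t : ℝ => max (t - ε n) 0) s.s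
      = cfcₙ (fun t : ℝ => max (t - ε n) 0) s.s
    rw [← cfcₙ_mul (f n) _ s.s (hf n).continuousOn (hf0 n) hcut.continuousOn hcut0]
    refine cfcₙ_congr fun t _ => ?_
    change f n t * max (t - ε n) 0 = max (t - ε n) 0
    rcases le_total t (ε n) with h | h
    · rw [max_eq_right (by linarith), mul_zero]
    · have : f n t = 1 := by
        refine min_eq_right ?_
        rw [one_le_div (hε n)]
        exact h.trans (le_max_left _ _)
      rw [this, one_mul]
  let V : ℕ → Submodule ℂ ν.H := fun n => LinearMap.ker ((k n).1 - .id ℂ ν.H).toLinearMap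
  have hVf (n) : FiniteDimensional ℂ (V n) := finiteDimensional_fixed (k n)
  have hVi (n) (g : G) (x : ν.H) (hx : x ∈ V n) : ν.U g x ∈ V n := by
    have h1 : (k n).1 x = x := sub_eq_zero.1 hx
    have h2 := DFunLike.congr_fun (hk n g) x
    change ν.op g ((k n).1 x) = (k n).1 (ν.op g x) at h2
    rw [h1] at h2
    exact sub_eq_zero.2 h2.symm
  let W : ℕ → Submodule ℂ ν.H := fun n => (Finset.range (n + 1)).sup V
  have hWf (n) : FiniteDimensional ℂ (W n) := Submodule.finiteDimensional_finset_sup _ _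
  have hWi (n) (g : G) : ∀ x ∈ W n, ν.U g x ∈ W n := by
    have : W n ≤ (W n).comap (ν.op g).toLinearMap := Finset.sup_le fun m hm x hx =>
      Finset.le_sup (f := V) hm (hVi m g x hx)
    exact this
  have hWmono (n) : W n ≤ W (n + 1) :=
    Finset.sup_mono (Finset.range_mono (Nat.le_succ _))
  choose κ v hv hvv hr hs hfd using fun n =>
    ν.exists_restrict (W n) (Submodule.closed_of_finiteDimensional (W n)) (hWi n)
  have hvi (n) : v (n + 1) ∘L ((v (n + 1)).adjoint ∘L v n) = v n := by
    ext1 y; exact hs (n + 1) _ (hWmono n (hr n y))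
  refine ⟨κ, v, fun n => (v (n + 1)).adjoint ∘L v n, fun n => hfd n (hWf n), hv, hvv,
    fun n => (hv (n + 1)).adjoint.comp (hv n), fun n => ?_, hvi, ?_⟩
  · rw [ContinuousLinearMap.adjoint_comp, ContinuousLinearMap.adjoint_adjoint,
      ContinuousLinearMap.comp_assoc, hvi, hvv]
  · have hd : DenseRange s.s.1 :=
      denseRange_of_injective (congrArg Subtype.val s.isFull.1.star_eq) s.isFull.injective
    rw [← dense_closure]
    refine Dense.mono ?_ hd
    rintro _ ⟨x, rfl⟩
    -- the elements `(s - ε n)₊ x` of the spectral subspaces converge to `s x`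
    have hlim : Tendsto (fun n => (cut (ε n) s.s).1 x) atTop (𝓝 (s.s.1 x)) := by
      rw [tendsto_iff_norm_sub_tendsto_zero]
      have h0 : Tendsto (fun n => ε n * ‖x‖) atTop (𝓝 0) := by
        have h := (tendsto_one_div_add_atTop_nhds_zero_nat (𝕜 := ℝ)).mul_const ‖x‖
        rwa [zero_mul] at h
      refine squeeze_zero (fun _ => norm_nonneg _) (fun n => ?_) h0
      refine ContinuousLinearMap.le_of_opNorm_le ((cut (ε n) s.s).1 - s.s.1) ?_ x
      have h1 : ‖cut (ε n) s.s - s.s‖ ≤ ε n := by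
        obtain ⟨r, hr⟩ := s.strictlyPos.1
        let _ := CStarAlgebra.spectralOrder (Cpt ν.H ν.H)
        have _ := CStarAlgebra.spectralOrderedRing (Cpt ν.H ν.H)
        refine norm_cut_sub_le (hε n).le ?_
        rw [hr]
        exact star_mul_self_nonneg r
      exact h1
    refine mem_closure_of_tendsto hlim (Eventually.of_forall fun n => ?_)
    refine Set.mem_iUnion.2 ⟨n, (v n).adjoint ((cut (ε n) s.s).1 x), hs n _ ?_⟩
    refine Finset.le_sup (f := V) (Finset.self_mem_range_succ n) ?_
    exact sub_eq_zero.2 (DFunLike.congr_fun (congrArg Subtype.val (hkcut n)) x)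

/-- A representation is a supremum in `Cu(G)` of an increasing sequence of finite dimensional
subrepresentations: embeddings of these in a representation `ω` can be corrected one after the other
so that they extend each other, and then they converge to an embedding of the union. -/
lemma InvStrictlyPos.exists_isLUB (s : InvStrictlyPos ν) : ∃ κ : ℕ → URep G,
    (∀ n, FiniteDimensional ℂ (κ n).H) ∧ (Monotone fun n => CuRep.mk (κ n)) ∧
      IsLUB (Set.range fun n => CuRep.mk (κ n)) (CuRep.mk ν) := by
  obtain ⟨κ, v, i, hf, hv, hvv, hi, hii, hvi, hd⟩ := s.exists_exhaustion
  refine ⟨κ, hf, monotone_nat_of_le_succ fun n => CuRep.mk_le_iff.2 ⟨i n, hi n, hii n⟩, ?_,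
    fun r hr => ?_⟩
  · rintro _ ⟨n, rfl⟩
    exact CuRep.mk_le_iff.2 ⟨v n, hv n, hvv n⟩
  obtain ⟨ω, rfl⟩ := CuRep.exists_rep r
  choose u hu huu using fun n => CuRep.mk_le_iff.1 (hr ⟨n, rfl⟩ : CuRep.mk (κ n) ≤ CuRep.mk ω)
  -- replace the embeddings `u n` by compatible ones
  choose e he hee hei using fun (n : ℕ)
    (w : {w : (κ n).H →L[ℂ] ω.H // Intertwines (κ n) ω w ∧ w.adjoint ∘L w = .id ℂ _}) =>
      (hi n).exists_extension (hu (n + 1)) w.2.1 (hii n) (huu (n + 1)) w.2.2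
  let w' : ∀ n, {w : (κ n).H →L[ℂ] ω.H // Intertwines (κ n) ω w ∧ w.adjoint ∘L w = .id ℂ _} :=
    fun n => Nat.rec ⟨u 0, hu 0, huu 0⟩ (fun n w => ⟨e n w, he n w, hee n w⟩) n
  let w : ∀ n, (κ n).H →L[ℂ] ω.H := fun n => (w' n).1
  have hw (n) : Intertwines (κ n) ω (w n) := (w' n).2.1
  have hww (n) : (w n).adjoint ∘L w n = .id ℂ _ := (w' n).2.2
  have hwi (n) : w (n + 1) ∘L i n = w n := hei n (w' n)
  let T : ℕ → ν.H →L[ℂ] ω.H := fun n => w n ∘L (v n).adjoint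
  have hP := tendsto_comp_adjoint hvi hvv hd
  have hT {m n : ℕ} (h : m ≤ n) (x : ν.H) : T n (v m ((v m).adjoint x)) = T m x := by
    obtain ⟨j, h1, h2⟩ := exists_factor hvi hwi h
    change w n ((v n).adjoint (v m ((v m).adjoint x))) = w m ((v m).adjoint x)
    generalize (v m).adjoint x = y
    rw [h1, h2, ContinuousLinearMap.comp_apply, ContinuousLinearMap.comp_apply,
      eq_of_adjoint_comp_self (hvv n)]
  have hcauchy (x : ν.H) : CauchySeq fun n => T n x := by
    refine Metric.cauchySeq_iff'.2 fun ε hε => ?_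
    obtain ⟨m, hm⟩ := (((tendsto_iff_norm_sub_tendsto_zero.1 (hP x)).eventually
      (gt_mem_nhds hε))).exists
    refine ⟨m, fun n hn => ?_⟩
    rw [dist_eq_norm, ← hT hn x, ← map_sub]
    refine lt_of_le_of_lt ?_ hm
    refine (ContinuousLinearMap.le_of_opNorm_le _
      (norm_comp_adjoint_le_one (hww n) (hvv n)) _).trans ?_
    rw [one_mul, norm_sub_rev]
    rfl
  choose T' hT' using fun x => cauchySeq_tendsto_of_complete (hcauchy x)
  let T₀ : ν.H →L[ℂ] ω.H := continuousLinearMapOfTendsto T (tendsto_pi_nhds.2 hT')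
  have hT₀ (x) : Tendsto (fun n => T n x) atTop (𝓝 (T₀ x)) := hT' x
  refine CuRep.mk_le_iff.2 ⟨T₀, fun g => ?_,
    (ContinuousLinearMap.norm_map_iff_adjoint_comp_self _).1 fun x => ?_⟩
  · ext1 x
    refine tendsto_nhds_unique (((ω.op g).continuous.tendsto _).comp (hT₀ x))
      ((hT₀ (ν.op g x)).congr fun n => ?_)
    exact (DFunLike.congr_fun (((hw n).comp (hv n).adjoint) g) x).symm
  · refine tendsto_nhds_unique (hT₀ x).norm ((hP x).norm.congr fun n => ?_)
    change ‖v n ((v n).adjoint x)‖ = ‖w n ((v n).adjoint x)‖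
    rw [norm_map_of_adjoint_comp_self (hvv n), norm_map_of_adjoint_comp_self (hww n)]

end FiniteDim

section Objects

variable {G : Type u} [TopologicalSpace G] [Group G] [IsTopologicalGroup G] [CompactSpace G]
  {A B : GAlg.{u, v} G} {μ ν ω μ' ν' : URep G}

/-- The homomorphism `x ↦ s ⊗ x` for a self-adjoint idempotent `s`, such as the identity of a finite
dimensional representation. -/
def KT.tensorOne (s : InvStrictlyPos ν) (hs : Cpt.comp s.s s.s = s.s) (hs' : Cpt.adj s.s = s.s) :
    KTG μ μ A →⋆ₙₐ[ℂ] KTG (ν.tensor μ) (ν.tensor μ) A where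
  toFun := KT.tensorLeft s.s
  map_smul' c x := map_smul (KT.tensorLeft s.s) c x
  map_zero' := map_zero (KT.tensorLeft s.s)
  map_add' := map_add (KT.tensorLeft s.s)
  map_mul' x y := by
    have h := KT.tensorLeft_comp s.s s.s x y
    rw [hs] at h
    exact h
  map_star' x := by
    have h := KT.tensorLeft_adj s.s x
    rw [hs'] at h
    exact h.symm

/-- If `[μ] ≪ [ν]`, then `μ` is contained in a finite dimensional subrepresentation `κ` of `ν`, and
`1 ⊗ (a - δ)₊ = (1 ⊗ a - δ)₊` for the identity of `κ`. -/
lemma CuG.wayBelow_smul (r r' : CuRep G) (x y : CuG A) (hr : WayBelow r r')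
    (hx : WayBelow x y) : WayBelow (r • x) (r' • y) := by
  obtain ⟨ν, rfl⟩ := CuRep.exists_rep r'
  obtain ⟨Y, rfl⟩ := CuG.exists_rep y
  obtain ⟨S⟩ := URep.exists_invStrictlyPos ν
  obtain ⟨κ, hf, hm, hlub⟩ := S.exists_isLUB
  obtain ⟨n, hn⟩ := hr _ _ hm hlub le_rfl
  obtain ⟨δ, hδ, hxδ⟩ := CuG.wayBelow_mk.1 hx
  let s := InvStrictlyPos.one (κ n)
  have h1 : r • x ≤ CuG.mk ((Y.cut δ hδ.le).tensor s) := by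
    rw [← CuG.smul_mk]
    exact CuG.smul_le_smul hn hxδ
  have h2 : CuG.mk ((Y.cut δ hδ.le).tensor s) = CuG.mk ((Y.tensor s).cut δ hδ.le) := by
    refine CuG.mk_congr (μ := (κ n).tensor Y.μ) ?_ _ _ _ _
    exact map_cut (KT.tensorOne (μ := Y.μ) (A := A) s rfl
      (Subtype.ext (ContinuousLinearMap.adjoint_id ..))) hδ.le
      (IsSelfAdjoint.of_nonneg Y.nonneg)
  have h3 : CuG.mk (Y.tensor s) ≤ CuRep.mk ν • CuG.mk Y := by
    rw [← CuG.smul_mk]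
    exact CuG.smul_le_smul (hlub.1 ⟨n, rfl⟩) le_rfl
  intro t z ht hz hyz
  exact (CuG.wayBelow_mk.2 ⟨δ, hδ, h1.trans h2.le⟩) t z ht hz (h3.trans hyz)

/-- Equivariant Cuntz semigroups are objects of `CCu^G`. -/
lemma CuG.isCCuG (A : GAlg.{u, v} G) : IsCCuG G (CuG A) where
  __ := CuG.isCCu A
  add_smul := CuG.add_smul
  smul_add := CuG.smul_add
  mul_smul := CuG.mul_smul
  one_smul := CuG.one_smul
  zero_smul := CuG.zero_smul
  smul_zero := CuG.smul_zero
  smul_le_smul _ _ _ _ := CuG.smul_le_smul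
  wayBelow_smul := CuG.wayBelow_smul
  sup_smul := CuG.sup_smul

/-- Equivariant homomorphisms induce morphisms of `CCu^G`. -/
lemma CuG.map_isCCuGHom (ψ : GHom A B) : IsCCuGHom G (CuG.map ψ) where
  __ := CuG.map_isCCuHom ψ
  map_smul r x := by
    obtain ⟨ν, rfl⟩ := CuRep.exists_rep r
    obtain ⟨X, rfl⟩ := CuG.exists_rep x
    obtain ⟨S⟩ := URep.exists_invStrictlyPos ν
    rw [CuG.map_mk, CuG.smul_mk ν S, CuG.smul_mk ν S, CuG.map_mk]
    refine CuG.mk_congr (μ := ν.tensor X.μ) ?_ _ _ _ _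
    have h := KT.tensorLeft_sandwich S.s (.id ℂ ν.H) (.id ℂ ν.H) (.id ℂ X.μ.H) (.id ℂ X.μ.H)
      ψ.toHom X.a
    rw [hmap_id] at h
    exact h

end Objects

/-! ### A faithful representation -/

section Faithful

variable {D : Type v} [NonUnitalCStarAlgebra D]

/-- A `C*`-algebra has enough representations: the closed cone of positive elements is separated
from `-h`, for a nonzero positive `h`, by a positive functional `τ` with `τ(h) > 0`. -/
lemma StarRep.exists_apply_ne_zero {a : D} (ha : a ≠ 0) : ∃ ρ : StarRep D, ρ.π a ≠ 0 := by
  let _ := CStarAlgebra.spectralOrder D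
  have _ := CStarAlgebra.spectralOrderedRing D
  have hx : a * star a ≠ 0 := (CStarRing.mul_star_self_eq_zero_iff a).not.2 ha
  let h : D := star (a * star a) * (a * star a)
  have hh0 : h ≠ 0 := (CStarRing.star_mul_self_eq_zero_iff _).not.2 hx
  have hh : 0 ≤ h := star_mul_self_nonneg _
  have hneg : -h ∉ {b : D | 0 ≤ b} := fun hn =>
    hh0 (le_antisymm (neg_nonneg.1 hn) hh)
  have hconv : Convex ℝ {b : D | 0 ≤ b} := fun x hx y hy s t hs ht _ => by
    change 0 ≤ s • x + t • y
    exact add_nonneg (smul_nonneg hs hx) (smul_nonneg ht hy)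
  obtain ⟨f, c, hf1, hf2⟩ := RCLike.geometric_hahn_banach_point_closed (𝕜 := ℂ) hconv
    CStarAlgebra.isClosed_nonneg hneg
  have hc : c < 0 := by simpa using hf2 0 (le_refl (0 : D))
  have hfpos (b : D) (hb : 0 ≤ b) : 0 ≤ (f b).re := by
    by_contra hlt
    rw [not_le] at hlt
    -- a functional which is bounded below on a cone is nonnegative on it
    have h1 := hf2 ((c / (f b).re) • b) (smul_nonneg (div_nonneg_of_nonpos hc.le hlt.le) hb)
    rw [← Complex.coe_smul, map_smul, smul_eq_mul] at h1
    change c < ((((c / (f b).re : ℝ) : ℂ)) * f b).re at h1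
    rw [Complex.re_ofReal_mul, div_mul_cancel₀ _ hlt.ne] at h1
    exact h1.false
  have hfh : 0 < (f h).re := by
    rw [map_neg] at hf1
    change (-f h).re < c at hf1
    rw [Complex.neg_re] at hf1
    linarith
  let τ₀ : D →ₗ[ℂ] ℂ :=
    { toFun := fun x => f x + star (f (star x))
      map_add' := fun x y => by rw [star_add, map_add, map_add, star_add]; ring
      map_smul' := fun c x => by
        rw [star_smul, map_smul, map_smul, smul_eq_mul, smul_eq_mul, star_mul', star_star,
          RingHom.id_apply, smul_eq_mul, mul_add] }
  have hτ₀ (b : D) (hb : 0 ≤ b) : τ₀ b = ((2 * (f b).re : ℝ) : ℂ) := by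
    change f b + star (f (star b)) = _
    rw [(IsSelfAdjoint.of_nonneg hb).star_eq]
    exact Complex.add_conj (f b)
  let τ : D →ₚ[ℂ] ℂ := .mk₀ τ₀ fun b hb => by
    rw [hτ₀ b hb]
    exact Complex.zero_le_real.2 (by linarith [hfpos b hb])
  refine ⟨{ L := τ.GNS, π := τ.gnsNonUnitalStarAlgHom }, fun h0 => ?_⟩
  have h1 : τ.gnsNonUnitalStarAlgHom a = 0 := h0
  have h2 := congrArg norm (DFunLike.congr_fun h1 ((τ.toPreGNS (star a) : τ.PreGNS) : τ.GNS))
  rw [PositiveLinearMap.gnsNonUnitalStarAlgHom_apply_coe, UniformSpace.Completion.norm_coe,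
    zero_apply, norm_zero, PositiveLinearMap.leftMulMapPreGNS_apply] at h2
  have h3 := τ.preGNS_norm_sq (τ.toPreGNS (a * star a))
  have h4 : ‖τ.toPreGNS (a * star a)‖ = 0 := h2
  rw [h4] at h3
  have h5 : τ₀ h = 0 := by
    change _ = τ₀ h at h3
    rw [← h3]; simp
  rw [hτ₀ h hh, Complex.ofReal_eq_zero] at h5
  linarith

/-- The homomorphism `a ↦ 1 ⊗ a` to `K(ℂ) ⊗ D`. -/
def KT.scalar (D : Type v) [NonUnitalCStarAlgebra D] : D →⋆ₙₐ[ℂ] KT ℂ ℂ D where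
  toFun a := KT.tmul ⟨.id ℂ ℂ, isCompactOperator_of_range_le (V := ⊤) _ fun _ => trivial⟩ a
  map_smul' c a := by
    refine (congrArg KT.of ?_).trans (map_smul KT.of c _)
    exact TensorProduct.tmul_smul _ _ _
  map_zero' := by
    refine (congrArg KT.of ?_).trans (map_zero KT.of)
    exact TensorProduct.tmul_zero _ _
  map_add' a b := by
    refine (congrArg KT.of ?_).trans (map_add KT.of _ _)
    exact TensorProduct.tmul_add _ _ _
  map_mul' a b := by
    refine Eq.trans ?_ (KT.comp_of _ _).symm
    rfl
  map_star' a := by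
    rw [KT.star_def]
    refine Eq.trans ?_ (KT.adj_of _).symm
    refine congrArg KT.of (congrArg (fun k => AlgKT.tmul k (star a)) ?_)
    exact Subtype.ext (ContinuousLinearMap.adjoint_id ..).symm

lemma KT.norm_scalar (a : D) : ‖KT.scalar D a‖ = ‖a‖ := by
  refine NonUnitalStarAlgHom.norm_map (KT.scalar D) ?_ a
  refine (injective_iff_map_eq_zero _).2 fun a ha => ?_
  by_contra ha0
  obtain ⟨ρ, hρ⟩ := StarRep.exists_apply_ne_zero ha0
  refine hρ ?_
  have h1 : ‖KT.scalar D a‖ = 0 := by rw [ha, norm_zero]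
  have h2 := AlgKT.le_norm ρ (AlgKT.tmul (⟨.id ℂ ℂ,
    isCompactOperator_of_range_le (V := ⊤) _ fun _ => trivial⟩ : Cpt ℂ ℂ) a)
  rw [← KT.of.norm_map] at h2
  have h3 : ρ.ampl (AlgKT.tmul (⟨.id ℂ ℂ,
    isCompactOperator_of_range_le (V := ⊤) _ fun _ => trivial⟩ : Cpt ℂ ℂ) a) = 0 :=
    norm_le_zero_iff.1 (h2.trans_eq h1)
  ext x
  have h4 := congrArg norm (DFunLike.congr_fun h3 (HTensor.of ((1 : ℂ) ⊗ₜ[ℂ] x)))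
  rw [StarRep.ampl_tmul, hmap_coe, TensorProduct.mapL_tmul, LinearIsometry.norm_map,
    TensorProduct.norm_tmul] at h4
  simpa using h4

/-- The elements `1 ⊗ a` exhaust `K(ℂ) ⊗ D`. -/
lemma KT.denseRange_scalar : DenseRange (KT.scalar D) := by
  refine KT.denseRange.mono ?_
  rintro _ ⟨t, rfl⟩
  induction t using AlgKT.induction with
  | zero => exact ⟨0, by rw [map_zero, map_zero]⟩
  | add x y hx hy =>
    obtain ⟨a, ha⟩ := hx
    obtain ⟨b, hb⟩ := hy
    exact ⟨a + b, by rw [map_add, map_add, ha, hb]⟩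
  | tmul k a =>
    refine ⟨k.1 1 • a, ?_⟩
    refine congrArg KT.of ?_
    have hk : k = k.1 1 • (⟨.id ℂ ℂ,
        isCompactOperator_of_range_le (V := ⊤) _ fun _ => trivial⟩ : Cpt ℂ ℂ) := by
      refine Subtype.ext (ContinuousLinearMap.ext_ring ?_)
      change k.1 1 = k.1 1 • (1 : ℂ)
      rw [smul_eq_mul, mul_one]
    conv_rhs => rw [hk]
    exact (TensorProduct.tmul_smul _ _ _).trans (TensorProduct.smul_tmul' _ _ _).symm

end Faithful

/-! ### Norms in the limit -/

section NormLimit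

variable {E F K : Type}
  [NormedAddCommGroup E] [InnerProductSpace ℂ E] [CompleteSpace E]
  [NormedAddCommGroup F] [InnerProductSpace ℂ F] [CompleteSpace F]
  [NormedAddCommGroup K] [InnerProductSpace ℂ K] [CompleteSpace K]
  {D L M : Type v} [NonUnitalCStarAlgebra D] [NonUnitalCStarAlgebra L] [NonUnitalCStarAlgebra M]

/-- The map `id ⊗ ψ`. -/
def KT.map (ψ : D →⋆ₙₐ[ℂ] L) : KT E F D →L[ℂ] KT E F L :=
  KT.sandwich (.id ℂ F) (.id ℂ E) ψ

lemma KT.map_comp (ψ : D →⋆ₙₐ[ℂ] L) (x : KT F K D) (y : KT E F D) :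
    KT.map ψ (KT.comp x y) = KT.comp (KT.map ψ x) (KT.map ψ y) := by
  unfold KT.map
  rw [KT.comp_sandwich, ContinuousLinearMap.comp_id, KT.sandwich_id]

lemma KT.map_adj (ψ : D →⋆ₙₐ[ℂ] L) (x : KT E F D) :
    KT.map ψ (KT.adj x) = KT.adj (KT.map ψ x) := by
  unfold KT.map
  rw [KT.sandwich_adj, ContinuousLinearMap.adjoint_id, ContinuousLinearMap.adjoint_id]

lemma KT.map_lmul (ψ : D →⋆ₙₐ[ℂ] L) (v : F →L[ℂ] K) (x : KT E F D) :
    KT.map ψ (KT.lmul v x) = KT.lmul v (KT.map ψ x) := by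
  unfold KT.map KT.lmul
  rw [KT.sandwich_sandwich, KT.sandwich_sandwich]
  rfl

lemma KT.map_rmul (ψ : D →⋆ₙₐ[ℂ] L) (w : K →L[ℂ] E) (x : KT E F D) :
    KT.map ψ (KT.rmul w x) = KT.rmul w (KT.map ψ x) := by
  unfold KT.map KT.rmul
  rw [KT.sandwich_sandwich, KT.sandwich_sandwich]
  rfl

lemma KT.map_map (ψ : L →⋆ₙₐ[ℂ] M) (φ : D →⋆ₙₐ[ℂ] L) (x : KT E F D) :
    KT.map ψ (KT.map φ x) = KT.map (ψ.comp φ) x := KT.sandwich_sandwich _ _ _ _ _ _ _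

lemma KT.map_tmul (ψ : D →⋆ₙₐ[ℂ] L) (k : Cpt E F) (a : D) :
    KT.map ψ (KT.tmul k a) = KT.tmul k (ψ a) := KT.sandwich_of _ _ _ _

lemma KT.norm_map_le (ψ : D →⋆ₙₐ[ℂ] L) (x : KT E F D) : ‖KT.map ψ x‖ ≤ ‖x‖ := by
  refine (KT.norm_sandwich_le _ _ _ _).trans ?_
  refine mul_le_of_le_one_left (norm_nonneg _) (mul_le_one₀ ?_ (norm_nonneg _) ?_) <;>
  exact ContinuousLinearMap.norm_id_le

lemma KT.lmul_sum {α : Type*} (s : Finset α) (v : α → F →L[ℂ] K) (x : KT E F D) :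
    KT.lmul (∑ i ∈ s, v i) x = ∑ i ∈ s, KT.lmul (v i) x := by
  classical
  induction s using Finset.induction_on with
  | empty => simp only [Finset.sum_empty, KT.lmul_zero_left]
  | insert a s ha ih => rw [Finset.sum_insert ha, Finset.sum_insert ha, KT.lmul_add_left, ih]

lemma KT.rmul_sum {α : Type*} (s : Finset α) (w : α → K →L[ℂ] E) (x : KT E F D) :
    KT.rmul (∑ i ∈ s, w i) x = ∑ i ∈ s, KT.rmul (w i) x := by
  classical
  induction s using Finset.induction_on with
  | empty => simp only [Finset.sum_empty, KT.rmul_zero_left]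
  | insert a s ha ih => rw [Finset.sum_insert ha, Finset.sum_insert ha, KT.rmul_add_left, ih]

/-- The projection to the span of a finite set. -/
def finProj (S : Finset E) : E →L[ℂ] E := (Submodule.span ℂ (S : Set E)).starProjection

lemma norm_finProj_le (S : Finset E) : ‖finProj S‖ ≤ 1 := Submodule.starProjection_norm_le _

lemma adjoint_finProj (S : Finset E) : (finProj S).adjoint = finProj S :=
  (isSelfAdjoint_starProjection _).adjoint_eq

lemma finProj_comp_self (S : Finset E) : finProj S ∘L finProj S = finProj S :=
  Submodule.isIdempotentElem_starProjection _

lemma tendsto_finProj (x : E) : Tendsto (fun S : Finset E => finProj S x) atTop (𝓝 x) := by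
  refine tendsto_const_nhds.congr' ?_
  filter_upwards [eventually_ge_atTop {x}] with S hS
  exact (Submodule.starProjection_eq_self_iff.2
    (Submodule.subset_span (hS (Finset.mem_singleton_self x)))).symm

lemma exists_finProj_eq_sum (S : Finset E) : ∃ (n : ℕ) (u : Fin n → ℂ →L[ℂ] E),
    finProj S = ∑ i, u i ∘L (u i).adjoint := by
  let b := stdOrthonormalBasis ℂ (Submodule.span ℂ (S : Set E))
  refine ⟨_, fun i => ContinuousLinearMap.toSpanSingleton ℂ (b i : E), ?_⟩
  ext x
  have h (y z : E) : (ContinuousLinearMap.toSpanSingleton ℂ y).adjoint z = ⟪y, z⟫_ℂ := by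
    have h1 := ContinuousLinearMap.adjoint_inner_right
      (ContinuousLinearMap.toSpanSingleton ℂ y) (1 : ℂ) z
    rw [ContinuousLinearMap.toSpanSingleton_apply, one_smul] at h1
    rw [← h1]
    simp
  rw [finProj, b.starProjection_eq_sum_rankOne, sum_apply,
    sum_apply]
  refine Finset.sum_congr rfl fun i _ => ?_
  rw [ContinuousLinearMap.comp_apply, h]
  rfl

/-- Compressions to finite dimensional subspaces converge to the identity. -/
lemma KT.tendsto_conj_finProj (x : KT E E D) :
    Tendsto (fun S : Finset E => KT.conj (finProj S) x) atTop (𝓝 x) := by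
  refine tendsto_clm_of_dense (T₀ := .id ℂ (KT E E D)) (C := 1) (fun S => ?_) KT.denseRange ?_ x
  · refine ContinuousLinearMap.opNorm_le_bound _ zero_le_one fun y => ?_
    refine (KT.norm_conj_le _ _).trans (mul_le_mul_of_nonneg_right ?_ (norm_nonneg _))
    exact pow_le_one₀ (norm_nonneg _) (norm_finProj_le S)
  · rintro _ ⟨t, rfl⟩
    induction t using AlgKT.induction with
    | zero => simpa only [map_zero] using tendsto_const_nhds
    | add x y hx hy => simpa only [map_add] using hx.add hy
    | tmul k a =>
      have hk : Tendsto (fun S : Finset E => Cpt.sandwich (finProj S) (finProj S).adjoint k) atTop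
          (𝓝 k) := by
        rw [tendsto_subtype_rng]
        have l1 : Tendsto (fun S : Finset E => finProj S ∘L k.1) atTop (𝓝 k.1) :=
          tendsto_comp_of_isCompactOperator (T₀ := .id ℂ E) norm_finProj_le tendsto_finProj k.2
        have l2 : Tendsto (fun S : Finset E => finProj S ∘L k.1.adjoint) atTop (𝓝 k.1.adjoint) :=
          tendsto_comp_of_isCompactOperator (T₀ := .id ℂ E) norm_finProj_le tendsto_finProj
            (isCompactOperator_adjoint k.2)
        have l3 : Tendsto (fun S : Finset E => k.1 ∘L finProj S) atTop (𝓝 k.1) := by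
          have h := (ContinuousLinearMap.adjoint (𝕜 := ℂ) (E := E) (F := E)).continuous.tendsto
            k.1.adjoint
          rw [ContinuousLinearMap.adjoint_adjoint] at h
          refine (h.comp l2).congr fun S => ?_
          change (finProj S ∘L k.1.adjoint).adjoint = _
          rw [ContinuousLinearMap.adjoint_comp, ContinuousLinearMap.adjoint_adjoint,
            adjoint_finProj]
        rw [tendsto_iff_norm_sub_tendsto_zero] at l1 l3 ⊢
        have h1 := l3.add l1
        rw [add_zero] at h1
        refine squeeze_zero (fun _ => norm_nonneg _) (fun S => ?_) h1
        change ‖finProj S ∘L k.1 ∘L (finProj S).adjoint - k.1‖ ≤ _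
        have e : finProj S ∘L k.1 ∘L (finProj S).adjoint - k.1
            = finProj S ∘L (k.1 ∘L finProj S - k.1) + (finProj S ∘L k.1 - k.1) := by
          rw [adjoint_finProj, ContinuousLinearMap.comp_sub]; abel
        rw [e]
        refine (norm_add_le _ _).trans (add_le_add ?_ le_rfl)
        refine (ContinuousLinearMap.opNorm_comp_le _ _).trans ?_
        exact mul_le_of_le_one_left (norm_nonneg _) (norm_finProj_le S)
      have hcont : Continuous fun k : Cpt E E => KT.tmul k a :=
        KT.continuous_tmul continuous_id continuous_const
      refine ((hcont.tendsto k).comp hk).congr fun S => ?_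
      exact (KT.conj_tmul _ _ _).symm

lemma norm_iterate_mul_self {a : D} (ha : IsSelfAdjoint a) (p : ℕ) :
    ‖(fun x : D => x * x)^[p] a‖ = ‖a‖ ^ 2 ^ p := by
  induction p generalizing a with
  | zero => simp
  | succ p ih =>
    rw [Function.iterate_succ_apply,
      ih (a := a * a) (by rw [IsSelfAdjoint, star_mul, ha.star_eq]), ha.norm_mul_self, ← pow_mul,
      pow_succ' 2 p]

variable {C : ℕ → Type v} [∀ m, NonUnitalCStarAlgebra (C m)]

/-- The asymptotic norm bound `limsup ‖(id ⊗ c m) t‖ ≤ ‖(id ⊗ j) t‖`. -/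
def NormLE (c : ∀ m, D →⋆ₙₐ[ℂ] C m) (j : D →⋆ₙₐ[ℂ] L) (t : KT E F D) : Prop :=
  ∀ r, ‖KT.map j t‖ < r → ∀ᶠ m in atTop, ‖KT.map (c m) t‖ ≤ r

variable {c : ∀ m, D →⋆ₙₐ[ℂ] C m} {j : D →⋆ₙₐ[ℂ] L}

lemma NormLE.of_approx {t : KT E F D} (h : ∀ ε > 0, ∃ t', ‖t - t'‖ ≤ ε ∧ NormLE c j t') :
    NormLE c j t := fun r hr => by
  obtain ⟨t', ht, h'⟩ := h ((r - ‖KT.map j t‖) / 3) (by linarith)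
  have h1 : ‖KT.map j t'‖ ≤ ‖KT.map j t‖ + ‖t - t'‖ := by
    have := KT.norm_map_le j (t - t')
    rw [map_sub] at this
    linarith [norm_sub_norm_le (KT.map j t') (KT.map j t),
      norm_sub_rev (KT.map j t') (KT.map j t)]
  filter_upwards [h' (‖KT.map j t‖ + 2 * ((r - ‖KT.map j t‖) / 3)) (by linarith)] with m hm
  have := KT.norm_map_le (c m) (t - t')
  rw [map_sub] at this
  linarith [norm_sub_norm_le (KT.map (c m) t) (KT.map (c m) t')]

/-- The bound for `K(ℂ) ⊗ D`, where `‖1 ⊗ a‖ = ‖a‖`. -/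
lemma NormLE.of_scalar (h : ∀ a, Tendsto (fun m => ‖c m a‖) atTop (𝓝 ‖j a‖)) (t : KT ℂ ℂ D) :
    NormLE c j t := NormLE.of_approx fun ε hε => by
  obtain ⟨_, ht, ⟨a, rfl⟩⟩ := Metric.dense_iff.1 KT.denseRange_scalar t ε hε
  refine ⟨KT.scalar D a, ?_, fun r hr => ?_⟩
  · rw [← dist_eq_norm, dist_comm]; exact le_of_lt ht
  · have e (M : Type v) [NonUnitalCStarAlgebra M] (ψ : D →⋆ₙₐ[ℂ] M) :
        ‖KT.map ψ (KT.scalar D a)‖ = ‖ψ a‖ := by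
      have h1 : KT.map ψ (KT.scalar D a) = KT.scalar M (ψ a) := KT.map_tmul _ _ _
      rw [h1, KT.norm_scalar]
    rw [e] at hr
    simp only [e]
    exact (h a).eventually (ge_mem_nhds hr)

/-- For elements supported on a fixed finite dimensional subspace, the bound holds up to a
constant, by comparison with the matrix entries. -/
lemma exists_eventually_norm_le_mul (h : ∀ a, Tendsto (fun m => ‖c m a‖) atTop (𝓝 ‖j a‖))
    (S : Finset E) : ∃ K : ℝ, ∀ y : KT E E D, KT.lmul (finProj S) y = y →
      KT.rmul (finProj S) y = y → ∀ r, ‖KT.map j y‖ < r →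
        ∀ᶠ m in atTop, ‖KT.map (c m) y‖ ≤ K * r := by
  obtain ⟨n, u, hu⟩ := exists_finProj_eq_sum S
  refine ⟨∑ i, ∑ k, ‖u i‖ * (‖u k‖ * (‖u i‖ * ‖u k‖ + 1)), fun y hl hr r hyr => ?_⟩
  have hr0 : 0 < r := (norm_nonneg _).trans_lt hyr
  have hent (i k : Fin n) : ∀ᶠ m in atTop,
      ‖KT.lmul (u i).adjoint (KT.rmul (u k) (KT.map (c m) y))‖ ≤ (‖u i‖ * ‖u k‖ + 1) * r := by
    have h1 := NormLE.of_scalar h (KT.lmul (u i).adjoint (KT.rmul (u k) y))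
      ((‖u i‖ * ‖u k‖ + 1) * r) (by
        rw [KT.map_lmul, KT.map_rmul]
        refine (KT.norm_lmul_le _ _).trans_lt ?_
        rw [LinearIsometryEquiv.norm_map]
        have h2 := mul_le_mul_of_nonneg_left (KT.norm_rmul_le (u k) (KT.map j y))
          (norm_nonneg (u i))
        have h3 : ‖u i‖ * ‖u k‖ * ‖KT.map j y‖ ≤ ‖u i‖ * ‖u k‖ * r := by gcongr
        nlinarith)
    simpa only [KT.map_lmul, KT.map_rmul] using h1
  filter_upwards [eventually_all.2 fun i => eventually_all.2 (hent i)] with m hm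
  have e : KT.map (c m) y = ∑ i, ∑ k, KT.lmul (u i) (KT.rmul (u k).adjoint
      (KT.lmul (u i).adjoint (KT.rmul (u k) (KT.map (c m) y)))) := by
    have e1 : KT.map (c m) y
        = KT.lmul (finProj S) (KT.rmul (finProj S) (KT.map (c m) y)) := by
      rw [← KT.map_rmul, ← KT.map_lmul, hr, hl]
    conv_lhs => rw [e1]
    rw [hu, KT.lmul_sum]
    refine Finset.sum_congr rfl fun i _ => ?_
    rw [KT.rmul_sum, map_sum]
    refine Finset.sum_congr rfl fun k _ => ?_
    rw [KT.rmul_lmul_comm, KT.lmul_lmul, KT.rmul_rmul]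
  rw [e, Finset.sum_mul]
  refine norm_sum_le_of_le _ fun i _ => ?_
  rw [Finset.sum_mul]
  refine norm_sum_le_of_le _ fun k _ => ?_
  refine (KT.norm_lmul_le _ _).trans ?_
  rw [mul_assoc]
  refine mul_le_mul_of_nonneg_left ((KT.norm_rmul_le _ _).trans ?_) (norm_nonneg _)
  rw [LinearIsometryEquiv.norm_map, mul_assoc]
  exact mul_le_mul_of_nonneg_left (hm i k) (norm_nonneg _)

/-- The constant of `exists_eventually_norm_le_mul` disappears by passing to high powers. -/
lemma NormLE.of_finProj (h : ∀ a, Tendsto (fun m => ‖c m a‖) atTop (𝓝 ‖j a‖))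
    {S : Finset E} {y : KT E E D} (hy : IsSelfAdjoint y) (hl : KT.lmul (finProj S) y = y)
    (hr : KT.rmul (finProj S) y = y) : NormLE c j y := fun r hyr => by
  obtain ⟨K, hK⟩ := exists_eventually_norm_le_mul h S
  obtain ⟨r', h1, h2⟩ := exists_between hyr
  have h0 : 0 < r' := (norm_nonneg _).trans_lt h1
  have hr0 : 0 < r := h0.trans h2
  obtain ⟨p, hp⟩ := ((tendsto_pow_atTop_atTop_of_one_lt
    ((one_lt_div h0).2 h2)).eventually_ge_atTop K).exists
  have hp' : K ≤ (r / r') ^ 2 ^ p :=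
    hp.trans (pow_le_pow_right₀ ((one_lt_div h0).2 h2).le Nat.lt_two_pow_self.le)
  have hmap (M : Type v) [NonUnitalCStarAlgebra M] (ψ : D →⋆ₙₐ[ℂ] M) :
      ‖KT.map ψ ((fun x : KT E E D => x * x)^[p] y)‖ = ‖KT.map ψ y‖ ^ 2 ^ p := by
    have h3 : Function.Semiconj (KT.map ψ) (fun x : KT E E D => x * x)
        (fun x : KT E E M => x * x) := fun x => KT.map_comp ψ x x
    rw [(h3.iterate_right p) y]
    refine norm_iterate_mul_self ?_ p
    rw [IsSelfAdjoint, KT.star_def, ← KT.map_adj]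
    exact congrArg _ hy.star_eq
  have hinv : ∀ p : ℕ, KT.lmul (finProj S) ((fun x : KT E E D => x * x)^[p] y)
      = (fun x : KT E E D => x * x)^[p] y ∧
      KT.rmul (finProj S) ((fun x : KT E E D => x * x)^[p] y)
      = (fun x : KT E E D => x * x)^[p] y := by
    intro p
    induction p with
    | zero => exact ⟨hl, hr⟩
    | succ p ih =>
      rw [Function.iterate_succ_apply']
      generalize (fun x : KT E E D => x * x)^[p] y = z at ih
      refine ⟨?_, ?_⟩
      · change KT.lmul (finProj S) (KT.comp z z) = KT.comp z z
        rw [← KT.lmul_comp, ih.1]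
      · change KT.rmul (finProj S) (KT.comp z z) = KT.comp z z
        rw [← KT.comp_rmul, ih.2]
  have key := hK _ (hinv p).1 (hinv p).2 (r' ^ 2 ^ p) (by
    rw [hmap]
    exact pow_lt_pow_left₀ h1 (norm_nonneg _) (by positivity))
  filter_upwards [key] with m hm
  rw [hmap] at hm
  refine (pow_le_pow_iff_left₀ (norm_nonneg _) hr0.le (n := 2 ^ p) (by positivity)).1 ?_
  refine hm.trans ((mul_le_mul_of_nonneg_right hp' (by positivity)).trans_eq ?_)
  rw [← mul_pow, div_mul_cancel₀ _ h0.ne']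

/-- If `‖c m a‖ → ‖j a‖` for all `a ∈ D`, then `limsup ‖(id ⊗ c m) t‖ ≤ ‖(id ⊗ j) t‖` for all
`t ∈ K(E, F) ⊗ D`. -/
lemma NormLE.of_tendsto (h : ∀ a, Tendsto (fun m => ‖c m a‖) atTop (𝓝 ‖j a‖)) (t : KT E F D) :
    NormLE c j t := fun r hr => by
  have hsa : IsSelfAdjoint (KT.comp (KT.adj t) t : KT E E D) := by
    rw [IsSelfAdjoint, KT.star_def, KT.adj_comp, KT.adj_adj]
  have h1 : NormLE c j (KT.comp (KT.adj t) t) := NormLE.of_approx fun ε hε => by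
    obtain ⟨S, hS⟩ := ((tendsto_iff_norm_sub_tendsto_zero.1
      (KT.tendsto_conj_finProj (KT.comp (KT.adj t) t))).eventually (ge_mem_nhds hε)).exists
    refine ⟨_, by rwa [norm_sub_rev], NormLE.of_finProj h (S := S) ?_ ?_ ?_⟩
    · rw [IsSelfAdjoint, KT.star_def, KT.conj, KT.sandwich_adj, ← KT.star_def, hsa.star_eq,
        ContinuousLinearMap.adjoint_adjoint]
    · rw [KT.conj, ← KT.lmul_rmul, KT.lmul_lmul, finProj_comp_self]
    · rw [KT.conj, ← KT.rmul_lmul, KT.rmul_rmul, adjoint_finProj, finProj_comp_self]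
  have e (M : Type v) [NonUnitalCStarAlgebra M] (ψ : D →⋆ₙₐ[ℂ] M) :
      ‖KT.map ψ (KT.comp (KT.adj t) t)‖ = ‖KT.map ψ t‖ * ‖KT.map ψ t‖ := by
    rw [KT.map_comp, KT.map_adj, KT.norm_adj_comp_self]
  have hr0 : 0 ≤ r := (norm_nonneg _).trans hr.le
  filter_upwards [h1 (r * r) (by rw [e]; exact mul_self_lt_mul_self (norm_nonneg _) hr)] with m hm
  rw [e] at hm
  nlinarith [norm_nonneg (KT.map (c m) t)]

end NormLimit

/-! ### Approximation in the limit system -/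

section LimitSystem

variable {G : Type u} [TopologicalSpace G] [Group G] {A B C : GAlg.{u, v} G} {μ ν : URep G}

/-- Composition of equivariant homomorphisms. -/
def GHom.comp (ψ : GHom B C) (φ : GHom A B) : GHom A C :=
  ⟨ψ.toHom.comp φ.toHom, fun g a =>
    (congrArg ψ.toHom (φ.equivariant g a)).trans (ψ.equivariant g _)⟩

variable {A : ℕ → GAlg.{u, v} G} {ι : ∀ n, GHom (A n) (A (n + 1))} {L : GAlg.{u, v} G}
  {j : ∀ n, GHom (A n) L}

variable (ι) in
/-- The composition `A n → A (n + m)` of the connecting maps, as an equivariant homomorphism. -/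
def connectHom (n : ℕ) : ∀ m, GHom (A n) (A (n + m))
  | 0 => GHom.id (A n)
  | m + 1 => (ι (n + m)).comp (connectHom n m)

lemma connectHom_apply (n m : ℕ) (a : (A n).carrier) :
    (connectHom ι n m).toHom a = connect ι n m a := by
  induction m with
  | zero => rfl
  | succ m ih => exact congrArg (ι (n + m)).toHom ih

lemma IsInductiveLimit.comp_connectHom (hL : IsInductiveLimit A ι L j) (n m : ℕ) :
    (j (n + m)).toHom.comp (connectHom ι n m).toHom = (j n).toHom := by
  ext a
  induction m with
  | zero => rfl
  | succ m ih => exact (hL.compatible (n + m) _).trans ih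

lemma IsInductiveLimit.tendsto_connectHom (hL : IsInductiveLimit A ι L j) (n : ℕ)
    (a : (A n).carrier) :
    Tendsto (fun m => ‖(connectHom ι n m).toHom a‖) atTop (𝓝 ‖(j n).toHom a‖) := by
  simpa only [connectHom_apply] using hL.tendsto_norm n a

/-- The elements of `K(E, F) ⊗ L` which come from a stage `m ≥ n`. -/
def stageRange (j : ∀ n, GHom (A n) L) (μ ν : URep G) (n : ℕ) : Set (KTG μ ν L) :=
  {y | ∃ m ≥ n, ∃ t : KTG μ ν (A m), KT.map (j m).toHom t = y}

/-- Every element of a stage has a representative in each later stage. -/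
lemma IsInductiveLimit.exists_push (hL : IsInductiveLimit A ι L j) {m m' : ℕ} (h : m ≤ m')
    (t : KTG μ ν (A m)) :
    ∃ t' : KTG μ ν (A m'), KT.map (j m').toHom t' = KT.map (j m).toHom t := by
  induction m', h using Nat.le_induction with
  | base => exact ⟨t, rfl⟩
  | succ m' h ih =>
    obtain ⟨t', ht'⟩ := ih
    refine ⟨KT.map (ι m').toHom t', ?_⟩
    rw [KT.map_map, ← ht']
    congr 2
    ext a
    exact hL.compatible m' a

/-- Elements of `K(E, F) ⊗ L` are approximated by elements of arbitrarily late stages. -/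
lemma IsInductiveLimit.dense_stageRange (hL : IsInductiveLimit A ι L j) (n : ℕ) :
    Dense (stageRange j μ ν n) := by
  intro y
  refine KT.induction y isClosed_closure fun t => ?_
  induction t using AlgKT.induction with
  | zero => exact subset_closure ⟨n, le_rfl, 0, (map_zero _).trans (map_zero _).symm⟩
  | add x y hx hy =>
    rw [map_add]
    refine map_mem_closure₂ continuous_add hx hy ?_
    rintro _ ⟨m, hm, t, rfl⟩ _ ⟨m', hm', t', rfl⟩
    obtain ⟨s, hs⟩ := hL.exists_push (le_max_left m m') t
    obtain ⟨s', hs'⟩ := hL.exists_push (le_max_right m m') t'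
    exact ⟨max m m', hm.trans (le_max_left _ _), s + s', by rw [map_add, hs, hs']⟩
  | tmul k a =>
    have hcont : Continuous fun a : L.carrier => KT.tmul k a :=
      KT.continuous_tmul continuous_const continuous_id
    refine map_mem_closure (f := fun a : L.carrier => KT.tmul k a) hcont (hL.dense a) ?_
    intro b hb
    obtain ⟨m, a', rfl⟩ := Set.mem_iUnion.1 hb
    obtain ⟨s, hs⟩ := hL.exists_push (le_max_left m n) (KT.tmul k a')
    exact ⟨max m n, le_max_right _ _, s, hs.trans (KT.map_tmul _ _ _)⟩

variable [IsTopologicalGroup G] [CompactSpace G]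

/-- Invariant elements of `K(E, F) ⊗ L` are approximated by invariant elements of the stages. -/
lemma IsInductiveLimit.exists_isInv (hL : IsInductiveLimit A ι L j) (n : ℕ) {y : KTG μ ν L}
    (hy : KTG.IsInv y) {U : Set (KTG μ ν L)} (hU : U ∈ 𝓝 y) :
    ∃ m ≥ n, ∃ t : KTG μ ν (A m), KTG.IsInv t ∧ KT.map (j m).toHom t ∈ U := by
  obtain ⟨ε, hε, hεU⟩ := Metric.nhds_basis_closedBall.mem_iff.1 hU
  obtain ⟨_, hx, m, hm, t, rfl⟩ := Metric.dense_iff.1 (hL.dense_stageRange n) y ε hε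
  obtain ⟨t', ht', h⟩ := KTG.exists_isInv_norm_le (j m) t hy (ε := ε) (by
    rw [← dist_eq_norm]; exact le_of_lt hx)
  exact ⟨m, hm, t', ht', hεU (by rw [Metric.mem_closedBall, dist_eq_norm]; exact h)⟩

lemma KT.map_sand {E F : Type} [NormedAddCommGroup E] [InnerProductSpace ℂ E] [CompleteSpace E]
    [NormedAddCommGroup F] [InnerProductSpace ℂ F] [CompleteSpace F] {D M : Type v}
    [NonUnitalCStarAlgebra D] [NonUnitalCStarAlgebra M] (ψ : D →⋆ₙₐ[ℂ] M) (d : KT E F D)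
    (b : KT E E D) : KT.map ψ (KT.sand d b) = KT.sand (KT.map ψ d) (KT.map ψ b) := by
  unfold KT.sand
  rw [KT.map_comp, KT.map_comp, KT.map_adj]

lemma KT.continuous_sand {E F : Type} [NormedAddCommGroup E] [InnerProductSpace ℂ E]
    [CompleteSpace E] [NormedAddCommGroup F] [InnerProductSpace ℂ F] [CompleteSpace F] {D : Type v}
    [NonUnitalCStarAlgebra D] (b : KT E E D) : Continuous fun d : KT E F D => KT.sand d b := by
  unfold KT.sand
  fun_prop

/-- Comparison in the limit is witnessed, up to cutting down, at a finite stage: an invariant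
`d` with `d b d* ≈ a` over `L` is approximated by one over a stage, and the estimate of the norm
holds at a later stage. -/
lemma IsInductiveLimit.exists_map_le (hL : IsInductiveLimit A ι L j) {n : ℕ}
    {x' x y : CuG (A n)} (hx : WayBelow x' x) (h : CuG.map (j n) x ≤ CuG.map (j n) y) :
    ∃ m k, CuG.map (connectHom ι (n + m) k) (CuG.map (connectHom ι n m) x')
      ≤ CuG.map (connectHom ι (n + m) k) (CuG.map (connectHom ι n m) y) := by
  obtain ⟨X, rfl⟩ := CuG.exists_rep x
  obtain ⟨Y, rfl⟩ := CuG.exists_rep y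
  obtain ⟨δ, hδ, hxδ⟩ := CuG.wayBelow_mk.1 hx
  obtain ⟨d, hd, hdn⟩ : ∃ d : KTG Y.μ X.μ L, KTG.IsInv d ∧
      ‖KT.sand d (KT.map (j n).toHom Y.a) - KT.map (j n).toHom X.a‖ ≤ δ / 2 :=
    GPos.exists_sand (x := X.map (j n)) (y := Y.map (j n)) h (half_pos hδ)
  let f : KTG Y.μ X.μ L → KTG X.μ X.μ L := fun d =>
    KT.sand d (KT.map (j n).toHom Y.a) - KT.map (j n).toHom X.a
  have hf : Continuous f := (KT.continuous_sand _).sub continuous_const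
  have hfd : ‖f d‖ < δ := lt_of_le_of_lt hdn (by linarith)
  obtain ⟨_, hm, t, ht, htU⟩ := hL.exists_isInv (μ := Y.μ) (ν := X.μ) n (y := d) hd
    ((isOpen_lt hf.norm continuous_const).mem_nhds hfd)
  obtain ⟨m, rfl⟩ := Nat.exists_eq_add_of_le hm
  let z : KTG X.μ X.μ (A (n + m)) := KT.sand t (KT.map (connectHom ι n m).toHom Y.a)
    - KT.map (connectHom ι n m).toHom X.a
  have hz : KT.map (j (n + m)).toHom z = f (KT.map (j (n + m)).toHom t) := by
    simp only [z, f, map_sub, KT.map_sand, KT.map_map, hL.comp_connectHom]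
  obtain ⟨r, hr1, hr2⟩ := exists_between (show ‖KT.map (j (n + m)).toHom z‖ < δ by rw [hz]; exact htU)
  obtain ⟨k, hk⟩ := (NormLE.of_tendsto
    (c := fun k => (connectHom ι (n + m) k).toHom) (hL.tendsto_connectHom (n + m)) z r hr1).exists
  refine ⟨m, k, ?_⟩
  refine (CuG.map_mono _ (CuG.map_mono _ hxδ)).trans ?_
  rw [CuG.map_mk, CuG.map_mk, CuG.map_mk, CuG.map_mk, ← GPos.cut_map, ← GPos.cut_map]
  have hdi : KTG.IsInv (μ := Y.μ) (ν := X.μ) (KT.map (connectHom ι (n + m) k).toHom t) :=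
    ht.sandwich _ (fun _ => rfl) (fun _ => rfl)
  have key := GPos.cut_le_of_sand (x := (X.map (connectHom ι n m)).map (connectHom ι (n + m) k))
    (y := (Y.map (connectHom ι n m)).map (connectHom ι (n + m) k)) hdi (ε := δ) (by
      refine lt_of_eq_of_lt ?_ (hk.trans_lt hr2)
      simp only [z, map_sub, KT.map_sand]
      rfl)
  exact key

/-- The classes coming from the stages are dense in `Cu^G(L)`: an invariant square root of a positive
element over `L` is approximated by an invariant element `t` over a stage, and the class is then
approximated by that of a cut-down of `t* t`. -/
lemma IsInductiveLimit.exists_le_map (hL : IsInductiveLimit A ι L j) {z' z : CuG L}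
    (h : WayBelow z' z) :
    ∃ n x, z' ≤ CuG.map (j n) x ∧ WayBelow (CuG.map (j n) x) z := by
  obtain ⟨Z, rfl⟩ := CuG.exists_rep z
  obtain ⟨δ, hδ, hzδ⟩ := CuG.wayBelow_mk.1 h
  obtain ⟨b, hb, hba, hbb⟩ := Z.exists_sqrt
  have hη : 0 < δ / 4 := by linarith
  let f : KTG Z.μ Z.μ L → KTG Z.μ Z.μ L := fun d => KT.comp (KT.adj d) d - Z.a
  have hf : Continuous f := by
    simp only [f]
    fun_prop
  have hfb : ‖f b‖ < δ / 4 := by simp only [f, hba, hbb, sub_self, norm_zero, hη]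
  obtain ⟨n, -, t, ht, htU⟩ := hL.exists_isInv 0 (y := b) hb
    ((isOpen_lt hf.norm continuous_const).mem_nhds hfb)
  let X : GPos (A n) := ⟨Z.μ, KT.comp (KT.adj t) t, ht.adj.comp ht, t, rfl⟩
  let a : KTG Z.μ Z.μ L := KT.map (j n).toHom (KT.comp (KT.adj t) t)
  have haX : 0 ≤ a := (X.map (j n)).nonneg
  have hai : KTG.IsInv a := (X.map (j n)).inv
  have ha : ‖a - Z.a‖ < δ / 4 := by
    have e : a = KT.comp (KT.adj (KT.map (j n).toHom t)) (KT.map (j n).toHom t) := by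
      simp only [a, KT.map_comp, KT.map_adj]
    rw [e]
    exact htU
  have h2 : (0 : ℝ) ≤ δ / 2 := by linarith
  have e : CuG.map (j n) (CuG.mk (X.cut (δ / 2) h2)) = CuG.mk ((X.map (j n)).cut (δ / 2) h2) := by
    rw [CuG.map_mk, ← GPos.cut_map]
  refine ⟨n, CuG.mk (X.cut (δ / 2) h2), ?_, ?_⟩
  · refine hzδ.trans ?_
    rw [e]
    have hn : ‖Z.a - cut (δ / 2) a‖ < δ := by
      have h3 := norm_cut_sub_le h2 haX
      calc ‖Z.a - cut (δ / 2) a‖ = ‖(a - Z.a) + (cut (δ / 2) a - a)‖ := by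
            rw [← norm_neg]; congr 1; abel
        _ ≤ ‖a - Z.a‖ + ‖cut (δ / 2) a - a‖ := norm_add_le _ _
        _ < δ := by linarith
    exact GPos.cut_le_of_norm_lt Z.inv ((X.map (j n)).cut (δ / 2) h2).inv Z.pos
      ((X.map (j n)).cut (δ / 2) h2).pos hn
  · rw [e]
    have h3 := CuG.mk_cut_wayBelow (X.map (j n)) hη.le (show δ / 4 < δ / 2 by linarith)
    have h4 : CuG.mk ((X.map (j n)).cut (δ / 4) hη.le) ≤ CuG.mk Z :=
      GPos.cut_le_of_norm_lt hai Z.inv (X.map (j n)).pos Z.pos ha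
    exact fun s w hs hw hz => h3 s w hs hw (h4.trans hz)

end LimitSystem

/-! ### Inductive limits in `CCu^G` from approximating cocones -/

section AbstractLimit

lemma WayBelow.le {S : Type*} [PartialOrder S] {x y : S} (h : WayBelow x y) : x ≤ y := by
  obtain ⟨_, hk⟩ := h (fun _ => y) y monotone_const (by simp [isLUB_singleton]) le_rfl
  exact hk

lemma WayBelow.trans_le {S : Type*} [PartialOrder S] {x y z : S} (h : WayBelow x y)
    (h' : y ≤ z) : WayBelow x z :=
  fun t w ht hw hz => h t w ht hw (h'.trans hz)

lemma WayBelow.of_le {S : Type*} [PartialOrder S] {x y z : S} (h : x ≤ y)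
    (h' : WayBelow y z) : WayBelow x z := fun t w ht hw hz => by
  obtain ⟨k, hk⟩ := h' t w ht hw hz
  exact ⟨k, h.trans hk⟩

variable {G : Type u} [TopologicalSpace G] [Group G]
  {Z T : Type*} [PartialOrder Z] [Zero Z] [Add Z] [SMul (CuRep G) Z]
  [PartialOrder T] [Zero T] [Add T] [SMul (CuRep G) T]

variable (G) in
/-- A dense partial morphism from `Z` to `T`, given by its graph: it is defined on a subsemimodule
of `Z` which is dense for the relation `≪`, it is order preserving, and each of its graph points is
the supremum of a sequence of graph points which is rapidly increasing in both coordinates. -/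
structure IsPartialHom (R : Z → T → Prop) : Prop where
  zero : R 0 0
  add : ∀ {z t z' t'}, R z t → R z' t' → R (z + z') (t + t')
  smul : ∀ (r : CuRep G) {z t}, R z t → R (r • z) (r • t)
  le : ∀ {z t z' t'}, R z t → R z' t' → z ≤ z' → t ≤ t'
  dense : ∀ {w w' : Z}, WayBelow w w' → ∃ z t, R z t ∧ w ≤ z ∧ WayBelow z w'
  exists_rapid : ∀ {z t}, R z t → ∃ (s : ℕ → Z) (p : ℕ → T), (∀ n, R (s n) (p n)) ∧
    (∀ n, WayBelow (s n) (s (n + 1))) ∧ (∀ n, WayBelow (p n) (p (n + 1))) ∧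
    IsLUB (Set.range s) z ∧ IsLUB (Set.range p) t

namespace IsPartialHom

variable {R : Z → T → Prop}

lemma wayBelow (hR : IsPartialHom G R) {z z' : Z} {t t' : T} (h : R z t) (h' : R z' t')
    (hz : WayBelow z z') : WayBelow t t' := by
  obtain ⟨s, p, hsp, hs, hp, hsz, hpt⟩ := hR.exists_rapid h'
  obtain ⟨k, hk⟩ := hz s z' (monotone_nat_of_le_succ fun n => (hs n).le) hsz le_rfl
  exact WayBelow.of_le (hR.le h (hsp k) hk) ((hp k).trans_le (hpt.1 ⟨k + 1, rfl⟩))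

/-- Every element is the supremum of a rapidly increasing sequence in the domain. -/
lemma exists_seq (hR : IsPartialHom G R) (hZ : IsCCuG G Z) (w : Z) :
    ∃ (s : ℕ → Z) (p : ℕ → T), (∀ n, R (s n) (p n)) ∧
      (∀ n, WayBelow (s n) (s (n + 1))) ∧ IsLUB (Set.range s) w := by
  obtain ⟨q, hq, hqw⟩ := hZ.exists_rapid w
  choose s p hsp hqs hsq using fun n => hR.dense (hq n)
  refine ⟨s, p, hsp, fun n => (hsq n).trans_le (hqs (n + 1)), ?_, ?_⟩
  · rintro _ ⟨n, rfl⟩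
    exact (hsq n).le.trans (hqw.1 ⟨n + 1, rfl⟩)
  · intro b hb
    refine hqw.2 ?_
    rintro _ ⟨n, rfl⟩
    exact (hqs n).trans (hb ⟨n, rfl⟩)

/-- If two increasing sequences in the domain have suprema `w ≤ w'` then the upper bounds of the
second sequence of values are upper bounds of the first one. -/
lemma le_of_isLUB (hR : IsPartialHom G R) {s s' : ℕ → Z} {p p' : ℕ → T} {w w' : Z} {b : T}
    (h : ∀ n, R (s n) (p n)) (h' : ∀ n, R (s' n) (p' n)) (hs' : Monotone s')
    (hw : IsLUB (Set.range s) w) (hw' : IsLUB (Set.range s') w') (hww : w ≤ w')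
    (hb : ∀ n, p' n ≤ b) (n : ℕ) : p n ≤ b := by
  obtain ⟨q, v, hqv, hq, -, hqs, hvp⟩ := hR.exists_rapid (h n)
  refine hvp.2 ?_
  rintro _ ⟨i, rfl⟩
  obtain ⟨k, hk⟩ := hq i s' w' hs' hw'
    ((hqs.1 ⟨i + 1, rfl⟩).trans ((hw.1 ⟨n, rfl⟩).trans hww))
  exact (hR.le (hqv i) (h' k) hk).trans (hb k)

/-- The value of the extension at `w` is the supremum of the values along any increasing sequence in
the domain with supremum `w`. -/
lemma exists_extension_apply (hR : IsPartialHom G R) (hZ : IsCCuG G Z) (hT : IsCCuG G T) (w : Z) :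
    ∃ t : T, ∀ (s : ℕ → Z) (p : ℕ → T), (∀ n, R (s n) (p n)) → Monotone s →
      IsLUB (Set.range s) w → IsLUB (Set.range p) t := by
  obtain ⟨s, p, hsp, hs, hsw⟩ := hR.exists_seq hZ w
  have hsm : Monotone s := monotone_nat_of_le_succ fun n => (hs n).le
  obtain ⟨t, ht⟩ := hT.exists_sup p fun m n h => hR.le (hsp m) (hsp n) (hsm h)
  refine ⟨t, fun s' p' hsp' hs' hsw' => ⟨?_, fun b hb => ht.2 ?_⟩⟩
  · rintro _ ⟨n, rfl⟩
    exact hR.le_of_isLUB hsp' hsp hsm hsw' hsw le_rfl (fun n => ht.1 ⟨n, rfl⟩) n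
  · rintro _ ⟨n, rfl⟩
    exact hR.le_of_isLUB hsp hsp' hs' hsw hsw' le_rfl (fun n => hb ⟨n, rfl⟩) n

/-- A dense partial morphism extends uniquely to a morphism of `CCu^G`. -/
theorem existsUnique_extension (hR : IsPartialHom G R) (hZ : IsCCuG G Z) (hT : IsCCuG G T) :
    ∃! χ : Z → T, IsCCuGHom G χ ∧ ∀ z t, R z t → χ z = t := by
  choose χ hχ using hR.exists_extension_apply hZ hT
  choose s p hsp hs hsw using hR.exists_seq hZ
  have hsm (w : Z) : Monotone (s w) := monotone_nat_of_le_succ fun n => (hs w n).le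
  have hpχ (w : Z) : IsLUB (Set.range (p w)) (χ w) := hχ w _ _ (hsp w) (hsm w) (hsw w)
  have hRχ (z : Z) (t : T) (h : R z t) : χ z = t :=
    (hχ z (fun _ => z) (fun _ => t) (fun _ => h) monotone_const (by simp [isLUB_singleton])).unique
      (by simp [isLUB_singleton])
  have hmono : Monotone χ := fun w w' hww => (hpχ w).2 <| by
    rintro _ ⟨n, rfl⟩
    exact hR.le_of_isLUB (hsp w) (hsp w') (hsm w') (hsw w) (hsw w') hww
      (fun n => (hpχ w').1 ⟨n, rfl⟩) n
  have hpm (w : Z) : Monotone (p w) := fun m n h => hR.le (hsp w m) (hsp w n) (hsm w h)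
  refine ⟨χ, ⟨⟨⟨hmono, hRχ 0 0 hR.zero, fun x y => ?_, fun q x hq hqx => ?_, fun x y hxy => ?_⟩,
    fun r x => ?_⟩, hRχ⟩, ?_⟩
  · exact (hχ (x + y) _ _ (fun n => hR.add (hsp x n) (hsp y n))
      (fun m n h => hZ.add_le_add _ _ _ _ (hsm x h) (hsm y h))
      (hZ.sup_add _ _ _ _ (hsm x) (hsm y) (hsw x) (hsw y))).unique
      (hT.sup_add _ _ _ _ (hpm x) (hpm y) (hpχ x) (hpχ y))
  · refine ⟨?_, fun b hb => (hpχ x).2 ?_⟩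
    · rintro _ ⟨n, rfl⟩
      exact hmono (hqx.1 ⟨n, rfl⟩)
    · rintro _ ⟨n, rfl⟩
      obtain ⟨k, hk⟩ := hs x n q x hq hqx ((hsw x).1 ⟨n + 1, rfl⟩)
      rw [← hRχ _ _ (hsp x n)]
      exact (hmono hk).trans (hb ⟨k, rfl⟩)
  · obtain ⟨k, hk⟩ := hxy (s y) y (hsm y) (hsw y) le_rfl
    refine WayBelow.of_le (hmono hk) ?_
    rw [hRχ _ _ (hsp y k)]
    exact (hR.wayBelow (hsp y k) (hsp y (k + 1)) (hs y k)).trans_le ((hpχ y).1 ⟨k + 1, rfl⟩)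
  · have hr : IsLUB (Set.range fun _ : ℕ => r) r := by simp [isLUB_singleton]
    exact (hχ (r • x) _ _ (fun n => hR.smul r (hsp x n))
      (fun m n h => hZ.smul_le_smul _ _ _ _ le_rfl (hsm x h))
      (hZ.sup_smul _ _ _ _ monotone_const (hsm x) hr (hsw x))).unique
      (hT.sup_smul _ _ _ _ monotone_const (hpm x) hr (hpχ x))
  · rintro χ' ⟨hχ', hRχ'⟩
    funext w
    have h := hχ'.map_sup (s w) w (hsm w) (hsw w)
    simp only [fun n => hRχ' _ _ (hsp w n)] at h
    exact h.unique (hpχ w)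

end IsPartialHom

/-- The composition `S n → S (n + m)` of the connecting maps of a sequence. -/
def push {S : ℕ → Type w} (φ : ∀ n, S n → S (n + 1)) (n : ℕ) : ∀ m, S n → S (n + m)
  | 0 => id
  | m + 1 => fun x => φ (n + m) (push φ n m x)

lemma apply_push {S : ℕ → Type w} {φ : ∀ n, S n → S (n + 1)} {X : Type*} {θ : ∀ n, S n → X}
    (hθ : ∀ n x, θ (n + 1) (φ n x) = θ n x) (n m : ℕ) (x : S n) :
    θ (n + m) (push φ n m x) = θ n x := by
  induction m with
  | zero => rfl
  | succ m ih => exact (hθ (n + m) _).trans ih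

/-- Two elements of stages of a sequence have representatives in a common stage; here `θ` is any
family of maps which is compatible with the connecting maps. -/
lemma exists_common_stage {S : ℕ → Type w} {φ : ∀ n, S n → S (n + 1)} {X : Type*}
    {θ : ∀ n, S n → X} (hθ : ∀ n x, θ (n + 1) (φ n x) = θ n x) {m n : ℕ} (x : S m) (y : S n) :
    ∃ (k : ℕ) (x' y' : S k), θ k x' = θ m x ∧ θ k y' = θ n y := by
  rcases le_total m n with h | h
  · obtain ⟨i, rfl⟩ := Nat.exists_eq_add_of_le h
    exact ⟨m + i, push φ m i x, y, apply_push hθ m i x, rfl⟩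
  · obtain ⟨i, rfl⟩ := Nat.exists_eq_add_of_le h
    exact ⟨n + i, x, push φ n i y, rfl, apply_push hθ n i y⟩

/-- A cocone `ψ n : S n → Z` is an inductive limit in `CCu^G` as soon as the images of the stages
are dense in `Z` for the relation `≪`, and inequalities in `Z` between elements of a stage hold in a
later stage up to a compact containment. -/
theorem isCCuGLimit_of_approx {S : ℕ → Type w} [∀ n, PartialOrder (S n)] [∀ n, Zero (S n)]
    [∀ n, Add (S n)] [∀ n, SMul (CuRep G) (S n)] {φ : ∀ n, S n → S (n + 1)}
    {Z : Type w} [PartialOrder Z] [Zero Z] [Add Z] [SMul (CuRep G) Z] {ψ : ∀ n, S n → Z}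
    (hS : ∀ n, IsCCuG G (S n)) (hZ : IsCCuG G Z) (hψ : ∀ n, IsCCuGHom G (ψ n))
    (hφψ : ∀ n x, ψ (n + 1) (φ n x) = ψ n x)
    (hdense : ∀ z' z : Z, WayBelow z' z → ∃ n x, z' ≤ ψ n x ∧ WayBelow (ψ n x) z)
    (hle : ∀ n (x' x y : S n), WayBelow x' x → ψ n x ≤ ψ n y →
      ∃ m k, push φ (n + m) k (push φ n m x') ≤ push φ (n + m) k (push φ n m y)) :
    IsCCuGLimit G S φ Z ψ where
  isCCuG := hZ
  isHom := hψ
  compatible := hφψ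
  universal T _ _ _ _ hT θ hθ hφθ := by
    have hpair : ∀ n x, (fun n x => (ψ n x, θ n x)) (n + 1) (φ n x) = (ψ n x, θ n x) :=
      fun n x => Prod.ext (hφψ n x) (hφθ n x)
    have hsup (n : ℕ) (x y : S n) (h : ψ n x ≤ ψ n y) : θ n x ≤ θ n y := by
      obtain ⟨s, hs, hsx⟩ := (hS n).exists_rapid x
      have hsm : Monotone s := monotone_nat_of_le_succ fun i => (hs i).le
      refine ((hθ n).map_sup s x hsm hsx).2 ?_
      rintro _ ⟨i, rfl⟩
      obtain ⟨m, k, hmk⟩ := hle n (s i) x y ((hs i).trans_le (hsx.1 ⟨i + 1, rfl⟩)) h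
      have := (hθ (n + m + k)).monotone hmk
      simpa only [apply_push hφθ] using this
    have hR : IsPartialHom G fun (z : Z) (t : T) => ∃ n x, ψ n x = z ∧ θ n x = t :=
      { zero := ⟨0, 0, (hψ 0).map_zero, (hθ 0).map_zero⟩
        add := by
          rintro _ _ _ _ ⟨m, x, rfl, rfl⟩ ⟨n, y, rfl, rfl⟩
          obtain ⟨k, x', y', hx, hy⟩ := exists_common_stage (θ := fun n x => (ψ n x, θ n x)) hpair x y
          obtain ⟨hx1, hx2⟩ := Prod.ext_iff.1 hx
          obtain ⟨hy1, hy2⟩ := Prod.ext_iff.1 hy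
          refine ⟨k, x' + y', ?_, ?_⟩
          · rw [(hψ k).map_add]
            exact congrArg₂ _ hx1 hy1
          · rw [(hθ k).map_add]
            exact congrArg₂ _ hx2 hy2
        smul := by
          rintro r _ _ ⟨n, x, rfl, rfl⟩
          exact ⟨n, r • x, (hψ n).map_smul r x, (hθ n).map_smul r x⟩
        le := by
          rintro _ _ _ _ ⟨m, x, rfl, rfl⟩ ⟨n, y, rfl, rfl⟩ h
          obtain ⟨k, x', y', hx, hy⟩ := exists_common_stage (θ := fun n x => (ψ n x, θ n x)) hpair x y
          obtain ⟨hx1, hx2⟩ := Prod.ext_iff.1 hx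
          obtain ⟨hy1, hy2⟩ := Prod.ext_iff.1 hy
          have := hsup k x' y' (hx1.trans_le (h.trans hy1.ge))
          exact hx2.ge.trans (this.trans hy2.le)
        dense := fun {w w'} h => by
          obtain ⟨n, x, hx, hx'⟩ := hdense w w' h
          exact ⟨ψ n x, θ n x, ⟨n, x, rfl, rfl⟩, hx, hx'⟩
        exists_rapid := by
          rintro _ _ ⟨n, x, rfl, rfl⟩
          obtain ⟨s, hs, hsx⟩ := (hS n).exists_rapid x
          have hsm : Monotone s := monotone_nat_of_le_succ fun i => (hs i).le
          exact ⟨fun i => ψ n (s i), fun i => θ n (s i), fun i => ⟨n, s i, rfl, rfl⟩,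
            fun i => (hψ n).map_wayBelow _ _ (hs i), fun i => (hθ n).map_wayBelow _ _ (hs i),
            (hψ n).map_sup s x hsm hsx, (hθ n).map_sup s x hsm hsx⟩ }
    refine (existsUnique_congr fun χ => and_congr_right fun _ => ?_).1
      (hR.existsUnique_extension hZ hT)
    exact ⟨fun h n x => h _ _ ⟨n, x, rfl, rfl⟩, by rintro h _ _ ⟨n, x, rfl, rfl⟩; exact h n x⟩

end AbstractLimit

section CategoryLemmas

variable {G : Type u} [TopologicalSpace G] [Group G]

variable (G) in
lemma IsCCuGHom.id (S : Type*) [PartialOrder S] [Zero S] [Add S] [SMul (CuRep G) S] :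
    IsCCuGHom G (fun x : S => x) :=
  ⟨⟨monotone_id, rfl, fun _ _ => rfl, fun _ _ _ h => h, fun _ _ h => h⟩, fun _ _ => rfl⟩

lemma IsCCuGHom.comp {S T V : Type*} [PartialOrder S] [Zero S] [Add S] [SMul (CuRep G) S]
    [PartialOrder T] [Zero T] [Add T] [SMul (CuRep G) T]
    [PartialOrder V] [Zero V] [Add V] [SMul (CuRep G) V] {ψ : T → V} {φ : S → T}
    (hψ : IsCCuGHom G ψ) (hφ : IsCCuGHom G φ) : IsCCuGHom G (fun x => ψ (φ x)) :=
  ⟨⟨hψ.monotone.comp hφ.monotone, by rw [hφ.map_zero, hψ.map_zero],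
    fun x y => by rw [hφ.map_add, hψ.map_add],
    fun s x hs h => hψ.map_sup _ _ (hφ.monotone.comp hs) (hφ.map_sup s x hs h),
    fun x y h => hψ.map_wayBelow _ _ (hφ.map_wayBelow x y h)⟩,
    fun r x => by rw [hφ.map_smul, hψ.map_smul]⟩

/-- Two inductive limits of the same system are isomorphic, by a unique morphism compatible with the
cocones. -/
lemma IsCCuGLimit.exists_iso {S : ℕ → Type w} [∀ n, PartialOrder (S n)] [∀ n, Zero (S n)]
    [∀ n, Add (S n)] [∀ n, SMul (CuRep G) (S n)] {φ : ∀ n, S n → S (n + 1)}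
    {Z : Type w} [PartialOrder Z] [Zero Z] [Add Z] [SMul (CuRep G) Z] {ψ : ∀ n, S n → Z}
    {Z' : Type w} [PartialOrder Z'] [Zero Z'] [Add Z'] [SMul (CuRep G) Z'] {ψ' : ∀ n, S n → Z'}
    (h : IsCCuGLimit G S φ Z ψ) (h' : IsCCuGLimit G S φ Z' ψ') :
    ∃ χ : Z → Z', IsCCuGIso G χ ∧ (∀ n x, χ (ψ n x) = ψ' n x) ∧
      ∀ χ' : Z → Z', IsCCuGHom G χ' → (∀ n x, χ' (ψ n x) = ψ' n x) → χ' = χ := by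
  obtain ⟨χ, ⟨hχ, hχψ⟩, hu⟩ := h.universal Z' h'.isCCuG ψ' h'.isHom h'.compatible
  obtain ⟨ξ, ⟨hξ, hξψ⟩, -⟩ := h'.universal Z h.isCCuG ψ h.isHom h.compatible
  have e1 := (h.universal Z h.isCCuG ψ h.isHom h.compatible).unique
    (y₁ := fun z => ξ (χ z)) (y₂ := fun z => z)
    ⟨hξ.comp hχ, fun n x => by rw [hχψ, hξψ]⟩ ⟨IsCCuGHom.id G Z, fun _ _ => rfl⟩
  have e2 := (h'.universal Z' h'.isCCuG ψ' h'.isHom h'.compatible).unique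
    (y₁ := fun z => χ (ξ z)) (y₂ := fun z => z)
    ⟨hχ.comp hξ, fun n x => by rw [hξψ, hχψ]⟩ ⟨IsCCuGHom.id G Z', fun _ _ => rfl⟩
  exact ⟨χ, ⟨hχ, ξ, hξ, congrFun e1, congrFun e2⟩, hχψ, fun χ' h1 h2 => hu χ' ⟨h1, h2⟩⟩

end CategoryLemmas

/-! ### The limit theorem for equivariant Cuntz semigroups -/

section LimitTheorem

variable {G : Type u} [TopologicalSpace G] [Group G] {A : ℕ → GAlg.{u, v} G}
  {ι : ∀ n, GHom (A n) (A (n + 1))} {L : GAlg.{u, v} G} {j : ∀ n, GHom (A n) L}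

lemma CuG.map_id (B : GAlg.{u, v} G) (x : CuG B) : CuG.map (GHom.id B) x = x := by
  obtain ⟨x, rfl⟩ := CuG.exists_rep x
  exact CuG.mk_congr (μ := x.μ) (KT.sandwich_id x.a) _ _ _ _

lemma CuG.push_map (n m : ℕ) (x : CuG (A n)) :
    push (fun n => CuG.map (ι n)) n m x = CuG.map (connectHom ι n m) x := by
  induction m with
  | zero => exact (CuG.map_id (A n) x).symm
  | succ m ih =>
    exact (congrArg (CuG.map (ι (n + m))) ih).trans
      (CuG.map_map (ι (n + m)) (connectHom ι n m) (connectHom ι n (m + 1)) (fun _ => rfl) x)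

/-- The functor `Cu^G` preserves sequential inductive limits. -/
theorem IsInductiveLimit.isCCuGLimit [IsTopologicalGroup G] [CompactSpace G]
    (hL : IsInductiveLimit A ι L j) :
    IsCCuGLimit G (fun n => CuG (A n)) (fun n => CuG.map (ι n)) (CuG L) (fun n => CuG.map (j n)) :=
  isCCuGLimit_of_approx (fun n => CuG.isCCuG (A n)) (CuG.isCCuG L) (fun n => CuG.map_isCCuGHom (j n))
    (fun n => CuG.map_map _ _ _ (hL.compatible n)) (fun _ _ h => hL.exists_le_map h)
    (fun n x' x y hx h => by
      obtain ⟨m, k, hmk⟩ := hL.exists_map_le hx h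
      refine ⟨m, k, ?_⟩
      simpa only [CuG.push_map] using hmk)

end LimitTheorem

end EquivCuntz

end

open EquivCuntz

theorem mainTheorem8 {G : Type u} [TopologicalSpace G] [Group G] [IsTopologicalGroup G]
    [CompactSpace G] [T2Space G]
    (A : ℕ → GAlg.{u, v} G) (ι : ∀ n, GHom (A n) (A (n + 1)))
    (L : GAlg.{u, v} G) (j : ∀ n, GHom (A n) L) (hL : IsInductiveLimit A ι L j) :
    -- the action of `Cu(G)` on equivariant Cuntz semigroups is well defined
    (∀ ν : URep G, Nonempty (InvStrictlyPos ν)) ∧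
    (∀ (B : GAlg.{u, v} G) (ν : URep G) (s : InvStrictlyPos ν) (a : GPos B),
      CuRep.mk ν • CuG.mk a = CuG.mk (a.tensor s)) ∧
    -- the semigroups `Cu^G(A n)` form an inductive system in `CCu^G`, with a cocone to `Cu^G(L)`
    (∀ n, IsCCuG G (CuG (A n))) ∧ IsCCuG G (CuG L) ∧
    (∀ n, IsCCuGHom G (CuG.map (ι n))) ∧ (∀ n, IsCCuGHom G (CuG.map (j n))) ∧
    (∀ n x, CuG.map (j (n + 1)) (CuG.map (ι n) x) = CuG.map (j n) x) ∧
    -- this system has an inductive limit in `CCu^G`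
    (∃ (S : Type (max 1 u v)) (_ : PartialOrder S) (_ : Zero S) (_ : Add S)
      (_ : SMul (CuRep G) S) (ψ : ∀ n, CuG (A n) → S),
      IsCCuGLimit G (fun n => CuG (A n)) (fun n => CuG.map (ι n)) S ψ) ∧
    -- for every such limit, the canonical morphism to `Cu^G(L)` is an isomorphism
    ∀ (S : Type (max 1 u v)) [PartialOrder S] [Zero S] [Add S] [SMul (CuRep G) S]
      (ψ : ∀ n, CuG (A n) → S),
      IsCCuGLimit G (fun n => CuG (A n)) (fun n => CuG.map (ι n)) S ψ →
      ∃ φ : S → CuG L, IsCCuGIso G φ ∧ (∀ n x, φ (ψ n x) = CuG.map (j n) x) ∧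
        ∀ φ' : S → CuG L, IsCCuGHom G φ' → (∀ n x, φ' (ψ n x) = CuG.map (j n) x) → φ' = φ := by
  refine ⟨URep.exists_invStrictlyPos, fun _ ν s a => CuG.smul_mk ν s a, fun n => CuG.isCCuG (A n),
    CuG.isCCuG L, fun n => CuG.map_isCCuGHom (ι n), fun n => CuG.map_isCCuGHom (j n),
    fun n => CuG.map_map _ _ _ (hL.compatible n),
    ⟨CuG L, inferInstance, inferInstance, inferInstance, inferInstance, _, hL.isCCuGLimit⟩, ?_⟩
  intro S _ _ _ _ ψ hψ
  exact hψ.exists_iso hL.isCCuGLimit
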